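/- Let $M>0$ and consider the exterior region $\mathscr D=\{r>2M\}$ of the Schwarzschild spacetime, with $$g=-\Big(1-\tfrac{2M}{r}\Big)dt^2+\Big(1-\tfrac{2M}{r}\Big)dr^{*2}+r^2d\sigma_{\mathbb S^2},\qquad r^*=r+2M\log(r-2M)-3M-2M\log M,$$ and $u=t-r^*$, $\underline u=t+r^*$. Covectors are written $v=v_tdt+v_{r^*}dr^*+v_\theta d\theta+v_\varphi d\varphi$, and $\mathcal P$ is the bundle of future light cones, i.e. of the $v\neq0$ with $$v_t=-\Big(|v_{r^*}|^2+\Big(1-\tfrac{2M}{r}\Big)\tfrac{|\slashed v|^2}{r^2}\Big)^{1/2},\qquad |\slashed v|^2=|v_\theta|^2+\tfrac{|v_\varphi|^2}{\sin^2\theta};$$ put $v_u=\frac{v_t-v_{r^*}}2$, $v_{\underline u}=\frac{v_t+v_{r^*}}2$, $d\mu_{\mathcal P}=\frac{dv_{r^*}dv_\theta dv_\varphi}{r^2|\sin\theta||v_t|}$ and $\langle y\rangle=(1+y^2)^{1/2}$. *Foliation.* Let $R_0>3M$, and let $\mathcal S$ be a smooth spherically symmetric spacelike hypersurface which crosses the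 future event horizon to the future of the bifurcation sphere and extends to $r=\infty$. In the ingoing coordinates $(\underline u,r,\omega)$ it is a graph $\underline u=\underline U(r)$ over $r\ge 2M$, where $\underline U$ is smooth up to $r=2M$ and $2\underline U'-(1-\frac{2M}r)|\underline U'|^2>0$. Let $u_0$ be the value of $u$ on the sphere $\mathcal S\cap\{r=R_0\}$. Set $\Sigma_0=(\mathcal S\cap\{2M<r<R_0\})\cup\{u=u_0,\ r\ge R_0\}$, and for $\tau\ge0$ let $\Sigma_\tau$ be the image of $\Sigma_0$ under $t\mapsto t+\tau$. On $\{r<R_0\}$, $n_{\Sigma_\tau}$ is the future unit normal of $\Sigma_\tau$ and $d\mu_{\Sigma_\tau}$ the induced volume; on $\{r\ge R_0\}$, $n_{\Sigma_\tau}=\partial_{\underline u}$ and $d\mu_{\Sigma_\tau}=r^2d\underline u\,d\mu_{\mathbb S^2}$. Let $\rho[h]=\int_{\mathcal P}h\,|v\cdot n_{\Sigma_\tau}|\,d\mu_{\mathcal P}$, and let $\widehat{\mathcal R}_0^{+\infty}$ be the part of $\mathcal P$ above $\bigcup_{\tau\ge0}\Sigma_\tau$. *Red-shift weight.* Let $2M<r_0<r_1<3M$,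 let $\chi:\mathbb R\to[0,1]$ be smooth with $\chi=1$ on $]-\infty,r_0]$ and $\chi=0$ on $[r_1,+\infty[$, and let $$v_{\mathrm N}=\frac{2\chi(r)v_u}{1-\frac{2M}r}+8\chi(r)\Big(1-\frac{2M}r\Big)v_t+v_t .$$ *Vector fields.* $\mathbf T=v_\alpha g^{\alpha\beta}\partial_{x^\beta}-\frac12\partial_{x^i}g^{\alpha\beta}v_\alpha v_\beta\partial_{v_i}$ is the Liouville vector field on $\mathcal P$; $\widehat\Omega_1,\widehat\Omega_2,\widehat\Omega_3$ are the complete lifts to $\mathcal P$ of the generators $\Omega_1,\Omega_2,\Omega_3$ of rotations about the three coordinate axes; $\widehat\Omega^I=\widehat\Omega_{I_1}\cdots\widehat\Omega_{I_k}$ for $I\in\{1,2,3\}^k$, and $|I|=k$. **Proposition.** Let $q\ge0$, $z\in\,]3,4]$ and $\delta>0$. There is a constant $C>0$, depending only on $M$, the foliation, $r_0$, $r_1$, $q$, $z$ and $\delta$, such that for every function $f:\widehat{\mathcal R}_0^{+\infty}\to\mathbb R$ of class $C^3$ with $\mathbf T(f)=0$, every $\tau\ge0$ and every $(t,r^*,\omega)\in\Sigma_\tau$,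 $$\int_{\mathcal P}\frac{|v_{\underline u}|^q}{|v_t|^q}|f||v_{\mathrm N}|^2d\mu_{\mathcal P}\Big|_{(t,r^*,\omega)}\le\frac{C}{r^{2+2q}}\sum_{\substack{n+|I|\le3\\ n\le1}}\left|\int_{\Sigma_\tau}\rho\left[\Big(1+r^{2zq+4}\frac{|v_{\underline u}|^{zq+2}}{|v_t|^{zq+2}}\Big)\big|\partial_t^n\widehat\Omega^If\big|^z\big\langle|v_t|+|\slashed v|\big\rangle^{3(z-3+\delta)}|v_t|^{4-z}|v_{\mathrm N}|^{2(z+1)}\right]d\mu_{\Sigma_\tau}\right|^{\frac1z},$$ where the integrals take values in $[0,+\infty]$. -/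

import Mathlib

open MeasureTheory
open scoped ContDiff ENNReal

noncomputable section

namespace SchwarzschildVlasov

/-- Space for the Cartesian-type coordinates `x = r ω` of the exterior region (`r = ‖x‖`, `ω ∈ S²`)
and for the spatial part of covectors. -/
abbrev E3 := EuclideanSpace ℝ (Fin 3)

/-- Spacetime points `(t, x)`; the exterior region is `2 * M < ‖x‖`. -/
abbrev Spacetime := ℝ × E3

/-- Coordinates `(t, x, p)` on the bundle of future light cones: the covector is
`v = v_t dt + p₁ dx₁ + p₂ dx₂ + p₃ dx₃`, where `v_t` is determined by `(x, p)`. -/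
abbrev Phase := ℝ × E3 × E3

/-- The vector product of `ℝ³`. -/
def cross (a b : E3) : E3 := WithLp.toLp 2 (crossProduct a.ofLp b.ofLp)

/-! ### The metric and the components of a light-like covector -/

/-- `1 - 2M/r`. -/
def lapse (M r : ℝ) : ℝ := 1 - 2 * M / r

/-- The Regge-Wheeler coordinate `r*`, normalised by `r* = 0` at `r = 3M`. -/
def rStar (M r : ℝ) : ℝ := r + 2 * M * Real.log (r - 2 * M) - 3 * M - 2 * M * Real.log M

/-- `v_{r*} = (1 - 2M/r) v_r`, where `v_r = v(∂_r) = ⟨p, x⟩ / r`. -/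
def vRStar (M : ℝ) (x p : E3) : ℝ := lapse M ‖x‖ * (inner ℝ x p / ‖x‖)

/-- `|v̸| = (v_θ² + v_φ² / sin² θ)^{1/2} = (v(Ω₁)² + v(Ω₂)² + v(Ω₃)²)^{1/2}`, where
`v(Ω_i) = ⟨p, e_i × x⟩ = ⟨x × p, e_i⟩`. -/
def vAng (x p : E3) : ℝ := ‖cross x p‖

/-- The inverse metric `g⁻¹(v, v)` at `(t, x)`, for the covector `v = w dt + p · dx`:
`-(1 - 2M/r)⁻¹ w² + (1 - 2M/r)⁻¹ v_{r*}² + |v̸|² / r²`. -/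
def invMetric (M : ℝ) (x : E3) (w : ℝ) (p : E3) : ℝ :=
  -(w ^ 2 / lapse M ‖x‖) + vRStar M x p ^ 2 / lapse M ‖x‖ + vAng x p ^ 2 / ‖x‖ ^ 2

/-- `v_t`: the nonpositive root of `g⁻¹(v, v) = 0`. -/
def vT (M : ℝ) (x p : E3) : ℝ :=
  -Real.sqrt (vRStar M x p ^ 2 + lapse M ‖x‖ * (vAng x p ^ 2 / ‖x‖ ^ 2))

/-- `v_u`, for `u = t - r*`. -/
def vU (M : ℝ) (x p : E3) : ℝ := (vT M x p - vRStar M x p) / 2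

/-- `v_{u̲}`, for `u̲ = t + r*`. -/
def vUbar (M : ℝ) (x p : E3) : ℝ := (vT M x p + vRStar M x p) / 2

/-- Smooth cutoff functions `χ : ℝ → [0, 1]` with `χ = 1` on `r ≤ r₀` and `χ = 0` on `r ≥ r₁`. -/
structure IsCutoff (r₀ r₁ : ℝ) (χ : ℝ → ℝ) : Prop where
  smooth : ContDiff ℝ ∞ χ
  nonneg : ∀ r, 0 ≤ χ r
  le_one : ∀ r, χ r ≤ 1
  eq_one : ∀ r, r ≤ r₀ → χ r = 1
  eq_zero : ∀ r, r₁ ≤ r → χ r = 0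

/-- `v_N = v(N)` for the red-shift vector field
`N = 2 χ(r) (1 - 2M/r)⁻¹ ∂_u + 8 χ(r) (1 - 2M/r) ∂_t + ∂_t`. -/
def vN (M : ℝ) (χ : ℝ → ℝ) (x p : E3) : ℝ :=
  2 * χ ‖x‖ * vU M x p / lapse M ‖x‖ + 8 * χ ‖x‖ * lapse M ‖x‖ * vT M x p + vT M x p

/-- The Japanese bracket `⟨y⟩ = (1 + y²)^{1/2}`. -/
def bracket (y : ℝ) : ℝ := Real.sqrt (1 + y ^ 2)

/-- `∫_P G dμ_P` over the future light cone above a point with spatial coordinate `x`. Since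
`|det g| = 1` in the coordinates `(t, x)`, the measure
`dμ_P = |det g⁻¹|^{1/2} (-v_t / (1 - 2M/r))⁻¹ dp`, which is
`dv_{r*} dv_θ dv_φ / (r² |sin θ| |v_t|)`, equals `(1 - 2M/r) |v_t|⁻¹ dp`.
The integral of a nonnegative function, with values in `[0, ∞]`. -/
def coneIntegral (M : ℝ) (x : E3) (G : E3 → ℝ) : ℝ≥0∞ :=
  ∫⁻ p : E3, ENNReal.ofReal (G p * (lapse M ‖x‖ / |vT M x p|))

/-! ### The foliation -/

/-- The data of the foliation. In the ingoing coordinates `(u̲, r, ω)`, regular across the future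
event horizon `r = 2M` and in which `g = -(1 - 2M/r) du̲² + 2 du̲ dr + r² dσ`, the spherically
symmetric hypersurface `S` is the graph `u̲ = U r`, `r ≥ 2M`. It is smooth up to the horizon, which
it crosses to the future of the bifurcation sphere (`u̲` is finite there), and it is spacelike: its
radial tangent vector `U' ∂_u̲ + ∂_r` has positive square length. -/
structure Foliation (M : ℝ) where
  /-- the area radius beyond which the leaves are null -/
  R₀ : ℝ
  three_mul_lt : 3 * M < R₀
  /-- the function whose graph is `S` -/
  U : ℝ → ℝ
  smooth : ContDiffOn ℝ ∞ U (Set.Ici (2 * M))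
  spacelike : ∀ r, 2 * M ≤ r →
    0 < 2 * derivWithin U (Set.Ici (2 * M)) r
      - lapse M r * derivWithin U (Set.Ici (2 * M)) r ^ 2

namespace Foliation

variable {M : ℝ} (𝓕 : Foliation M)

/-- The derivative of `U`. -/
def U' (r : ℝ) : ℝ := derivWithin 𝓕.U (Set.Ici (2 * M)) r

/-- The part of `S` in the exterior region, where `u̲ = t + r*`. -/
def hypersurface : Set Spacetime :=
  {y | 2 * M < ‖y.2‖ ∧ y.1 + rStar M ‖y.2‖ = 𝓕.U ‖y.2‖}

/-- The value `u₀ = t₀ - R₀*` of `u` on the sphere `r = R₀` of `S`, where `t₀ = U(R₀) - R₀*`. -/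
def u₀ : ℝ := (𝓕.U 𝓕.R₀ - rStar M 𝓕.R₀) - rStar M 𝓕.R₀

/-- The outgoing null cone `u = τ + u₀`, `r ≥ R₀`. For `τ ≥ 0` it lies in the causal future of
`S`. -/
def nullPart (τ : ℝ) : Set Spacetime :=
  {y | 𝓕.R₀ ≤ ‖y.2‖ ∧ y.1 - rStar M ‖y.2‖ = τ + 𝓕.u₀}

/-- The leaf `Σ_0`. -/
def leafZero : Set Spacetime :=
  (𝓕.hypersurface ∩ {y | ‖y.2‖ < 𝓕.R₀}) ∪ 𝓕.nullPart 0

/-- The leaf `Σ_τ`, for `τ ≥ 0`: the image of `Σ_0` under the flow of `∂_t` for time `τ`. -/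
def leaf (τ : ℝ) : Set Spacetime := (fun y : Spacetime => (y.1 + τ, y.2)) '' 𝓕.leafZero

/-- The region of the bundle of light cones above the union of the leaves `Σ_τ`, `τ ≥ 0`. -/
def phaseRegion : Set Phase :=
  {y | (∃ τ : ℝ, 0 ≤ τ ∧ (y.1, y.2.1) ∈ 𝓕.leaf τ) ∧ y.2.2 ≠ 0}

/-- The time function of which `Σ_0` is the graph: `Σ_τ` consists of the points
`(height r + τ, x)` with `r = ‖x‖ > 2M`. -/
def height (r : ℝ) : ℝ :=
  if r < 𝓕.R₀ then 𝓕.U r - rStar M r else 𝓕.u₀ + rStar M r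

/-- `Σ_τ` is the graph of `height + τ` over the exterior region. -/
theorem mem_leaf_iff (hM : 0 < M) (τ t : ℝ) (x : E3) :
    (t, x) ∈ 𝓕.leaf τ ↔ 2 * M < ‖x‖ ∧ t = 𝓕.height ‖x‖ + τ := by
  have h3 := 𝓕.three_mul_lt
  have key : (t, x) ∈ 𝓕.leaf τ ↔ (t - τ, x) ∈ 𝓕.leafZero := by
    constructor
    · rintro ⟨⟨s, y⟩, hy, he⟩
      simp only [Prod.mk.injEq] at he
      obtain ⟨rfl, rfl⟩ := he
      simpa using hy
    · intro h
      exact ⟨(t - τ, x), h, by simp⟩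
  rw [key]
  simp only [leafZero, hypersurface, nullPart, height, Set.mem_union, Set.mem_inter_iff,
    Set.mem_ofPred_eq]
  by_cases h : ‖x‖ < 𝓕.R₀
  · simp only [h, if_true, not_le.mpr h, false_and, or_false, and_true]
    constructor <;> rintro ⟨h1, h2⟩ <;> exact ⟨h1, by linarith⟩
  · simp only [h, if_false, not_lt.mp h, and_false, false_or, true_and]
    constructor
    · intro h2
      exact ⟨by linarith [not_lt.mp h], by linarith⟩
    · rintro ⟨_, h2⟩
      linarith

/-- The density with respect to `dx = r² dr dμ_{S²}` of the volume form `dμ_{Σ_τ}`, in the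
parametrization `x ↦ (height r + τ, x)`: the Riemannian one on the spacelike part, and
`r² du̲ dμ_{S²}`, with `du̲ = 2 (1 - 2M/r)⁻¹ dr` along the leaf, on the null part. -/
def leafDensity (r : ℝ) : ℝ :=
  if r < 𝓕.R₀ then Real.sqrt (2 * 𝓕.U' r - lapse M r * 𝓕.U' r ^ 2) else 2 / lapse M r

/-- `∫_{Σ_τ} G dμ_{Σ_τ}`, for `G` with values in `[0, ∞]`. -/
def leafIntegral (τ : ℝ) (G : Spacetime → ℝ≥0∞) : ℝ≥0∞ :=
  ∫⁻ x in {x : E3 | 2 * M < ‖x‖},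
    G (𝓕.height ‖x‖ + τ, x) * ENNReal.ofReal (𝓕.leafDensity ‖x‖)

/-- `v · n_{Σ_τ}`: on the spacelike part, `n_{Σ_τ}` is the future unit normal
`(2U' - (1 - 2M/r) U'²)^{-1/2} (U' ∂_u̲ + (2 (1 - 2M/r)⁻¹ - U') ∂_u)`, where `∂_u`, `∂_u̲` are those
of the coordinates `(u, u̲)`; on the null part, `n_{Σ_τ} = ∂_u̲`. -/
def vNormal (x p : E3) : ℝ :=
  if ‖x‖ < 𝓕.R₀ then
    (𝓕.U' ‖x‖ * vUbar M x p + (2 / lapse M ‖x‖ - 𝓕.U' ‖x‖) * vU M x p)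
      / Real.sqrt (2 * 𝓕.U' ‖x‖ - lapse M ‖x‖ * 𝓕.U' ‖x‖ ^ 2)
  else vUbar M x p

/-- `ρ[G] = ∫_P G |v · n_{Σ_τ}| dμ_P` at a point with spatial coordinate `x`. -/
def rho (x : E3) (G : E3 → ℝ) : ℝ≥0∞ :=
  coneIntegral M x (fun p => G p * |𝓕.vNormal x p|)

end Foliation

/-! ### The Liouville operator and the commuting vector fields

Derivatives are taken within a region `D` of the phase space, so that they make sense on its
boundary (the part above `Σ_0`). -/

/-- The Liouville vector field
`T = v_α g^{αβ} ∂_{x^β} - (1/2) ∂_{x^i} g^{αβ} v_α v_β ∂_{p_i}`,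
in the coordinates `(t, x, p)`. -/
def liouville (M : ℝ) (D : Set Phase) (f : Phase → ℝ) (y : Phase) : ℝ :=
  let x := y.2.1
  let p := y.2.2
  let w := vT M x p
  fderivWithin ℝ f D y
    (-(w / lapse M ‖x‖),
      (1 / 2 : ℝ) • gradient (fun k => invMetric M x w k) p,
      -((1 / 2 : ℝ) • gradient (fun z => invMetric M z w p) x))

/-- `∂_t`. -/
def dT (D : Set Phase) (f : Phase → ℝ) (y : Phase) : ℝ :=
  fderivWithin ℝ f D y (1, 0, 0)

/-- `Ω̂_i`, the complete lift of the rotation vector field `Ω_i : x ↦ e_i × x`. It rotates position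
and covector simultaneously. -/
def omegaHat (D : Set Phase) (i : Fin 3) (f : Phase → ℝ) (y : Phase) : ℝ :=
  fderivWithin ℝ f D y
    (0, cross (EuclideanSpace.single i 1) y.2.1, cross (EuclideanSpace.single i 1) y.2.2)

/-- `Ω̂^I = Ω̂_{I_1} ⋯ Ω̂_{I_k}` for `I ∈ {1,2,3}^k`. -/
def omegaHatWord (D : Set Phase) {k : ℕ} (I : Fin k → Fin 3) (f : Phase → ℝ) : Phase → ℝ :=
  (List.ofFn I).foldr (fun i g => omegaHat D i g) f

/-- `∂_t^n Ω̂^I f`. -/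
def mixedDeriv (D : Set Phase) (n : ℕ) {k : ℕ} (I : Fin k → Fin 3) (f : Phase → ℝ) : Phase → ℝ :=
  (dT D)^[n] (omegaHatWord D I f)

end SchwarzschildVlasov

end

noncomputable section

namespace SchwarzschildVlasov

/-! ### The vector product -/

/-! Above a sphere of radius `r` put `x = r e` and let the covector be `mom M r e y`, so that
`v_{r*} = ⟨e, y⟩` and the angular momentum is `e × y`. In these coordinates the cone measure is `dy
/ (r² |v_t|)` (`coneIntegral_eq`), the lifted rotations act on `(e, y)` simultaneously, and along a
leaf `t = H r` the Liouville field splits into `v_{r*} ∂_r`, a multiple `Φ` of `∂_t`, a multiple of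
`∂_{v_{r*}}` and a rotation about the angular momentum (`liouvilleP_mom`,
`TransportData.vlasov_eq`). The factor `Φ` is `|v · n|` times the volume density of the leaf. Three
estimates are combined.

Sobolev on the sphere: two rotational derivatives in `L¹` control the supremum. Applied to `|f|^z`
and integrated in `y` against a weight in `v_{r*}` and `|v̸|`, this bounds an integral over one cone
by integrals over the cones above a whole sphere, at the price of words `Ω̂^I` with `|I| ≤ 2`
(`Foliation.sobolev_sphere`).

Radial transport: for `g = Ω̂^I f`, which is again a solution (`Foliation.liouville_omegaHat`),
consider `K(r) = ∫ v_{r*}² j(r) μ(|v_t|, |v̸|) |g|^z` over one sign of `v_{r*}`. One factor `v_{r*}`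
comes from the Liouville field; the other makes the density vanish at `v_{r*} = 0`, so that cutting
to one sign leaves no boundary term. In `K'` the derivatives in `v_{r*}` and along rotations are
integrated by parts, and `μ` contributes nothing because `|v_t|` and `|v̸|` are conserved. What
remains is `j'`, a potential term and `Φ ∂_t g`, all bounded by the flux of `|g|^z + |∂_t g|^z`
through the leaf (`TransportSetup.K_le`); this is where the single `∂_t` comes from. Averaging the
starting radius over `[3M, R₀]` removes the initial value (`Foliation.exists_sphereFlux_le`).

Hölder in `y`: the dual factor is a power of `v_{r*}² (|v_t| + |v̸|)⁴ ⟨|v_t| + |v̸|⟩^{3(z-3+δ)}`. It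
is dominated by a product of three functions `|x|^{-s} (1 + x²)^{-m}` of one variable with `s =
2/(z-1)`, integrable at `0` because `z > 3` and at infinity because `δ > 0`
(`lintegral_dualFactor_lt_top`, `holder_half`).

The weight `j μ` must lie between what Hölder requires (`holderWeight`) and what the flux pays for
(`fluxWeight`). Both comparisons rest on the null relation `|v̸|² = 4 r² |v_u̲| |v_u| / (1 - 2M/r)`.
Near the horizon outgoing particles have red-shift energy of order `|v_t| / (1 - 2M/r)`, handled by
a power of the lapse in `j`; for ingoing ones it is bounded by conserved quantities. Far away `r²
|v_u̲| / |v_t|` is bounded by conserved quantities for outgoing particles, and for ingoing ones it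
is of order `r²`, handled by a power of `r` in `j`. Hence four weights (`Foliation.exists_weight`).
-/

theorem cross_apply_zero (a b : E3) : cross a b 0 = a 1 * b 2 - a 2 * b 1 := by
  simp [cross, crossProduct]

theorem cross_apply_one (a b : E3) : cross a b 1 = a 2 * b 0 - a 0 * b 2 := by
  simp [cross, crossProduct]

theorem cross_apply_two (a b : E3) : cross a b 2 = a 0 * b 1 - a 1 * b 0 := by
  simp [cross, crossProduct]

theorem inner_eq_sum (a b : E3) : inner ℝ a b = a 0 * b 0 + a 1 * b 1 + a 2 * b 2 := by
  simp [PiLp.inner_apply, Fin.sum_univ_three]; ring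

theorem norm_sq_eq_sum (a : E3) : ‖a‖ ^ 2 = a 0 ^ 2 + a 1 ^ 2 + a 2 ^ 2 := by
  simp [EuclideanSpace.norm_sq_eq, Fin.sum_univ_three]

theorem E3.ext {a b : E3} (h0 : a 0 = b 0) (h1 : a 1 = b 1) (h2 : a 2 = b 2) : a = b := by
  ext i; fin_cases i <;> assumption

theorem cross_add_right (a b c : E3) : cross a (b + c) = cross a b + cross a c := by
  apply E3.ext <;> simp only [cross_apply_zero, cross_apply_one, cross_apply_two, PiLp.add_apply] <;>
    ring

theorem cross_add_left (a b c : E3) : cross (a + b) c = cross a c + cross b c := by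
  apply E3.ext <;> simp only [cross_apply_zero, cross_apply_one, cross_apply_two, PiLp.add_apply] <;>
    ring

theorem cross_smul_right (s : ℝ) (a b : E3) : cross a (s • b) = s • cross a b := by
  apply E3.ext <;>
    simp only [cross_apply_zero, cross_apply_one, cross_apply_two, PiLp.smul_apply, smul_eq_mul] <;>
    ring

theorem cross_smul_left (s : ℝ) (a b : E3) : cross (s • a) b = s • cross a b := by
  apply E3.ext <;>
    simp only [cross_apply_zero, cross_apply_one, cross_apply_two, PiLp.smul_apply, smul_eq_mul] <;>
    ring

theorem cross_self_eq_zero (a : E3) : cross a a = 0 := by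
  apply E3.ext <;>
    simp only [cross_apply_zero, cross_apply_one, cross_apply_two, PiLp.zero_apply] <;> ring

theorem cross_zero_right (a : E3) : cross a 0 = 0 := by
  simpa using cross_smul_right 0 a 0

theorem cross_cross_left (a b c : E3) :
    cross (cross a b) c = (inner ℝ a c : ℝ) • b - (inner ℝ b c : ℝ) • a := by
  apply E3.ext <;>
    simp only [cross_apply_zero, cross_apply_one, cross_apply_two, PiLp.smul_apply, smul_eq_mul,
      PiLp.sub_apply, inner_eq_sum] <;> ring

theorem cross_cross_right (a b c : E3) :
    cross a (cross b c) = (inner ℝ a c : ℝ) • b - (inner ℝ a b : ℝ) • c := by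
  apply E3.ext <;>
    simp only [cross_apply_zero, cross_apply_one, cross_apply_two, PiLp.smul_apply, smul_eq_mul,
      PiLp.sub_apply, inner_eq_sum] <;> ring

theorem norm_cross_sq (a b : E3) : ‖cross a b‖ ^ 2 = ‖a‖ ^ 2 * ‖b‖ ^ 2 - inner ℝ a b ^ 2 := by
  simp only [norm_sq_eq_sum, inner_eq_sum, cross_apply_zero, cross_apply_one, cross_apply_two]
  ring

theorem inner_cross_self_left (a b : E3) : inner ℝ a (cross a b) = 0 := by
  simp only [inner_eq_sum, cross_apply_zero, cross_apply_one, cross_apply_two]; ring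

theorem inner_cross_self_right (a b : E3) : inner ℝ b (cross a b) = 0 := by
  simp only [inner_eq_sum, cross_apply_zero, cross_apply_one, cross_apply_two]; ring

theorem inner_cross_comm (a b c : E3) : inner ℝ (cross a b) c = -inner ℝ b (cross a c) := by
  simp only [inner_eq_sum, cross_apply_zero, cross_apply_one, cross_apply_two]; ring

/-- The vector product with a fixed left factor, as a continuous linear map. -/
def crossL (a : E3) : E3 →L[ℝ] E3 :=
  LinearMap.toContinuousLinearMap
    { toFun := cross a, map_add' := cross_add_right a, map_smul' := fun s => cross_smul_right s a }

@[fun_prop]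
theorem continuous_cross {X : Type*} [TopologicalSpace X] {f g : X → E3} (hf : Continuous f)
    (hg : Continuous g) : Continuous fun x => cross (f x) (g x) := by
  have h (i : Fin 3) : Continuous fun x => f x i := by fun_prop
  have h' (i : Fin 3) : Continuous fun x => g x i := by fun_prop
  unfold cross
  refine (PiLp.continuous_toLp 2 _).comp (continuous_pi fun i => ?_)
  fin_cases i
  · simp only [crossProduct, LinearMap.mk₂_apply]
    exact ((h 1).mul (h' 2)).sub ((h 2).mul (h' 1))
  · simp only [crossProduct, LinearMap.mk₂_apply]
    exact ((h 2).mul (h' 0)).sub ((h 0).mul (h' 2))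
  · simp only [crossProduct, LinearMap.mk₂_apply]
    exact ((h 0).mul (h' 1)).sub ((h 1).mul (h' 0))

@[fun_prop]
theorem measurable_cross {X : Type*} [MeasurableSpace X] {f g : X → E3} (hf : Measurable f)
    (hg : Measurable g) : Measurable fun x => cross (f x) (g x) :=
  (continuous_cross continuous_fst continuous_snd : Continuous fun z : E3 × E3 =>
    cross z.1 z.2).measurable.comp (hf.prodMk hg)

/-! ### Elementary facts on the lapse -/

theorem lapse_pos {M r : ℝ} (hM : 0 < M) (hr : 2 * M < r) : 0 < lapse M r := by
  have : 0 < r := by linarith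
  unfold lapse
  rw [sub_pos, div_lt_one this]; exact hr

theorem lapse_lt_one {M r : ℝ} (hM : 0 < M) (hr : 2 * M < r) : lapse M r < 1 := by
  have : 0 < r := by linarith
  unfold lapse
  have : 0 < 2 * M / r := by positivity
  linarith

theorem hasDerivAt_lapse (M : ℝ) {r : ℝ} (hr : r ≠ 0) :
    HasDerivAt (lapse M) (2 * M / r ^ 2) r := by
  have := ((hasDerivAt_inv hr).const_mul (2 * M)).const_sub 1
  exact this.congr_deriv (by field_simp)

theorem hasDerivAt_rStar {M r : ℝ} (hM : 0 < M) (hr : 2 * M < r) :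
    HasDerivAt (rStar M) (1 / lapse M r) r := by
  have h1 : r - 2 * M ≠ 0 := by linarith
  have h2 : r ≠ 0 := by linarith
  have := ((((hasDerivAt_id r).sub_const (2 * M)).log h1).const_mul (2 * M))
  have := (((hasDerivAt_id r).add this).sub_const (3 * M)).sub_const (2 * M * Real.log M)
  refine this.congr_deriv ?_
  simp only [lapse, id]
  have h3 : 1 - 2 * M / r = (r - 2 * M) / r := by field_simp
  rw [h3]; field_simp; ring

/-! ### The Liouville vector field -/

/-- Lagrange's identity for `|x × p|²` merges the radial and angular terms, leaving the lapse in a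
denominator only next to `w²`. This form is differentiated in Cartesian coordinates. -/
theorem invMetric_eq (M : ℝ) {x : E3} (hx : x ≠ 0) (w : ℝ) (p : E3) :
    invMetric M x w p =
      -(w ^ 2 / lapse M ‖x‖) + ‖p‖ ^ 2 - 2 * M / ‖x‖ ^ 3 * inner ℝ x p ^ 2 := by
  have hr : ‖x‖ ≠ 0 := norm_ne_zero_iff.mpr hx
  unfold invMetric vRStar vAng
  rw [norm_cross_sq]
  by_cases h : lapse M ‖x‖ = 0
  -- On the horizon the quotients by the lapse are zero by convention, and the remaining terms agree
  -- because `r = 2M`.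
  · have : ‖x‖ = 2 * M := by
      unfold lapse at h
      field_simp at h; linarith
    rw [h, ← this]; simp; field_simp
  · have : (lapse M ‖x‖ * (inner ℝ x p / ‖x‖)) ^ 2 / lapse M ‖x‖ =
        lapse M ‖x‖ * (inner ℝ x p / ‖x‖) ^ 2 := by field_simp
    rw [this]
    generalize w ^ 2 / lapse M ‖x‖ = A
    unfold lapse
    field_simp
    ring

theorem hasFDerivAt_norm {x : E3} (hx : x ≠ 0) :
    HasFDerivAt (fun y : E3 => ‖y‖) (‖x‖⁻¹ • innerSL ℝ x) x := by
  have hr : ‖x‖ ≠ 0 := norm_ne_zero_iff.mpr hx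
  have h := (hasStrictFDerivAt_norm_sq x).hasFDerivAt.sqrt (by positivity)
  simp only [Real.sqrt_sq (norm_nonneg _)] at h
  refine h.congr_fderiv ?_
  ext y
  simp
  field_simp

/-- The position part of the Liouville vector field. -/
def liouvilleX (M : ℝ) (x p : E3) : E3 := p - (2 * M / ‖x‖ ^ 3 * inner ℝ x p) • x

/-- The momentum part of the Liouville vector field. -/
def liouvilleP (M : ℝ) (x p : E3) : E3 :=
  (-(vT M x p ^ 2 / lapse M ‖x‖ ^ 2 * (M / ‖x‖ ^ 3)) - 3 * M * inner ℝ x p ^ 2 / ‖x‖ ^ 5) • x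
    + (2 * M / ‖x‖ ^ 3 * inner ℝ x p) • p

theorem gradient_invMetric_momentum (M : ℝ) {x : E3} (hx : x ≠ 0) (w : ℝ) (p : E3) :
    gradient (fun k => invMetric M x w k) p = (2 : ℝ) • liouvilleX M x p := by
  apply HasGradientAt.gradient
  rw [hasGradientAt_iff_hasFDerivAt]
  simp only [invMetric_eq M hx]
  have h1 := (hasStrictFDerivAt_norm_sq p).hasFDerivAt
  have h2 := ((innerSL ℝ x).hasFDerivAt (x := p)).pow 2
  have := ((h1.const_add (-(w ^ 2 / lapse M ‖x‖))).sub (h2.const_mul (2 * M / ‖x‖ ^ 3)))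
  refine this.congr_fderiv ?_
  ext h
  simp [liouvilleX]
  ring

/-- Only the metric coefficients are differentiated: the component `w` stays frozen at its value at
`x`, so no derivative of `vT` enters. -/
theorem gradient_invMetric_position {M : ℝ} (hM : 0 < M) {x : E3} (hx : 2 * M < ‖x‖) (p : E3) :
    gradient (fun z => invMetric M z (vT M x p) p) x = -(2 : ℝ) • liouvilleP M x p := by
  have hr : 0 < ‖x‖ := by linarith
  have hx0 : x ≠ 0 := norm_pos_iff.mp hr
  have hl := lapse_pos hM hx
  apply HasGradientAt.gradient
  rw [hasGradientAt_iff_hasFDerivAt]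
  have hev : (fun z => invMetric M z (vT M x p) p) =ᶠ[nhds x] fun z =>
      -(vT M x p ^ 2 / lapse M ‖z‖) + ‖p‖ ^ 2 - 2 * M / ‖z‖ ^ 3 * inner ℝ z p ^ 2 := by
    filter_upwards [isOpen_ne.mem_nhds hx0] with z hz
    exact invMetric_eq M hz _ p
  refine HasFDerivAt.congr_of_eventuallyEq ?_ hev
  set w := vT M x p with hw
  have hd : HasDerivAt (fun r => -(w ^ 2 / lapse M r))
      (w ^ 2 / lapse M ‖x‖ ^ 2 * (2 * M / ‖x‖ ^ 2)) ‖x‖ := by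
    have := ((hasDerivAt_lapse M hr.ne').inv hl.ne').const_mul (-w ^ 2)
    refine (this.congr_deriv (by field_simp)).congr_of_eventuallyEq (.of_forall fun r => ?_)
    simp [div_eq_mul_inv]
  have hd2 : HasDerivAt (fun r => 2 * M / r ^ 3) (-(6 * M / ‖x‖ ^ 4)) ‖x‖ := by
    have := (((hasDerivAt_id ‖x‖).pow 3).inv (by simpa using hr.ne')).const_mul (2 * M)
    refine this.congr_deriv ?_
    simp; field_simp; ring
  have h1 := hd.comp_hasFDerivAt x (hasFDerivAt_norm hx0)
  have h2 := hd2.comp_hasFDerivAt x (hasFDerivAt_norm hx0)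
  have h3 := (((innerSL ℝ).flip p).hasFDerivAt (x := x)).pow 2
  have := (h1.add_const (‖p‖ ^ 2)).sub (h2.mul h3)
  refine this.congr_fderiv ?_
  ext h
  have e1 : (innerSL ℝ) p x = inner ℝ x p := by
    rw [innerSL_apply_apply]; exact real_inner_comm _ _
  have e2 : (innerSL ℝ) p h = inner ℝ p h := rfl
  simp [liouvilleP, ← hw, e1, e2]
  field_simp
  ring

theorem liouville_eq {M : ℝ} (hM : 0 < M) (D : Set Phase) (f : Phase → ℝ) (t : ℝ) {x : E3}
    (hx : 2 * M < ‖x‖) (p : E3) :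
    liouville M D f (t, x, p) =
      fderivWithin ℝ f D (t, x, p)
        (-(vT M x p / lapse M ‖x‖), liouvilleX M x p, liouvilleP M x p) := by
  have hx0 : x ≠ 0 := norm_pos_iff.mp (by linarith)
  simp only [liouville, gradient_invMetric_momentum M hx0, gradient_invMetric_position hM hx,
    smul_smul]
  norm_num

/-! ### Rotations -/

/-- The rotation about the unit vector `a` by the angle `s`. -/
def rot (a : E3) (s : ℝ) (x : E3) : E3 :=
  Real.cos s • x + Real.sin s • cross a x + ((1 - Real.cos s) * inner ℝ a x) • a

theorem rot_zero (a x : E3) : rot a 0 x = x := by simp [rot]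

theorem rot_add (a : E3) (s : ℝ) (x y : E3) : rot a s (x + y) = rot a s x + rot a s y := by
  simp only [rot, cross_add_right, inner_add_right]; module

theorem rot_smul (a : E3) (s c : ℝ) (x : E3) : rot a s (c • x) = c • rot a s x := by
  simp only [rot, cross_smul_right, inner_smul_right]; module

theorem rot_axis {a : E3} (ha : ‖a‖ = 1) (s : ℝ) : rot a s a = a := by
  simp only [rot, cross_self_eq_zero, real_inner_self_eq_norm_sq, ha]; module

/-- Rodrigues' formula solves the linear equation `x' = a × x`. The invariance properties of `rot`
are deduced from this equation instead of from trigonometry. -/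
theorem hasDerivAt_rot {a : E3} (ha : ‖a‖ = 1) (x : E3) (s : ℝ) :
    HasDerivAt (fun s => rot a s x) (cross a (rot a s x)) s := by
  have h1 := (Real.hasDerivAt_cos s).smul_const x
  have h2 := (Real.hasDerivAt_sin s).smul_const (cross a x)
  have h3 := (((Real.hasDerivAt_cos s).const_sub 1).mul_const (inner ℝ a x)).smul_const a
  refine ((h1.add h2).add h3).congr_deriv ?_
  simp only [rot, cross_add_right, cross_smul_right, cross_cross_right, cross_self_eq_zero,
    real_inner_self_eq_norm_sq, ha]
  module

/-- The vector product as a continuous bilinear map. -/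
def crossB : E3 →L[ℝ] E3 →L[ℝ] E3 :=
  LinearMap.toContinuousBilinearMap
    (LinearMap.mk₂ ℝ cross cross_add_left (fun c a b => cross_smul_left c a b) cross_add_right
      (fun c a b => cross_smul_right c a b))

theorem hasDerivAt_cross {f g : ℝ → E3} {f' g' : E3} {s : ℝ} (hf : HasDerivAt f f' s)
    (hg : HasDerivAt g g' s) :
    HasDerivAt (fun s => cross (f s) (g s)) (cross f' (g s) + cross (f s) g') s := by
  have := crossB.hasDerivAt_of_bilinear (fun _ => hf) (fun _ => hg)
  refine this.congr_deriv ?_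
  rw [add_comm]; rfl

/-- The generator `a × ·` is antisymmetric, so the inner product has zero derivative in the angle
and keeps its value at angle `0`. -/
theorem inner_rot_rot {a : E3} (ha : ‖a‖ = 1) (s : ℝ) (x y : E3) :
    inner ℝ (rot a s x) (rot a s y) = inner ℝ x y := by
  have hd (s : ℝ) : HasDerivAt (fun s => inner ℝ (rot a s x) (rot a s y)) 0 s := by
    refine ((hasDerivAt_rot ha x s).inner ℝ (hasDerivAt_rot ha y s)).congr_deriv ?_
    rw [inner_cross_comm]; ring
  have := is_const_of_deriv_eq_zero (fun s => (hd s).differentiableAt) (fun s => (hd s).deriv) s 0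
  simpa [rot_zero] using this

theorem norm_rot {a : E3} (ha : ‖a‖ = 1) (s : ℝ) (x : E3) : ‖rot a s x‖ = ‖x‖ := by
  rw [norm_eq_sqrt_real_inner, inner_rot_rot ha, ← norm_eq_sqrt_real_inner]

/-- The rotation about the unit vector `a` by the angle `s`, as a linear isometry. -/
def rotL (a : E3) (ha : ‖a‖ = 1) (s : ℝ) : E3 ≃ₗᵢ[ℝ] E3 :=
  LinearIsometry.toLinearIsometryEquiv
    { toFun := rot a s, map_add' := rot_add a s, map_smul' := rot_smul a s,
      norm_map' := norm_rot ha s } rfl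

@[simp] theorem rotL_apply (a : E3) (ha : ‖a‖ = 1) (s : ℝ) (x : E3) : rotL a ha s x = rot a s x :=
  rfl

/-- By the Jacobi identity the defect `u` solves `u' = a × u`. Its norm is therefore constant, and
it vanishes at angle `0`. -/
theorem rot_cross {a : E3} (ha : ‖a‖ = 1) (s : ℝ) (x y : E3) :
    rot a s (cross x y) = cross (rot a s x) (rot a s y) := by
  set u : ℝ → E3 := fun s => rot a s (cross x y) - cross (rot a s x) (rot a s y) with hu
  have hd (s : ℝ) : HasDerivAt u (cross a (u s)) s := by
    refine ((hasDerivAt_rot ha _ s).sub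
      (hasDerivAt_cross (hasDerivAt_rot ha x s) (hasDerivAt_rot ha y s))).congr_deriv ?_
    apply E3.ext <;>
      simp only [hu, cross_apply_zero, cross_apply_one, cross_apply_two, PiLp.sub_apply,
        PiLp.add_apply] <;> ring
  have hd2 (s : ℝ) : HasDerivAt (fun s => inner ℝ (u s) (u s)) 0 s := by
    refine ((hd s).inner ℝ (hd s)).congr_deriv ?_
    rw [inner_cross_comm, inner_cross_self_right]; simp
  have := is_const_of_deriv_eq_zero (fun s => (hd2 s).differentiableAt) (fun s => (hd2 s).deriv) s 0
  have h0 : u 0 = 0 := by simp [hu, rot_zero]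
  rw [h0, inner_zero_left, inner_self_eq_zero] at this
  exact sub_eq_zero.mp this

/-! ### Rotational invariance of the Liouville vector field -/

section Invariance

variable (M : ℝ) (R : E3 ≃ₗᵢ[ℝ] E3) (x p : E3)

theorem vAng_map : vAng (R x) (R p) = vAng x p := by
  unfold vAng
  rw [← sq_eq_sq₀ (norm_nonneg _) (norm_nonneg _), norm_cross_sq, norm_cross_sq]
  simp

theorem vRStar_map : vRStar M (R x) (R p) = vRStar M x p := by simp [vRStar]

theorem vT_map : vT M (R x) (R p) = vT M x p := by simp [vT, vAng_map, vRStar_map]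

theorem liouvilleX_map : liouvilleX M (R x) (R p) = R (liouvilleX M x p) := by
  simp [liouvilleX]

theorem liouvilleP_map : liouvilleP M (R x) (R p) = R (liouvilleP M x p) := by
  simp [liouvilleP, vT_map]

end Invariance

/-! ### Coordinates adapted to the radial direction -/

/-- The energy `-v_t` of the covector with `v_{r*} = v` and `|v̸| = L`. -/
def energy (M r v L : ℝ) : ℝ := Real.sqrt (v ^ 2 + lapse M r / r ^ 2 * L ^ 2)

/-- The covector at `r e` with `v_{r*} = ⟨e, y⟩` and angular momentum `e × y`. -/
def mom (M r : ℝ) (e y : E3) : E3 :=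
  (inner ℝ e y / lapse M r) • e + r⁻¹ • (y - (inner ℝ e y : ℝ) • e)

section Coordinates

variable {M r : ℝ} {e : E3} (y : E3)

theorem inner_mom (he : ‖e‖ = 1) : inner ℝ e (mom M r e y) = inner ℝ e y / lapse M r := by
  simp [mom, inner_add_right, inner_smul_right, inner_sub_right, he]

theorem cross_mom (hr : r ≠ 0) : cross (r • e) (mom M r e y) = cross e y := by
  have : mom M r e y = (inner ℝ e y / lapse M r - r⁻¹ * inner ℝ e y) • e + r⁻¹ • y := by
    unfold mom; module
  rw [this, cross_add_right, cross_smul_right, cross_smul_right, cross_smul_left,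
    cross_smul_left, cross_self_eq_zero, smul_zero, smul_zero, zero_add, smul_smul,
    inv_mul_cancel₀ hr, one_smul]

theorem vAng_mom (hr : r ≠ 0) : vAng (r • e) (mom M r e y) = ‖cross e y‖ := by
  rw [vAng, cross_mom y hr]

theorem norm_smul_unit (hr : 0 < r) (he : ‖e‖ = 1) : ‖r • e‖ = r := by
  rw [norm_smul, he, mul_one, Real.norm_of_nonneg hr.le]

theorem vRStar_mom (hM : 0 < M) (hr : 2 * M < r) (he : ‖e‖ = 1) :
    vRStar M (r • e) (mom M r e y) = inner ℝ e y := by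
  have hr0 : 0 < r := by linarith
  have := lapse_pos hM hr
  rw [vRStar, norm_smul_unit hr0 he, real_inner_smul_left, inner_mom y he]
  field_simp

theorem vT_mom (hM : 0 < M) (hr : 2 * M < r) (he : ‖e‖ = 1) :
    vT M (r • e) (mom M r e y) = -energy M r (inner ℝ e y) ‖cross e y‖ := by
  have hr0 : 0 < r := by linarith
  rw [vT, vRStar_mom y hM hr he, vAng_mom y hr0.ne', norm_smul_unit hr0 he, energy]
  congr 3
  ring

theorem norm_sq_decomp (he : ‖e‖ = 1) : ‖y‖ ^ 2 = inner ℝ e y ^ 2 + ‖cross e y‖ ^ 2 := by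
  rw [norm_cross_sq, he]; ring

theorem energy_sq (hM : 0 < M) (hr : 2 * M < r) (v L : ℝ) :
    energy M r v L ^ 2 = v ^ 2 + lapse M r / r ^ 2 * L ^ 2 := by
  have := lapse_pos hM hr
  exact Real.sq_sqrt (by positivity)

theorem energy_nonneg (M r v L : ℝ) : 0 ≤ energy M r v L := Real.sqrt_nonneg _

theorem energy_pos_iff (hM : 0 < M) (hr : 2 * M < r) (v L : ℝ) :
    0 < energy M r v L ↔ v ≠ 0 ∨ L ≠ 0 := by
  have := lapse_pos hM hr
  have hr0 : 0 < r := by linarith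
  rw [energy, Real.sqrt_pos]
  constructor
  · intro h
    by_contra! h'
    simp [h'.1, h'.2] at h
  · rintro (h | h) <;> positivity

theorem ne_zero_iff_or (he : ‖e‖ = 1) : y ≠ 0 ↔ inner ℝ e y ≠ 0 ∨ ‖cross e y‖ ≠ 0 := by
  rw [← norm_ne_zero_iff, ← pow_ne_zero_iff two_ne_zero, norm_sq_decomp y he]
  constructor
  · intro h
    by_contra! h'
    simp [h'.1, h'.2] at h
  · rintro (h | h) <;> positivity

theorem mom_ne_zero (hr : r ≠ 0) (hM : 0 < M) (hr' : 2 * M < r) (he : ‖e‖ = 1) (hy : y ≠ 0) :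
    mom M r e y ≠ 0 := by
  intro h
  have h1 := inner_mom (M := M) (r := r) y he
  have h2 := cross_mom (M := M) (e := e) y hr
  have hl := lapse_pos hM hr'
  rw [h] at h1 h2
  rcases (ne_zero_iff_or y he).mp hy with h3 | h3
  · rw [inner_zero_right] at h1
    exact h3 (by field_simp at h1; linarith)
  · rw [cross_zero_right] at h2
    simp [← h2] at h3

end Coordinates

/-- The derivative of `Λ / r²`. -/
def potDeriv (M r : ℝ) : ℝ := -(2 / r ^ 3) + 6 * M / r ^ 4

theorem hasDerivAt_pot (M : ℝ) {r : ℝ} (hr : r ≠ 0) :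
    HasDerivAt (fun r => lapse M r / r ^ 2) (potDeriv M r) r := by
  refine ((hasDerivAt_lapse M hr).div (hasDerivAt_pow 2 r) (by positivity)).congr_deriv ?_
  unfold potDeriv lapse
  simp
  field_simp
  ring

/-- The derivative of `mom M r e y` with respect to `r`. -/
def momDeriv (M r : ℝ) (e y : E3) : E3 :=
  (-(inner ℝ e y / lapse M r ^ 2 * (2 * M / r ^ 2))) • e
    + (-(r ^ 2)⁻¹) • (y - (inner ℝ e y : ℝ) • e)

theorem hasDerivAt_mom {M r : ℝ} (hM : 0 < M) (hr : 2 * M < r) (e y : E3) :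
    HasDerivAt (fun r => mom M r e y) (momDeriv M r e y) r := by
  have hr0 : r ≠ 0 := by linarith
  have hl := lapse_pos hM hr
  have h1 := (((hasDerivAt_lapse M hr0).inv hl.ne').const_mul (inner ℝ e y)).smul_const e
  have h2 := (hasDerivAt_inv hr0).smul_const (y - (inner ℝ e y : ℝ) • e)
  refine (h1.add h2).congr_deriv ?_
  unfold momDeriv
  congr 2
  field_simp

/-- Decomposition of the momentum part of the Liouville vector field along the radial derivative at
fixed `y`, the derivative in `v_{r*}` and the rotation about the angular momentum. -/
theorem liouvilleP_mom {M r : ℝ} (hM : 0 < M) (hr : 2 * M < r) {e : E3} (he : ‖e‖ = 1) (y : E3) :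
    liouvilleP M (r • e) (mom M r e y) =
      (inner ℝ e y : ℝ) • momDeriv M r e y
        - (1 / 2 * ‖cross e y‖ ^ 2 * potDeriv M r / lapse M r) • e
        + (r ^ 2)⁻¹ • cross (cross e y) (mom M r e y) := by
  have hr0 : 0 < r := by linarith
  have hl := lapse_pos hM hr
  have hE := energy_sq hM hr (inner ℝ e y) ‖cross e y‖
  have hc : cross (cross e y) (mom M r e y) =
      (inner ℝ e y / lapse M r) • (y - (inner ℝ e y : ℝ) • e) - (r⁻¹ * ‖cross e y‖ ^ 2) • e := by
    rw [cross_cross_left, inner_mom y he, norm_cross_sq, he]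
    have : inner ℝ y (mom M r e y) =
        inner ℝ e y ^ 2 / lapse M r + r⁻¹ * (‖y‖ ^ 2 - inner ℝ e y ^ 2) := by
      simp only [mom, inner_add_right, inner_smul_right, inner_sub_right,
        real_inner_self_eq_norm_sq, real_inner_comm e y]
      ring
    rw [this]; module
  rw [hc, liouvilleP, vT_mom y hM hr he, norm_smul_unit hr0 he, real_inner_smul_left,
    inner_mom y he, neg_sq, hE]
  generalize ‖cross e y‖ = L
  unfold momDeriv mom potDeriv
  generalize (inner ℝ e y : ℝ) = v
  -- Eliminating `M` in favour of the lapse turns both components into rational identities in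
  -- independent variables.
  have hl2 : 2 * M = r * (1 - lapse M r) := by unfold lapse; field_simp; ring
  generalize lapse M r = l at *
  obtain rfl : M = r * (1 - l) / 2 := by linarith
  match_scalars
  · field_simp
    ring
  · field_simp
    ring

theorem liouvilleX_mom {M r : ℝ} (hM : 0 < M) (hr : 2 * M < r) {e : E3} (he : ‖e‖ = 1) (y : E3) :
    liouvilleX M (r • e) (mom M r e y) =
      (inner ℝ e y : ℝ) • e + (r ^ 2)⁻¹ • cross (cross e y) (r • e) := by
  have hr0 : 0 < r := by linarith
  have hl := lapse_pos hM hr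
  rw [liouvilleX, norm_smul_unit hr0 he, real_inner_smul_left, inner_mom y he, cross_cross_left,
    real_inner_smul_right, real_inner_smul_right, real_inner_self_eq_norm_sq, he, mom,
    real_inner_comm e y]
  generalize (inner ℝ e y : ℝ) = v
  have hl2 : 2 * M = r * (1 - lapse M r) := by unfold lapse; field_simp; ring
  generalize lapse M r = l at *
  obtain rfl : M = r * (1 - l) / 2 := by linarith
  match_scalars
  · field_simp
    ring
  · field_simp

/-! ### The phase region -/

namespace Foliation

variable {M : ℝ} (𝓕 : Foliation M)

theorem mem_phaseRegion_iff (hM : 0 < M) (t : ℝ) (x p : E3) :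
    (t, x, p) ∈ 𝓕.phaseRegion ↔ 2 * M < ‖x‖ ∧ 𝓕.height ‖x‖ ≤ t ∧ p ≠ 0 := by
  simp only [phaseRegion, Set.mem_ofPred_eq, 𝓕.mem_leaf_iff hM]
  constructor
  · rintro ⟨⟨τ, hτ, h1, h2⟩, h3⟩
    exact ⟨h1, by linarith, h3⟩
  · rintro ⟨h1, h2, h3⟩
    exact ⟨⟨t - 𝓕.height ‖x‖, by linarith, h1, by ring⟩, h3⟩

/-- The height function of the spacelike part, for all radii. -/
def innerHeight (r : ℝ) : ℝ := 𝓕.U r - rStar M r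

/-- The height function of the null part, for all radii. -/
def outerHeight (r : ℝ) : ℝ := 𝓕.u₀ + rStar M r

theorem two_mul_lt_R₀ (hM : 0 < M) : 2 * M < 𝓕.R₀ := by linarith [𝓕.three_mul_lt]

theorem innerHeight_R₀ : 𝓕.innerHeight 𝓕.R₀ = 𝓕.outerHeight 𝓕.R₀ := by
  simp [innerHeight, outerHeight, u₀]

theorem height_of_le {r : ℝ} (h : r ≤ 𝓕.R₀) : 𝓕.height r = 𝓕.innerHeight r := by
  rcases h.lt_or_eq with h | rfl
  · simp [height, innerHeight, h]
  · rw [innerHeight_R₀]; simp [height, outerHeight]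

theorem height_of_ge {r : ℝ} (h : 𝓕.R₀ ≤ r) : 𝓕.height r = 𝓕.outerHeight r := by
  simp [height, outerHeight, not_lt.mpr h]

theorem hasDerivAt_U {r : ℝ} (hr : 2 * M < r) : HasDerivAt 𝓕.U (𝓕.U' r) r := by
  have h1 : Set.Ici (2 * M) ∈ nhds r := Ici_mem_nhds hr
  have h2 : DifferentiableAt ℝ 𝓕.U r :=
    ((𝓕.smooth.contDiffAt h1).differentiableAt (by simp))
  rw [U', derivWithin_of_mem_nhds h1]
  exact h2.hasDerivAt

theorem continuousOn_U' : ContinuousOn 𝓕.U' (Set.Ici (2 * M)) :=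
  𝓕.smooth.continuousOn_derivWithin (uniqueDiffOn_Ici _) (by simp)

theorem hasDerivAt_innerHeight (hM : 0 < M) {r : ℝ} (hr : 2 * M < r) :
    HasDerivAt 𝓕.innerHeight (𝓕.U' r - 1 / lapse M r) r :=
  (𝓕.hasDerivAt_U hr).sub (hasDerivAt_rStar hM hr)

theorem hasDerivAt_outerHeight (hM : 0 < M) {r : ℝ} (hr : 2 * M < r) :
    HasDerivAt 𝓕.outerHeight (1 / lapse M r) r :=
  (hasDerivAt_rStar hM hr).const_add _

-- The height function is only piecewise smooth, its two branches meeting at `R₀`. An upper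
-- Lipschitz bound at each point, read off from the derivatives of the branches, is all that is
-- needed to place a cone inside the region.
open Filter Asymptotics in
theorem height_le_of_near (hM : 0 < M) {r : ℝ} (hr : 2 * M < r) :
    ∃ K, 0 ≤ K ∧ ∀ᶠ s in nhds r, 𝓕.height s ≤ 𝓕.height r + K * |s - r| := by
  obtain ⟨K₁, h₁⟩ := (𝓕.hasDerivAt_innerHeight hM hr).isBigO_sub.bound
  obtain ⟨K₂, h₂⟩ := (𝓕.hasDerivAt_outerHeight hM hr).isBigO_sub.bound
  refine ⟨max 0 (max K₁ K₂), le_max_left _ _, ?_⟩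
  have hc : ∀ᶠ s in nhds r, (s ≤ 𝓕.R₀ ∧ r ≤ 𝓕.R₀) ∨ (𝓕.R₀ ≤ s ∧ 𝓕.R₀ ≤ r) := by
    rcases lt_trichotomy r 𝓕.R₀ with h | h | h
    · filter_upwards [Iio_mem_nhds h] with s hs
      exact Or.inl ⟨le_of_lt hs, h.le⟩
    · refine .of_forall fun s => ?_
      rcases le_total s 𝓕.R₀ with h' | h'
      · exact Or.inl ⟨h', h.le⟩
      · exact Or.inr ⟨h', h.ge⟩
    · filter_upwards [Ioi_mem_nhds h] with s hs
      exact Or.inr ⟨le_of_lt hs, h.le⟩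
  filter_upwards [h₁, h₂, hc] with s h1 h2 h3
  simp only [Real.norm_eq_abs] at h1 h2
  have hk1 : K₁ * |s - r| ≤ max 0 (max K₁ K₂) * |s - r| := by gcongr; simp
  have hk2 : K₂ * |s - r| ≤ max 0 (max K₁ K₂) * |s - r| := by gcongr; simp
  rcases h3 with ⟨h3, h4⟩ | ⟨h3, h4⟩
  · rw [𝓕.height_of_le h3, 𝓕.height_of_le h4]
    linarith [le_abs_self (𝓕.innerHeight s - 𝓕.innerHeight r)]
  · rw [𝓕.height_of_ge h3, 𝓕.height_of_ge h4]
    linarith [le_abs_self (𝓕.outerHeight s - 𝓕.outerHeight r)]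

/-- The region contains its boundary above `Σ_0`, so it is not open. Convex subsets with interior
through every point make derivatives within it unique and make second derivatives symmetric up to
the boundary. -/
theorem exists_convex_subset (hM : 0 < M) {y : Phase} (hy : y ∈ 𝓕.phaseRegion) :
    ∃ S : Set Phase, Convex ℝ S ∧ (interior S).Nonempty ∧ y ∈ S ∧ S ⊆ 𝓕.phaseRegion := by
  obtain ⟨t, x, p⟩ := y
  obtain ⟨hx, ht, hp⟩ := (𝓕.mem_phaseRegion_iff hM t x p).mp hy
  obtain ⟨K, hK, hev⟩ := 𝓕.height_le_of_near hM hx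
  have hev' := (hev.and (Ioi_mem_nhds hx))
  have hcont : Filter.Tendsto (fun z : E3 => ‖z‖) (nhds x) (nhds ‖x‖) := continuous_norm.tendsto x
  obtain ⟨ε, hε, hball⟩ := Metric.eventually_nhds_iff.mp (hcont.eventually hev')
  -- A cone in spacetime of slope `K` with vertex at the point stays above the graph of the height.
  -- The radius `‖p‖` of the momentum ball is what keeps the zero covector out.
  refine ⟨{z | K * ‖z.2.1 - x‖ ≤ z.1 - t} ∩ {z | z.2.1 ∈ Metric.ball x ε} ∩
    {z | z.2.2 ∈ Metric.ball p ‖p‖}, ?_, ?_, ?_, ?_⟩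
  · refine ((?_ : Convex ℝ {z : Phase | K * ‖z.2.1 - x‖ ≤ z.1 - t}).inter ?_).inter ?_
    · have h1 : ConvexOn ℝ Set.univ fun z : Phase => K * ‖z.2.1 - x‖ - z.1 := by
        have h2 : ConvexOn ℝ Set.univ fun z : Phase => ‖z.2.1 - x‖ := by
          have h3 : ConvexOn ℝ Set.univ fun z : E3 => ‖z - x‖ := by
            simpa [dist_eq_norm] using convexOn_dist x (convex_univ (𝕜 := ℝ) (E := E3))
          exact h3.comp_linearMap
            ((LinearMap.fst ℝ E3 E3).comp (LinearMap.snd ℝ ℝ (E3 × E3)))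
        have h4 : ConcaveOn ℝ Set.univ fun z : Phase => z.1 :=
          (LinearMap.fst ℝ ℝ (E3 × E3)).concaveOn convex_univ
        exact (h2.smul hK).sub h4
      have := h1.convex_le (-t)
      convert this using 1
      ext z
      simp only [Set.mem_ofPred_eq, Set.mem_univ, true_and]
      constructor <;> intro h <;> linarith
    · exact (convex_ball x ε).linear_preimage
        ((LinearMap.fst ℝ E3 E3).comp (LinearMap.snd ℝ ℝ (E3 × E3)))
    · exact (convex_ball p ‖p‖).linear_preimage
        ((LinearMap.snd ℝ E3 E3).comp (LinearMap.snd ℝ ℝ (E3 × E3)))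
  · have ho : IsOpen ({z : Phase | K * ‖z.2.1 - x‖ < z.1 - t} ∩ {z | z.2.1 ∈ Metric.ball x ε} ∩
        {z | z.2.2 ∈ Metric.ball p ‖p‖}) := by
      refine ((isOpen_lt (by fun_prop) (by fun_prop)).inter ?_).inter ?_
      · exact Metric.isOpen_ball.preimage (by fun_prop : Continuous fun z : Phase => z.2.1)
      · exact Metric.isOpen_ball.preimage (by fun_prop : Continuous fun z : Phase => z.2.2)
    refine ⟨(t + 1, x, p), interior_maximal ?_ ho ?_⟩
    · intro z hz
      simp only [Set.mem_inter_iff, Set.mem_ofPred_eq] at hz ⊢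
      exact ⟨⟨hz.1.1.le, hz.1.2⟩, hz.2⟩
    · simp [hε, norm_pos_iff.mpr hp]
  · simp [hε]
    exact hp
  · rintro ⟨s, z, k⟩ ⟨⟨h1, h2⟩, h3⟩
    obtain ⟨h4, h5⟩ := hball h2
    refine (𝓕.mem_phaseRegion_iff hM s z k).mpr ⟨h5, ?_, ?_⟩
    · have h6 : K * |‖z‖ - ‖x‖| ≤ K * ‖z - x‖ := by
        gcongr; exact abs_norm_sub_norm_le z x
      simp only [Set.mem_ofPred_eq] at h1
      linarith
    · rintro rfl
      simp at h3

theorem uniqueDiffOn_phaseRegion (hM : 0 < M) : UniqueDiffOn ℝ 𝓕.phaseRegion := by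
  intro y hy
  obtain ⟨S, h1, h2, h3, h4⟩ := 𝓕.exists_convex_subset hM hy
  exact (uniqueDiffWithinAt_convex h1 h2 (subset_closure h3)).mono h4

/-- Symmetry of the second derivative within a set is available at limits of interior points;
`liouville_omegaHat` needs it also above `Σ_0`. -/
theorem phaseRegion_subset_closure_interior (hM : 0 < M) {y : Phase} (hy : y ∈ 𝓕.phaseRegion) :
    y ∈ closure (interior 𝓕.phaseRegion) := by
  obtain ⟨S, h1, h2, h3, h4⟩ := 𝓕.exists_convex_subset hM hy
  have := h1.closure_interior_eq_closure_of_nonempty_interior h2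
  exact closure_mono (interior_mono h4) (this ▸ subset_closure h3)

end Foliation

/-! ### Rotations of the phase space -/

/-- The infinitesimal rotation of position and covector about `a`. -/
def rotField (a : E3) : Phase →L[ℝ] Phase :=
  (0 : Phase →L[ℝ] ℝ).prod
    (((crossL a).comp ((ContinuousLinearMap.fst ℝ E3 E3).comp
      (ContinuousLinearMap.snd ℝ ℝ (E3 × E3)))).prod
    ((crossL a).comp ((ContinuousLinearMap.snd ℝ E3 E3).comp
      (ContinuousLinearMap.snd ℝ ℝ (E3 × E3)))))

@[simp] theorem rotField_apply (a : E3) (y : Phase) :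
    rotField a y = (0, cross a y.2.1, cross a y.2.2) := rfl

/-- The simultaneous rotation of position and covector about `a` by the angle `s`. -/
def rotPhase (a : E3) (s : ℝ) (y : Phase) : Phase := (y.1, rot a s y.2.1, rot a s y.2.2)

theorem hasDerivAt_rotPhase {a : E3} (ha : ‖a‖ = 1) (y : Phase) (s : ℝ) :
    HasDerivAt (fun s => rotPhase a s y) (rotField a (rotPhase a s y)) s :=
  (hasDerivAt_const s y.1).prodMk
    ((hasDerivAt_rot ha y.2.1 s).prodMk (hasDerivAt_rot ha y.2.2 s))

theorem cross_eq_sum (a b : E3) :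
    cross a b = ∑ i : Fin 3, a i • cross (EuclideanSpace.single i 1) b := by
  apply E3.ext <;>
    simp [Fin.sum_univ_three, cross_apply_zero, cross_apply_one, cross_apply_two] <;> ring

/-- The axis `a` may depend on the point. It is used with the angular momentum as axis, where it
expresses the rotational part of the Liouville field through the three `Ω̂_i`. -/
theorem fderivWithin_rotField (D : Set Phase) (f : Phase → ℝ) (a : E3) (y : Phase) :
    fderivWithin ℝ f D y (rotField a y) = ∑ i : Fin 3, a i * omegaHat D i f y := by
  have : rotField a y = ∑ i : Fin 3, a i • (0, cross (EuclideanSpace.single i 1) y.2.1,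
      cross (EuclideanSpace.single i 1) y.2.2) := by
    rw [rotField_apply, cross_eq_sum a y.2.1, cross_eq_sum a y.2.2]
    simp [Fin.sum_univ_three]
  rw [this, map_sum]
  simp only [map_smul, smul_eq_mul, omegaHat]

namespace Foliation

variable {M : ℝ} (𝓕 : Foliation M)

theorem rotPhase_mem (hM : 0 < M) {a : E3} (ha : ‖a‖ = 1) (s : ℝ) {y : Phase}
    (hy : y ∈ 𝓕.phaseRegion) : rotPhase a s y ∈ 𝓕.phaseRegion := by
  obtain ⟨t, x, p⟩ := y
  rw [rotPhase]
  rw [𝓕.mem_phaseRegion_iff hM] at hy ⊢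
  simp only [norm_rot ha]
  refine ⟨hy.1, hy.2.1, ?_⟩
  rw [← norm_ne_zero_iff, norm_rot ha]
  simpa using hy.2.2

/-- Rotation orbits never leave the region, so the derivative in the angle is two-sided even at
points above `Σ_0`. -/
theorem hasDerivAt_comp_rotPhase (hM : 0 < M) {f : Phase → ℝ}
    (hf : DifferentiableOn ℝ f 𝓕.phaseRegion) {a : E3} (ha : ‖a‖ = 1) (s : ℝ) {y : Phase}
    (hy : y ∈ 𝓕.phaseRegion) :
    HasDerivAt (fun s => f (rotPhase a s y))
      (∑ i : Fin 3, a i * omegaHat 𝓕.phaseRegion i f (rotPhase a s y)) s := by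
  rw [← fderivWithin_rotField, ← hasDerivWithinAt_univ]
  exact (hf _ (𝓕.rotPhase_mem hM ha s hy)).hasFDerivWithinAt.comp_hasDerivWithinAt s
    (hasDerivAt_rotPhase ha y s).hasDerivWithinAt fun u _ => 𝓕.rotPhase_mem hM ha u hy

theorem contDiffOn_omegaHat (hM : 0 < M) {f : Phase → ℝ} {n : ℕ}
    (hf : ContDiffOn ℝ (n + 1) f 𝓕.phaseRegion) (i : Fin 3) :
    ContDiffOn ℝ n (omegaHat 𝓕.phaseRegion i f) 𝓕.phaseRegion :=
  (hf.fderivWithin (𝓕.uniqueDiffOn_phaseRegion hM) le_rfl).clm_apply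
    (rotField (EuclideanSpace.single i 1)).contDiff.contDiffOn

/-- The Liouville vector field at `y`. -/
def _root_.SchwarzschildVlasov.liouvilleField (M : ℝ) (y : Phase) : Phase :=
  (-(vT M y.2.1 y.2.2 / lapse M ‖y.2.1‖), liouvilleX M y.2.1 y.2.2, liouvilleP M y.2.1 y.2.2)

theorem liouville_eq_fderivWithin (hM : 0 < M) (f : Phase → ℝ) {y : Phase}
    (hy : y ∈ 𝓕.phaseRegion) :
    liouville M 𝓕.phaseRegion f y = fderivWithin ℝ f 𝓕.phaseRegion y (liouvilleField M y) :=
  liouville_eq hM _ f y.1 ((𝓕.mem_phaseRegion_iff hM y.1 y.2.1 y.2.2).mp hy).1 y.2.2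

theorem _root_.SchwarzschildVlasov.liouvilleField_rotPhase (M : ℝ) {a : E3} (ha : ‖a‖ = 1) (s : ℝ)
    (y : Phase) :
    liouvilleField M (rotPhase a s y) =
      rotPhase a s (liouvilleField M y) := by
  have h1 := vT_map M (rotL a ha s) y.2.1 y.2.2
  have h2 := liouvilleX_map M (rotL a ha s) y.2.1 y.2.2
  have h3 := liouvilleP_map M (rotL a ha s) y.2.1 y.2.2
  simp only [rotL_apply] at h1 h2 h3
  simp only [liouvilleField, rotPhase, h1, h2, h3, norm_rot ha]

/-- The complete lifts of the rotations commute with the Liouville operator: they preserve its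
kernel. -/
theorem liouville_omegaHat (hM : 0 < M) {f : Phase → ℝ} (hf : ContDiffOn ℝ 2 f 𝓕.phaseRegion)
    (hT : ∀ y ∈ 𝓕.phaseRegion, liouville M 𝓕.phaseRegion f y = 0) (i : Fin 3) :
    ∀ y ∈ 𝓕.phaseRegion, liouville M 𝓕.phaseRegion (omegaHat 𝓕.phaseRegion i f) y = 0 := by
  intro y hy
  set D := 𝓕.phaseRegion with hD
  have hu := 𝓕.uniqueDiffOn_phaseRegion hM
  set a : E3 := EuclideanSpace.single i 1 with ha'
  have ha : ‖a‖ = 1 := by simp [ha']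
  set V := liouvilleField M y with hV
  have hF : ContDiffOn ℝ 1 (fderivWithin ℝ f D) D := hf.fderivWithin hu (by norm_num)
  have hFd := ((hF y hy).differentiableWithinAt (by simp)).hasFDerivWithinAt
  set F2 := fderivWithin ℝ (fderivWithin ℝ f D) D y with hF2
  have hsymm : IsSymmSndFDerivWithinAt ℝ f D y :=
    (hf y hy).isSymmSndFDerivWithinAt (by simp) hu
      (𝓕.phaseRegion_subset_closure_interior hM hy) hy
  have h1 : HasFDerivWithinAt (omegaHat D i f)
      (((fderivWithin ℝ f D y).comp (rotField a)) + F2.flip (rotField a y)) D y :=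
    hFd.clm_apply (rotField a).hasFDerivAt.hasFDerivWithinAt
  rw [𝓕.liouville_eq_fderivWithin hM _ hy, h1.fderivWithin (hu y hy)]
  -- Rotational invariance of the Liouville field turns `T f = 0` along the orbit of `y` into
  -- `df(R_s y)(R_s V) = 0`. Its derivative at `s = 0`, with the symmetry of the second derivative,
  -- is the claim.
  have h2 : HasDerivAt (fun s => fderivWithin ℝ f D (rotPhase a s y) (rotPhase a s V))
      (F2 (rotField a y) V + fderivWithin ℝ f D y (rotField a V)) 0 := by
    have h3 : HasDerivAt (fun s => fderivWithin ℝ f D (rotPhase a s y)) (F2 (rotField a y)) 0 := by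
      rw [← hasDerivWithinAt_univ]
      have h4 : rotPhase a 0 y = y := by simp [rotPhase, rot_zero]
      have h5 := (hasDerivAt_rotPhase ha y 0).hasDerivWithinAt (s := Set.univ)
      rw [h4] at h5
      have hFd' : HasFDerivWithinAt (fderivWithin ℝ f D) F2 D (rotPhase a 0 y) := by rwa [h4]
      exact hFd'.comp_hasDerivWithinAt (0 : ℝ) h5 fun u _ => 𝓕.rotPhase_mem hM ha u hy
    have h4 := hasDerivAt_rotPhase ha V 0
    have := h3.clm_apply h4
    simpa [rotPhase, rot_zero] using this
  have h3 : (fun s => fderivWithin ℝ f D (rotPhase a s y) (rotPhase a s V)) = fun _ => 0 := by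
    funext s
    rw [hV, ← liouvilleField_rotPhase M ha,
      ← 𝓕.liouville_eq_fderivWithin hM _ (𝓕.rotPhase_mem hM ha s hy)]
    exact hT _ (𝓕.rotPhase_mem hM ha s hy)
  rw [h3] at h2
  have h4 := h2.unique (hasDerivAt_const (0 : ℝ) (0 : ℝ))
  have h5 := hsymm V (rotField a y)
  simp only [_root_.add_apply, ContinuousLinearMap.comp_apply,
    ContinuousLinearMap.flip_apply]
  rw [← hF2] at h5
  rw [← hV, h5]
  linarith

end Foliation

/-! ### Integration over spheres and cones -/

/-- The unit sphere. -/
abbrev S2 := Metric.sphere (0 : E3) 1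

/-- The surface measure of the unit sphere. -/
abbrev sphMeasure : Measure S2 := (volume : Measure E3).toSphere

theorem S2.norm_eq (e : S2) : ‖(e : E3)‖ = 1 := by simp

theorem finrank_E3 : Module.finrank ℝ E3 = 3 := by simp

theorem lintegral_polar {Φ : E3 → ℝ≥0∞} (hΦ : Measurable Φ) :
    ∫⁻ x, Φ x = ∫⁻ r in Set.Ioi (0 : ℝ), ∫⁻ e, ENNReal.ofReal (r ^ 2) * Φ (r • (e : E3))
      ∂sphMeasure := by
  have h1 : ∫⁻ x, Φ x = ∫⁻ x : ({(0 : E3)}ᶜ : Set E3), Φ x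
      ∂((volume : Measure E3).comap Subtype.val) := by
    rw [lintegral_subtype_comap (measurableSet_singleton _).compl, restrict_compl_singleton]
  have hΨ : Measurable fun z : S2 × Set.Ioi (0 : ℝ) => Φ ((z.2 : ℝ) • (z.1 : E3)) := by fun_prop
  have h2 := ((volume : Measure E3).measurePreserving_homeomorphUnitSphereProd).lintegral_comp hΨ
  have h3 : ∀ x : ({(0 : E3)}ᶜ : Set E3), Φ (((homeomorphUnitSphereProd E3 x).2 : ℝ) •
      ((homeomorphUnitSphereProd E3 x).1 : E3)) = Φ x := by
    intro x
    congr 1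
    have : (x : E3) ≠ 0 := x.2
    simp [this]
  simp only [h3] at h2
  rw [h1, h2, lintegral_prod_symm _ hΨ.aemeasurable, Measure.volumeIoiPow,
    lintegral_withDensity_eq_lintegral_mul _ (by fun_prop) (by fun_prop)]
  rw [finrank_E3, ← lintegral_subtype_comap measurableSet_Ioi]
  refine lintegral_congr fun r => ?_
  rw [Pi.mul_apply, lintegral_const_mul _ (by fun_prop)]

-- `toSphere` measures a set by the volume of the solid cone over it, and an isometry maps such
-- cones to such cones.
open scoped Pointwise in
theorem measurePreserving_sphere (R : E3 ≃ₗᵢ[ℝ] E3) :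
    MeasurePreserving (fun e : S2 => (⟨R e, by simp⟩ : S2)) sphMeasure sphMeasure := by
  have hm : Measurable (fun e : S2 => (⟨R e, by simp⟩ : S2)) :=
    (R.continuous.comp continuous_subtype_val).measurable.subtype_mk
  refine ⟨hm, ?_⟩
  ext s hs
  rw [Measure.map_apply hm hs, Measure.toSphere_apply' _ (hm hs), Measure.toSphere_apply' _ hs]
  congr 1
  rw [← R.measurePreserving.measure_preimage_emb R.toHomeomorph.measurableEmbedding
    (Set.Ioo (0 : ℝ) 1 • (Subtype.val '' s : Set E3))]
  congr 1
  ext x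
  simp only [Set.mem_smul, Set.mem_image, Set.mem_preimage, Subtype.exists, exists_and_right,
    exists_eq_right]
  constructor
  · rintro ⟨c, hc, e, ⟨he, h⟩, rfl⟩
    exact ⟨c, hc, R e, ⟨by simpa using he, h⟩, by simp⟩
  · rintro ⟨c, hc, e, ⟨he, h⟩, h2⟩
    refine ⟨c, hc, R.symm e, ⟨by simpa using he, ?_⟩, ?_⟩
    · simpa only [R.apply_symm_apply] using h
    · apply R.injective
      rw [map_smul, R.apply_symm_apply, h2]

/-- `mom M r e` as a linear map. -/
def momL (M r : ℝ) (e : E3) : E3 →ₗ[ℝ] E3 where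
  toFun := mom M r e
  map_add' y z := by simp only [mom, inner_add_right]; module
  map_smul' c y := by simp only [mom, inner_smul_right, RingHom.id_apply]; module

/-- Up to the factor `r⁻¹` in all three directions, the map is the identity orthogonally to `e` and
multiplies `e` by `r / lapse`. -/
theorem det_momL {M r : ℝ} (hM : 0 < M) (hr : 2 * M < r) {e : E3} (he : ‖e‖ = 1) :
    LinearMap.det (momL M r e) = (lapse M r * r ^ 2)⁻¹ := by
  have hr0 : 0 < r := by linarith
  have hl := lapse_pos hM hr
  have : momL M r e = r⁻¹ •
      LinearMap.transvection ((innerSL ℝ e : E3 →L[ℝ] ℝ) : E3 →ₗ[ℝ] ℝ)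
        ((r / lapse M r - 1) • e) := by
    ext1 y
    simp only [momL, LinearMap.coe_mk, AddHom.coe_mk, mom, LinearMap.smul_apply,
      LinearMap.transvection.apply, ContinuousLinearMap.coe_coe, innerSL_apply_apply]
    match_scalars
    · field_simp
      ring
    · ring
  rw [this, LinearMap.det_smul, LinearMap.transvection.det, finrank_E3]
  simp [he]
  field_simp

theorem lintegral_mom {M r : ℝ} (hM : 0 < M) (hr : 2 * M < r) {e : E3} (he : ‖e‖ = 1)
    (G : E3 → ℝ≥0∞) :
    ∫⁻ p, G p = ENNReal.ofReal ((lapse M r * r ^ 2)⁻¹) * ∫⁻ y, G (mom M r e y) := by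
  have hr0 : 0 < r := by linarith
  have hl := lapse_pos hM hr
  have hpos : 0 < (lapse M r * r ^ 2)⁻¹ := by positivity
  have hdet : LinearMap.det (momL M r e) ≠ 0 := by rw [det_momL hM hr he]; exact hpos.ne'
  have h1 := Measure.map_linearMap_addHaar_eq_smul_addHaar (volume : Measure E3) hdet
  have hemb : MeasurableEmbedding (momL M r e) := by
    have := (LinearEquiv.ofIsUnitDet (f := momL M r e) (v := (EuclideanSpace.basisFun (Fin 3) ℝ).toBasis)
      (v' := (EuclideanSpace.basisFun (Fin 3) ℝ).toBasis)
      (by rw [LinearMap.det_toMatrix]; exact hdet.isUnit)).toContinuousLinearEquiv.toHomeomorph.measurableEmbedding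
    exact this
  have h2 := hemb.lintegral_map (μ := (volume : Measure E3)) G
  rw [h1, lintegral_smul_measure, det_momL hM hr he, inv_inv, abs_of_pos (by positivity)] at h2
  have h3 : ∫⁻ y, G (mom M r e y) = ∫⁻ y, G (momL M r e y) := rfl
  rw [h3, ← h2, smul_eq_mul, ← mul_assoc, ← ENNReal.ofReal_mul hpos.le,
    inv_mul_cancel₀ (by positivity), ENNReal.ofReal_one, one_mul]

/-- The Jacobian `1 / (lapse r²)` cancels the lapse in the density of the cone measure. -/
theorem coneIntegral_eq {M r : ℝ} (hM : 0 < M) (hr : 2 * M < r) {e : E3} (he : ‖e‖ = 1)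
    (G : E3 → ℝ) :
    coneIntegral M (r • e) G =
      ∫⁻ y, ENNReal.ofReal (G (mom M r e y) /
        (r ^ 2 * energy M r (inner ℝ e y) ‖cross e y‖)) := by
  have hr0 : 0 < r := by linarith
  have hl := lapse_pos hM hr
  rw [coneIntegral, lintegral_mom hM hr he, ← lintegral_const_mul' _ _ ENNReal.ofReal_ne_top]
  refine lintegral_congr fun y => ?_
  rw [← ENNReal.ofReal_mul (by positivity), vT_mom y hM hr he, norm_smul_unit hr0 he, abs_neg,
    abs_of_nonneg (energy_nonneg _ _ _ _)]
  congr 1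
  field_simp

/-- The integral of the derivative along a one-parameter family of measure preserving maps
vanishes. -/
theorem integral_eq_zero_of_measurePreserving {X : Type*} [MeasurableSpace X] {μ : Measure X}
    {φ : ℝ → X → X} (hφ : ∀ s, MeasurePreserving (φ s) μ μ) (hφ0 : ∀ x, φ 0 x = x)
    {A A' : X → ℝ} (hA : Integrable A μ) (hA' : AEStronglyMeasurable A' μ)
    (hd : ∀ x s, HasDerivAt (fun s => A (φ s x)) (A' (φ s x)) s)
    {g : X → ℝ} (hg : Integrable g μ) (hb : ∀ x, ∀ s ∈ Metric.ball (0 : ℝ) 1, |A' (φ s x)| ≤ g x) :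
    ∫ x, A' x ∂μ = 0 := by
  have h := (hasDerivAt_integral_of_dominated_loc_of_deriv_le (μ := μ) (F := fun s x => A (φ s x))
    (F' := fun s x => A' (φ s x)) (x₀ := 0) (bound := g) (Metric.ball_mem_nhds 0 one_pos)
    (.of_forall fun s => hA.aestronglyMeasurable.comp_measurePreserving (hφ s))
    (by simpa only [hφ0] using hA) (by simpa only [hφ0] using hA')
    (.of_forall fun x s hs => hb x s hs) hg (.of_forall fun x s _ => hd x s)).2
  have hc : (fun s => ∫ x, A (φ s x) ∂μ) = fun _ => ∫ x, A x ∂μ := by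
    funext s
    have h1 : AEStronglyMeasurable A (Measure.map (φ s) μ) := by
      rw [(hφ s).map_eq]; exact hA.aestronglyMeasurable
    rw [← integral_map (hφ s).measurable.aemeasurable h1, (hφ s).map_eq]
  rw [hc] at h
  have := h.unique (hasDerivAt_const (0 : ℝ) _)
  simpa only [hφ0] using this

/-- Fubini's theorem in the Cartesian coordinates of `E3`. -/
theorem lintegral_E3 {Φ : E3 → ℝ≥0∞} (hΦ : Measurable Φ) :
    ∫⁻ x, Φ x = ∫⁻ z : ℝ × ℝ × ℝ, Φ !₂[z.1, z.2.1, z.2.2] := by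
  have h1 := PiLp.volume_preserving_toLp (Fin 3)
  have h2 := (volume_preserving_piFinSuccAbove (fun _ : Fin 3 => ℝ) 0).symm
  have h3 := (volume_preserving_piFinTwo (fun _ : Fin 2 => ℝ)).symm
  have h4 := (MeasurePreserving.id (volume : Measure ℝ)).prod h3
  have h5 := h1.comp (h2.comp h4)
  have h6 := h5.lintegral_comp hΦ
  refine h6.symm.trans (lintegral_congr fun z => ?_)
  congr 1
  apply E3.ext <;> rfl

/-- A patch of directions is enough for the Sobolev inequality, so the angle is restricted to
`]0,1[`, well inside the range of polar coordinates, and only an inequality is kept. -/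
theorem lintegral_polar_sector_le {F : ℝ × ℝ → ℝ≥0∞} (hF : Measurable F) :
    ∫⁻ β in Set.Ioo (0 : ℝ) 1, ∫⁻ s in Set.Ioi (0 : ℝ),
      ENNReal.ofReal s * F (s * Real.cos β, s * Real.sin β) ≤ ∫⁻ z, F z := by
  rw [← lintegral_comp_polarCoord_symm]
  have h1 : Set.Ioi (0 : ℝ) ×ˢ Set.Ioo (0 : ℝ) 1 ⊆ polarCoord.target := by
    refine Set.prod_mono le_rfl (Set.Ioo_subset_Ioo ?_ ?_)
    · linarith [Real.pi_pos]
    · linarith [Real.pi_gt_three]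
  refine le_trans (le_of_eq ?_) (lintegral_mono_set h1)
  rw [Measure.volume_eq_prod, ← Measure.prod_restrict, lintegral_prod_symm]
  · simp [polarCoord_symm_apply]
  · simp only [polarCoord_symm_apply, smul_eq_mul]
    have : Measurable fun p : ℝ × ℝ => ENNReal.ofReal p.1 * F (p.1 * Real.cos p.2, p.1 * Real.sin p.2) := by
      fun_prop
    exact this.aemeasurable

theorem lintegral_spherical_sector_le {Φ : E3 → ℝ≥0∞} (hΦ : Measurable Φ) :
    ∫⁻ α in Set.Ioo (0 : ℝ) 1, ∫⁻ β in Set.Ioo (0 : ℝ) 1, ∫⁻ s in Set.Ioi (0 : ℝ),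
      ENNReal.ofReal (s ^ 2 * Real.cos β) *
        Φ (s • !₂[Real.cos β * Real.cos α, Real.cos β * Real.sin α, Real.sin β]) ≤ ∫⁻ x, Φ x := by
  have hG : Measurable fun z : ℝ × ℝ × ℝ => Φ !₂[z.1, z.2.1, z.2.2] := by
    refine hΦ.comp ((PiLp.continuous_toLp 2 _).comp (continuous_pi fun i => ?_)).measurable
    fin_cases i <;> simp <;> fun_prop
  set G : ℝ × ℝ × ℝ → ℝ≥0∞ := fun z => Φ !₂[z.1, z.2.1, z.2.2] with hGdef
  have h1 : ∫⁻ x, Φ x = ∫⁻ c : ℝ, ∫⁻ z : ℝ × ℝ, G (z.1, z.2, c) := by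
    rw [lintegral_E3 hΦ]
    have h := (volume_preserving_prodAssoc (α₁ := ℝ) (β₁ := ℝ) (γ₁ := ℝ)).lintegral_comp hG
    rw [← h, Measure.volume_eq_prod, lintegral_prod_symm]
    · rfl
    · exact (hG.comp (MeasurableEquiv.measurable _)).aemeasurable
  rw [h1]
  have h2 (c : ℝ) := lintegral_polar_sector_le (F := fun z => G (z.1, z.2, c)) (by fun_prop)
  refine le_trans ?_ (lintegral_mono h2)
  rw [lintegral_lintegral_swap (μ := (volume : Measure ℝ)) (f := fun c α =>
    ∫⁻ s in Set.Ioi (0 : ℝ), ENNReal.ofReal s * G (s * Real.cos α, s * Real.sin α, c))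
    (by fun_prop)]
  refine lintegral_mono fun α => ?_
  have h3 : ∫⁻ c : ℝ, ∫⁻ s in Set.Ioi (0 : ℝ), ENNReal.ofReal s *
      G (s * Real.cos α, s * Real.sin α, c) = ∫⁻ z : ℝ × ℝ, (Set.Ioi (0 : ℝ)).indicator
        (fun s => ENNReal.ofReal s * G (s * Real.cos α, s * Real.sin α, z.2)) z.1 := by
    rw [Measure.volume_eq_prod, lintegral_prod_symm]
    · refine lintegral_congr fun c => ?_
      exact (lintegral_indicator measurableSet_Ioi _).symm
    · have : Measurable ((Set.Ioi (0 : ℝ) ×ˢ (Set.univ : Set ℝ)).indicator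
          fun z : ℝ × ℝ => ENNReal.ofReal z.1 * G (z.1 * Real.cos α, z.1 * Real.sin α, z.2)) :=
        Measurable.indicator (by fun_prop) (measurableSet_Ioi.prod .univ)
      refine this.aemeasurable.congr (.of_forall fun z => ?_)
      simp [Set.indicator]
  rw [h3]
  refine le_trans ?_ (lintegral_polar_sector_le ?_)
  · refine setLIntegral_mono' measurableSet_Ioo fun β hβ => ?_
    refine setLIntegral_mono' measurableSet_Ioi fun s hs => ?_
    have hs : 0 < s := hs
    have hc : 0 < Real.cos β := Real.cos_pos_of_mem_Ioo
      ⟨by linarith [Real.pi_pos, hβ.1], by linarith [Real.pi_gt_three, hβ.2]⟩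
    have hsc : s * Real.cos β ∈ Set.Ioi (0 : ℝ) := mul_pos hs hc
    rw [Set.indicator_of_mem hsc, ← mul_assoc, ← ENNReal.ofReal_mul hs.le]
    apply le_of_eq
    congr 2
    · ring
    · apply E3.ext <;> simp [mul_assoc]
  · have : Measurable ((Set.Ioi (0 : ℝ) ×ˢ (Set.univ : Set ℝ)).indicator
        fun z : ℝ × ℝ => ENNReal.ofReal z.1 * G (z.1 * Real.cos α, z.1 * Real.sin α, z.2)) :=
      Measurable.indicator (by fun_prop) (measurableSet_Ioi.prod .univ)
    convert this using 1
    funext z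
    simp [Set.indicator]

theorem measurable_inv_norm_smul : Measurable fun x : E3 => ‖x‖⁻¹ • x := by fun_prop

/-- Extend `Φ` by homogeneity of degree zero to the shell `1 < |x| < 2` and compute the volume
integral twice, in spherical coordinates and by integration over spheres. The radial density is at
most `4` on the shell, and `cos β ≥ 1/2` on the patch; hence the factor `8`. -/
theorem lintegral_sphere_sector_le {Φ : E3 → ℝ≥0∞} (hΦ : Measurable Φ) :
    ∫⁻ α in Set.Ioo (0 : ℝ) 1, ∫⁻ β in Set.Ioo (0 : ℝ) 1,
      Φ !₂[Real.cos β * Real.cos α, Real.cos β * Real.sin α, Real.sin β] ≤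
        8 * ∫⁻ e, Φ (e : E3) ∂sphMeasure := by
  set Ψ : E3 → ℝ≥0∞ := (norm ⁻¹' Set.Ioo (1 : ℝ) 2).indicator fun x => Φ (‖x‖⁻¹ • x) with hΨdef
  have hset : MeasurableSet ((norm : E3 → ℝ) ⁻¹' Set.Ioo (1 : ℝ) 2) :=
    measurable_norm measurableSet_Ioo
  have hΨ : Measurable Ψ := (hΦ.comp measurable_inv_norm_smul).indicator hset
  have hval (s : ℝ) (hs : 0 < s) (e : E3) (he : ‖e‖ = 1) :
      Ψ (s • e) = (Set.Ioo (1 : ℝ) 2).indicator (fun _ => Φ e) s := by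
    simp only [hΨdef, Set.indicator, Set.mem_preimage, norm_smul_unit hs he, smul_smul,
      inv_mul_cancel₀ hs.ne', one_smul]
  have hlow := lintegral_spherical_sector_le hΨ
  have hup : ∫⁻ x, Ψ x ≤ 4 * ∫⁻ e, Φ (e : E3) ∂sphMeasure := by
    rw [lintegral_polar hΨ]
    calc ∫⁻ r in Set.Ioi (0 : ℝ), ∫⁻ e, ENNReal.ofReal (r ^ 2) * Ψ (r • (e : E3)) ∂sphMeasure
        ≤ ∫⁻ r in Set.Ioi (0 : ℝ), (Set.Ioo (1 : ℝ) 2).indicator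
          (fun _ => 4 * ∫⁻ e, Φ (e : E3) ∂sphMeasure) r := by
          refine setLIntegral_mono' measurableSet_Ioi fun r hr => ?_
          have hr : 0 < r := hr
          simp only [hval r hr _ (S2.norm_eq _)]
          by_cases h : r ∈ Set.Ioo (1 : ℝ) 2
          · simp only [Set.indicator_of_mem h]
            rw [lintegral_const_mul _ (by fun_prop)]
            gcongr
            rw [show (4 : ℝ≥0∞) = ENNReal.ofReal 4 by simp]
            apply ENNReal.ofReal_le_ofReal
            nlinarith [h.1, h.2]
          · simp [Set.indicator_of_notMem h]
      _ ≤ ∫⁻ r, (Set.Ioo (1 : ℝ) 2).indicator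
          (fun _ => 4 * ∫⁻ e, Φ (e : E3) ∂sphMeasure) r := setLIntegral_le_lintegral _ _
      _ = _ := by
          rw [lintegral_indicator measurableSet_Ioo, setLIntegral_const, Real.volume_Ioo]
          norm_num
  have hlow2 : ∫⁻ α in Set.Ioo (0 : ℝ) 1, ∫⁻ β in Set.Ioo (0 : ℝ) 1,
      Φ !₂[Real.cos β * Real.cos α, Real.cos β * Real.sin α, Real.sin β] ≤ 2 * ∫⁻ x, Ψ x := by
    refine le_trans ?_ (mul_le_mul_right hlow 2)
    rw [← lintegral_const_mul' _ _ (by simp)]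
    refine lintegral_mono fun α => ?_
    rw [← lintegral_const_mul' _ _ (by simp)]
    refine setLIntegral_mono' measurableSet_Ioo fun β hβ => ?_
    set e : E3 := !₂[Real.cos β * Real.cos α, Real.cos β * Real.sin α, Real.sin β] with he
    have hnorm : ‖e‖ = 1 := by
      rw [← sq_eq_sq₀ (norm_nonneg _) zero_le_one, norm_sq_eq_sum]
      simp [he]
      nlinarith [Real.sin_sq_add_cos_sq α, Real.sin_sq_add_cos_sq β]
    have hcos : 1 / 2 ≤ Real.cos β := by
      have := Real.one_sub_sq_div_two_le_cos (x := β)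
      nlinarith [hβ.1, hβ.2]
    calc Φ e = 2 * ∫⁻ s in Set.Ioo (1 : ℝ) 2, ENNReal.ofReal (1 / 2) * Φ e := by
          rw [setLIntegral_const, Real.volume_Ioo, ← mul_assoc, ← mul_assoc]
          rw [show (2 : ℝ≥0∞) = ENNReal.ofReal 2 by simp, ← ENNReal.ofReal_mul (by norm_num)]
          norm_num
      _ ≤ 2 * ∫⁻ s in Set.Ioo (1 : ℝ) 2, ENNReal.ofReal (s ^ 2 * Real.cos β) * Ψ (s • e) := by
          refine mul_le_mul_right (setLIntegral_mono' measurableSet_Ioo fun s hs => ?_) 2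
          rw [hval s (by linarith [hs.1]) e hnorm, Set.indicator_of_mem hs]
          gcongr
          nlinarith [hs.1]
      _ ≤ _ := by
          gcongr
          exact fun s hs => Set.mem_Ioi.mpr (by linarith [hs.1])
  calc _ ≤ 2 * ∫⁻ x, Ψ x := hlow2
    _ ≤ 2 * (4 * ∫⁻ e, Φ (e : E3) ∂sphMeasure) := by gcongr
    _ = _ := by rw [← mul_assoc]; norm_num

/-- The surface integral controls the integral over a patch around any point `e`. -/
theorem lintegral_rot_rot_le {Φ : E3 → ℝ≥0∞} (hΦ : Measurable Φ) {a e : E3} (ha : ‖a‖ = 1)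
    (he : ‖e‖ = 1) (hae : inner ℝ a e = (0 : ℝ)) :
    ∫⁻ α in Set.Ioo (0 : ℝ) 1, ∫⁻ β in Set.Ioo (0 : ℝ) 1,
      Φ (rot a α (rot (cross e a) β e)) ≤ 8 * ∫⁻ e, Φ (e : E3) ∂sphMeasure := by
  have hea : inner ℝ e a = (0 : ℝ) := by rw [real_inner_comm]; exact hae
  have hc : ‖cross a e‖ = 1 := by
    rw [← sq_eq_sq₀ (norm_nonneg _) zero_le_one, norm_cross_sq, ha, he, hae]; norm_num
  have hon : Orthonormal ℝ ![e, cross a e, a] := by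
    refine ⟨fun i => by fin_cases i <;> simp [ha, he, hc], fun i j hij => ?_⟩
    fin_cases i <;> fin_cases j <;>
      simp_all [inner_cross_self_left, inner_cross_self_right, real_inner_comm]
  have hspan : ⊤ ≤ Submodule.span ℝ (Set.range ![e, cross a e, a]) :=
    (hon.linearIndependent.span_eq_top_of_card_eq_finrank (by simp)).ge
  set bas := OrthonormalBasis.mk hon hspan
  set R : E3 ≃ₗᵢ[ℝ] E3 := bas.repr.symm
  have hR (u v w : ℝ) : R !₂[u, v, w] = u • e + v • cross a e + w • a := by
    rw [← OrthonormalBasis.sum_repr_symm]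
    simp [Fin.sum_univ_three, bas]
  -- In the orthonormal frame `(e, a × e, a)` the doubly rotated point has longitude `α` and
  -- latitude `β`.
  have hpt (α β : ℝ) : rot a α (rot (cross e a) β e) =
      R !₂[Real.cos β * Real.cos α, Real.cos β * Real.sin α, Real.sin β] := by
    have h1 : rot (cross e a) β e = Real.cos β • e + Real.sin β • a := by
      have : inner ℝ (cross e a) e = (0 : ℝ) := by
        rw [real_inner_comm]; exact inner_cross_self_left _ _
      rw [rot, cross_cross_left, this, hae, real_inner_self_eq_norm_sq, he]
      module
    rw [h1, rot_add, rot_smul, rot_smul, rot_axis ha, hR, rot, hae]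
    module
  simp only [hpt]
  have h1 := lintegral_sphere_sector_le (Φ := fun x => Φ (R x)) (by fun_prop)
  have h2 := (measurePreserving_sphere R).lintegral_comp (f := fun e : S2 => Φ e) (by fun_prop)
  rw [← h2]
  exact h1

/-! ### Measurability -/

theorem measurable_indicator_of_continuousOn {X Y : Type*} [TopologicalSpace X] [MeasurableSpace X]
    [OpensMeasurableSpace X] [TopologicalSpace Y] [MeasurableSpace Y] [BorelSpace Y] [Zero Y]
    {s : Set X} (hs : MeasurableSet s) {g : X → Y} (hg : ContinuousOn g s) :
    Measurable (s.indicator g) := by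
  classical
  rw [← Set.piecewise_eq_indicator]
  exact hg.measurable_piecewise continuousOn_const hs

namespace Foliation

variable {M : ℝ} (𝓕 : Foliation M)

theorem continuousOn_height (hM : 0 < M) : ContinuousOn 𝓕.height (Set.Ioi (2 * M)) := by
  have h1 : ContinuousOn 𝓕.height (Set.Ioc (2 * M) 𝓕.R₀) := by
    refine ContinuousOn.congr (f := 𝓕.innerHeight) (fun r hr => ?_) fun r hr => 𝓕.height_of_le hr.2
    exact (𝓕.hasDerivAt_innerHeight hM hr.1).continuousAt.continuousWithinAt
  have h2 : ContinuousOn 𝓕.height (Set.Ici 𝓕.R₀) := by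
    refine ContinuousOn.congr (f := 𝓕.outerHeight) (fun r hr => ?_) fun r hr => 𝓕.height_of_ge hr
    have hr : 2 * M < r := (𝓕.two_mul_lt_R₀ hM).trans_le hr
    exact (𝓕.hasDerivAt_outerHeight hM hr).continuousAt.continuousWithinAt
  intro r hr
  rcases lt_trichotomy r 𝓕.R₀ with h | h | h
  · exact ((h1 r ⟨hr, h.le⟩).continuousAt (Ioc_mem_nhds hr h)).continuousWithinAt
  · have h3 := (h1 r ⟨hr, h.le⟩).union (h2 r h.ge)
    rw [Set.Ioc_union_Ici_eq_Ioi (𝓕.two_mul_lt_R₀ hM)] at h3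
    exact h3
  · exact ((h2 r h.le).continuousAt (Ici_mem_nhds h)).continuousWithinAt

theorem measurableSet_phaseRegion (hM : 0 < M) : MeasurableSet 𝓕.phaseRegion := by
  have h1 : Measurable ((Set.Ioi (2 * M)).indicator 𝓕.height) :=
    measurable_indicator_of_continuousOn measurableSet_Ioi (𝓕.continuousOn_height hM)
  have h2 : 𝓕.phaseRegion = {y : Phase | 2 * M < ‖y.2.1‖} ∩
      {y : Phase | (Set.Ioi (2 * M)).indicator 𝓕.height ‖y.2.1‖ ≤ y.1} ∩
      {y : Phase | y.2.2 = 0}ᶜ := by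
    ext ⟨t, x, p⟩
    rw [𝓕.mem_phaseRegion_iff hM]
    simp only [Set.mem_inter_iff, Set.mem_ofPred_eq, Set.mem_compl_iff, and_assoc]
    refine and_congr_right fun hx => ?_
    rw [Set.indicator_of_mem (show ‖x‖ ∈ Set.Ioi (2 * M) from hx)]
  rw [h2]
  refine ((measurableSet_lt (by fun_prop) (by fun_prop)).inter
    (measurableSet_le (by fun_prop) (by fun_prop))).inter ?_
  exact (measurableSet_eq_fun (by fun_prop) (by fun_prop)).compl

theorem mem_phaseRegion_mom (hM : 0 < M) {r : ℝ} (hr : 2 * M < r) {t : ℝ} (ht : 𝓕.height r ≤ t)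
    {e : E3} (he : ‖e‖ = 1) {y : E3} (hy : y ≠ 0) : (t, r • e, mom M r e y) ∈ 𝓕.phaseRegion := by
  have hr0 : 0 < r := by linarith
  rw [𝓕.mem_phaseRegion_iff hM, norm_smul_unit hr0 he]
  exact ⟨hr, ht, mom_ne_zero y hr0.ne' hM hr he hy⟩

end Foliation

theorem rot_mom (M r : ℝ) {a : E3} (ha : ‖a‖ = 1) (s : ℝ) (e y : E3) :
    rot a s (mom M r e y) = mom M r (rot a s e) (rot a s y) := by
  have := inner_rot_rot ha s e y
  simp only [← rotL_apply a ha] at this ⊢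
  simp only [mom, map_add, map_smul, map_sub, this]

@[fun_prop]
theorem measurable_rot {X : Type*} [MeasurableSpace X] (a : E3) {s : X → ℝ} {f : X → E3}
    (hs : Measurable s) (hf : Measurable f) : Measurable fun x => rot a (s x) (f x) := by
  unfold rot
  fun_prop

theorem measurable_lapse (M : ℝ) : Measurable (lapse M) := by unfold lapse; fun_prop

@[fun_prop]
theorem measurable_mom {X : Type*} [MeasurableSpace X] (M : ℝ) {r : X → ℝ} {e y : X → E3}
    (hr : Measurable r) (he : Measurable e) (hy : Measurable y) :
    Measurable fun x => mom M (r x) (e x) (y x) := by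
  have := measurable_lapse M
  unfold mom
  fun_prop

@[fun_prop]
theorem measurable_energy {X : Type*} [MeasurableSpace X] (M : ℝ) {r v L : X → ℝ}
    (hr : Measurable r) (hv : Measurable v) (hL : Measurable L) :
    Measurable fun x => energy M (r x) (v x) (L x) := by
  have := measurable_lapse M
  unfold energy
  fun_prop

/-! ### A Sobolev inequality on the spheres -/

/-- Write `w 0` as `w s` minus the integral of `w'` over `[0, s]` and average over `s` in `]0,1[`.
If `w'` is not integrable, the right-hand side is infinite. -/
theorem ofReal_abs_le_lintegral {w w' : ℝ → ℝ} (h : ∀ s, HasDerivAt w (w' s) s) :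
    ENNReal.ofReal |w 0| ≤
      ∫⁻ s in Set.Ioo (0 : ℝ) 1, (ENNReal.ofReal |w s| + ENNReal.ofReal |w' s|) := by
  have hw' : Measurable w' := by
    have : w' = deriv w := funext fun s => (h s).deriv.symm
    rw [this]; exact measurable_deriv w
  have hwm : Measurable w :=
    (continuous_iff_continuousAt.mpr fun s => (h s).continuousAt).measurable
  set I := ∫⁻ s in Set.Ioo (0 : ℝ) 1, ENNReal.ofReal |w' s| with hI
  rw [lintegral_add_left (by fun_prop)]
  by_cases hfin : I = ⊤
  · rw [← hI, hfin]; simp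
  have hint : IntegrableOn w' (Set.Ioo 0 1) := by
    refine ⟨hw'.aestronglyMeasurable, ?_⟩
    rw [hasFiniteIntegral_iff_norm]
    simpa only [Real.norm_eq_abs] using lt_top_iff_ne_top.mpr hfin
  have key : ∀ s ∈ Set.Ioo (0 : ℝ) 1, ENNReal.ofReal |w 0| ≤ ENNReal.ofReal |w s| + I := by
    intro s hs
    have hint' : IntegrableOn w' (Set.Ioc 0 s) :=
      (hint.mono_set fun u hu => ⟨hu.1, hu.2.trans_lt hs.2⟩)
    have hF := intervalIntegral.integral_eq_sub_of_hasDerivAt (fun u _ => h u)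
      ((intervalIntegrable_iff_integrableOn_Ioc_of_le hs.1.le).mpr hint')
    have h1 : |w 0| ≤ |w s| + ∫ u in Set.Ioo (0 : ℝ) 1, |w' u| := by
      have h2 : |∫ u in (0 : ℝ)..s, w' u| ≤ ∫ u in Set.Ioo (0 : ℝ) 1, |w' u| := by
        rw [intervalIntegral.integral_of_le hs.1.le]
        refine (abs_integral_le_integral_abs).trans ?_
        exact setIntegral_mono_set hint.abs (.of_forall fun _ => abs_nonneg _)
          (LE.le.eventuallyLE fun u hu => ⟨hu.1, hu.2.trans_lt hs.2⟩)
      have h3 : w 0 = w s - ∫ u in (0 : ℝ)..s, w' u := by rw [hF]; ring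
      rw [h3]
      exact (abs_sub _ _).trans (by linarith)
    refine (ENNReal.ofReal_le_ofReal h1).trans ?_
    rw [ENNReal.ofReal_add (abs_nonneg _) (integral_nonneg fun _ => abs_nonneg _),
      ofReal_integral_eq_lintegral_ofReal hint.abs (.of_forall fun _ => abs_nonneg _)]
  calc ENNReal.ofReal |w 0| = ∫⁻ _ in Set.Ioo (0 : ℝ) 1, ENNReal.ofReal |w 0| := by simp
    _ ≤ ∫⁻ s in Set.Ioo (0 : ℝ) 1, (ENNReal.ofReal |w s| + I) :=
        setLIntegral_mono' measurableSet_Ioo key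
    _ = _ := by rw [lintegral_add_right _ measurable_const]; simp [hI]

/-- This is the second derivative of `|x|^z`; no singularity appears at `x = 0` because the exponent
is large. -/
theorem hasDerivAt_abs_rpow_mul {z : ℝ} (hz : 3 < z) (x : ℝ) :
    HasDerivAt (fun x => z * |x| ^ (z - 2) * x) (z * (z - 1) * |x| ^ (z - 2)) x := by
  have h1 := ((hasDerivAt_abs_rpow x (p := z - 2) (by linarith)).const_mul z).mul (hasDerivAt_id x)
  refine h1.congr_deriv ?_
  have : |x| ^ (z - 2 - 2) * x * x = |x| ^ (z - 2) := by
    rcases eq_or_ne x 0 with rfl | hx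
    · simp [Real.zero_rpow (show z - 2 ≠ 0 by linarith)]
    · rw [mul_assoc, ← abs_mul_abs_self x, ← sq, ← Real.rpow_natCast,
        ← Real.rpow_add (abs_pos.mpr hx)]
      congr 1
      push_cast; ring
  simp only [id, mul_one]
  linear_combination z * (z - 2) * this

/-- The exponents add up to `z`, so each factor may be replaced by the largest of the three. This
plays the role of Young's inequality for the products created by differentiating `|f|^z`. -/
theorem rpow_mul_mul_le {z : ℝ} (hz : 3 < z) {a b c S : ℝ} (ha : 0 ≤ a) (hb : 0 ≤ b) (hc : 0 ≤ c)
    (haS : a ^ z ≤ S) (hbS : b ^ z ≤ S) (hcS : c ^ z ≤ S) : a ^ (z - 2) * b * c ≤ S := by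
  set m := max a (max b c) with hm
  have ham : a ≤ m := le_max_left _ _
  have hbm : b ≤ m := (le_max_left _ _).trans (le_max_right _ _)
  have hcm : c ≤ m := (le_max_right _ _).trans (le_max_right _ _)
  have hm0 : 0 ≤ m := ha.trans ham
  have h1 : a ^ (z - 2) * b * c ≤ m ^ (z - 2) * m * m := by gcongr; linarith
  have h2 : m ^ (z - 2) * m * m = m ^ z := by
    rcases hm0.eq_or_lt with h | h
    · rw [← h, mul_zero, Real.zero_rpow (by linarith)]
    · rw [mul_assoc, ← sq, ← Real.rpow_natCast, ← Real.rpow_add h]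
      congr 1; push_cast; ring
  have h3 : m ^ z ≤ S := by
    rcases max_choice a (max b c) with h | h
    · rw [hm, h]; exact haS
    · rcases max_choice b c with h' | h' <;> rw [hm, h, h'] <;> assumption
  linarith

/-- The sum of the `|Ω̂^I f|^z` over the words `I` of length at most two. -/
def rotSum (D : Set Phase) (z : ℝ) (f : Phase → ℝ) (y : Phase) : ℝ :=
  ∑ k ∈ Finset.range 3, ∑ I : Fin k → Fin 3, |omegaHatWord D I f y| ^ z

theorem omegaHatWord_zero (D : Set Phase) (I : Fin 0 → Fin 3) (f : Phase → ℝ) :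
    omegaHatWord D I f = f := by simp [omegaHatWord]

theorem omegaHatWord_succ (D : Set Phase) {k : ℕ} (I : Fin (k + 1) → Fin 3) (f : Phase → ℝ) :
    omegaHatWord D I f = omegaHat D (I 0) (omegaHatWord D (fun j => I j.succ) f) := by
  simp [omegaHatWord, List.ofFn_succ]

theorem le_rotSum (D : Set Phase) (z : ℝ) (f : Phase → ℝ) (y : Phase) {k : ℕ} (hk : k < 3)
    (I : Fin k → Fin 3) : |omegaHatWord D I f y| ^ z ≤ rotSum D z f y := by
  have h1 : |omegaHatWord D I f y| ^ z ≤ ∑ I : Fin k → Fin 3, |omegaHatWord D I f y| ^ z :=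
    Finset.single_le_sum (f := fun I : Fin k → Fin 3 => |omegaHatWord D I f y| ^ z)
      (fun _ _ => by positivity) (Finset.mem_univ I)
  refine h1.trans ?_
  exact Finset.single_le_sum (f := fun k => ∑ I : Fin k → Fin 3, |omegaHatWord D I f y| ^ z)
    (fun _ _ => Finset.sum_nonneg fun _ _ => by positivity) (Finset.mem_range.mpr hk)

theorem abs_apply_le_one {a : E3} (ha : ‖a‖ = 1) (i : Fin 3) : |a i| ≤ 1 := by
  have := PiLp.norm_apply_le a i
  rwa [ha, Real.norm_eq_abs] at this

/-- The constant in the Sobolev inequality. -/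
def sobolevConst (z : ℝ) : ℝ := 1 + 30 * z + 27 * z ^ 2

namespace Foliation

variable {M : ℝ} (𝓕 : Foliation M)

/-- The one-dimensional estimate is used twice: along the rotation about `b` for `|f|^z`, then along
the rotation about `a` for `|f|^z` and for its derivative `V`. Only the mixed second derivative
appears, which is enough in two dimensions. -/
theorem sobolev_pointwise (hM : 0 < M) {z : ℝ} (hz : 3 < z) {f : Phase → ℝ}
    (hf : ContDiffOn ℝ 2 f 𝓕.phaseRegion) {a b : E3} (ha : ‖a‖ = 1) (hb : ‖b‖ = 1) {y : Phase}
    (hy : y ∈ 𝓕.phaseRegion) :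
    ENNReal.ofReal (|f y| ^ z) ≤ ∫⁻ β in Set.Ioo (0 : ℝ) 1, ∫⁻ α in Set.Ioo (0 : ℝ) 1,
      ENNReal.ofReal (sobolevConst z * rotSum 𝓕.phaseRegion z f (rotPhase a α (rotPhase b β y))) := by
  set D := 𝓕.phaseRegion with hD
  set g : Fin 3 → Phase → ℝ := fun i => omegaHat D i f with hg
  have hf1 : DifferentiableOn ℝ f D := hf.differentiableOn (by simp)
  have hg1 (i : Fin 3) : DifferentiableOn ℝ (g i) D :=
    (𝓕.contDiffOn_omegaHat hM (n := 1) (by norm_num; exact hf) i).differentiableOn (by simp)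
  set U : Phase → ℝ := fun y => |f y| ^ z
  set V : Phase → ℝ := fun y => z * |f y| ^ (z - 2) * f y * ∑ i, b i * g i y with hV
  have hUd (c : E3) (hc : ‖c‖ = 1) (y : Phase) (hy : y ∈ D) (s : ℝ) :
      HasDerivAt (fun s => U (rotPhase c s y)) (z * |f (rotPhase c s y)| ^ (z - 2) *
        f (rotPhase c s y) * ∑ i, c i * g i (rotPhase c s y)) s :=
    (hasDerivAt_abs_rpow _ (by linarith)).comp s (𝓕.hasDerivAt_comp_rotPhase hM hf1 hc s hy)
  have hVd (y : Phase) (hy : y ∈ D) (s : ℝ) := ((hasDerivAt_abs_rpow_mul hz _).comp s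
      (𝓕.hasDerivAt_comp_rotPhase hM hf1 ha s hy)).mul (HasDerivAt.fun_sum (u := Finset.univ)
      fun i _ => (𝓕.hasDerivAt_comp_rotPhase hM (hg1 i) ha s hy).const_mul (b i))
  have h1 := ofReal_abs_le_lintegral (hUd b hb y hy)
  have h0 : rotPhase b 0 y = y := by simp [rotPhase, rot_zero]
  rw [h0, abs_of_nonneg (show 0 ≤ U y by positivity)] at h1
  refine h1.trans ?_
  refine setLIntegral_mono' measurableSet_Ioo fun β _ => ?_
  set w := rotPhase b β y
  have hw : w ∈ D := 𝓕.rotPhase_mem hM hb β hy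
  have h2 := ofReal_abs_le_lintegral (hUd a ha w hw)
  have h3 := ofReal_abs_le_lintegral (hVd w hw)
  have h0 : rotPhase a 0 w = w := by simp [rotPhase, rot_zero]
  simp only [Pi.mul_apply, Function.comp_apply, h0] at h2 h3
  refine (add_le_add h2 h3).trans ?_
  rw [← lintegral_add_left']
  swap
  · have hm1 : Measurable fun s => U (rotPhase a s w) :=
      (continuous_iff_continuousAt.mpr fun s => (hUd a ha w hw s).continuousAt).measurable
    have hm2 : Measurable (deriv fun s => U (rotPhase a s w)) := measurable_deriv _
    simp only [funext fun s => (hUd a ha w hw s).deriv] at hm2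
    exact (hm1.abs.ennreal_ofReal.add hm2.abs.ennreal_ofReal).aemeasurable
  refine setLIntegral_mono' measurableSet_Ioo fun α _ => ?_
  set u := rotPhase a α w
  set S := rotSum D z f u with hS
  have hS0 : 0 ≤ S := Finset.sum_nonneg fun _ _ => Finset.sum_nonneg fun _ _ => by positivity
  have e0 : |f u| ^ z ≤ S := by
    simpa [omegaHatWord_zero] using le_rotSum D z f u (k := 0) (by norm_num) Fin.elim0
  have e1 (i : Fin 3) : |g i u| ^ z ≤ S := by
    simpa [omegaHatWord_succ, omegaHatWord_zero] using
      le_rotSum D z f u (k := 1) (by norm_num) (fun _ => i)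
  have e2 (i j : Fin 3) : |omegaHat D j (g i) u| ^ z ≤ S := by
    simpa [omegaHatWord_succ, omegaHatWord_zero] using
      le_rotSum D z f u (k := 2) (by norm_num) ![j, i]
  have hlin (c : E3) (hc : ‖c‖ = 1) (h : Fin 3 → ℝ) : |∑ i, c i * h i| ≤ ∑ i, |h i| := by
    refine (Finset.abs_sum_le_sum_abs _ _).trans (Finset.sum_le_sum fun i _ => ?_)
    rw [abs_mul]
    exact mul_le_of_le_one_left (abs_nonneg _) (abs_apply_le_one hc i)
  have hz0 : 0 < z := by linarith
  have m1 (x : ℝ) (hx : |x| ^ z ≤ S) : |z * |f u| ^ (z - 2) * f u| * |x| ≤ z * S := by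
    rw [abs_mul, abs_mul, abs_of_pos hz0, abs_of_nonneg (show 0 ≤ |f u| ^ (z - 2) by positivity),
      mul_assoc, mul_assoc, ← mul_assoc (|f u| ^ (z - 2))]
    gcongr
    exact rpow_mul_mul_le hz (abs_nonneg _) (abs_nonneg _) (abs_nonneg _) e0 e0 hx
  have m2 (x x' : ℝ) (hx : |x| ^ z ≤ S) (hx' : |x'| ^ z ≤ S) :
      |z * (z - 1) * |f u| ^ (z - 2)| * |x| * |x'| ≤ z ^ 2 * S := by
    rw [abs_mul, abs_of_nonneg (show 0 ≤ |f u| ^ (z - 2) by positivity),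
      abs_of_nonneg (by nlinarith : 0 ≤ z * (z - 1)), mul_assoc, mul_assoc,
      ← mul_assoc (|f u| ^ (z - 2))]
    have := rpow_mul_mul_le hz (abs_nonneg _) (abs_nonneg _) (abs_nonneg _) e0 hx hx'
    calc z * (z - 1) * (|f u| ^ (z - 2) * |x| * |x'|) ≤ z * (z - 1) * S := by
          gcongr; nlinarith
      _ ≤ z ^ 2 * S := by gcongr; nlinarith
  have b1 (c : E3) (hc : ‖c‖ = 1) :
      |z * |f u| ^ (z - 2) * f u * ∑ i, c i * g i u| ≤ 3 * (z * S) := by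
    rw [abs_mul]
    refine (mul_le_mul_of_nonneg_left (hlin c hc _) (abs_nonneg _)).trans ?_
    rw [Finset.mul_sum]
    refine (Finset.sum_le_sum fun i _ => m1 _ (e1 i)).trans (by simp)
  have b2 : |z * (z - 1) * |f u| ^ (z - 2) * (∑ i, a i * g i u) * ∑ i, b i * g i u| ≤
      9 * (z ^ 2 * S) := by
    rw [abs_mul, abs_mul]
    calc _ ≤ |z * (z - 1) * |f u| ^ (z - 2)| * (∑ i, |g i u|) * ∑ i, |g i u| := by
          gcongr
          · exact hlin a ha _
          · exact hlin b hb _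
      _ = ∑ i, ∑ j, |z * (z - 1) * |f u| ^ (z - 2)| * |g i u| * |g j u| := by
          rw [mul_assoc, Finset.sum_mul_sum]
          simp only [Finset.mul_sum, mul_assoc]
      _ ≤ ∑ i : Fin 3, ∑ j : Fin 3, z ^ 2 * S :=
          Finset.sum_le_sum fun i _ => Finset.sum_le_sum fun j _ => m2 _ _ (e1 i) (e1 j)
      _ = _ := by simp; ring
  have b3 : |z * |f u| ^ (z - 2) * f u * ∑ i, b i * ∑ j, a j * omegaHat D j (g i) u| ≤
      9 * (z * S) := by
    rw [abs_mul]
    calc _ ≤ |z * |f u| ^ (z - 2) * f u| * ∑ i, ∑ j, |omegaHat D j (g i) u| := by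
          gcongr
          refine (hlin b hb _).trans (Finset.sum_le_sum fun i _ => hlin a ha _)
      _ = ∑ i, ∑ j, |z * |f u| ^ (z - 2) * f u| * |omegaHat D j (g i) u| := by
          simp only [Finset.mul_sum]
      _ ≤ ∑ i : Fin 3, ∑ j : Fin 3, z * S :=
          Finset.sum_le_sum fun i _ => Finset.sum_le_sum fun j _ => m1 _ (e2 i j)
      _ = _ := by simp; ring
  have b4 : |U u| ≤ S := by rw [abs_of_nonneg (show 0 ≤ U u by positivity)]; exact e0
  rw [← ENNReal.ofReal_add (by positivity) (by positivity),
    ← ENNReal.ofReal_add (by positivity) (by positivity),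
    ← ENNReal.ofReal_add (by positivity) (by positivity)]
  apply ENNReal.ofReal_le_ofReal
  have b5 := abs_add_le (z * (z - 1) * |f u| ^ (z - 2) * (∑ i, a i * g i u) * ∑ i, b i * g i u)
    (z * |f u| ^ (z - 2) * f u * ∑ i, b i * ∑ j, a j * omegaHat D j (g i) u)
  have b6 := b1 a ha
  have b7 := b1 b hb
  have hzS : 0 ≤ z * S := by positivity
  have hzS2 : 0 ≤ z ^ 2 * S := by positivity
  -- The bounds add up to `(1 + 15 z + 9 z²) S`; the constant is not sharp.
  unfold sobolevConst
  nlinarith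

end Foliation

/-! ### Words in the rotations, and the Sobolev inequality integrated over momenta -/

namespace Foliation

variable {M : ℝ} (𝓕 : Foliation M)

theorem contDiffOn_omegaHatWord (hM : 0 < M) {f : Phase → ℝ} {n k : ℕ}
    (hf : ContDiffOn ℝ ((n + k : ℕ)) f 𝓕.phaseRegion) (I : Fin k → Fin 3) :
    ContDiffOn ℝ n (omegaHatWord 𝓕.phaseRegion I f) 𝓕.phaseRegion := by
  induction k generalizing n with
  | zero => rw [omegaHatWord_zero]; exact hf
  | succ k ih =>
    rw [omegaHatWord_succ]
    refine 𝓕.contDiffOn_omegaHat hM ?_ _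
    have := ih (n := n + 1) (by convert hf using 2; ring) fun j => I j.succ
    exact_mod_cast this

theorem liouville_omegaHatWord (hM : 0 < M) {f : Phase → ℝ} {k : ℕ}
    (hf : ContDiffOn ℝ ((1 + k : ℕ)) f 𝓕.phaseRegion)
    (hT : ∀ y ∈ 𝓕.phaseRegion, liouville M 𝓕.phaseRegion f y = 0) (I : Fin k → Fin 3) :
    ∀ y ∈ 𝓕.phaseRegion, liouville M 𝓕.phaseRegion (omegaHatWord 𝓕.phaseRegion I f) y = 0 := by
  induction k with
  | zero => rw [omegaHatWord_zero]; exact hT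
  | succ k ih =>
    rw [omegaHatWord_succ]
    refine 𝓕.liouville_omegaHat hM ?_ (ih (hf.of_le (by norm_cast; omega)) _) _
    have := 𝓕.contDiffOn_omegaHatWord hM (n := 2) (k := k)
      (hf.of_le (by norm_cast; omega)) fun j => I j.succ
    exact_mod_cast this

theorem measurable_indicator_rotSum (hM : 0 < M) {z : ℝ} (hz : 0 < z) {f : Phase → ℝ}
    (hf : ContDiffOn ℝ 2 f 𝓕.phaseRegion) :
    Measurable (𝓕.phaseRegion.indicator
      fun y => ENNReal.ofReal (rotSum 𝓕.phaseRegion z f y)) := by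
  refine measurable_indicator_of_continuousOn (𝓕.measurableSet_phaseRegion hM) ?_
  refine ENNReal.continuous_ofReal.comp_continuousOn ?_
  refine continuousOn_finsetSum _ fun k hk => continuousOn_finsetSum _ fun I _ => ?_
  have hk : k ≤ 2 := by have := Finset.mem_range.mp hk; omega
  have h := (𝓕.contDiffOn_omegaHatWord hM (n := 0) (k := k)
    (hf.of_le (by norm_cast; omega)) I).continuousOn
  exact h.abs.rpow_const fun _ _ => Or.inr hz.le

/-- The weight `k` depends on `(e, y)` only through rotation invariants. Integrating the pointwise
inequality in `y` and rotating the integration variable therefore turns the right-hand side into the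
integral of one function of `e` over a patch, which the surface integral controls. -/
theorem sobolev_sphere (hM : 0 < M) {z : ℝ} (hz : 3 < z) {f : Phase → ℝ}
    (hf : ContDiffOn ℝ 2 f 𝓕.phaseRegion) {r : ℝ} (hr : 2 * M < r) {t : ℝ} (ht : 𝓕.height r ≤ t)
    {e : E3} (he : ‖e‖ = 1) {k : ℝ × ℝ → ℝ≥0∞} (hk : Measurable k) :
    ∫⁻ y, k (inner ℝ e y, ‖cross e y‖) * ENNReal.ofReal (|f (t, r • e, mom M r e y)| ^ z) ≤
      ENNReal.ofReal (8 * sobolevConst z) * ∫⁻ e : S2, (∫⁻ y, k (inner ℝ (e : E3) y, ‖cross e y‖) *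
        𝓕.phaseRegion.indicator (fun y => ENNReal.ofReal (rotSum 𝓕.phaseRegion z f y))
          (t, r • (e : E3), mom M r e y)) ∂sphMeasure := by
  set D := 𝓕.phaseRegion with hD
  set S : Phase → ℝ≥0∞ := D.indicator (fun y => ENNReal.ofReal (rotSum D z f y)) with hS
  have hSm : Measurable S := 𝓕.measurable_indicator_rotSum hM (by linarith) hf
  obtain ⟨a, ha, hae'⟩ : ∃ a : E3, ‖a‖ = 1 ∧ inner ℝ a e = (0 : ℝ) := by
    have he0 : e ≠ 0 := by rintro rfl; simp at he
    have : Fact (Module.finrank ℝ E3 = 2 + 1) := ⟨finrank_E3⟩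
    have h1 : Module.finrank ℝ (Submodule.span ℝ {e})ᗮ = 2 :=
      Submodule.finrank_orthogonal_span_singleton he0
    have h2 : Nontrivial (Submodule.span ℝ {e})ᗮ := Module.nontrivial_of_finrank_pos (R := ℝ) (by omega)
    obtain ⟨⟨w, hw⟩, hw0⟩ := exists_ne (0 : (Submodule.span ℝ {e})ᗮ)
    have hw0 : w ≠ 0 := fun h => hw0 (Subtype.ext h)
    have hw1 : ‖w‖ ≠ 0 := norm_ne_zero_iff.mpr hw0
    refine ⟨‖w‖⁻¹ • w, by rw [norm_smul, norm_inv, norm_norm, inv_mul_cancel₀ hw1], ?_⟩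
    rw [real_inner_smul_left, real_inner_comm, (Submodule.mem_orthogonal_singleton_iff_inner_right.mp hw),
      mul_zero]
  set b := cross e a with hb'
  have hb : ‖b‖ = 1 := by
    rw [← sq_eq_sq₀ (norm_nonneg _) zero_le_one, norm_cross_sq, ha, he, real_inner_comm, hae']
    norm_num
  set Ψ : E3 → ℝ≥0∞ := fun e => ∫⁻ y, k (inner ℝ e y, ‖cross e y‖) * S (t, r • e, mom M r e y) with hΨ
  have hΨm : Measurable Ψ := by
    refine Measurable.lintegral_prod_right' (f := fun z : E3 × E3 =>
      k (inner ℝ z.1 z.2, ‖cross z.1 z.2‖) * S (t, r • z.1, mom M r z.1 z.2)) ?_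
    fun_prop
  set c := ENNReal.ofReal (sobolevConst z) with hc
  have hc0 : 0 ≤ sobolevConst z := by unfold sobolevConst; nlinarith
  have hrot (α β : ℝ) (y : E3) : inner ℝ (rot a α (rot b β e)) (rot a α (rot b β y)) = (inner ℝ e y : ℝ) := by
    rw [inner_rot_rot ha, inner_rot_rot hb]
  have hrot2 (α β : ℝ) (y : E3) : ‖cross (rot a α (rot b β e)) (rot a α (rot b β y))‖ = ‖cross e y‖ := by
    rw [← rot_cross ha, ← rot_cross hb, norm_rot ha, norm_rot hb]
  -- The zero covector lies outside the region, so the pointwise inequality is available only for `y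
  -- ≠ 0`, that is, almost everywhere.
  have hpt : ∀ y : E3, y ≠ 0 → k (inner ℝ e y, ‖cross e y‖) *
      ENNReal.ofReal (|f (t, r • e, mom M r e y)| ^ z) ≤
      ∫⁻ β in Set.Ioo (0 : ℝ) 1, ∫⁻ α in Set.Ioo (0 : ℝ) 1, k (inner ℝ e y, ‖cross e y‖) *
        (c * S (rotPhase a α (rotPhase b β (t, r • e, mom M r e y)))) := by
    intro y hy
    have hmem := 𝓕.mem_phaseRegion_mom hM hr ht he hy
    have h1 := 𝓕.sobolev_pointwise hM hz hf ha hb hmem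
    have h2 : ∀ β α, ENNReal.ofReal (sobolevConst z *
        rotSum D z f (rotPhase a α (rotPhase b β (t, r • e, mom M r e y)))) =
        c * S (rotPhase a α (rotPhase b β (t, r • e, mom M r e y))) := by
      intro β α
      rw [hS, Set.indicator_of_mem (𝓕.rotPhase_mem hM ha _ (𝓕.rotPhase_mem hM hb _ hmem)),
        ENNReal.ofReal_mul hc0]
    simp only [← hD, h2] at h1
    refine (mul_le_mul_right h1 _).trans (le_of_eq ?_)
    have hm : Measurable fun z : ℝ × ℝ => c * S (rotPhase a z.2 (rotPhase b z.1 (t, r • e, mom M r e y))) := by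
      unfold rotPhase
      fun_prop
    rw [← lintegral_const_mul _ (hm.lintegral_prod_right')]
    refine lintegral_congr fun β => ?_
    exact (lintegral_const_mul _ (hm.comp measurable_prodMk_left)).symm
  have hae : ∀ᵐ y : E3, y ≠ 0 := by
    simp [ae_iff, Set.ofPred_eq_eq_singleton]
  have hjoint : Measurable fun z : (E3 × ℝ) × ℝ => k (inner ℝ e z.1.1, ‖cross e z.1.1‖) *
        (c * S (rotPhase a z.2 (rotPhase b z.1.2 (t, r • e, mom M r e z.1.1)))) := by
    unfold rotPhase
    fun_prop
  -- Rotating phase space moves `e` and `y` together; the isometry in `y` is absorbed by Lebesgue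
  -- measure and only the rotated `e` remains.
  have hsub (α β : ℝ) : ∫⁻ y, k (inner ℝ e y, ‖cross e y‖) *
      (c * S (rotPhase a α (rotPhase b β (t, r • e, mom M r e y)))) =
      c * Ψ (rot a α (rot b β e)) := by
    have h1 := (((rotL b hb β).trans (rotL a ha α)).measurePreserving).lintegral_comp_emb
      ((rotL b hb β).trans (rotL a ha α)).toHomeomorph.measurableEmbedding
      (fun y => c * (k (inner ℝ (rot a α (rot b β e)) y, ‖cross (rot a α (rot b β e)) y‖) *
        S (t, r • (rot a α (rot b β e)), mom M r (rot a α (rot b β e)) y)))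
    simp only [LinearIsometryEquiv.trans_apply, rotL_apply, hrot, hrot2] at h1
    rw [hΨ, ← lintegral_const_mul' _ _ ENNReal.ofReal_ne_top, ← h1]
    refine lintegral_congr fun y => ?_
    simp only [rotPhase, rot_smul, rot_mom M r hb, rot_mom M r ha]
    ring
  calc _ ≤ ∫⁻ y, ∫⁻ β in Set.Ioo (0 : ℝ) 1, ∫⁻ α in Set.Ioo (0 : ℝ) 1, k (inner ℝ e y, ‖cross e y‖) *
        (c * S (rotPhase a α (rotPhase b β (t, r • e, mom M r e y)))) :=
        lintegral_mono_ae (hae.mono hpt)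
    _ = ∫⁻ β in Set.Ioo (0 : ℝ) 1, ∫⁻ α in Set.Ioo (0 : ℝ) 1, c * Ψ (rot a α (rot b β e)) := by
        rw [lintegral_lintegral_swap (hjoint.lintegral_prod_right').aemeasurable]
        refine lintegral_congr fun β => ?_
        rw [lintegral_lintegral_swap (Measurable.aemeasurable ?_)]
        · simp only [hsub]
        · exact hjoint.comp (f := fun z : E3 × ℝ => ((z.1, β), z.2)) (by fun_prop)
    _ = ∫⁻ α in Set.Ioo (0 : ℝ) 1, ∫⁻ β in Set.Ioo (0 : ℝ) 1, c * Ψ (rot a α (rot b β e)) := by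
        rw [lintegral_lintegral_swap (by fun_prop)]
    _ ≤ 8 * ∫⁻ e, c * Ψ (e : E3) ∂sphMeasure :=
        lintegral_rot_rot_le (Φ := fun e => c * Ψ e) (by fun_prop) ha he hae'
    _ = _ := by
        rw [lintegral_const_mul _ (by fun_prop), ← mul_assoc, ENNReal.ofReal_mul (by norm_num),
          ENNReal.ofReal_ofNat]

end Foliation

/-! ### The transport identity along the leaves -/

/-- The product of the surface measure of the unit sphere and of Lebesgue measure. -/
abbrev sphereBundle : Measure (S2 × E3) := sphMeasure.prod volume

instance : SFinite sphereBundle := Measure.prod.instSFinite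

/-- The truncated integrands live on the product of the sphere with a shell of momenta. This set is
compact, and for `c₁ > 0` it avoids the zero covector, where continuity may fail. -/
theorem integrable_of_shell {c₁ c₂ : ℝ} {F : S2 × E3 → ℝ}
    (hF : ContinuousOn F {z | c₁ ≤ ‖z.2‖ ∧ ‖z.2‖ ≤ c₂})
    (h0 : ∀ z, ¬(c₁ ≤ ‖z.2‖ ∧ ‖z.2‖ ≤ c₂) → F z = 0) :
    Integrable F sphereBundle ∧ ∃ B, 0 ≤ B ∧ ∀ z, |F z| ≤ B := by
  have hK : IsCompact {z : S2 × E3 | c₁ ≤ ‖z.2‖ ∧ ‖z.2‖ ≤ c₂} := by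
    have h1 : IsCompact ((Set.univ : Set S2) ×ˢ Metric.closedBall (0 : E3) c₂) :=
      isCompact_univ.prod (isCompact_closedBall _ _)
    refine h1.of_isClosed_subset ?_ fun z hz => ⟨Set.mem_univ _, by simpa using hz.2⟩
    exact (isClosed_le continuous_const (by fun_prop : Continuous fun z : S2 × E3 => ‖z.2‖)).inter
      (isClosed_le (by fun_prop : Continuous fun z : S2 × E3 => ‖z.2‖) continuous_const)
  refine ⟨?_, ?_⟩
  · rw [← integrableOn_univ]
    exact (hF.integrableOn_compact hK).of_forall_sdiff_eq_zero MeasurableSet.univ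
      fun z hz => h0 z hz.2
  · obtain ⟨B, hB⟩ := hK.exists_bound_of_continuousOn hF
    refine ⟨max B 0, le_max_right _ _, fun z => ?_⟩
    by_cases hz : c₁ ≤ ‖z.2‖ ∧ ‖z.2‖ ≤ c₂
    · exact (hB z hz).trans (le_max_left _ _)
    · rw [h0 z hz]; simp

theorem integrableOn_of_shell {a b c₁ c₂ : ℝ} {F : ℝ × S2 × E3 → ℝ}
    (hF : ContinuousOn F {z | z.1 ∈ Set.Icc a b ∧ c₁ ≤ ‖z.2.2‖ ∧ ‖z.2.2‖ ≤ c₂})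
    (h0 : ∀ z, z.1 ∈ Set.Icc a b → ¬(c₁ ≤ ‖z.2.2‖ ∧ ‖z.2.2‖ ≤ c₂) → F z = 0) :
    IntegrableOn F (Set.Icc a b ×ˢ Set.univ) ((volume : Measure ℝ).prod sphereBundle) := by
  have hK : IsCompact {z : ℝ × S2 × E3 | z.1 ∈ Set.Icc a b ∧ c₁ ≤ ‖z.2.2‖ ∧ ‖z.2.2‖ ≤ c₂} := by
    have h1 : IsCompact (Set.Icc a b ×ˢ ((Set.univ : Set S2) ×ˢ Metric.closedBall (0 : E3) c₂)) :=
      isCompact_Icc.prod (isCompact_univ.prod (isCompact_closedBall _ _))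
    refine h1.of_isClosed_subset ?_ fun z hz => ⟨hz.1, Set.mem_univ _, by simpa using hz.2.2⟩
    exact (isClosed_Icc.preimage continuous_fst).inter
      ((isClosed_le continuous_const (by fun_prop : Continuous fun z : ℝ × S2 × E3 => ‖z.2.2‖)).inter
        (isClosed_le (by fun_prop : Continuous fun z : ℝ × S2 × E3 => ‖z.2.2‖) continuous_const))
  exact (hF.integrableOn_compact hK).of_forall_sdiff_eq_zero
    (measurableSet_Icc.prod MeasurableSet.univ) fun z hz => h0 z hz.1.1 fun h => hz.2 ⟨hz.1.1, h⟩

/-- The set of arguments `(r, v, L)` on which the weights are differentiated. -/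
def weightDomain (a b : ℝ) : Set (ℝ × ℝ × ℝ) :=
  {z | z.1 ∈ Set.Icc a b ∧ 0 ≤ z.2.2 ∧ (z.2.1 ≠ 0 ∨ z.2.2 ≠ 0)}

/-- A solution `g` of the Vlasov equation, a radial graph `t = H r`, a weight `w(r, v_{r*}, |v̸|)` and
a nonlinearity `P`, for the transport identity over `a ≤ r ≤ b`. -/
structure TransportData {M : ℝ} (𝓕 : Foliation M) (a b : ℝ) where
  g : Phase → ℝ
  H : ℝ → ℝ
  H' : ℝ → ℝ
  P : ℝ → ℝ
  P' : ℝ → ℝ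
  w : ℝ → ℝ → ℝ → ℝ
  wr : ℝ → ℝ → ℝ → ℝ
  wv : ℝ → ℝ → ℝ → ℝ
  c₁ : ℝ
  c₂ : ℝ
  hM : 0 < M
  lt_a : 2 * M < a
  a_le_b : a ≤ b
  c₁_pos : 0 < c₁
  c₂_nonneg : 0 ≤ c₂
  g_smooth : ContDiffOn ℝ 1 g 𝓕.phaseRegion
  g_liouville : ∀ y ∈ 𝓕.phaseRegion, liouville M 𝓕.phaseRegion g y = 0
  height_le : ∀ r ∈ Set.Icc a b, 𝓕.height r ≤ H r
  H_deriv : ∀ r ∈ Set.Icc a b, HasDerivAt H (H' r) r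
  H'_cont : ContinuousOn H' (Set.Icc a b)
  P_deriv : ∀ x, HasDerivAt P (P' x) x
  P'_cont : Continuous P'
  w_deriv_r : ∀ z ∈ weightDomain a b,
    HasDerivAt (fun r => w r z.2.1 z.2.2) (wr z.1 z.2.1 z.2.2) z.1
  w_deriv_v : ∀ z ∈ weightDomain a b,
    HasDerivAt (fun v => w z.1 v z.2.2) (wv z.1 z.2.1 z.2.2) z.2.1
  w_cont : ContinuousOn (fun z : ℝ × ℝ × ℝ => w z.1 z.2.1 z.2.2) (weightDomain a b)
  wr_cont : ContinuousOn (fun z : ℝ × ℝ × ℝ => wr z.1 z.2.1 z.2.2) (weightDomain a b)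
  wv_cont : ContinuousOn (fun z : ℝ × ℝ × ℝ => wv z.1 z.2.1 z.2.2) (weightDomain a b)
  supp : ∀ r ∈ Set.Icc a b, ∀ v L, 0 ≤ L → (v ^ 2 + L ^ 2 < c₁ ^ 2 ∨ c₂ ^ 2 < v ^ 2 + L ^ 2) →
    w r v L = 0 ∧ wr r v L = 0 ∧ wv r v L = 0

namespace TransportData

variable {M : ℝ} {𝓕 : Foliation M} {a b : ℝ} (T : TransportData 𝓕 a b)

/-- The point of the phase space with coordinates `(r, e, y)`. -/
def pt (r : ℝ) (z : S2 × E3) : Phase := (T.H r, r • (z.1 : E3), mom M r z.1 z.2)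

/-- The derivative of `g` at that point. -/
def dg (r : ℝ) (z : S2 × E3) : Phase →L[ℝ] ℝ := fderivWithin ℝ T.g 𝓕.phaseRegion (T.pt r z)

/-- `v_{r*}`. -/
def _root_.SchwarzschildVlasov.vr (z : S2 × E3) : ℝ := inner ℝ (z.1 : E3) z.2

/-- `|v̸|`. -/
def _root_.SchwarzschildVlasov.va (z : S2 × E3) : ℝ := ‖cross (z.1 : E3) z.2‖

@[fun_prop]
theorem _root_.SchwarzschildVlasov.continuous_vr : Continuous vr := by unfold vr; fun_prop

@[fun_prop]
theorem _root_.SchwarzschildVlasov.continuous_va : Continuous va := by unfold va; fun_prop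

theorem two_mul_lt (T : TransportData 𝓕 a b) {r : ℝ} (hr : r ∈ Set.Icc a b) : 2 * M < r := T.lt_a.trans_le hr.1

theorem pt_mem {r : ℝ} (hr : r ∈ Set.Icc a b) {z : S2 × E3} (hz : z.2 ≠ 0) :
    T.pt r z ∈ 𝓕.phaseRegion :=
  𝓕.mem_phaseRegion_mom T.hM (T.two_mul_lt hr) (T.height_le r hr) (S2.norm_eq z.1) hz

/-- The derivative of `pt` in `r`. -/
def ptDeriv (r : ℝ) (z : S2 × E3) : Phase := (T.H' r, (z.1 : E3), momDeriv M r z.1 z.2)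

theorem hasDerivAt_pt {r : ℝ} (hr : r ∈ Set.Icc a b) (z : S2 × E3) :
    HasDerivAt (fun r => T.pt r z) (T.ptDeriv r z) r := by
  refine (T.H_deriv r hr).prodMk (HasDerivAt.prodMk ?_ (hasDerivAt_mom T.hM (T.two_mul_lt hr) _ _))
  simpa using (hasDerivAt_id r).smul_const (z.1 : E3)

theorem mem_weightDomain {r : ℝ} (hr : r ∈ Set.Icc a b) {z : S2 × E3} (hz : z.2 ≠ 0) :
    (r, vr z, va z) ∈ weightDomain a b :=
  ⟨hr, norm_nonneg _, (ne_zero_iff_or z.2 (S2.norm_eq z.1)).mp hz⟩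

theorem supp_shell {r : ℝ} (hr : r ∈ Set.Icc a b) {z : S2 × E3}
    (hz : ¬(T.c₁ ≤ ‖z.2‖ ∧ ‖z.2‖ ≤ T.c₂)) :
    T.w r (vr z) (va z) = 0 ∧ T.wr r (vr z) (va z) = 0 ∧ T.wv r (vr z) (va z) = 0 := by
  refine T.supp r hr _ _ (norm_nonneg _) ?_
  have h := norm_sq_decomp z.2 (S2.norm_eq z.1)
  have h1 : ‖z.2‖ ^ 2 = vr z ^ 2 + va z ^ 2 := h
  rw [← h1]
  by_cases h2 : T.c₁ ≤ ‖z.2‖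
  · right
    have h3 : T.c₂ < ‖z.2‖ := by by_contra h4; exact hz ⟨h2, not_lt.mp h4⟩
    exact pow_lt_pow_left₀ h3 T.c₂_nonneg two_ne_zero
  · left
    exact pow_lt_pow_left₀ (not_le.mp h2) (norm_nonneg _) two_ne_zero

/-- The set on which the integrands are continuous. -/
def dom (a b : ℝ) : Set (ℝ × S2 × E3) := {z | z.1 ∈ Set.Icc a b ∧ z.2.2 ≠ 0}

theorem continuousOn_pt : ContinuousOn (fun z : ℝ × S2 × E3 => T.pt z.1 z.2) (dom a b) := by
  have hH : ContinuousOn T.H (Set.Icc a b) := fun r hr =>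
    (T.H_deriv r hr).continuousAt.continuousWithinAt
  have h1 : ContinuousOn (fun z : ℝ × S2 × E3 => T.H z.1) (dom a b) :=
    hH.comp continuousOn_fst fun z hz => hz.1
  have hl : ContinuousOn (fun z : ℝ × S2 × E3 => lapse M z.1) (dom a b) := by
    have : ContinuousOn (lapse M) (Set.Icc a b) := fun r hr =>
      (hasDerivAt_lapse M (by linarith [T.two_mul_lt hr, T.hM])).continuousAt.continuousWithinAt
    exact this.comp continuousOn_fst fun z hz => hz.1
  have hl0 : ∀ z ∈ dom a b, lapse M z.1 ≠ 0 := fun z hz =>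
    (lapse_pos T.hM (T.two_mul_lt hz.1)).ne'
  have hr0 : ∀ z ∈ dom a b, z.1 ≠ 0 := fun z hz => by linarith [T.two_mul_lt hz.1, T.hM]
  unfold pt mom
  fun_prop (disch := assumption)

theorem continuousOn_g : ContinuousOn (fun z : ℝ × S2 × E3 => T.g (T.pt z.1 z.2)) (dom a b) :=
  T.g_smooth.continuousOn.comp T.continuousOn_pt fun _ hz => T.pt_mem hz.1 hz.2

theorem continuousOn_dg : ContinuousOn (fun z : ℝ × S2 × E3 => T.dg z.1 z.2) (dom a b) :=
  (T.g_smooth.continuousOn_fderivWithin (𝓕.uniqueDiffOn_phaseRegion T.hM) le_rfl).comp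
    T.continuousOn_pt fun _ hz => T.pt_mem hz.1 hz.2

theorem continuousOn_weight {u : ℝ → ℝ → ℝ → ℝ}
    (hu : ContinuousOn (fun z : ℝ × ℝ × ℝ => u z.1 z.2.1 z.2.2) (weightDomain a b)) :
    ContinuousOn (fun z : ℝ × S2 × E3 => u z.1 (vr z.2) (va z.2)) (dom a b) :=
  hu.comp (f := fun z : ℝ × S2 × E3 => (z.1, vr z.2, va z.2)) (by fun_prop)
    fun _ hz => mem_weightDomain hz.1 hz.2

/-- `∂_t g`. -/
def gt (r : ℝ) (z : S2 × E3) : ℝ := dT 𝓕.phaseRegion T.g (T.pt r z)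

/-- The derivative of `g` in `v_{r*}`. -/
def gv (r : ℝ) (z : S2 × E3) : ℝ := T.dg r z (0, 0, (lapse M r)⁻¹ • (z.1 : E3))

/-- The transported density. -/
def F (r : ℝ) (z : S2 × E3) : ℝ := vr z * (T.w r (vr z) (va z) * T.P (T.g (T.pt r z)))

/-- Its derivative in `r`. -/
def Fr (r : ℝ) (z : S2 × E3) : ℝ :=
  vr z * (T.wr r (vr z) (va z) * T.P (T.g (T.pt r z)) +
    T.w r (vr z) (va z) * (T.P' (T.g (T.pt r z)) * T.dg r z (T.ptDeriv r z)))

/-- `-v · n` up to the density of the volume form. -/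
def Φ (r : ℝ) (z : S2 × E3) : ℝ := energy M r (vr z) (va z) / lapse M r - T.H' r * vr z

/-- The source term of the transport identity. -/
def source (r : ℝ) (z : S2 × E3) : ℝ :=
  (vr z * T.wr r (vr z) (va z) - 1 / 2 * va z ^ 2 * potDeriv M r * T.wv r (vr z) (va z))
      * T.P (T.g (T.pt r z))
    - T.w r (vr z) (va z) * T.P' (T.g (T.pt r z)) * (T.Φ r z * T.gt r z)

/-- The derivative in `v_{r*}` which integrates to zero. -/
def angTerm (r : ℝ) (z : S2 × E3) : ℝ :=
  va z ^ 2 * (T.wv r (vr z) (va z) * T.P (T.g (T.pt r z)) +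
    T.w r (vr z) (va z) * (T.P' (T.g (T.pt r z)) * T.gv r z))

/-- The rotational derivatives which integrate to zero. -/
def rotTerm (i : Fin 3) (r : ℝ) (z : S2 × E3) : ℝ :=
  cross (z.1 : E3) z.2 i * T.w r (vr z) (va z) *
    (T.P' (T.g (T.pt r z)) * omegaHat 𝓕.phaseRegion i T.g (T.pt r z))

/-- The radial derivative at fixed `(e, y)` is taken along the graph `t = H r`. Tilting it there
costs `H' v_{r*} ∂_t`, which combines with the original coefficient of `∂_t` into `Φ`. The rotation
about the angular momentum has coefficient `r⁻²`. -/
theorem vlasov_eq {r : ℝ} (hr : r ∈ Set.Icc a b) {z : S2 × E3} (hz : z.2 ≠ 0) :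
    vr z * T.dg r z (T.ptDeriv r z) = 1 / 2 * va z ^ 2 * potDeriv M r * T.gv r z
      - (r ^ 2)⁻¹ * ∑ i, cross (z.1 : E3) z.2 i * omegaHat 𝓕.phaseRegion i T.g (T.pt r z)
      - T.Φ r z * T.gt r z := by
  have hr2 := T.two_mul_lt hr
  have hr0 : 0 < r := by linarith [T.hM]
  have he := S2.norm_eq z.1
  have h0 := T.g_liouville _ (T.pt_mem hr hz)
  rw [𝓕.liouville_eq_fderivWithin T.hM _ (T.pt_mem hr hz)] at h0
  have hV : liouvilleField M (T.pt r z) =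
      (energy M r (vr z) (va z) / lapse M r - T.H' r * vr z) • ((1, 0, 0) : Phase)
        + vr z • T.ptDeriv r z
        - (1 / 2 * va z ^ 2 * potDeriv M r) • ((0, 0, (lapse M r)⁻¹ • (z.1 : E3)) : Phase)
        + (r ^ 2)⁻¹ • rotField (cross (z.1 : E3) z.2) (T.pt r z) := by
    simp only [liouvilleField, pt, vT_mom z.2 T.hM hr2 he, liouvilleX_mom T.hM hr2 he,
      liouvilleP_mom T.hM hr2 he, norm_smul_unit hr0 he, rotField_apply, ptDeriv, Prod.smul_mk,
      Prod.mk_add_mk, Prod.mk_sub_mk, vr, va, Prod.mk.injEq]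
    refine ⟨?_, ?_, ?_⟩
    · simp only [smul_eq_mul]; ring
    · simp only [smul_zero]; module
    · simp only [smul_zero]
      match_scalars <;> ring
  rw [hV, map_add, map_sub, map_add, map_smul, map_smul, map_smul, map_smul,
    fderivWithin_rotField] at h0
  simp only [smul_eq_mul] at h0
  simp only [gv, gt, dg, dT, Φ]
  linarith

/-- The prefactor `v_{r*}` of the density is exactly what allows the equation to be substituted for
the radial derivative of `g`. The derivatives of `g` in `v_{r*}` and along rotations are gathered,
with the matching derivative of the weight, into terms of zero integral. -/
theorem Fr_eq {r : ℝ} (hr : r ∈ Set.Icc a b) (z : S2 × E3) :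
    T.Fr r z = T.source r z + 1 / 2 * potDeriv M r * T.angTerm r z
      - (r ^ 2)⁻¹ * ∑ i, T.rotTerm i r z := by
  by_cases hz : z.2 = 0
  -- The equation is not available at the zero covector; there the weights vanish because the
  -- support starts at `c₁ > 0`.
  · have h1 : vr z = 0 := by simp [vr, hz]
    have h2 : va z = 0 := by simp [va, hz, cross_zero_right]
    have h3 : T.w r 0 0 = 0 ∧ T.wr r 0 0 = 0 ∧ T.wv r 0 0 = 0 :=
      T.supp r hr 0 0 le_rfl (Or.inl (by simpa using pow_pos T.c₁_pos 2))
    simp [Fr, source, angTerm, rotTerm, h1, h2, h3.1]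
  · have h := T.vlasov_eq hr hz
    simp only [Fr, source, angTerm, rotTerm]
    have hsum : ∑ i, cross (z.1 : E3) z.2 i * T.w r (vr z) (va z) *
        (T.P' (T.g (T.pt r z)) * omegaHat 𝓕.phaseRegion i T.g (T.pt r z)) =
        T.w r (vr z) (va z) * T.P' (T.g (T.pt r z)) *
          ∑ i, cross (z.1 : E3) z.2 i * omegaHat 𝓕.phaseRegion i T.g (T.pt r z) := by
      rw [Finset.mul_sum]
      exact Finset.sum_congr rfl fun i _ => by ring
    rw [hsum]
    linear_combination T.w r (vr z) (va z) * T.P' (T.g (T.pt r z)) * h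

end TransportData

/-- The bound `hφn` on the displacement of `y` confines every point that `φ s` sends into the shell,
for `|s| < 1`, to a ball of radius `c₂ + 1`. This gives the dominating function required to
differentiate under the integral. -/
theorem integral_eq_zero_of_shell {φ : ℝ → S2 × E3 → S2 × E3}
    (hφ : ∀ s, MeasurePreserving (φ s) sphereBundle sphereBundle) (hφ0 : ∀ z, φ 0 z = z)
    (hφn : ∀ z, ∀ s ∈ Metric.ball (0 : ℝ) 1, ‖z.2‖ ≤ ‖(φ s z).2‖ + 1)
    {c₁ c₂ : ℝ} {A A' : S2 × E3 → ℝ}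
    (hA : ContinuousOn A {z | c₁ ≤ ‖z.2‖ ∧ ‖z.2‖ ≤ c₂})
    (hA0 : ∀ z, ¬(c₁ ≤ ‖z.2‖ ∧ ‖z.2‖ ≤ c₂) → A z = 0)
    (hA' : ContinuousOn A' {z | c₁ ≤ ‖z.2‖ ∧ ‖z.2‖ ≤ c₂})
    (hA'0 : ∀ z, ¬(c₁ ≤ ‖z.2‖ ∧ ‖z.2‖ ≤ c₂) → A' z = 0)
    (hd : ∀ z s, HasDerivAt (fun s => A (φ s z)) (A' (φ s z)) s) :
    ∫ z, A' z ∂sphereBundle = 0 := by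
  obtain ⟨hi, B, hB0, hB⟩ := integrable_of_shell hA' hA'0
  classical
  have hg : Integrable (fun z : S2 × E3 => if ‖z.2‖ ≤ c₂ + 1 then B else 0) sphereBundle := by
    refine (integrable_of_shell (c₁ := 0) (c₂ := c₂ + 1) ?_ ?_).1
    · exact continuousOn_const.congr fun z hz => if_pos hz.2
    · intro z hz
      exact if_neg fun h => hz ⟨norm_nonneg _, h⟩
  refine integral_eq_zero_of_measurePreserving hφ hφ0 (integrable_of_shell hA hA0).1
    hi.aestronglyMeasurable hd hg fun z s hs => ?_
  split_ifs with h
  · exact hB _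
  · rw [hA'0 _ fun h' => h ((hφn z s hs).trans (by linarith [h'.2])), abs_zero]

namespace TransportData

variable {M : ℝ} {𝓕 : Foliation M} {a b : ℝ} (T : TransportData 𝓕 a b)

theorem shell_subset_dom : {z : ℝ × S2 × E3 | z.1 ∈ Set.Icc a b ∧ T.c₁ ≤ ‖z.2.2‖ ∧ ‖z.2.2‖ ≤ T.c₂}
    ⊆ dom a b := fun _ hz =>
  ⟨hz.1, norm_pos_iff.mp (T.c₁_pos.trans_le hz.2.1)⟩

theorem continuousOn_slice {u : ℝ × S2 × E3 → ℝ} (hu : ContinuousOn u (dom a b)) {r : ℝ}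
    (hr : r ∈ Set.Icc a b) :
    ContinuousOn (fun z => u (r, z)) {z : S2 × E3 | T.c₁ ≤ ‖z.2‖ ∧ ‖z.2‖ ≤ T.c₂} :=
  hu.comp (f := fun z : S2 × E3 => (r, z)) (by fun_prop) fun _ hz =>
    T.shell_subset_dom ⟨hr, hz⟩

theorem continuousOn_P : ContinuousOn (fun z : ℝ × S2 × E3 => T.P (T.g (T.pt z.1 z.2))) (dom a b) :=
  (continuous_iff_continuousAt.mpr fun x => (T.P_deriv x).continuousAt).comp_continuousOn
    T.continuousOn_g

theorem continuousOn_P' :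
    ContinuousOn (fun z : ℝ × S2 × E3 => T.P' (T.g (T.pt z.1 z.2))) (dom a b) :=
  T.P'_cont.comp_continuousOn T.continuousOn_g

theorem continuousOn_lapse (T : TransportData 𝓕 a b) :
    ContinuousOn (fun z : ℝ × S2 × E3 => lapse M z.1) (dom a b) := by
  have : ContinuousOn (lapse M) (Set.Icc a b) := fun r hr =>
    (hasDerivAt_lapse M (by linarith [T.two_mul_lt hr, T.hM])).continuousAt.continuousWithinAt
  exact this.comp continuousOn_fst fun z hz => hz.1

theorem lapse_ne_zero (T : TransportData 𝓕 a b) {z : ℝ × S2 × E3} (hz : z ∈ dom a b) : lapse M z.1 ≠ 0 :=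
  (lapse_pos T.hM (T.two_mul_lt hz.1)).ne'

theorem fst_ne_zero (T : TransportData 𝓕 a b) {z : ℝ × S2 × E3} (hz : z ∈ dom a b) : z.1 ≠ 0 := by
  linarith [T.two_mul_lt hz.1, T.hM]

theorem continuousOn_gt : ContinuousOn (fun z : ℝ × S2 × E3 => T.gt z.1 z.2) (dom a b) :=
  T.continuousOn_dg.clm_apply continuousOn_const

theorem continuousOn_gv : ContinuousOn (fun z : ℝ × S2 × E3 => T.gv z.1 z.2) (dom a b) := by
  refine T.continuousOn_dg.clm_apply ?_
  have h := T.continuousOn_lapse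
  have h0 : ∀ z ∈ dom a b, lapse M z.1 ≠ 0 := fun z hz => T.lapse_ne_zero hz
  fun_prop (disch := assumption)

theorem continuousOn_omegaHat (i : Fin 3) : ContinuousOn
    (fun z : ℝ × S2 × E3 => omegaHat 𝓕.phaseRegion i T.g (T.pt z.1 z.2)) (dom a b) := by
  have h : ContinuousOn (omegaHat 𝓕.phaseRegion i T.g) 𝓕.phaseRegion :=
    (𝓕.contDiffOn_omegaHat T.hM (n := 0) (by simpa using T.g_smooth) i).continuousOn
  exact h.comp T.continuousOn_pt fun _ hz => T.pt_mem hz.1 hz.2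

theorem continuousOn_Φ : ContinuousOn (fun z : ℝ × S2 × E3 => T.Φ z.1 z.2) (dom a b) := by
  have h := T.continuousOn_lapse
  have h0 : ∀ z ∈ dom a b, lapse M z.1 ≠ 0 := fun z hz => T.lapse_ne_zero hz
  have h1 : ContinuousOn (fun z : ℝ × S2 × E3 => T.H' z.1) (dom a b) :=
    T.H'_cont.comp continuousOn_fst fun z hz => hz.1
  have h2 : ∀ z ∈ dom a b, z.1 ^ 2 ≠ 0 := fun z hz => pow_ne_zero 2 (T.fst_ne_zero hz)
  unfold Φ energy
  fun_prop (disch := assumption)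

theorem continuousOn_potDeriv (T : TransportData 𝓕 a b) :
    ContinuousOn (fun z : ℝ × S2 × E3 => potDeriv M z.1) (dom a b) := by
  have h2 : ∀ z ∈ dom a b, z.1 ^ 3 ≠ 0 := fun z hz => pow_ne_zero 3 (T.fst_ne_zero hz)
  have h3 : ∀ z ∈ dom a b, z.1 ^ 4 ≠ 0 := fun z hz => pow_ne_zero 4 (T.fst_ne_zero hz)
  unfold potDeriv
  fun_prop (disch := assumption)

theorem continuousOn_F : ContinuousOn (fun z : ℝ × S2 × E3 => T.F z.1 z.2) (dom a b) := by
  have h1 := continuousOn_weight T.w_cont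
  have h2 := T.continuousOn_P
  unfold F
  fun_prop

theorem continuousOn_source : ContinuousOn (fun z : ℝ × S2 × E3 => T.source z.1 z.2) (dom a b) := by
  have h1 := continuousOn_weight T.w_cont
  have h2 := continuousOn_weight T.wr_cont
  have h3 := continuousOn_weight T.wv_cont
  have h4 := T.continuousOn_P
  have h5 := T.continuousOn_P'
  have h6 := T.continuousOn_Φ
  have h7 := T.continuousOn_gt
  have h8 := T.continuousOn_potDeriv
  unfold source
  fun_prop

theorem continuousOn_angTerm :
    ContinuousOn (fun z : ℝ × S2 × E3 => T.angTerm z.1 z.2) (dom a b) := by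
  have h1 := continuousOn_weight T.w_cont
  have h3 := continuousOn_weight T.wv_cont
  have h4 := T.continuousOn_P
  have h5 := T.continuousOn_P'
  have h7 := T.continuousOn_gv
  unfold angTerm
  fun_prop

theorem continuousOn_rotTerm (i : Fin 3) :
    ContinuousOn (fun z : ℝ × S2 × E3 => T.rotTerm i z.1 z.2) (dom a b) := by
  have h1 := continuousOn_weight T.w_cont
  have h5 := T.continuousOn_P'
  have h7 := T.continuousOn_omegaHat i
  unfold rotTerm
  fun_prop

theorem integrable_slice {u : ℝ × S2 × E3 → ℝ} (hu : ContinuousOn u (dom a b)) {r : ℝ}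
    (hr : r ∈ Set.Icc a b) (h0 : ∀ z : S2 × E3, ¬(T.c₁ ≤ ‖z.2‖ ∧ ‖z.2‖ ≤ T.c₂) → u (r, z) = 0) :
    Integrable (fun z => u (r, z)) sphereBundle :=
  (integrable_of_shell (T.continuousOn_slice hu hr) h0).1

theorem F_eq_zero {r : ℝ} (hr : r ∈ Set.Icc a b) {z : S2 × E3}
    (hz : ¬(T.c₁ ≤ ‖z.2‖ ∧ ‖z.2‖ ≤ T.c₂)) : T.F r z = 0 := by
  simp [F, (T.supp_shell hr hz).1]

theorem Fr_eq_zero {r : ℝ} (hr : r ∈ Set.Icc a b) {z : S2 × E3}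
    (hz : ¬(T.c₁ ≤ ‖z.2‖ ∧ ‖z.2‖ ≤ T.c₂)) : T.Fr r z = 0 := by
  simp [Fr, (T.supp_shell hr hz).1, (T.supp_shell hr hz).2.1]

theorem source_eq_zero {r : ℝ} (hr : r ∈ Set.Icc a b) {z : S2 × E3}
    (hz : ¬(T.c₁ ≤ ‖z.2‖ ∧ ‖z.2‖ ≤ T.c₂)) : T.source r z = 0 := by
  simp [source, T.supp_shell hr hz]

theorem angTerm_eq_zero {r : ℝ} (hr : r ∈ Set.Icc a b) {z : S2 × E3}
    (hz : ¬(T.c₁ ≤ ‖z.2‖ ∧ ‖z.2‖ ≤ T.c₂)) : T.angTerm r z = 0 := by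
  simp [angTerm, T.supp_shell hr hz]

theorem rotTerm_eq_zero (i : Fin 3) {r : ℝ} (hr : r ∈ Set.Icc a b) {z : S2 × E3}
    (hz : ¬(T.c₁ ≤ ‖z.2‖ ∧ ‖z.2‖ ≤ T.c₂)) : T.rotTerm i r z = 0 := by
  simp [rotTerm, T.supp_shell hr hz]

theorem va_shift (s : ℝ) (z : S2 × E3) : va (z.1, z.2 + s • (z.1 : E3)) = va z := by
  simp [va, cross_add_right, cross_smul_right, cross_self_eq_zero]

theorem vr_shift (s : ℝ) (z : S2 × E3) : vr (z.1, z.2 + s • (z.1 : E3)) = vr z + s := by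
  simp [vr, inner_add_right, inner_smul_right]

theorem measurePreserving_shift (s : ℝ) :
    MeasurePreserving (fun z : S2 × E3 => (z.1, z.2 + s • (z.1 : E3))) sphereBundle
      sphereBundle := by
  refine (MeasurePreserving.id sphMeasure).skew_product (g := fun e y => y + s • (e : E3)) ?_ ?_
  · fun_prop
  · exact .of_forall fun e => (measurePreserving_add_right volume (s • (e : E3))).map_eq

theorem hasDerivAt_comp {r : ℝ} (hr : r ∈ Set.Icc a b) {z : S2 × E3} (hz : z.2 ≠ 0)
    {γ : ℝ → Phase} {γ' : Phase} {s : ℝ} (hγ : HasDerivAt γ γ' s) (hs : γ s = T.pt r z)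
    (hm : ∀ᶠ s' in nhds s, γ s' ∈ 𝓕.phaseRegion) :
    HasDerivAt (fun s => T.P (T.g (γ s))) (T.P' (T.g (T.pt r z)) * T.dg r z γ') s := by
  have h1 : HasFDerivWithinAt T.g (T.dg r z) 𝓕.phaseRegion (γ s) := by
    rw [hs]
    exact ((T.g_smooth.differentiableOn one_ne_zero) _ (T.pt_mem hr hz)).hasFDerivWithinAt
  have h2 : HasDerivAt (fun s => T.g (γ s)) (T.dg r z γ') s := by
    have := h1.comp_hasDerivAt (x := s) hγ hm
    exact this
  have h3 := (T.P_deriv (T.g (γ s))).comp s h2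
  rw [hs] at h3
  exact h3

/-- The translation `y ↦ y + s e` shifts `v_{r*}` by `s`, fixes `e × y` and preserves the measure;
the integrand is a derivative along it. -/
theorem integral_angTerm {r : ℝ} (hr : r ∈ Set.Icc a b) :
    ∫ z, T.angTerm r z ∂sphereBundle = 0 := by
  have hA : ContinuousOn (fun z : ℝ × S2 × E3 =>
      va z.2 ^ 2 * (T.w z.1 (vr z.2) (va z.2) * T.P (T.g (T.pt z.1 z.2)))) (dom a b) := by
    have h1 := continuousOn_weight T.w_cont
    have h2 := T.continuousOn_P
    fun_prop
  refine integral_eq_zero_of_shell (φ := fun s z => (z.1, z.2 + s • (z.1 : E3)))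
    (A := fun z => va z ^ 2 * (T.w r (vr z) (va z) * T.P (T.g (T.pt r z)))) measurePreserving_shift
    (fun z => by simp) ?_ (T.continuousOn_slice hA hr) ?_
    (T.continuousOn_slice T.continuousOn_angTerm hr) (fun z hz => T.angTerm_eq_zero hr hz) ?_
  · intro z s hs
    have h1 : ‖s • (z.1 : E3)‖ ≤ 1 := by
      rw [norm_smul, S2.norm_eq, mul_one]
      exact (mem_ball_zero_iff.mp hs).le
    calc ‖z.2‖ = ‖(z.2 + s • (z.1 : E3)) - s • (z.1 : E3)‖ := by simp
      _ ≤ _ := (norm_sub_le _ _).trans (by gcongr)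
  · intro z hz
    simp [(T.supp_shell hr hz).1]
  · intro z s
    -- A line of translation can meet `y = 0`, where `g` need not be differentiable, only when the
    -- angular momentum vanishes. In that case the prefactor `|v̸|²` is zero.
    by_cases hv : va z = 0
    · simp only [angTerm, va_shift, hv]
      simpa using hasDerivAt_const s (0 : ℝ)
    have hne : ∀ s, z.2 + s • (z.1 : E3) ≠ 0 := fun s h => hv (by
      rw [← va_shift s z]; simp [va, h, cross_zero_right])
    have hw : HasDerivAt (fun s => T.w r (vr z + s) (va z)) (T.wv r (vr z + s) (va z)) s := by
      have h := T.w_deriv_v (r, vr z + s, va z) ⟨hr, norm_nonneg _, Or.inr hv⟩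
      simpa using h.comp_const_add (vr z) s
    have hγ : HasDerivAt (fun s => T.pt r (z.1, z.2 + s • (z.1 : E3)))
        ((0, 0, (lapse M r)⁻¹ • (z.1 : E3)) : Phase) s := by
      refine (hasDerivAt_const s (T.H r)).prodMk
        (HasDerivAt.prodMk (hasDerivAt_const s (r • (z.1 : E3))) ?_)
      have h1 : ∀ s : ℝ, mom M r z.1 (z.2 + s • (z.1 : E3)) =
          mom M r z.1 z.2 + s • ((lapse M r)⁻¹ • (z.1 : E3)) := by
        intro s
        have h2 : inner ℝ (z.1 : E3) (z.1 : E3) = (1 : ℝ) := by simp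
        simp only [mom, inner_add_right, inner_smul_right, h2]
        module
      simp only [h1]
      simpa using (((hasDerivAt_id s).smul_const ((lapse M r)⁻¹ • (z.1 : E3))).const_add
        (mom M r z.1 z.2))
    have hP := T.hasDerivAt_comp (z := (z.1, z.2 + s • (z.1 : E3))) hr (hne s) hγ rfl
      (.of_forall fun s' => T.pt_mem (z := (z.1, z.2 + s' • (z.1 : E3))) hr (hne s'))
    have h := (hw.mul hP).const_mul (va z ^ 2)
    simp only [angTerm, va_shift, vr_shift]
    exact h

theorem norm_axis (i : Fin 3) : ‖(EuclideanSpace.single i 1 : E3)‖ = 1 := by simp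

/-- The simultaneous rotation of `e` and `y`. -/
def rotBundle (i : Fin 3) (s : ℝ) (z : S2 × E3) : S2 × E3 :=
  (⟨rotL (EuclideanSpace.single i 1) (norm_axis i) s z.1, by
    rw [mem_sphere_zero_iff_norm, LinearIsometryEquiv.norm_map, S2.norm_eq]⟩,
    rotL (EuclideanSpace.single i 1) (norm_axis i) s z.2)

theorem measurePreserving_rotBundle (i : Fin 3) (s : ℝ) :
    MeasurePreserving (rotBundle i s) sphereBundle sphereBundle :=
  (measurePreserving_sphere _).prod
    (rotL (EuclideanSpace.single i 1) (norm_axis i) s).measurePreserving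

theorem rotBundle_zero (i : Fin 3) (z : S2 × E3) : rotBundle i 0 z = z :=
  Prod.ext (Subtype.ext (rot_zero (EuclideanSpace.single i 1) (z.1 : E3)))
    (rot_zero (EuclideanSpace.single i 1) z.2)

theorem vr_rotBundle (i : Fin 3) (s : ℝ) (z : S2 × E3) : vr (rotBundle i s z) = vr z := by
  exact inner_rot_rot (norm_axis i) s _ _

theorem cross_rotBundle (i : Fin 3) (s : ℝ) (z : S2 × E3) :
    cross ((rotBundle i s z).1 : E3) (rotBundle i s z).2 =
      rot (EuclideanSpace.single i 1) s (cross (z.1 : E3) z.2) :=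
  (rot_cross (norm_axis i) s _ _).symm

theorem va_rotBundle (i : Fin 3) (s : ℝ) (z : S2 × E3) : va (rotBundle i s z) = va z := by
  rw [va, cross_rotBundle, norm_rot (norm_axis i), va]

theorem cross_rotBundle_apply (i : Fin 3) (s : ℝ) (z : S2 × E3) :
    cross ((rotBundle i s z).1 : E3) (rotBundle i s z).2 i = cross (z.1 : E3) z.2 i := by
  have h : ∀ x : E3, x i = inner ℝ (EuclideanSpace.single i 1 : E3) x := fun x => by
    simp [EuclideanSpace.inner_single_left]
  have h1 := inner_rot_rot (norm_axis i) s (EuclideanSpace.single i 1) (cross (z.1 : E3) z.2)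
  rw [rot_axis (norm_axis i)] at h1
  rw [cross_rotBundle, h, h (cross _ _), h1]

theorem pt_rotBundle (i : Fin 3) (s r : ℝ) (z : S2 × E3) :
    T.pt r (rotBundle i s z) = rotPhase (EuclideanSpace.single i 1) s (T.pt r z) := by
  simp only [pt, rotPhase, rot_smul, rot_mom M r (norm_axis i)]
  rfl

/-- The component of the angular momentum along an axis is invariant under rotation about that axis,
as are `v_{r*}` and `|v̸|`. The coefficient therefore passes inside the derivative, and the rotation
preserves the measure. -/
theorem integral_rotTerm (i : Fin 3) {r : ℝ} (hr : r ∈ Set.Icc a b) :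
    ∫ z, T.rotTerm i r z ∂sphereBundle = 0 := by
  have hA : ContinuousOn (fun z : ℝ × S2 × E3 => cross (z.2.1 : E3) z.2.2 i *
      T.w z.1 (vr z.2) (va z.2) * T.P (T.g (T.pt z.1 z.2))) (dom a b) := by
    have h1 := continuousOn_weight T.w_cont
    have h2 := T.continuousOn_P
    fun_prop
  refine integral_eq_zero_of_shell (φ := rotBundle i)
    (A := fun z => cross (z.1 : E3) z.2 i * T.w r (vr z) (va z) * T.P (T.g (T.pt r z)))
    (measurePreserving_rotBundle i)
    (rotBundle_zero i) ?_ (T.continuousOn_slice hA hr) ?_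
    (T.continuousOn_slice (T.continuousOn_rotTerm i) hr) (fun z hz => T.rotTerm_eq_zero i hr hz) ?_
  · intro z s _
    have : ‖(rotBundle i s z).2‖ = ‖z.2‖ := norm_rot (norm_axis i) s z.2
    linarith
  · intro z hz
    simp [(T.supp_shell hr hz).1]
  · intro z s
    simp only [rotTerm, vr_rotBundle, va_rotBundle, cross_rotBundle_apply, pt_rotBundle]
    by_cases hz : z.2 = 0
    · have : cross (z.1 : E3) z.2 i = 0 := by simp [hz, cross_zero_right]
      simpa [this] using hasDerivAt_const s (0 : ℝ)
    have h1 := 𝓕.hasDerivAt_comp_rotPhase T.hM (T.g_smooth.differentiableOn one_ne_zero)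
      (norm_axis i) s (T.pt_mem hr hz)
    have h2 := ((T.P_deriv _).comp s h1).const_mul
      (cross (z.1 : E3) z.2 i * T.w r (vr z) (va z))
    refine h2.congr_deriv ?_
    simp

theorem integral_Fr {r : ℝ} (hr : r ∈ Set.Icc a b) :
    ∫ z, T.Fr r z ∂sphereBundle = ∫ z, T.source r z ∂sphereBundle := by
  have h1 : Integrable (fun z => T.source r z) sphereBundle :=
    T.integrable_slice T.continuousOn_source hr fun z hz => T.source_eq_zero hr hz
  have h2 : Integrable (fun z => T.angTerm r z) sphereBundle :=
    T.integrable_slice T.continuousOn_angTerm hr fun z hz => T.angTerm_eq_zero hr hz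
  have h3 : ∀ i, Integrable (fun z => T.rotTerm i r z) sphereBundle :=
    fun i => T.integrable_slice (T.continuousOn_rotTerm i) hr
    fun z hz => T.rotTerm_eq_zero i hr hz
  simp only [T.Fr_eq hr]
  rw [integral_sub (by exact h1.add (h2.const_mul _))
      (by exact (integrable_finsetSum _ fun i _ => h3 i).const_mul _),
    integral_add h1 (h2.const_mul _), integral_const_mul, integral_const_mul,
    integral_finsetSum _ fun i _ => h3 i]
  simp [T.integral_angTerm hr, fun i => T.integral_rotTerm i hr]

theorem hasDerivAt_F {r : ℝ} (hr : r ∈ Set.Icc a b) {z : S2 × E3} (hz : z.2 ≠ 0)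
    (hm : ∀ᶠ r' in nhds r, T.pt r' z ∈ 𝓕.phaseRegion) :
    HasDerivAt (fun r => T.F r z) (T.Fr r z) r :=
  ((T.w_deriv_r _ (mem_weightDomain hr hz)).mul
    (T.hasDerivAt_comp hr hz (T.hasDerivAt_pt hr z) rfl hm)).const_mul _

theorem integral_Fr_right (z : S2 × E3) :
    ∫ r in Set.Icc a b, T.Fr r z = T.F b z - T.F a z := by
  have ha : a ∈ Set.Icc a b := ⟨le_rfl, T.a_le_b⟩
  have hb : b ∈ Set.Icc a b := ⟨T.a_le_b, le_rfl⟩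
  by_cases hz : z.2 = 0
  · have h : ¬(T.c₁ ≤ ‖z.2‖ ∧ ‖z.2‖ ≤ T.c₂) := fun h => by
      have := T.c₁_pos; rw [hz, norm_zero] at h; linarith [h.1]
    rw [T.F_eq_zero ha h, T.F_eq_zero hb h, sub_zero]
    exact setIntegral_eq_zero_of_forall_eq_zero fun r hr => T.Fr_eq_zero hr h
  have hFr : ContinuousOn (fun r => T.Fr r z) (Set.Icc a b) := by
    have h : ContinuousOn (fun z : ℝ × S2 × E3 => T.source z.1 z.2
        + 1 / 2 * potDeriv M z.1 * T.angTerm z.1 z.2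
        - (z.1 ^ 2)⁻¹ * ∑ i, T.rotTerm i z.1 z.2) (dom a b) := by
      have h1 := T.continuousOn_source
      have h2 := T.continuousOn_angTerm
      have h3 := T.continuousOn_rotTerm
      have h4 := T.continuousOn_potDeriv
      have h5 : ∀ z ∈ dom a b, z.1 ^ 2 ≠ 0 := fun z hz => pow_ne_zero 2 (T.fst_ne_zero hz)
      have h6 : ContinuousOn (fun z : ℝ × S2 × E3 => ∑ i, T.rotTerm i z.1 z.2) (dom a b) :=
        continuousOn_finsetSum _ fun i _ => h3 i
      fun_prop (disch := assumption)
    exact (h.comp (f := fun r : ℝ => (r, z)) (by fun_prop) fun r hr => ⟨hr, hz⟩).congr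
      fun r hr => T.Fr_eq hr z
  rw [integral_Icc_eq_integral_Ioc, ← intervalIntegral.integral_of_le T.a_le_b]
  refine intervalIntegral.integral_eq_sub_of_hasDerivAt_of_le (f := fun r => T.F r z) T.a_le_b ?_ (fun r hr => ?_)
    (hFr.intervalIntegrable_of_Icc T.a_le_b)
  · exact T.continuousOn_F.comp (f := fun r : ℝ => (r, z)) (by fun_prop) fun r hr => ⟨hr, hz⟩
  · refine T.hasDerivAt_F ⟨hr.1.le, hr.2.le⟩ hz ?_
    filter_upwards [Ioo_mem_nhds hr.1 hr.2] with r' hr'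
    exact T.pt_mem ⟨hr'.1.le, hr'.2.le⟩ hz

/-- The transport inequality. -/
theorem ofReal_abs_sub_le :
    ENNReal.ofReal |(∫ z, T.F b z ∂sphereBundle) - ∫ z, T.F a z ∂sphereBundle| ≤
      ∫⁻ r in Set.Icc a b, ∫⁻ z, ENNReal.ofReal |T.source r z| ∂sphereBundle := by
  have ha : a ∈ Set.Icc a b := ⟨le_rfl, T.a_le_b⟩
  have hb : b ∈ Set.Icc a b := ⟨T.a_le_b, le_rfl⟩
  have hi : ∀ {r : ℝ}, r ∈ Set.Icc a b → Integrable (fun z => T.F r z) sphereBundle := fun hr =>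
    T.integrable_slice T.continuousOn_F hr fun z hz => T.F_eq_zero hr hz
  have hFr : IntegrableOn (fun z : ℝ × S2 × E3 => T.Fr z.1 z.2) (Set.Icc a b ×ˢ Set.univ)
      ((volume : Measure ℝ).prod sphereBundle) := by
    refine integrableOn_of_shell (c₁ := T.c₁) (c₂ := T.c₂) ?_ fun z hz h => T.Fr_eq_zero hz h
    have h1 := T.continuousOn_P
    have h2 := T.continuousOn_P'
    have h3 := continuousOn_weight T.w_cont
    have h4 := continuousOn_weight T.wr_cont
    have h5 : ContinuousOn (fun z : ℝ × S2 × E3 => T.dg z.1 z.2 (T.ptDeriv z.1 z.2)) (dom a b) := by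
      refine T.continuousOn_dg.clm_apply ?_
      have h1 : ContinuousOn (fun z : ℝ × S2 × E3 => T.H' z.1) (dom a b) :=
        T.H'_cont.comp continuousOn_fst fun z hz => hz.1
      have h := T.continuousOn_lapse
      have h0 : ∀ z ∈ dom a b, lapse M z.1 ^ 2 ≠ 0 := fun z hz => pow_ne_zero 2 (T.lapse_ne_zero hz)
      have h5 : ∀ z ∈ dom a b, z.1 ^ 2 ≠ 0 := fun z hz => pow_ne_zero 2 (T.fst_ne_zero hz)
      unfold ptDeriv momDeriv
      fun_prop (disch := assumption)
    refine ContinuousOn.mono ?_ T.shell_subset_dom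
    unfold Fr
    fun_prop
  have hFr' : Integrable (Function.uncurry fun r z => T.Fr r z)
      (((volume : Measure ℝ).restrict (Set.Icc a b)).prod sphereBundle) := by
    have h := hFr
    rw [IntegrableOn, ← Measure.prod_restrict, Measure.restrict_univ] at h
    exact h
  -- The fundamental theorem of calculus in `r` is applied at fixed `(e, y)`, and the integrations
  -- by parts at fixed `r`; Fubini connects the two.
  have key : (∫ z, T.F b z ∂sphereBundle) - ∫ z, T.F a z ∂sphereBundle =
      ∫ r in Set.Icc a b, ∫ z, T.source r z ∂sphereBundle := by
    rw [← integral_sub (hi hb) (hi ha)]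
    simp only [← T.integral_Fr_right]
    rw [← integral_integral_swap hFr']
    exact setIntegral_congr_fun measurableSet_Icc fun r hr => T.integral_Fr hr
  rw [key, ← Real.enorm_eq_ofReal_abs]
  refine (enorm_integral_le_lintegral_enorm _).trans (lintegral_mono fun r => ?_)
  refine (enorm_integral_le_lintegral_enorm _).trans (lintegral_mono fun z => ?_)
  rw [Real.enorm_eq_ofReal_abs]

end TransportData

/-! ### Truncations of the weights -/

theorem hasDerivAt_max_zero_sq (x : ℝ) : HasDerivAt (fun x : ℝ => max x 0 ^ 2) (2 * max x 0) x := by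
  rcases lt_trichotomy x 0 with h | rfl | h
  · rw [max_eq_right h.le, mul_zero]
    refine (hasDerivAt_const x (0 : ℝ)).congr_of_eventuallyEq ?_
    filter_upwards [Iio_mem_nhds h] with y hy
    rw [max_eq_right (le_of_lt hy)]; simp
  · rw [hasDerivAt_iff_tendsto_slope_zero]
    have h : Filter.Tendsto (fun t : ℝ => max t 0) (nhdsWithin 0 {0}ᶜ) (nhds 0) := by
      have : Continuous fun t : ℝ => max t 0 := by fun_prop
      simpa using (this.tendsto 0).mono_left nhdsWithin_le_nhds
    simp only [max_self, mul_zero, zero_add]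
    refine h.congr' ?_
    filter_upwards [self_mem_nhdsWithin] with t ht
    have ht' : t ≠ 0 := ht
    rcases le_total t 0 with h0 | h0
    · simp [max_eq_right h0]
    · rw [max_eq_left h0]; simp; field_simp
  · rw [max_eq_left h.le]
    refine ((hasDerivAt_pow 2 x).congr_of_eventuallyEq ?_).congr_deriv (by simp)
    filter_upwards [Ioi_mem_nhds h] with y hy
    rw [max_eq_left (le_of_lt hy)]

/-- A continuously differentiable approximation of the positive part. -/
def softPos (κ x : ℝ) : ℝ := Real.sqrt (max x 0 ^ 2 + κ ^ 2) - κ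

/-- Its derivative. -/
def softPos' (κ x : ℝ) : ℝ := max x 0 / Real.sqrt (max x 0 ^ 2 + κ ^ 2)

theorem hasDerivAt_softPos {κ : ℝ} (hκ : 0 < κ) (x : ℝ) :
    HasDerivAt (softPos κ) (softPos' κ x) x := by
  have h : max x 0 ^ 2 + κ ^ 2 ≠ 0 := by positivity
  refine ((((hasDerivAt_max_zero_sq x).add_const (κ ^ 2)).sqrt h).sub_const κ).congr_deriv ?_
  rw [softPos', mul_div_mul_left _ _ two_ne_zero]

theorem continuous_softPos' {κ : ℝ} (hκ : 0 < κ) : Continuous (softPos' κ) := by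
  have h : ∀ x : ℝ, Real.sqrt (max x 0 ^ 2 + κ ^ 2) ≠ 0 := fun x => by positivity
  unfold softPos'
  fun_prop (disch := assumption)

theorem softPos_nonneg {κ : ℝ} (hκ : 0 < κ) (x : ℝ) : 0 ≤ softPos κ x := by
  have h : κ ≤ Real.sqrt (max x 0 ^ 2 + κ ^ 2) := Real.le_sqrt_of_sq_le (by nlinarith [sq_nonneg (max x 0)])
  unfold softPos; linarith

theorem softPos_le {κ : ℝ} (hκ : 0 < κ) (x : ℝ) : softPos κ x ≤ max x 0 := by
  have h : Real.sqrt (max x 0 ^ 2 + κ ^ 2) ≤ max x 0 + κ :=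
    Real.sqrt_le_iff.mpr ⟨by positivity, by nlinarith [le_max_right x 0]⟩
  unfold softPos; linarith

theorem softPos_of_nonpos {κ x : ℝ} (hκ : 0 < κ) (hx : x ≤ 0) : softPos κ x = 0 :=
  le_antisymm ((softPos_le hκ x).trans (max_eq_right hx).le) (softPos_nonneg hκ x)

theorem softPos'_nonneg (κ x : ℝ) : 0 ≤ softPos' κ x := by unfold softPos'; positivity

theorem softPos'_le_one {κ : ℝ} (x : ℝ) : softPos' κ x ≤ 1 :=
  div_le_one_of_le₀ (Real.le_sqrt_of_sq_le (by nlinarith [sq_nonneg κ])) (Real.sqrt_nonneg _)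

theorem softPos'_of_nonpos {κ x : ℝ} (hx : x ≤ 0) : softPos' κ x = 0 := by
  simp [softPos', max_eq_right hx]

theorem tendsto_softPos {x : ℝ} (hx : 0 < x) {κ : ℕ → ℝ}
    (hκ : Filter.Tendsto κ Filter.atTop (nhds 0)) :
    Filter.Tendsto (fun n => softPos (κ n) x) Filter.atTop (nhds x) := by
  have h : Continuous fun κ => softPos κ x := by unfold softPos; fun_prop
  have h1 := (h.tendsto 0).comp hκ
  have h2 : softPos 0 x = x := by
    simp [softPos, max_eq_left hx.le, Real.sqrt_sq hx.le]
  rwa [h2] at h1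

theorem exists_truncation (n : ℕ) : ∃ ζ : ℝ → ℝ, ContDiff ℝ 1 ζ ∧ (∀ x, 0 ≤ ζ x) ∧ (∀ x, ζ x ≤ 1) ∧
    (∀ x, ((n : ℝ) + 2)⁻¹ ≤ x → x ≤ n + 2 → ζ x = 1) ∧
    ∃ k₁ k₂ : ℝ, 0 < k₁ ∧ 0 ≤ k₂ ∧ ∀ x, (x < k₁ ∨ k₂ < x) → ζ x = 0 ∧ deriv ζ x = 0 := by
  have hm : (2 : ℝ) ≤ (n : ℝ) + 2 := by have := Nat.cast_nonneg (α := ℝ) n; linarith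
  set m : ℝ := (n : ℝ) + 2
  have hi : m⁻¹ ≤ 1 / 2 := by rw [← one_div]; gcongr
  have hi0 : 0 < m⁻¹ := by positivity
  -- Centred at `m = n + 2`, the inner ball starts at `1/m` and the support at `1/(2m) > 0`. The
  -- shift by `2` gives `m⁻¹ ≤ 1/2 < m`, so the radii are positive.
  let f : ContDiffBump m := ⟨m - m⁻¹, m - m⁻¹ / 2, by linarith, by linarith⟩
  refine ⟨f, f.contDiff, fun x => f.nonneg, fun x => f.le_one, ?_, m⁻¹ / 2, 2 * m, by positivity,
    by positivity, ?_⟩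
  · intro x h1 h2
    refine f.one_of_mem_closedBall ?_
    rw [Metric.mem_closedBall, Real.dist_eq, abs_le]
    change -(m - m⁻¹) ≤ x - m ∧ x - m ≤ m - m⁻¹
    constructor <;> linarith
  · intro x hx
    have hz : ∀ᶠ y in nhds x, f y = 0 := by
      have h : ∀ y, (y < m⁻¹ / 2 ∨ 2 * m < y) → f y = 0 := fun y hy => by
        refine f.zero_of_le_dist ?_
        change m - m⁻¹ / 2 ≤ dist y m
        rw [Real.dist_eq]
        rcases hy with hy | hy
        · rw [abs_of_nonpos (by linarith)]; linarith
        · rw [abs_of_nonneg (by linarith)]; linarith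
      rcases hx with hx | hx
      · filter_upwards [Iio_mem_nhds hx] with y hy using h y (Or.inl hy)
      · filter_upwards [Ioi_mem_nhds hx] with y hy using h y (Or.inr hy)
    refine ⟨hz.self_of_nhds, ?_⟩
    have h : (f : ℝ → ℝ) =ᶠ[nhds x] fun _ => 0 := hz
    rw [h.deriv_eq, deriv_const]

/-! ### The transport inequality for a weight -/

/-- A weight `j(r) μ(|v_t|, |v̸|)`. -/
structure Weight (M : ℝ) where
  j : ℝ → ℝ
  j' : ℝ → ℝ
  μ : ℝ → ℝ → ℝ
  μ' : ℝ → ℝ → ℝ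
  j_nonneg : ∀ r, 2 * M < r → 0 ≤ j r
  j_deriv : ∀ r, 2 * M < r → HasDerivAt j (j' r) r
  j'_cont : ContinuousOn j' (Set.Ioi (2 * M))
  μ_nonneg : ∀ E L, 0 < E → 0 ≤ L → 0 ≤ μ E L
  μ_deriv : ∀ E L, 0 < E → 0 ≤ L → HasDerivAt (fun E => μ E L) (μ' E L) E
  μ_cont : ContinuousOn (fun z : ℝ × ℝ => μ z.1 z.2) (Set.Ioi 0 ×ˢ Set.Ici 0)
  μ'_cont : ContinuousOn (fun z : ℝ × ℝ => μ' z.1 z.2) (Set.Ioi 0 ×ˢ Set.Ici 0)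

/-- `v_{r*}² j μ` on `ε v_{r*} > 0`. -/
def Weight.density {M : ℝ} (W : Weight M) (ε r v L : ℝ) : ℝ :=
  if 0 < ε * v then v ^ 2 * (W.j r * W.μ (energy M r v L) L) else 0

/-- The point of the phase space with coordinates `(r, e, y)` on the graph of `H`. -/
def graphPoint (M : ℝ) (H : ℝ → ℝ) (r : ℝ) (z : S2 × E3) : Phase :=
  (H r, r • (z.1 : E3), mom M r z.1 z.2)

theorem hasDerivAt_energy_r {M r v L : ℝ} (hM : 0 < M) (hr : 2 * M < r) (h : v ≠ 0 ∨ L ≠ 0) :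
    HasDerivAt (fun r => energy M r v L) (potDeriv M r * L ^ 2 / (2 * energy M r v L)) r := by
  have h0 := (energy_pos_iff hM hr v L).mpr h
  exact ((((hasDerivAt_pot M (by linarith)).mul_const (L ^ 2)).const_add (v ^ 2)).sqrt
    (Real.sqrt_pos.mp h0).ne')

theorem hasDerivAt_energy_v {M r v L : ℝ} (hM : 0 < M) (hr : 2 * M < r) (h : v ≠ 0 ∨ L ≠ 0) :
    HasDerivAt (fun v => energy M r v L) (v / energy M r v L) v := by
  have h0 := (energy_pos_iff hM hr v L).mpr h
  refine (((hasDerivAt_pow 2 v).add_const (lapse M r / r ^ 2 * L ^ 2)).sqrt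
    (Real.sqrt_pos.mp h0).ne').congr_deriv ?_
  simp only [energy, Nat.cast_ofNat, Nat.add_one_sub_one, pow_one]
  rw [mul_div_mul_left _ _ two_ne_zero]

theorem abs_le_energy {M r : ℝ} (hM : 0 < M) (hr : 2 * M < r) (v L : ℝ) : |v| ≤ energy M r v L := by
  have := lapse_pos hM hr
  exact Real.abs_le_sqrt (by have : 0 ≤ lapse M r / r ^ 2 * L ^ 2 := by positivity
                             linarith)

section Truncated

variable {M a b : ℝ} (W : Weight M) (ε κ : ℝ) (ζ : ℝ → ℝ)

/-- The truncated weight. -/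
def truncated (r v L : ℝ) : ℝ :=
  ε * softPos κ (ε * v) * (W.j r * (ζ (energy M r v L) * W.μ (energy M r v L) L))

/-- The derivative in `|v_t|` of the truncated weight. -/
def truncatedE (r v L : ℝ) : ℝ :=
  ε * softPos κ (ε * v) * (W.j r * (deriv ζ (energy M r v L) * W.μ (energy M r v L) L
    + ζ (energy M r v L) * W.μ' (energy M r v L) L))

/-- The derivative in `r` of the truncated weight. -/
def truncatedR (r v L : ℝ) : ℝ :=
  ε * softPos κ (ε * v) * (W.j' r * (ζ (energy M r v L) * W.μ (energy M r v L) L))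
    + truncatedE W ε κ ζ r v L * (potDeriv M r * L ^ 2 / (2 * energy M r v L))

/-- The derivative in `v_{r*}` of the truncated weight. -/
def truncatedV (r v L : ℝ) : ℝ :=
  ε * (softPos' κ (ε * v) * ε) * (W.j r * (ζ (energy M r v L) * W.μ (energy M r v L) L))
    + truncatedE W ε κ ζ r v L * (v / energy M r v L)

variable {W ε κ ζ}

theorem hasDerivAt_truncated_r (hM : 0 < M) (hζ : ContDiff ℝ 1 ζ) {r v L : ℝ} (hr : 2 * M < r)
    (hL : 0 ≤ L) (h : v ≠ 0 ∨ L ≠ 0) :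
    HasDerivAt (fun r => truncated W ε κ ζ r v L) (truncatedR W ε κ ζ r v L) r := by
  have hE := (energy_pos_iff hM hr v L).mpr h
  have h1 := ((hζ.differentiable one_ne_zero).differentiableAt.hasDerivAt
    (x := energy M r v L)).mul (W.μ_deriv _ L hE hL)
  have h2 := h1.comp r (hasDerivAt_energy_r hM hr h)
  refine (((W.j_deriv r hr).mul h2).const_mul (ε * softPos κ (ε * v))).congr_deriv ?_
  simp only [truncatedR, truncatedE, Function.comp, Pi.mul_apply]
  ring

theorem hasDerivAt_truncated_v (hM : 0 < M) (hκ : 0 < κ) (hζ : ContDiff ℝ 1 ζ) {r v L : ℝ}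
    (hr : 2 * M < r) (hL : 0 ≤ L) (h : v ≠ 0 ∨ L ≠ 0) :
    HasDerivAt (fun v => truncated W ε κ ζ r v L) (truncatedV W ε κ ζ r v L) v := by
  have hE := (energy_pos_iff hM hr v L).mpr h
  have h1 := ((hζ.differentiable one_ne_zero).differentiableAt.hasDerivAt
    (x := energy M r v L)).mul (W.μ_deriv _ L hE hL)
  have h2 := h1.comp v (hasDerivAt_energy_v hM hr h)
  have h3 : HasDerivAt (fun v => softPos κ (ε * v)) (softPos' κ (ε * v) * ε) v :=
    (hasDerivAt_softPos hκ (ε * v)).comp v (by simpa using (hasDerivAt_id v).const_mul ε)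
  refine ((h3.const_mul ε).mul (h2.const_mul (W.j r))).congr_deriv ?_
  simp only [truncatedV, truncatedE, Function.comp, Pi.mul_apply]
  ring

theorem continuousOn_energy (hM : 0 < M) (ha : 2 * M < a) :
    ContinuousOn (fun z : ℝ × ℝ × ℝ => energy M z.1 z.2.1 z.2.2) (weightDomain a b) := by
  have h : ∀ z ∈ weightDomain a b, z.1 ≠ 0 := fun z hz => by
    have := hz.1.1
    linarith
  have h2 : ∀ z ∈ weightDomain a b, z.1 ^ 2 ≠ 0 := fun z hz => pow_ne_zero 2 (h z hz)
  unfold energy lapse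
  fun_prop (disch := assumption)

theorem energy_pos_of_mem (hM : 0 < M) (ha : 2 * M < a) {z : ℝ × ℝ × ℝ} (hz : z ∈ weightDomain a b) :
    0 < energy M z.1 z.2.1 z.2.2 :=
  (energy_pos_iff hM (ha.trans_le hz.1.1) _ _).mpr hz.2.2

theorem continuousOn_comp_energy (hM : 0 < M) (ha : 2 * M < a) {u : ℝ → ℝ → ℝ}
    (hu : ContinuousOn (fun z : ℝ × ℝ => u z.1 z.2) (Set.Ioi 0 ×ˢ Set.Ici 0)) :
    ContinuousOn (fun z : ℝ × ℝ × ℝ => u (energy M z.1 z.2.1 z.2.2) z.2.2) (weightDomain a b) := by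
  have h := continuousOn_energy (b := b) hM ha
  exact hu.comp (f := fun z : ℝ × ℝ × ℝ => (energy M z.1 z.2.1 z.2.2, z.2.2)) (by fun_prop)
    fun z hz => ⟨energy_pos_of_mem hM ha hz, hz.2.1⟩

theorem continuousOn_comp_r (ha : 2 * M < a) {u : ℝ → ℝ} (hu : ContinuousOn u (Set.Ioi (2 * M))) :
    ContinuousOn (fun z : ℝ × ℝ × ℝ => u z.1) (weightDomain a b) :=
  hu.comp continuousOn_fst fun _ hz => ha.trans_le hz.1.1

theorem continuousOn_j (W : Weight M) : ContinuousOn W.j (Set.Ioi (2 * M)) := fun r hr =>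
  (W.j_deriv r hr).continuousAt.continuousWithinAt

theorem continuous_softPos (κ : ℝ) : Continuous (softPos κ) := by unfold softPos; fun_prop

theorem continuousOn_potDeriv_Ioi (hM : 0 < M) : ContinuousOn (potDeriv M) (Set.Ioi (2 * M)) := by
  have h0 : ∀ r ∈ Set.Ioi (2 * M), r ≠ 0 := fun r hr => by
    have : 2 * M < r := hr
    linarith
  have h3 : ∀ r ∈ Set.Ioi (2 * M), r ^ 3 ≠ 0 := fun r hr => pow_ne_zero 3 (h0 r hr)
  have h4 : ∀ r ∈ Set.Ioi (2 * M), r ^ 4 ≠ 0 := fun r hr => pow_ne_zero 4 (h0 r hr)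
  unfold potDeriv
  fun_prop (disch := assumption)

theorem continuousOn_truncated (hM : 0 < M) (ha : 2 * M < a) (hζ : ContDiff ℝ 1 ζ) :
    ContinuousOn (fun z : ℝ × ℝ × ℝ => truncated W ε κ ζ z.1 z.2.1 z.2.2) (weightDomain a b) := by
  have h1 := continuousOn_energy (b := b) hM ha
  have h2 := continuousOn_comp_energy (b := b) hM ha W.μ_cont
  have h3 := continuousOn_comp_r (b := b) ha (continuousOn_j W)
  have h4 := hζ.continuous.comp_continuousOn h1
  have h5 : ContinuousOn (fun z : ℝ × ℝ × ℝ => softPos κ (ε * z.2.1)) (weightDomain a b) :=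
    ((continuous_softPos κ).comp (by fun_prop : Continuous fun z : ℝ × ℝ × ℝ => ε * z.2.1)).continuousOn
  simp only [Function.comp_def] at h4
  exact (continuousOn_const.mul h5).mul (h3.mul (h4.mul h2))

theorem continuousOn_truncatedE (hM : 0 < M) (ha : 2 * M < a) (hζ : ContDiff ℝ 1 ζ) :
    ContinuousOn (fun z : ℝ × ℝ × ℝ => truncatedE W ε κ ζ z.1 z.2.1 z.2.2) (weightDomain a b) := by
  have h1 := continuousOn_energy (b := b) hM ha
  have h2 := continuousOn_comp_energy (b := b) hM ha W.μ_cont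
  have h2' := continuousOn_comp_energy (b := b) hM ha W.μ'_cont
  have h3 := continuousOn_comp_r (b := b) ha (continuousOn_j W)
  have h4 := hζ.continuous.comp_continuousOn h1
  have h4' := (hζ.continuous_deriv le_rfl).comp_continuousOn h1
  have h5 : ContinuousOn (fun z : ℝ × ℝ × ℝ => softPos κ (ε * z.2.1)) (weightDomain a b) :=
    ((continuous_softPos κ).comp (by fun_prop : Continuous fun z : ℝ × ℝ × ℝ => ε * z.2.1)).continuousOn
  simp only [Function.comp_def] at h4 h4'
  exact (continuousOn_const.mul h5).mul (h3.mul ((h4'.mul h2).add (h4.mul h2')))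

theorem continuousOn_truncatedR (hM : 0 < M) (ha : 2 * M < a) (hζ : ContDiff ℝ 1 ζ) :
    ContinuousOn (fun z : ℝ × ℝ × ℝ => truncatedR W ε κ ζ z.1 z.2.1 z.2.2) (weightDomain a b) := by
  have h1 := continuousOn_energy (b := b) hM ha
  have h2 := continuousOn_comp_energy (b := b) hM ha W.μ_cont
  have h3 := continuousOn_comp_r (b := b) ha W.j'_cont
  have h4 := hζ.continuous.comp_continuousOn h1
  have h5 : ContinuousOn (fun z : ℝ × ℝ × ℝ => softPos κ (ε * z.2.1)) (weightDomain a b) :=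
    ((continuous_softPos κ).comp (by fun_prop : Continuous fun z : ℝ × ℝ × ℝ => ε * z.2.1)).continuousOn
  have h6 := continuousOn_truncatedE (W := W) (ε := ε) (κ := κ) (b := b) hM ha hζ
  have h7 := continuousOn_comp_r (b := b) ha (continuousOn_potDeriv_Ioi hM)
  have h8 : ∀ z ∈ weightDomain a b, 2 * energy M z.1 z.2.1 z.2.2 ≠ 0 := fun z hz =>
    mul_ne_zero two_ne_zero (energy_pos_of_mem hM ha hz).ne'
  simp only [Function.comp_def] at h4
  refine ((continuousOn_const.mul h5).mul (h3.mul (h4.mul h2))).add (h6.mul (ContinuousOn.div ?_ ?_ h8))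
  · exact h7.mul (by fun_prop)
  · exact continuousOn_const.mul h1

theorem continuousOn_truncatedV (hM : 0 < M) (ha : 2 * M < a) (hκ : 0 < κ) (hζ : ContDiff ℝ 1 ζ) :
    ContinuousOn (fun z : ℝ × ℝ × ℝ => truncatedV W ε κ ζ z.1 z.2.1 z.2.2) (weightDomain a b) := by
  have h1 := continuousOn_energy (b := b) hM ha
  have h2 := continuousOn_comp_energy (b := b) hM ha W.μ_cont
  have h3 := continuousOn_comp_r (b := b) ha (continuousOn_j W)
  have h4 := hζ.continuous.comp_continuousOn h1
  have h5 : ContinuousOn (fun z : ℝ × ℝ × ℝ => softPos' κ (ε * z.2.1)) (weightDomain a b) :=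
    ((continuous_softPos' hκ).comp (by fun_prop : Continuous fun z : ℝ × ℝ × ℝ => ε * z.2.1)).continuousOn
  have h6 := continuousOn_truncatedE (W := W) (ε := ε) (κ := κ) (b := b) hM ha hζ
  have h8 : ∀ z ∈ weightDomain a b, energy M z.1 z.2.1 z.2.2 ≠ 0 := fun z hz =>
    (energy_pos_of_mem hM ha hz).ne'
  simp only [Function.comp_def] at h4
  exact ((continuousOn_const.mul (h5.mul continuousOn_const)).mul (h3.mul (h4.mul h2))).add
    (h6.mul (ContinuousOn.div (by fun_prop) h1 h8))

/-- The truncation `ζ` acts on `|v_t|`. For `r` in a compact interval away from the horizon, `lapse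
/ r²` lies between positive constants, so `|v_t|²` is comparable with `v² + L²` and a fixed shell
works for all these radii. -/
theorem truncated_supp (hM : 0 < M) (ha : 2 * M < a) (hab : a ≤ b) {k₁ k₂ : ℝ} (hk₁ : 0 < k₁)
    (hk₂ : 0 ≤ k₂) (hk : ∀ x, (x < k₁ ∨ k₂ < x) → ζ x = 0 ∧ deriv ζ x = 0) :
    ∃ c₁ c₂ : ℝ, 0 < c₁ ∧ 0 ≤ c₂ ∧ ∀ r ∈ Set.Icc a b, ∀ v L, 0 ≤ L →
      (v ^ 2 + L ^ 2 < c₁ ^ 2 ∨ c₂ ^ 2 < v ^ 2 + L ^ 2) →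
      truncated W ε κ ζ r v L = 0 ∧ truncatedR W ε κ ζ r v L = 0 ∧ truncatedV W ε κ ζ r v L = 0 := by
  have ha0 : 0 < a := by linarith
  have hb0 : 0 < b := by linarith
  have hla := lapse_pos hM ha
  have hmono : ∀ r ∈ Set.Icc a b, lapse M a ≤ lapse M r := fun r hr => by
    unfold lapse
    have : 2 * M / r ≤ 2 * M / a := div_le_div_of_nonneg_left (by positivity) ha0 hr.1
    linarith
  have hup : ∀ r ∈ Set.Icc a b, lapse M r / r ^ 2 ≤ 1 / a ^ 2 := fun r hr => by
    have hr0 : 0 < r := ha0.trans_le hr.1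
    have := lapse_lt_one hM (ha.trans_le hr.1)
    have h2 : a ^ 2 ≤ r ^ 2 := pow_le_pow_left₀ ha0.le hr.1 2
    gcongr
  have hlo : ∀ r ∈ Set.Icc a b, lapse M a / b ^ 2 ≤ lapse M r / r ^ 2 := fun r hr => by
    have hr0 : 0 < r := ha0.trans_le hr.1
    have h2 : r ^ 2 ≤ b ^ 2 := pow_le_pow_left₀ hr0.le hr.2 2
    have := hmono r hr
    have h3 : 0 ≤ lapse M r := hla.le.trans this
    gcongr
  set V₁ := 1 / a ^ 2 with hV₁
  set V₀ := lapse M a / b ^ 2 with hV₀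
  have hV₁0 : 0 < V₁ := by positivity
  have hV₀0 : 0 < V₀ := by positivity
  have hz : ∀ r ∈ Set.Icc a b, ∀ v L : ℝ, (energy M r v L < k₁ ∨ k₂ < energy M r v L) →
      truncated W ε κ ζ r v L = 0 ∧ truncatedR W ε κ ζ r v L = 0 ∧
        truncatedV W ε κ ζ r v L = 0 := fun r _ v L h => by
    obtain ⟨h1, h2⟩ := hk _ h
    simp [truncated, truncatedR, truncatedV, truncatedE, h1, h2]
  refine ⟨k₁ / Real.sqrt (1 + V₁), k₂ * Real.sqrt (1 + 1 / V₀), by positivity, by positivity, ?_⟩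
  intro r hr v L _ h
  have hE := energy_sq hM (ha.trans_le hr.1) v L
  have hE0 := energy_nonneg M r v L
  refine hz r hr v L ?_
  rw [div_pow, mul_pow, Real.sq_sqrt (by positivity), Real.sq_sqrt (by positivity),
    lt_div_iff₀ (by positivity)] at h
  rcases h with h | h
  · left
    refine lt_of_pow_lt_pow_left₀ 2 hk₁.le ?_
    rw [hE]
    nlinarith [hup r hr, sq_nonneg v, sq_nonneg L, mul_le_mul_of_nonneg_right (hup r hr) (sq_nonneg L),
      mul_nonneg hV₁0.le (sq_nonneg v)]
  · right
    refine lt_of_pow_lt_pow_left₀ 2 hE0 ?_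
    rw [hE]
    have h1 : V₀ * L ^ 2 ≤ lapse M r / r ^ 2 * L ^ 2 :=
      mul_le_mul_of_nonneg_right (hlo r hr) (sq_nonneg L)
    have h2 : v ^ 2 + L ^ 2 ≤ (v ^ 2 + lapse M r / r ^ 2 * L ^ 2) * (1 + 1 / V₀) := by
      have h3 : L ^ 2 = V₀ * L ^ 2 * (1 / V₀) := by field_simp
      have h4 : V₀ * L ^ 2 * (1 / V₀) ≤ lapse M r / r ^ 2 * L ^ 2 * (1 / V₀) :=
        mul_le_mul_of_nonneg_right h1 (by positivity)
      have h5 : 0 ≤ v ^ 2 * (1 / V₀) := by positivity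
      have h6 : 0 ≤ lapse M r / r ^ 2 * L ^ 2 := le_trans (by positivity) h1
      nlinarith
    exact lt_of_mul_lt_mul_right (h.trans_le h2) (by positivity)

end Truncated

theorem hasDerivAt_abs_rpow' {z : ℝ} (hz : 3 < z) (x : ℝ) :
    HasDerivAt (fun x : ℝ => |x| ^ z) (z * |x| ^ (z - 2) * x) x :=
  hasDerivAt_abs_rpow x (by linarith)

theorem abs_rpow_mul_le {z : ℝ} (hz : 3 < z) (x y : ℝ) :
    |z * |x| ^ (z - 2) * x| * |y| ≤ z * (|x| ^ z + |y| ^ z) := by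
  have h := rpow_mul_mul_le hz (S := |x| ^ z + |y| ^ z) (abs_nonneg x) (abs_nonneg x) (abs_nonneg y)
    (by have := Real.rpow_nonneg (abs_nonneg y) z; linarith)
    (by have := Real.rpow_nonneg (abs_nonneg y) z; linarith)
    (by have := Real.rpow_nonneg (abs_nonneg x) z; linarith)
  rw [abs_mul, abs_mul, abs_of_pos (by linarith : 0 < z),
    abs_of_nonneg (Real.rpow_nonneg (abs_nonneg x) _)]
  calc _ = z * (|x| ^ (z - 2) * |x| * |y|) := by ring
    _ ≤ _ := by gcongr

/-- The assumptions of the transport inequality: a solution `g`, a radial graph `t = H r` over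
`[a, b]`, the sign `ε` of `v_{r*}`, a weight, and a bound `S` of the source term. -/
structure TransportSetup {M : ℝ} (𝓕 : Foliation M) (a b z : ℝ) where
  g : Phase → ℝ
  H : ℝ → ℝ
  H' : ℝ → ℝ
  W : Weight M
  ε : ℝ
  S : ℝ → ℝ → ℝ → ℝ
  hM : 0 < M
  lt_a : 2 * M < a
  a_le_b : a ≤ b
  hz : 3 < z
  sign : ε ^ 2 = 1
  g_smooth : ContDiffOn ℝ 1 g 𝓕.phaseRegion
  g_liouville : ∀ y ∈ 𝓕.phaseRegion, liouville M 𝓕.phaseRegion g y = 0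
  height_le : ∀ r ∈ Set.Icc a b, 𝓕.height r ≤ H r
  H_deriv : ∀ r ∈ Set.Icc a b, HasDerivAt H (H' r) r
  H'_cont : ContinuousOn H' (Set.Icc a b)
  S_nonneg : ∀ r ∈ Set.Icc a b, ∀ v L, 0 ≤ L → 0 ≤ S r v L
  source_le : ∀ r ∈ Set.Icc a b, ∀ v L, 0 ≤ L → 0 < ε * v →
    W.μ (energy M r v L) L * (v ^ 2 * |W.j' r| + 1 / 2 * L ^ 2 * |potDeriv M r| * W.j r
      + z * |v| * W.j r * |energy M r v L / lapse M r - H' r * v|) ≤ S r v L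

namespace TransportSetup

variable {M : ℝ} {𝓕 : Foliation M} {a b z : ℝ} (T : TransportSetup 𝓕 a b z)

theorem abs_ε : |T.ε| = 1 := by
  rcases mul_self_eq_one_iff.mp (by rw [← sq, T.sign] : T.ε * T.ε = 1) with h | h <;> simp [h]

/-- The transported quantity. -/
def K (r : ℝ) : ℝ≥0∞ :=
  ∫⁻ x, ENNReal.ofReal (T.W.density T.ε r (vr x) (va x) * |T.g (graphPoint M T.H r x)| ^ z)
    ∂sphereBundle

/-- The bound of the variation of the transported quantity. -/
def R : ℝ≥0∞ :=
  ∫⁻ r in Set.Icc a b, ∫⁻ x, ENNReal.ofReal ((|T.g (graphPoint M T.H r x)| ^ z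
    + |dT 𝓕.phaseRegion T.g (graphPoint M T.H r x)| ^ z) * T.S r (vr x) (va x)) ∂sphereBundle

/-- The truncated data. -/
theorem exists_data (n : ℕ) : ∃ (ζ : ℝ → ℝ) (D : TransportData 𝓕 a b),
    (∀ x, 0 ≤ ζ x) ∧ (∀ x, ζ x ≤ 1) ∧ (∀ x, ((n : ℝ) + 2)⁻¹ ≤ x → x ≤ n + 2 → ζ x = 1) ∧
    D.g = T.g ∧ D.H = T.H ∧ D.H' = T.H' ∧ D.P = (fun x => |x| ^ z) ∧
    D.P' = (fun x => z * |x| ^ (z - 2) * x) ∧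
    D.w = truncated T.W T.ε ((n : ℝ) + 1)⁻¹ ζ ∧ D.wr = truncatedR T.W T.ε ((n : ℝ) + 1)⁻¹ ζ ∧
    D.wv = truncatedV T.W T.ε ((n : ℝ) + 1)⁻¹ ζ := by
  obtain ⟨ζ, hζ, hζ0, hζ1, hζ2, k₁, k₂, hk₁, hk₂, hk⟩ := exists_truncation n
  obtain ⟨c₁, c₂, hc₁, hc₂, hsupp⟩ := truncated_supp (W := T.W) (ε := T.ε) (κ := ((n : ℝ) + 1)⁻¹)
    T.hM T.lt_a T.a_le_b hk₁ hk₂ hk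
  have hκ : 0 < ((n : ℝ) + 1)⁻¹ := by positivity
  have hlt : ∀ y ∈ weightDomain a b, 2 * M < y.1 := fun y hy => T.lt_a.trans_le hy.1.1
  refine ⟨ζ, ⟨T.g, T.H, T.H', fun x => |x| ^ z, fun x => z * |x| ^ (z - 2) * x,
    truncated T.W T.ε ((n : ℝ) + 1)⁻¹ ζ, truncatedR T.W T.ε ((n : ℝ) + 1)⁻¹ ζ,
    truncatedV T.W T.ε ((n : ℝ) + 1)⁻¹ ζ, c₁, c₂, T.hM, T.lt_a, T.a_le_b, hc₁, hc₂, T.g_smooth,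
    T.g_liouville, T.height_le, T.H_deriv, T.H'_cont, hasDerivAt_abs_rpow' T.hz, ?_,
    fun y hy => hasDerivAt_truncated_r T.hM hζ (hlt y hy) hy.2.1 hy.2.2,
    fun y hy => hasDerivAt_truncated_v T.hM hκ hζ (hlt y hy) hy.2.1 hy.2.2,
    continuousOn_truncated T.hM T.lt_a hζ, continuousOn_truncatedR T.hM T.lt_a hζ,
    continuousOn_truncatedV T.hM T.lt_a hκ hζ, hsupp⟩, hζ0, hζ1, hζ2, rfl, rfl, rfl, rfl, rfl, rfl,
    rfl, rfl⟩
  exact continuous_iff_continuousAt.mpr fun x => (hasDerivAt_abs_rpow_mul T.hz x).continuousAt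

/-- The bound is uniform in `n`. The truncation enters only through `0 ≤ ζ ≤ 1`, the bound of
`softPos` by `|v_{r*}|` and `softPos' ≤ 1`, never through the derivative of `ζ`. -/
theorem abs_source_le (n : ℕ) {ζ : ℝ → ℝ} (D : TransportData 𝓕 a b)
    (hζ0 : ∀ x, 0 ≤ ζ x) (hζ1 : ∀ x, ζ x ≤ 1) (hg : D.g = T.g) (hH : D.H = T.H) (hH' : D.H' = T.H')
    (hP : D.P = fun x => |x| ^ z) (hP' : D.P' = fun x => z * |x| ^ (z - 2) * x)
    (hw : D.w = truncated T.W T.ε ((n : ℝ) + 1)⁻¹ ζ)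
    (hwr : D.wr = truncatedR T.W T.ε ((n : ℝ) + 1)⁻¹ ζ)
    (hwv : D.wv = truncatedV T.W T.ε ((n : ℝ) + 1)⁻¹ ζ) {r : ℝ} (hr : r ∈ Set.Icc a b)
    (x : S2 × E3) :
    |D.source r x| ≤ (|T.g (graphPoint M T.H r x)| ^ z
      + |dT 𝓕.phaseRegion T.g (graphPoint M T.H r x)| ^ z) * T.S r (vr x) (va x) := by
  have hr2 : 2 * M < r := T.lt_a.trans_le hr.1
  have hL : 0 ≤ va x := norm_nonneg _
  have hκ : 0 < ((n : ℝ) + 1)⁻¹ := by positivity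
  have hpt : D.pt r x = graphPoint M T.H r x := by simp only [TransportData.pt, hH, graphPoint]
  simp only [TransportData.source, TransportData.gt, TransportData.Φ, hpt, hg, hH', hP, hP', hw, hwr,
    hwv]
  have hS := T.S_nonneg r hr (vr x) (va x) hL
  set G := |T.g (graphPoint M T.H r x)| ^ z with hG
  set Gt := |dT 𝓕.phaseRegion T.g (graphPoint M T.H r x)| ^ z with hGt
  have hG0 : 0 ≤ G := Real.rpow_nonneg (abs_nonneg _) _
  have hGt0 : 0 ≤ Gt := Real.rpow_nonneg (abs_nonneg _) _
  by_cases hv : 0 < T.ε * vr x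
  swap
  · have h1 := softPos_of_nonpos hκ (not_lt.mp hv)
    have h2 := softPos'_of_nonpos (κ := ((n : ℝ) + 1)⁻¹) (not_lt.mp hv)
    simp only [truncated, truncatedR, truncatedV, truncatedE, h1, h2, mul_zero, zero_mul, add_zero,
      sub_zero, abs_zero]
    positivity
  have hv0 : vr x ≠ 0 := fun h => by simp [h] at hv
  have hE : 0 < energy M r (vr x) (va x) := (energy_pos_iff T.hM hr2 _ _).mpr (Or.inl hv0)
  have hsrc := T.source_le r hr (vr x) (va x) hL hv
  set E := energy M r (vr x) (va x)
  set Φ := E / lapse M r - T.H' r * vr x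
  have hμ := T.W.μ_nonneg E (va x) hE hL
  have hj := T.W.j_nonneg r hr2
  set m := T.W.μ E (va x)
  have habs : T.ε * vr x = |vr x| := by
    rw [← abs_of_pos hv, abs_mul, T.abs_ε, one_mul]
  have hη0 := softPos_nonneg hκ (T.ε * vr x)
  have hη1 : softPos ((n : ℝ) + 1)⁻¹ (T.ε * vr x) ≤ |vr x| :=
    (softPos_le hκ _).trans (by rw [habs]; simp)
  have hθ0 := softPos'_nonneg ((n : ℝ) + 1)⁻¹ (T.ε * vr x)
  have hθ1 := softPos'_le_one (κ := ((n : ℝ) + 1)⁻¹) (T.ε * vr x)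
  set η := softPos ((n : ℝ) + 1)⁻¹ (T.ε * vr x)
  set θ := softPos' ((n : ℝ) + 1)⁻¹ (T.ε * vr x)
  have hε1 : |T.ε| = 1 := T.abs_ε
  -- Conservation of `|v_t|` reads `v ∂_r E = (1/2) L² potDeriv ∂_v E`. All terms with derivatives
  -- of `ζ` or `μ` therefore cancel; only `j'` and the derivative of the additional factor in
  -- `v_{r*}` survive.
  have hmain : vr x * truncatedR T.W T.ε ((n : ℝ) + 1)⁻¹ ζ r (vr x) (va x)
      - 1 / 2 * va x ^ 2 * potDeriv M r * truncatedV T.W T.ε ((n : ℝ) + 1)⁻¹ ζ r (vr x) (va x)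
      = (ζ E * m) * (T.ε * vr x * η * T.W.j' r - 1 / 2 * va x ^ 2 * potDeriv M r * θ * T.W.j r) := by
    have hE' : E ≠ 0 := hE.ne'
    have h2 : T.ε * (θ * T.ε) = θ := by linear_combination θ * T.sign
    simp only [truncatedR, truncatedV]
    change vr x * (T.ε * η * (T.W.j' r * (ζ E * m)) + _ * (_ / (2 * E)))
      - 1 / 2 * va x ^ 2 * potDeriv M r * (T.ε * (θ * T.ε) * (T.W.j r * (ζ E * m)) + _ * (_ / E)) = _
    rw [h2]
    field_simp
    ring
  rw [hmain]
  have hζE0 := hζ0 E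
  have hζE1 := hζ1 E
  have hA : |T.ε * vr x * η * T.W.j' r - 1 / 2 * va x ^ 2 * potDeriv M r * θ * T.W.j r| ≤
      vr x ^ 2 * |T.W.j' r| + 1 / 2 * va x ^ 2 * |potDeriv M r| * T.W.j r := by
    refine (abs_sub _ _).trans (add_le_add ?_ ?_)
    · rw [abs_mul, abs_mul, habs, abs_abs, abs_of_nonneg hη0, ← sq_abs (vr x), sq]
      gcongr
    · rw [abs_mul, abs_mul, abs_mul, abs_of_nonneg hj, abs_of_nonneg hθ0,
        abs_of_nonneg (by positivity : 0 ≤ 1 / 2 * va x ^ 2)]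
      have : 1 / 2 * va x ^ 2 * |potDeriv M r| * θ ≤ 1 / 2 * va x ^ 2 * |potDeriv M r| * 1 := by
        gcongr
      rw [mul_one] at this
      gcongr
  have hw1 : |truncated T.W T.ε ((n : ℝ) + 1)⁻¹ ζ r (vr x) (va x)| ≤ m * (|vr x| * T.W.j r) := by
    change |T.ε * η * (T.W.j r * (ζ E * m))| ≤ _
    rw [abs_mul, abs_mul, hε1, one_mul, abs_of_nonneg hη0, abs_of_nonneg (by positivity)]
    calc η * (T.W.j r * (ζ E * m)) ≤ |vr x| * (T.W.j r * (1 * m)) := by gcongr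
      _ = _ := by ring
  have hY := abs_rpow_mul_le T.hz (T.g (graphPoint M T.H r x))
    (dT 𝓕.phaseRegion T.g (graphPoint M T.H r x))
  calc _ ≤ |ζ E * m * (T.ε * vr x * η * T.W.j' r - 1 / 2 * va x ^ 2 * potDeriv M r * θ * T.W.j r) * G|
        + |truncated T.W T.ε ((n : ℝ) + 1)⁻¹ ζ r (vr x) (va x)
          * (z * |T.g (graphPoint M T.H r x)| ^ (z - 2) * T.g (graphPoint M T.H r x))
          * (Φ * dT 𝓕.phaseRegion T.g (graphPoint M T.H r x))| := abs_sub _ _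
    _ ≤ m * (vr x ^ 2 * |T.W.j' r| + 1 / 2 * va x ^ 2 * |potDeriv M r| * T.W.j r) * (G + Gt)
        + m * (|vr x| * T.W.j r) * |Φ| * (z * (G + Gt)) := by
      refine add_le_add ?_ ?_
      · rw [abs_mul, abs_mul, abs_of_nonneg hG0, abs_of_nonneg (by positivity : 0 ≤ ζ E * m)]
        have h1 : ζ E * m ≤ m := by nlinarith
        have h2 : G ≤ G + Gt := by linarith
        gcongr
      · rw [abs_mul, abs_mul, abs_mul Φ]
        calc _ = |truncated T.W T.ε ((n : ℝ) + 1)⁻¹ ζ r (vr x) (va x)| * |Φ| *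
            (|z * |T.g (graphPoint M T.H r x)| ^ (z - 2) * T.g (graphPoint M T.H r x)| *
              |dT 𝓕.phaseRegion T.g (graphPoint M T.H r x)|) := by ring
          _ ≤ _ := by gcongr
    _ = (G + Gt) * (m * (vr x ^ 2 * |T.W.j' r| + 1 / 2 * va x ^ 2 * |potDeriv M r| * T.W.j r
      + z * |vr x| * T.W.j r * |Φ|)) := by ring
    _ ≤ _ := by gcongr

/-- The transport inequality is applied to the truncated weights. At `r₁` they are dominated by the
full density; at `r₂` Fatou's lemma removes the truncation. No finiteness of `K` is assumed, and the
absolute value in the transport inequality gives both directions. -/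
theorem K_le {r₁ r₂ : ℝ} (h : (r₁ = a ∧ r₂ = b) ∨ (r₁ = b ∧ r₂ = a)) : T.K r₂ ≤ T.K r₁ + T.R := by
  choose ζ D hζ0 hζ1 hζ2 hg hH hH' hP hP' hw hwr hwv using T.exists_data
  have ha : a ∈ Set.Icc a b := ⟨le_rfl, T.a_le_b⟩
  have hb : b ∈ Set.Icc a b := ⟨T.a_le_b, le_rfl⟩
  have h1 : r₁ ∈ Set.Icc a b := by rcases h with h | h <;> rw [h.1] <;> assumption
  have h2 : r₂ ∈ Set.Icc a b := by rcases h with h | h <;> rw [h.2] <;> assumption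
  have hε1 : |T.ε| = 1 := T.abs_ε
  have hF : ∀ n r x, (D n).F r x = vr x * (truncated T.W T.ε ((n : ℝ) + 1)⁻¹ (ζ n) r (vr x) (va x)
      * |T.g (graphPoint M T.H r x)| ^ z) := fun n r x => by
    simp only [TransportData.F, TransportData.pt, hw, hP, hg, hH, graphPoint]
  have hF0 : ∀ n r x, ¬ 0 < T.ε * vr x → (D n).F r x = 0 := fun n r x hv => by
    have hκ : 0 < ((n : ℝ) + 1)⁻¹ := by positivity
    rw [hF, truncated, softPos_of_nonpos hκ (not_lt.mp hv)]; simp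
  have hF1 : ∀ n, ∀ r ∈ Set.Icc a b, ∀ x, 0 < T.ε * vr x → (D n).F r x =
      |vr x| * softPos ((n : ℝ) + 1)⁻¹ (T.ε * vr x) * ζ n (energy M r (vr x) (va x)) *
        (T.W.j r * T.W.μ (energy M r (vr x) (va x)) (va x) * |T.g (graphPoint M T.H r x)| ^ z) ∧
      0 ≤ T.W.j r * T.W.μ (energy M r (vr x) (va x)) (va x) * |T.g (graphPoint M T.H r x)| ^ z ∧
      T.ε * vr x = |vr x| ∧ 0 < energy M r (vr x) (va x) := by
    intro n r hr x hv
    have hr2 : 2 * M < r := T.lt_a.trans_le hr.1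
    have hL : 0 ≤ va x := norm_nonneg _
    have hv0 : vr x ≠ 0 := fun h => by simp [h] at hv
    have hE : 0 < energy M r (vr x) (va x) := (energy_pos_iff T.hM hr2 _ _).mpr (Or.inl hv0)
    have hμ := T.W.μ_nonneg _ (va x) hE hL
    have hj := T.W.j_nonneg r hr2
    have habs : T.ε * vr x = |vr x| := by
      rw [← abs_of_pos hv, abs_mul, hε1, one_mul]
    refine ⟨?_, by positivity, habs, hE⟩
    rw [hF, truncated, ← habs]
    ring
  have hFnn : ∀ n, ∀ r ∈ Set.Icc a b, ∀ x, 0 ≤ (D n).F r x := by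
    intro n r hr x
    by_cases hv : 0 < T.ε * vr x
    · obtain ⟨e1, e2, -, -⟩ := hF1 n r hr x hv
      have hκ : 0 < ((n : ℝ) + 1)⁻¹ := by positivity
      have := softPos_nonneg hκ (T.ε * vr x)
      have := hζ0 n (energy M r (vr x) (va x))
      rw [e1]
      positivity
    · rw [hF0 n r x hv]
  have hFi : ∀ n, ∀ r ∈ Set.Icc a b, Integrable (fun x => (D n).F r x) sphereBundle :=
    fun n r hr => (D n).integrable_slice (D n).continuousOn_F hr fun _ hx => (D n).F_eq_zero hr hx
  have hstep : ∀ n, ∫⁻ x, ENNReal.ofReal ((D n).F r₂ x) ∂sphereBundle ≤ T.K r₁ + T.R := by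
    intro n
    have e1 := ofReal_integral_eq_lintegral_ofReal (hFi n r₂ h2) (.of_forall (hFnn n r₂ h2))
    have e2 := ofReal_integral_eq_lintegral_ofReal (hFi n r₁ h1) (.of_forall (hFnn n r₁ h1))
    have e3 : ENNReal.ofReal |(∫ x, (D n).F r₂ x ∂sphereBundle) - ∫ x, (D n).F r₁ x ∂sphereBundle| ≤
        T.R := by
      have e4 : ENNReal.ofReal |(∫ x, (D n).F b x ∂sphereBundle) - ∫ x, (D n).F a x ∂sphereBundle| ≤
          T.R := by
        refine (D n).ofReal_abs_sub_le.trans ?_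
        refine setLIntegral_mono' measurableSet_Icc fun r hr => lintegral_mono fun x => ?_
        exact ENNReal.ofReal_le_ofReal (T.abs_source_le n (D n) (hζ0 n) (hζ1 n) (hg n) (hH n) (hH' n)
          (hP n) (hP' n) (hw n) (hwr n) (hwv n) hr x)
      rcases h with h | h
      · rwa [h.1, h.2]
      · rwa [h.1, h.2, abs_sub_comm]
    have e5 : ∫⁻ x, ENNReal.ofReal ((D n).F r₁ x) ∂sphereBundle ≤ T.K r₁ := by
      refine lintegral_mono fun x => ENNReal.ofReal_le_ofReal ?_
      by_cases hv : 0 < T.ε * vr x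
      · obtain ⟨e1, e2, e3, -⟩ := hF1 n r₁ h1 x hv
        have hκ : 0 < ((n : ℝ) + 1)⁻¹ := by positivity
        have h3 := softPos_nonneg hκ (T.ε * vr x)
        have h4 : softPos ((n : ℝ) + 1)⁻¹ (T.ε * vr x) ≤ |vr x| :=
          (softPos_le hκ _).trans (by rw [e3]; simp)
        have h5 := hζ0 n (energy M r₁ (vr x) (va x))
        have h6 := hζ1 n (energy M r₁ (vr x) (va x))
        rw [e1, Weight.density, if_pos hv]
        calc _ ≤ |vr x| * |vr x| * 1 * (T.W.j r₁ * T.W.μ (energy M r₁ (vr x) (va x)) (va x) *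
              |T.g (graphPoint M T.H r₁ x)| ^ z) := by gcongr
          _ = _ := by rw [abs_mul_abs_self]; ring
      · rw [hF0 n r₁ x hv, Weight.density, if_neg hv, zero_mul]
    rw [← e1]
    set I₁ := ∫ x, (D n).F r₁ x ∂sphereBundle
    set I₂ := ∫ x, (D n).F r₂ x ∂sphereBundle
    calc ENNReal.ofReal I₂ ≤ ENNReal.ofReal (I₁ + |I₂ - I₁|) :=
          ENNReal.ofReal_le_ofReal (by linarith [le_abs_self (I₂ - I₁)])
      _ ≤ ENNReal.ofReal I₁ + ENNReal.ofReal |I₂ - I₁| := ENNReal.ofReal_add_le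
      _ ≤ _ := by rw [e2]; exact add_le_add e5 e3
  have hlim : ∀ x, Filter.Tendsto (fun n => ENNReal.ofReal ((D n).F r₂ x)) Filter.atTop
      (nhds (ENNReal.ofReal (T.W.density T.ε r₂ (vr x) (va x) *
        |T.g (graphPoint M T.H r₂ x)| ^ z))) := by
    intro x
    refine (ENNReal.continuous_ofReal.tendsto _).comp ?_
    by_cases hv : 0 < T.ε * vr x
    · obtain ⟨-, -, e3, hE⟩ := hF1 0 r₂ h2 x hv
      simp only [fun n => (hF1 n r₂ h2 x hv).1, Weight.density, if_pos hv]
      have t1 := tendsto_softPos hv (κ := fun n : ℕ => ((n : ℝ) + 1)⁻¹)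
        (by simpa using tendsto_one_div_add_atTop_nhds_zero_nat (𝕜 := ℝ))
      have t2 : Filter.Tendsto (fun n => ζ n (energy M r₂ (vr x) (va x))) Filter.atTop (nhds 1) := by
        refine tendsto_const_nhds.congr' ?_
        filter_upwards [Filter.eventually_ge_atTop (max ⌈energy M r₂ (vr x) (va x)⌉₊
          ⌈(energy M r₂ (vr x) (va x))⁻¹⌉₊)] with n hn
        refine (hζ2 n _ ?_ ?_).symm
        · rw [inv_le_comm₀ (by positivity) hE]
          have := (Nat.le_ceil _).trans (Nat.cast_le (α := ℝ).mpr ((le_max_right _ _).trans hn))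
          linarith
        · have := (Nat.le_ceil _).trans (Nat.cast_le (α := ℝ).mpr ((le_max_left _ _).trans hn))
          linarith
      have t3 := ((t1.const_mul |vr x|).mul t2).mul_const (T.W.j r₂ *
        T.W.μ (energy M r₂ (vr x) (va x)) (va x) * |T.g (graphPoint M T.H r₂ x)| ^ z)
      rw [e3, abs_mul_abs_self] at t3
      rw [e3]
      convert t3 using 2
      ring
    · simp only [fun n => hF0 n r₂ x hv, Weight.density, if_neg hv, zero_mul]
      exact tendsto_const_nhds
  calc T.K r₂ = ∫⁻ x, Filter.liminf (fun n => ENNReal.ofReal ((D n).F r₂ x)) Filter.atTop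
        ∂sphereBundle := lintegral_congr fun x => (hlim x).liminf_eq.symm
    _ ≤ Filter.liminf (fun n => ∫⁻ x, ENNReal.ofReal ((D n).F r₂ x) ∂sphereBundle) Filter.atTop :=
      lintegral_liminf_le' fun n => (hFi n r₂ h2).aestronglyMeasurable.aemeasurable.ennreal_ofReal
    _ ≤ _ := Filter.liminf_le_of_le (by isBoundedDefault) fun c hc => by
      obtain ⟨n, hn⟩ := hc.exists
      exact hn.trans (hstep n)

end TransportSetup

/-! ### Pointwise comparison of the weights -/

/-- `|v_u̲|`. -/
def aU (M r v L : ℝ) : ℝ := (energy M r v L - v) / 2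

/-- `|v_u|`. -/
def bU (M r v L : ℝ) : ℝ := (energy M r v L + v) / 2

/-- The red-shift energy `|v_t| + |v_u| / (1 - 2M/r)`. -/
def redEnergy (M r v L : ℝ) : ℝ := energy M r v L + bU M r v L / lapse M r

/-- The weight of the energy flux through the leaves. -/
def fluxWeight (M q z δ r v L : ℝ) : ℝ :=
  (1 + (r ^ 2 * (aU M r v L / energy M r v L)) ^ (z * q + 2)) *
    bracket (energy M r v L + L) ^ (3 * (z - 3 + δ)) * energy M r v L ^ (3 - z) *
    redEnergy M r v L ^ (2 * (z + 1))

section Pointwise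

variable {M r v L : ℝ}

theorem aU_nonneg (hM : 0 < M) (hr : 2 * M < r) : 0 ≤ aU M r v L := by
  have := abs_le_energy hM hr v L
  unfold aU; linarith [le_abs_self v]

theorem bU_nonneg (hM : 0 < M) (hr : 2 * M < r) : 0 ≤ bU M r v L := by
  have := abs_le_energy hM hr v L
  unfold bU; linarith [neg_abs_le v]

theorem aU_add_bU : aU M r v L + bU M r v L = energy M r v L := by unfold aU bU; ring

theorem aU_le (hM : 0 < M) (hr : 2 * M < r) : aU M r v L ≤ energy M r v L := by
  linarith [bU_nonneg (v := v) (L := L) hM hr, aU_add_bU (M := M) (r := r) (v := v) (L := L)]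

theorem bU_le (hM : 0 < M) (hr : 2 * M < r) : bU M r v L ≤ energy M r v L := by
  linarith [aU_nonneg (v := v) (L := L) hM hr, aU_add_bU (M := M) (r := r) (v := v) (L := L)]

/-- This is the null condition written in `v_u` and `v_u̲`. Every exchange below between powers of
`r`, powers of the lapse and angular momentum comes from it. -/
theorem sq_eq_aU_mul_bU (hM : 0 < M) (hr : 2 * M < r) :
    L ^ 2 = 4 * r ^ 2 * aU M r v L * (bU M r v L / lapse M r) := by
  have h1 := energy_sq hM hr v L
  have h2 := lapse_pos hM hr
  have hr0 : r ≠ 0 := by linarith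
  have h3 : 4 * (aU M r v L * bU M r v L) = lapse M r / r ^ 2 * L ^ 2 := by
    unfold aU bU; linear_combination h1
  have h4 : L ^ 2 = r ^ 2 * (lapse M r / r ^ 2 * L ^ 2) / lapse M r := by field_simp
  rw [h4, ← h3]; ring

theorem le_redEnergy (hM : 0 < M) (hr : 2 * M < r) : energy M r v L ≤ redEnergy M r v L := by
  have h1 := bU_nonneg (v := v) (L := L) hM hr
  have h2 := lapse_pos hM hr
  have : 0 ≤ bU M r v L / lapse M r := by positivity
  unfold redEnergy; linarith

theorem bU_div_le_redEnergy : bU M r v L / lapse M r ≤ redEnergy M r v L := by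
  have := energy_nonneg M r v L
  unfold redEnergy; linarith

theorem lapse_mono (hM : 0 < M) {s : ℝ} (hs : 0 < s) (h : s ≤ r) : lapse M s ≤ lapse M r := by
  unfold lapse
  have : 2 * M / r ≤ 2 * M / s := div_le_div_of_nonneg_left (by positivity) hs h
  linarith

theorem lapse_ge_third (hM : 0 < M) (h : 3 * M ≤ r) : 1 / 3 ≤ lapse M r := by
  have h0 : 0 < r := by linarith
  rw [lapse, le_sub_comm, div_le_iff₀ h0]; linarith

theorem abs_potDeriv_le (hM : 0 < M) (hr : 2 * M < r) : |potDeriv M r| ≤ 4 / r ^ 3 := by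
  have h0 : 0 < r := by linarith
  have h : potDeriv M r = (-2 + 6 * (M / r)) / r ^ 3 := by
    unfold potDeriv; field_simp
  have h1 : M / r ≤ 1 / 2 := by rw [div_le_iff₀ h0]; linarith
  have h2 : 0 ≤ M / r := by positivity
  rw [h, abs_div, abs_of_pos (pow_pos h0 3)]
  gcongr
  rw [abs_le]; constructor <;> linarith

/-- The angular momentum is controlled by the flux. -/
theorem pot_le_of_flux (hM : 0 < M) (hr : 2 * M < r) {c Φ : ℝ} (hc : 0 < c)
    (hΦ : c * (aU M r v L + bU M r v L / lapse M r) ≤ Φ) :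
    L ^ 2 * |potDeriv M r| ≤ 8 / (M * c) * (energy M r v L * Φ) := by
  have h0 : 0 < r := by linarith
  have ha := aU_nonneg (v := v) (L := L) hM hr
  have ha' := aU_le (v := v) (L := L) hM hr
  have hb := bU_nonneg (v := v) (L := L) hM hr
  have hl := lapse_pos hM hr
  have hE := energy_nonneg M r v L
  have hb' : 0 ≤ bU M r v L / lapse M r := by positivity
  have h1 : bU M r v L / lapse M r ≤ Φ / c := by
    rw [le_div_iff₀ hc]; nlinarith
  calc L ^ 2 * |potDeriv M r| ≤ L ^ 2 * (4 / r ^ 3) := by gcongr; exact abs_potDeriv_le hM hr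
    _ = 16 / r * (aU M r v L * (bU M r v L / lapse M r)) := by
      rw [sq_eq_aU_mul_bU (v := v) hM hr]; field_simp; ring
    _ ≤ 16 / (2 * M) * (energy M r v L * (Φ / c)) := by gcongr
    _ = _ := by field_simp; ring

/-- On null leaves the flux controls only `|v_u̲|`. For `r ≥ 3M` the other factor of `|v̸|²` needs
no flux, since `|v_u| / lapse ≤ 3 |v_t|`. -/
theorem pot_le_of_flux' (hM : 0 < M) (hr : 3 * M ≤ r) {c Φ : ℝ} (hc : 0 < c)
    (hΦ : c * aU M r v L ≤ Φ) :
    L ^ 2 * |potDeriv M r| ≤ 24 / (M * c) * (energy M r v L * Φ) := by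
  have hr2 : 2 * M < r := by linarith
  have h0 : 0 < r := by linarith
  have ha := aU_nonneg (v := v) (L := L) hM hr2
  have hb' := bU_le (v := v) (L := L) hM hr2
  have hb := bU_nonneg (v := v) (L := L) hM hr2
  have hl := lapse_ge_third hM hr
  have hE := energy_nonneg M r v L
  have h1 : aU M r v L ≤ Φ / c := by
    rw [le_div_iff₀ hc]; linarith
  have h3 : 0 ≤ Φ / c := ha.trans h1
  have h2 : bU M r v L / lapse M r ≤ 3 * energy M r v L := by
    rw [div_le_iff₀ (by linarith)]; nlinarith
  calc L ^ 2 * |potDeriv M r| ≤ L ^ 2 * (4 / r ^ 3) := by gcongr; exact abs_potDeriv_le hM hr2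
    _ = 16 / r * (aU M r v L * (bU M r v L / lapse M r)) := by
      rw [sq_eq_aU_mul_bU (v := v) hM hr2]; field_simp; ring
    _ ≤ 16 / (2 * M) * (Φ / c * (3 * energy M r v L)) := by gcongr
    _ = _ := by field_simp; ring

end Pointwise

/-! ### The flux densities -/

namespace Foliation

variable {M : ℝ} (𝓕 : Foliation M)

/-- `|v · n|` times the density of the volume form, on the spacelike part of the leaves. -/
def innerFlux (r v L : ℝ) : ℝ := energy M r v L / lapse M r - (𝓕.U' r - 1 / lapse M r) * v

/-- `|v · n|` times the density of the volume form, on the null part of the leaves. -/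
def _root_.SchwarzschildVlasov.outerFlux (M r v L : ℝ) : ℝ :=
  energy M r v L / lapse M r - 1 / lapse M r * v

theorem innerFlux_eq (r v L : ℝ) :
    𝓕.innerFlux r v L = 𝓕.U' r * aU M r v L + (2 / lapse M r - 𝓕.U' r) * bU M r v L := by
  unfold innerFlux aU bU; ring

theorem _root_.SchwarzschildVlasov.outerFlux_eq (M r v L : ℝ) :
    outerFlux M r v L = 2 * aU M r v L / lapse M r := by
  unfold outerFlux aU; ring

/-- The spacelike condition factors as `U' (2 - lapse U') > 0`, and both factors cannot be negative
when the lapse is nonnegative. The horizon itself is included. -/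
theorem U'_pos (hM : 0 < M) {r : ℝ} (hr : 2 * M ≤ r) :
    0 < 𝓕.U' r ∧ 0 < 2 - lapse M r * 𝓕.U' r := by
  have h := 𝓕.spacelike r hr
  have hl : 0 ≤ lapse M r := by
    have h0 : 0 < r := by linarith
    rw [lapse, sub_nonneg, div_le_one h0]; exact hr
  change 0 < 2 * 𝓕.U' r - lapse M r * 𝓕.U' r ^ 2 at h
  have h1 : 0 < 𝓕.U' r * (2 - lapse M r * 𝓕.U' r) := by linarith [h]
  rcases pos_and_pos_or_neg_and_neg_of_mul_pos h1 with h2 | h2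
  · exact h2
  · nlinarith

/-- The coefficients of `|v_u̲|` and `|v_u| / lapse` are positive and continuous on the compact
interval `[2M, R₀]`. Uniformity down to the horizon holds because the hypersurface crosses it
regularly and is spacelike there. -/
theorem exists_innerFlux_ge (hM : 0 < M) : ∃ c : ℝ, 0 < c ∧ ∀ r, 2 * M < r → r ≤ 𝓕.R₀ → ∀ v L,
    c * (aU M r v L + bU M r v L / lapse M r) ≤ 𝓕.innerFlux r v L := by
  have hne : (Set.Icc (2 * M) 𝓕.R₀).Nonempty := ⟨_, le_rfl, (𝓕.two_mul_lt_R₀ hM).le⟩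
  have hc1 : ContinuousOn 𝓕.U' (Set.Icc (2 * M) 𝓕.R₀) := 𝓕.continuousOn_U'.mono fun r hr => hr.1
  have hc2 : ContinuousOn (fun r => 2 - lapse M r * 𝓕.U' r) (Set.Icc (2 * M) 𝓕.R₀) := by
    have : ContinuousOn (lapse M) (Set.Icc (2 * M) 𝓕.R₀) := fun r hr =>
      (hasDerivAt_lapse M (by linarith [hr.1])).continuousAt.continuousWithinAt
    fun_prop
  obtain ⟨r₁, hr₁, h₁⟩ := isCompact_Icc.exists_isMinOn hne hc1
  obtain ⟨r₂, hr₂, h₂⟩ := isCompact_Icc.exists_isMinOn hne hc2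
  refine ⟨min (𝓕.U' r₁) (2 - lapse M r₂ * 𝓕.U' r₂),
    lt_min (𝓕.U'_pos hM hr₁.1).1 (𝓕.U'_pos hM hr₂.1).2, fun r hr hr' v L => ?_⟩
  have ha := aU_nonneg (v := v) (L := L) hM hr
  have hb := bU_nonneg (v := v) (L := L) hM hr
  have hl := lapse_pos hM hr
  have e1 : 𝓕.U' r₁ ≤ 𝓕.U' r := h₁ ⟨hr.le, hr'⟩
  have e2 : 2 - lapse M r₂ * 𝓕.U' r₂ ≤ 2 - lapse M r * 𝓕.U' r := h₂ ⟨hr.le, hr'⟩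
  have e3 : 𝓕.innerFlux r v L = 𝓕.U' r * aU M r v L
      + (2 - lapse M r * 𝓕.U' r) * (bU M r v L / lapse M r) := by
    rw [innerFlux_eq]; field_simp
  rw [e3, mul_add]
  have hb' : 0 ≤ bU M r v L / lapse M r := by positivity
  gcongr
  · exact (min_le_left _ _).trans e1
  · exact (min_le_right _ _).trans e2

theorem _root_.SchwarzschildVlasov.outerFlux_ge {r : ℝ} (hM : 0 < M) (hr : 2 * M < r) (v L : ℝ) :
    1 * aU M r v L ≤ outerFlux M r v L := by
  have ha := aU_nonneg (v := v) (L := L) hM hr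
  have hl := lapse_pos hM hr
  rw [outerFlux_eq, le_div_iff₀ hl]
  nlinarith [lapse_lt_one hM hr]

end Foliation

/-! ### The four weights -/

/-- Weights of the form `j(r) μ(|v_t|, |v̸|)`, with `μ` smooth. -/
def Weight.ofContDiffOn {M : ℝ} (j j' : ℝ → ℝ) (μ : ℝ → ℝ → ℝ)
    (hj : ∀ r, 2 * M < r → 0 ≤ j r) (hj' : ∀ r, 2 * M < r → HasDerivAt j (j' r) r)
    (hjc : ContinuousOn j' (Set.Ioi (2 * M))) (hμ : ∀ E L, 0 < E → 0 ≤ L → 0 ≤ μ E L)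
    (hs : ContDiffOn ℝ 1 (fun x : ℝ × ℝ => μ x.1 x.2) (Set.Ioi 0 ×ˢ Set.univ)) : Weight M where
  j := j
  j' := j'
  μ := μ
  μ' E L := fderiv ℝ (fun x : ℝ × ℝ => μ x.1 x.2) (E, L) (1, 0)
  j_nonneg := hj
  j_deriv := hj'
  j'_cont := hjc
  μ_nonneg := hμ
  μ_deriv E L hE _ := by
    have ho : IsOpen (Set.Ioi (0 : ℝ) ×ˢ (Set.univ : Set ℝ)) := isOpen_Ioi.prod isOpen_univ
    have h := ((hs.differentiableOn one_ne_zero).differentiableAt (x := (E, L))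
      (ho.mem_nhds ⟨hE, trivial⟩)).hasFDerivAt
    exact h.comp_hasDerivAt E (f := fun E => (E, L)) ((hasDerivAt_id E).prodMk (hasDerivAt_const E L))
  μ_cont := hs.continuousOn.mono (Set.prod_mono le_rfl (Set.subset_univ _))
  μ'_cont := by
    have ho : IsOpen (Set.Ioi (0 : ℝ) ×ˢ (Set.univ : Set ℝ)) := isOpen_Ioi.prod isOpen_univ
    exact ((hs.continuousOn_fderiv_of_isOpen ho le_rfl).clm_apply continuousOn_const).mono
      (Set.prod_mono le_rfl (Set.subset_univ _))

theorem bracket_pos (y : ℝ) : 0 < bracket y := by unfold bracket; positivity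

theorem contDiff_bracket : ContDiff ℝ ∞ bracket := by
  unfold bracket
  exact ContDiff.sqrt (by fun_prop) fun y => by positivity

/-- The factor common to the four weights. -/
def bracketWeight (z δ E L : ℝ) : ℝ := bracket (E + L) ^ (3 * (z - 3 + δ))

theorem bracketWeight_pos (z δ E L : ℝ) : 0 < bracketWeight z δ E L :=
  Real.rpow_pos_of_pos (bracket_pos _) _

theorem contDiff_bracketWeight (z δ : ℝ) :
    ContDiff ℝ ∞ fun x : ℝ × ℝ => bracketWeight z δ x.1 x.2 :=
  ContDiff.rpow_const_of_ne (contDiff_bracket.comp (by fun_prop)) fun x => (bracket_pos _).ne'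

theorem contDiffOn_rpow_fst (p : ℝ) :
    ContDiffOn ℝ 1 (fun x : ℝ × ℝ => x.1 ^ p) (Set.Ioi 0 ×ˢ Set.univ) :=
  ContDiffOn.rpow_const_of_ne (by fun_prop) fun x hx => (Set.mem_Ioi.mp hx.1).ne'

/-- The weight for the outgoing particles near the horizon. -/
def nearOut {M : ℝ} (hM : 0 < M) (z δ : ℝ) : Weight M :=
  Weight.ofContDiffOn (fun r => lapse M r ^ (-(2 * (z + 1))))
    (fun r => 2 * M / r ^ 2 * (-(2 * (z + 1))) * lapse M r ^ (-(2 * (z + 1)) - 1))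
    (fun E L => bracketWeight z δ E L * E ^ (z + 4))
    (fun r hr => Real.rpow_nonneg (lapse_pos hM hr).le _)
    (fun r hr => (hasDerivAt_lapse M (by linarith)).rpow_const (Or.inl (lapse_pos hM hr).ne'))
    (by
      have h1 : ContinuousOn (lapse M) (Set.Ioi (2 * M)) := fun r hr =>
        (hasDerivAt_lapse M (by linarith [Set.mem_Ioi.mp hr])).continuousAt.continuousWithinAt
      have h2 : ContinuousOn (fun r => lapse M r ^ (-(2 * (z + 1)) - 1)) (Set.Ioi (2 * M)) :=
        h1.rpow_const fun r hr => Or.inl (lapse_pos hM hr).ne'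
      have h3 : ∀ r ∈ Set.Ioi (2 * M), r ^ 2 ≠ 0 := fun r hr =>
        pow_ne_zero 2 (by linarith [Set.mem_Ioi.mp hr])
      fun_prop (disch := assumption))
    (fun E L hE _ => mul_nonneg (bracketWeight_pos _ _ _ _).le (Real.rpow_nonneg hE.le _))
    (((contDiff_bracketWeight z δ).of_le (by simp)).contDiffOn.mul (contDiffOn_rpow_fst _))

/-- The weight for the ingoing particles near the horizon. -/
def nearIn {M : ℝ} (z δ : ℝ) : Weight M :=
  Weight.ofContDiffOn (fun _ => 1) (fun _ => 0)
    (fun E L => bracketWeight z δ E L * (E ^ (-(3 * z)) * (E ^ 2 + L ^ 2) ^ (2 * (z + 1))))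
    (fun _ _ => zero_le_one) (fun r _ => hasDerivAt_const r 1) continuousOn_const
    (fun E L hE _ => mul_nonneg (bracketWeight_pos _ _ _ _).le (by positivity))
    (((contDiff_bracketWeight z δ).of_le (by simp)).contDiffOn.mul
      ((contDiffOn_rpow_fst _).mul (ContDiffOn.rpow_const_of_ne (by fun_prop) fun x hx => by
        have : 0 < x.1 := hx.1
        positivity)))

/-- The weight for the outgoing particles in the far region. -/
def farOut {M : ℝ} (q z δ : ℝ) : Weight M :=
  Weight.ofContDiffOn (fun _ => 1) (fun _ => 0)
    (fun E L => bracketWeight z δ E L * (E ^ (z + 4) * (1 + (L / E) ^ 2) ^ (z * q + 2)))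
    (fun _ _ => zero_le_one) (fun r _ => hasDerivAt_const r 1) continuousOn_const
    (fun E L hE _ => mul_nonneg (bracketWeight_pos _ _ _ _).le (by positivity))
    (((contDiff_bracketWeight z δ).of_le (by simp)).contDiffOn.mul
      ((contDiffOn_rpow_fst _).mul (ContDiffOn.rpow_const_of_ne
        (by
          have h : ∀ x ∈ Set.Ioi (0 : ℝ) ×ˢ (Set.univ : Set ℝ), x.1 ≠ 0 := fun x hx =>
            (Set.mem_Ioi.mp hx.1).ne'
          fun_prop (disch := assumption)) fun x hx => by positivity)))

/-- The weight for the ingoing particles in the far region. -/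
def farIn {M : ℝ} (hM : 0 < M) (q z δ : ℝ) : Weight M :=
  Weight.ofContDiffOn (fun r => r ^ (2 * (z * q + 2)))
    (fun r => 2 * (z * q + 2) * r ^ (2 * (z * q + 2) - 1))
    (fun E L => bracketWeight z δ E L * E ^ (z + 4))
    (fun r hr => Real.rpow_nonneg (by linarith) _)
    (fun r hr => Real.hasDerivAt_rpow_const (Or.inl (by linarith)))
    (continuousOn_const.mul (continuousOn_id.rpow_const fun r hr =>
      Or.inl (by simpa using (by linarith [Set.mem_Ioi.mp hr] : r ≠ 0))))
    (fun E L hE _ => mul_nonneg (bracketWeight_pos _ _ _ _).le (Real.rpow_nonneg hE.le _))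
    (((contDiff_bracketWeight z δ).of_le (by simp)).contDiffOn.mul (contDiffOn_rpow_fst _))

/-! ### The four weights are controlled by the weight of the flux -/

/-- Each of the three terms of the source is at most a constant times `E j Φ`; together with `μ` the
factor `E j` is absorbed by the flux weight, and `Φ` remains. -/
theorem source_bound {E j j' μ V L v Φ c₁ c₂ c₃ z w : ℝ} (hj : 0 ≤ j) (hμ : 0 ≤ μ)
    (hz : 0 ≤ z) (hΦ : 0 ≤ Φ) (hc₂ : 0 ≤ c₂) (hc₃ : 0 ≤ c₃) (hv : |v| ≤ E)
    (h₁ : E * (j * μ) ≤ c₁ * w) (h₂ : L ^ 2 * |V| ≤ c₂ * (E * Φ))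
    (h₃ : v ^ 2 * |j'| ≤ c₃ * (j * (E * Φ))) :
    μ * (v ^ 2 * |j'| + 1 / 2 * L ^ 2 * |V| * j + z * |v| * j * |Φ|) ≤
      (c₃ + c₂ / 2 + z) * c₁ * (w * Φ) := by
  have e1 : 1 / 2 * L ^ 2 * |V| * j ≤ 1 / 2 * (c₂ * (E * Φ)) * j := by
    rw [mul_assoc (1 / 2 : ℝ)]; gcongr
  have e2 : z * |v| * j * |Φ| ≤ z * E * j * Φ := by rw [abs_of_nonneg hΦ]; gcongr
  calc _ ≤ μ * (c₃ * (j * (E * Φ)) + 1 / 2 * (c₂ * (E * Φ)) * j + z * E * j * Φ) := by gcongr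
    _ = (c₃ + c₂ / 2 + z) * Φ * (E * (j * μ)) := by ring
    _ ≤ (c₃ + c₂ / 2 + z) * Φ * (c₁ * w) := by gcongr
    _ = _ := by ring

section Cases

variable {M q z δ r v L : ℝ}

theorem fluxWeight_ge (hM : 0 < M) (hr : 2 * M < r) (hz : 3 < z) {s x : ℝ} (hs : 0 ≤ s)
    (hs' : s ≤ redEnergy M r v L)
    (hx : x ≤ 1 + (r ^ 2 * (aU M r v L / energy M r v L)) ^ (z * q + 2)) :
    x * bracketWeight z δ (energy M r v L) L * energy M r v L ^ (3 - z) * s ^ (2 * (z + 1)) ≤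
      fluxWeight M q z δ r v L := by
  have hB := (bracketWeight_pos z δ (energy M r v L) L).le
  have hE := energy_nonneg M r v L
  have ha := aU_nonneg (v := v) (L := L) hM hr
  have hX : 0 ≤ (r ^ 2 * (aU M r v L / energy M r v L)) ^ (z * q + 2) :=
    Real.rpow_nonneg (by positivity) _
  have hE' : 0 ≤ energy M r v L ^ (3 - z) := Real.rpow_nonneg hE _
  unfold fluxWeight
  change _ ≤ _ * bracketWeight z δ (energy M r v L) L * _ * _
  have hs2 : s ^ (2 * (z + 1)) ≤ redEnergy M r v L ^ (2 * (z + 1)) :=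
    Real.rpow_le_rpow hs hs' (by linarith)
  have hs3 : 0 ≤ s ^ (2 * (z + 1)) := Real.rpow_nonneg hs _
  have h1X := add_nonneg zero_le_one hX
  gcongr

theorem one_le_factor (hM : 0 < M) (hr : 2 * M < r) :
    1 ≤ 1 + (r ^ 2 * (aU M r v L / energy M r v L)) ^ (z * q + 2) := by
  have hE := energy_nonneg M r v L
  have ha := aU_nonneg (v := v) (L := L) hM hr
  have hX : 0 ≤ (r ^ 2 * (aU M r v L / energy M r v L)) ^ (z * q + 2) :=
    Real.rpow_nonneg (by positivity) _
  linarith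

theorem energy_rpow_mul {E : ℝ} (hE : 0 < E) :
    E * E ^ (z + 4) = E ^ (3 - z) * E ^ (2 * (z + 1)) := by
  nth_rewrite 1 [← Real.rpow_one E]
  rw [← Real.rpow_add hE, ← Real.rpow_add hE]
  congr 1; ring

/-- Outgoing particles have `|v_u| ≥ |v_t| / 2`, so the red-shift energy is at least `|v_t| / (2
lapse)`, and its power `2(z+1)` pays for the singular power of the lapse in `j`. -/
theorem weight_le_nearOut (hM : 0 < M) (hr : 2 * M < r) (hz : 3 < z) (hv : 0 < v) :
    energy M r v L * ((nearOut hM z δ).j r * (nearOut hM z δ).μ (energy M r v L) L) ≤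
      2 ^ (2 * (z + 1)) * fluxWeight M q z δ r v L := by
  have hl := lapse_pos hM hr
  have hE : 0 < energy M r v L := (energy_pos_iff hM hr _ _).mpr (Or.inl hv.ne')
  have hs : energy M r v L / (2 * lapse M r) ≤ redEnergy M r v L := by
    refine le_trans ?_ bU_div_le_redEnergy
    rw [div_mul_eq_div_div]
    gcongr
    unfold bU; linarith
  have h := fluxWeight_ge (q := q) (δ := δ) hM hr hz (by positivity) hs (one_le_factor hM hr)
  refine le_trans (le_of_eq ?_) (mul_le_mul_of_nonneg_left h (by positivity))
  change energy M r v L * (lapse M r ^ (-(2 * (z + 1))) *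
    (bracketWeight z δ (energy M r v L) L * energy M r v L ^ (z + 4))) = _
  have e := energy_rpow_mul (z := z) hE
  rw [Real.div_rpow hE.le (by positivity), Real.mul_rpow zero_le_two hl.le, Real.rpow_neg hl.le]
  have h2 : (0 : ℝ) < 2 ^ (2 * (z + 1)) := by positivity
  have h3 : 0 < lapse M r ^ (2 * (z + 1)) := by positivity
  field_simp
  linear_combination bracketWeight z δ (energy M r v L) L * e

/-- The logarithmic derivative of `j` blows up like `1 / lapse` at the horizon. This is harmless for
outgoing particles, whose flux dominates `|v_t| / lapse`. -/
theorem deriv_le_nearOut (hM : 0 < M) (hr : 2 * M < r) (hz : 3 < z) (hv : 0 < v) {c Φ : ℝ}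
    (hc : 0 < c) (hΦ : c * (aU M r v L + bU M r v L / lapse M r) ≤ Φ) :
    v ^ 2 * |(nearOut hM z δ).j' r| ≤
      2 * (z + 1) / M / c * ((nearOut hM z δ).j r * (energy M r v L * Φ)) := by
  have hl := lapse_pos hM hr
  have h0 : 0 < r := by linarith
  have hE : 0 < energy M r v L := (energy_pos_iff hM hr _ _).mpr (Or.inl hv.ne')
  have hvE := abs_le_energy hM hr v L
  rw [abs_of_pos hv] at hvE
  have ha := aU_nonneg (v := v) (L := L) hM hr
  have h1 : energy M r v L / lapse M r ≤ 2 / c * Φ := by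
    have h2 : energy M r v L / lapse M r ≤ 2 * (bU M r v L / lapse M r) := by
      rw [← mul_div_assoc]; gcongr; unfold bU; linarith
    have h3 : bU M r v L / lapse M r ≤ Φ / c := by rw [le_div_iff₀ hc]; nlinarith
    calc _ ≤ 2 * (Φ / c) := h2.trans (by gcongr)
      _ = _ := by ring
  have h4 : (nearOut hM z δ).j' r =
      -(2 * M / r ^ 2 * (2 * (z + 1)) * (lapse M r ^ (-(2 * (z + 1))) / lapse M r)) := by
    change 2 * M / r ^ 2 * (-(2 * (z + 1))) * lapse M r ^ (-(2 * (z + 1)) - 1) = _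
    rw [Real.rpow_sub_one hl.ne']; ring
  have hj : 0 < lapse M r ^ (-(2 * (z + 1))) := by positivity
  rw [h4, abs_neg, abs_of_nonneg (by positivity)]
  change _ ≤ _ * (lapse M r ^ (-(2 * (z + 1))) * _)
  have h5 : 2 * M / r ^ 2 ≤ 1 / (2 * M) := by
    rw [div_le_div_iff₀ (by positivity) (by positivity)]; nlinarith
  calc v ^ 2 * (2 * M / r ^ 2 * (2 * (z + 1)) * (lapse M r ^ (-(2 * (z + 1))) / lapse M r))
      ≤ energy M r v L ^ 2 * (1 / (2 * M) * (2 * (z + 1)) *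
        (lapse M r ^ (-(2 * (z + 1))) / lapse M r)) := by gcongr
    _ = (z + 1) / M * lapse M r ^ (-(2 * (z + 1))) * energy M r v L *
        (energy M r v L / lapse M r) := by field_simp
    _ ≤ (z + 1) / M * lapse M r ^ (-(2 * (z + 1))) * energy M r v L * (2 / c * Φ) := by gcongr
    _ = _ := by field_simp

/-- On bounded radii the null relation, with `|v_u̲| ≤ |v_t|`, bounds `|v_t|² + |v̸|²` by a multiple
of `|v_t|` times the red-shift energy. The exponents of `nearIn` then reproduce `E^{3-z}`. -/
theorem weight_le_nearIn (hM : 0 < M) (hr : 2 * M < r) (hz : 3 < z) (hv : v ≠ 0) {R : ℝ}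
    (hR : r ≤ R) :
    energy M r v L * ((nearIn (M := M) z δ).j r * (nearIn (M := M) z δ).μ (energy M r v L) L) ≤
      (1 + 4 * R ^ 2) ^ (2 * (z + 1)) * fluxWeight M q z δ r v L := by
  have hE : 0 < energy M r v L := (energy_pos_iff hM hr _ _).mpr (Or.inl hv)
  have h0 : 0 < r := by linarith
  have hN := le_redEnergy (v := v) (L := L) hM hr
  have hb := bU_div_le_redEnergy (M := M) (r := r) (v := v) (L := L)
  have ha := aU_le (v := v) (L := L) hM hr
  have ha0 := aU_nonneg (v := v) (L := L) hM hr
  have hl := lapse_pos hM hr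
  have hN0 : 0 < redEnergy M r v L := hE.trans_le hN
  have hb0 : 0 ≤ bU M r v L / lapse M r := div_nonneg (bU_nonneg hM hr) hl.le
  have key : energy M r v L ^ 2 + L ^ 2 ≤
      (1 + 4 * R ^ 2) * (energy M r v L * redEnergy M r v L) := by
    have h1 : L ^ 2 ≤ 4 * R ^ 2 * (energy M r v L * redEnergy M r v L) := by
      rw [sq_eq_aU_mul_bU (v := v) (L := L) hM hr]
      calc _ = 4 * r ^ 2 * (aU M r v L * (bU M r v L / lapse M r)) := by ring
        _ ≤ _ := by gcongr
    nlinarith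
  have h := fluxWeight_ge (q := q) (δ := δ) hM hr hz hN0.le le_rfl (one_le_factor hM hr)
  refine le_trans ?_ (mul_le_mul_of_nonneg_left h (by positivity))
  change energy M r v L * (1 * (bracketWeight z δ (energy M r v L) L *
    (energy M r v L ^ (-(3 * z)) * (energy M r v L ^ 2 + L ^ 2) ^ (2 * (z + 1))))) ≤ _
  have hB := (bracketWeight_pos z δ (energy M r v L) L).le
  have e : energy M r v L * (energy M r v L ^ (-(3 * z)) * energy M r v L ^ (2 * (z + 1))) =
      energy M r v L ^ (3 - z) := by
    rw [← Real.rpow_add hE]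
    nth_rewrite 1 [← Real.rpow_one (energy M r v L)]
    rw [← Real.rpow_add hE]
    congr 1; ring
  have key2 : (energy M r v L ^ 2 + L ^ 2) ^ (2 * (z + 1)) ≤ (1 + 4 * R ^ 2) ^ (2 * (z + 1)) *
      (energy M r v L ^ (2 * (z + 1)) * redEnergy M r v L ^ (2 * (z + 1))) := by
    rw [← Real.mul_rpow hE.le hN0.le, ← Real.mul_rpow (by positivity) (by positivity)]
    exact Real.rpow_le_rpow (by positivity) key (by linarith)
  calc _ ≤ energy M r v L * (1 * (bracketWeight z δ (energy M r v L) L *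
      (energy M r v L ^ (-(3 * z)) * ((1 + 4 * R ^ 2) ^ (2 * (z + 1)) *
      (energy M r v L ^ (2 * (z + 1)) * redEnergy M r v L ^ (2 * (z + 1))))))) := by gcongr
    _ = (1 + 4 * R ^ 2) ^ (2 * (z + 1)) * (1 * bracketWeight z δ (energy M r v L) L *
      (energy M r v L * (energy M r v L ^ (-(3 * z)) * energy M r v L ^ (2 * (z + 1)))) *
        redEnergy M r v L ^ (2 * (z + 1))) := by ring
    _ = _ := by rw [e]

theorem bU_div_le (hM : 0 < M) (hr : 3 * M ≤ r) :
    bU M r v L / lapse M r ≤ 3 * energy M r v L := by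
  have hr2 : 2 * M < r := by linarith
  have hl := lapse_ge_third hM hr
  have hb := bU_le (v := v) (L := L) hM hr2
  have hE := energy_nonneg M r v L
  rw [div_le_iff₀ (by linarith)]; nlinarith

/-- For `r ≥ 3M` the conserved ratio satisfies `(|v̸| / |v_t|)² ≤ 12 X` with `X = r² |v_u̲| /
|v_t|`, so the `r`-weight of the flux pays for it. The constant `13` comes from `1 + 12 X ≤ 13
max(1, X)`. -/
theorem weight_le_farOut (hM : 0 < M) (hr : 3 * M ≤ r) (hz : 3 < z) (hq : 0 ≤ q) (hv : 0 < v) :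
    energy M r v L * ((farOut (M := M) q z δ).j r * (farOut (M := M) q z δ).μ (energy M r v L) L) ≤
      13 ^ (z * q + 2) * fluxWeight M q z δ r v L := by
  have hr2 : 2 * M < r := by linarith
  have hE : 0 < energy M r v L := (energy_pos_iff hM hr2 _ _).mpr (Or.inl hv.ne')
  have ha0 := aU_nonneg (v := v) (L := L) hM hr2
  have hm : 0 ≤ z * q + 2 := by have : 0 ≤ z * q := mul_nonneg (by linarith) hq
                                linarith
  have hX : (L / energy M r v L) ^ 2 ≤ 12 * (r ^ 2 * (aU M r v L / energy M r v L)) := by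
    rw [div_pow, sq_eq_aU_mul_bU (v := v) (L := L) hM hr2]
    calc _ ≤ 4 * r ^ 2 * aU M r v L * (3 * energy M r v L) / energy M r v L ^ 2 := by
          gcongr; exact bU_div_le hM hr
      _ = _ := by field_simp; ring
  set X := r ^ 2 * (aU M r v L / energy M r v L) with hXdef
  have hX0 : 0 ≤ X := by positivity
  have key : (1 + (L / energy M r v L) ^ 2) ^ (z * q + 2) ≤ 13 ^ (z * q + 2) * (1 + X ^ (z * q + 2)) := by
    have h1 : 1 + (L / energy M r v L) ^ 2 ≤ 13 * max 1 X := by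
      linarith [le_max_left 1 X, le_max_right 1 X]
    refine (Real.rpow_le_rpow (by positivity) h1 hm).trans ?_
    rw [Real.mul_rpow (by norm_num) (by positivity)]
    gcongr
    rcases max_choice 1 X with h | h <;> rw [h]
    · rw [Real.one_rpow]; linarith [Real.rpow_nonneg hX0 (z * q + 2)]
    · linarith
  have h := fluxWeight_ge (q := q) (δ := δ) (v := v) (L := L) hM hr2 hz hE.le (le_redEnergy hM hr2)
    le_rfl
  refine le_trans ?_ (mul_le_mul_of_nonneg_left h (by positivity))
  change energy M r v L * (1 * (bracketWeight z δ (energy M r v L) L *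
    (energy M r v L ^ (z + 4) * (1 + (L / energy M r v L) ^ 2) ^ (z * q + 2)))) ≤ _
  have hB := (bracketWeight_pos z δ (energy M r v L) L).le
  have e := energy_rpow_mul (z := z) hE
  calc _ ≤ energy M r v L * (1 * (bracketWeight z δ (energy M r v L) L *
      (energy M r v L ^ (z + 4) * (13 ^ (z * q + 2) * (1 + X ^ (z * q + 2)))))) := by gcongr
    _ = 13 ^ (z * q + 2) * (1 + X ^ (z * q + 2)) * bracketWeight z δ (energy M r v L) L *
        (energy M r v L * energy M r v L ^ (z + 4)) := by ring
    _ = _ := by rw [e]; ring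

/-- Ingoing particles have `|v_u̲| ≥ |v_t| / 2`, so the `r`-weight of the flux is at least a full
power of `r² / 2`. -/
theorem weight_le_farIn (hM : 0 < M) (hr : 2 * M < r) (hz : 3 < z) (hq : 0 ≤ q) (hv : v < 0) :
    energy M r v L * ((farIn hM q z δ).j r * (farIn hM q z δ).μ (energy M r v L) L) ≤
      2 ^ (z * q + 2) * fluxWeight M q z δ r v L := by
  have hE : 0 < energy M r v L := (energy_pos_iff hM hr _ _).mpr (Or.inl hv.ne)
  have hm : 0 ≤ z * q + 2 := by have : 0 ≤ z * q := mul_nonneg (by linarith) hq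
                                linarith
  have h0 : 0 < r := by linarith
  have hX : (r ^ 2 / 2) ^ (z * q + 2) ≤
      1 + (r ^ 2 * (aU M r v L / energy M r v L)) ^ (z * q + 2) := by
    refine le_trans (Real.rpow_le_rpow (by positivity) ?_ hm) (le_add_of_nonneg_left zero_le_one)
    rw [div_eq_mul_one_div]
    refine mul_le_mul_of_nonneg_left ?_ (by positivity)
    rw [div_le_div_iff₀ two_pos hE]
    unfold aU; linarith
  have h := fluxWeight_ge (q := q) (δ := δ) (v := v) (L := L) hM hr hz hE.le (le_redEnergy hM hr) hX
  refine le_trans (le_of_eq ?_) (mul_le_mul_of_nonneg_left h (by positivity))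
  change energy M r v L * (r ^ (2 * (z * q + 2)) *
    (bracketWeight z δ (energy M r v L) L * energy M r v L ^ (z + 4))) = _
  have e := energy_rpow_mul (z := z) hE
  rw [Real.div_rpow (by positivity) zero_le_two, Real.rpow_mul h0.le, Real.rpow_two]
  have h2 : (0 : ℝ) < 2 ^ (z * q + 2) := by positivity
  field_simp
  linear_combination bracketWeight z δ (energy M r v L) L * e

/-- For ingoing particles a flux controlling `|v_u̲|` controls `|v_t|`, and the logarithmic
derivative of `j` is a multiple of `1/r`, bounded by the same multiple of `1/(2M)`. -/
theorem deriv_le_farIn (hM : 0 < M) (hr : 2 * M < r) (hz : 3 < z) (hq : 0 ≤ q) (hv : v < 0) {c Φ : ℝ}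
    (hc : 0 < c) (hΦ : c * aU M r v L ≤ Φ) :
    v ^ 2 * |(farIn hM q z δ).j' r| ≤
      2 * (z * q + 2) / M / c * ((farIn hM q z δ).j r * (energy M r v L * Φ)) := by
  have h0 : 0 < r := by linarith
  have hm : 0 ≤ z * q + 2 := by have : 0 ≤ z * q := mul_nonneg (by linarith) hq
                                linarith
  have hE : 0 < energy M r v L := (energy_pos_iff hM hr _ _).mpr (Or.inl hv.ne)
  have hvE := abs_le_energy hM hr v L
  have h1 : energy M r v L ≤ 2 / c * Φ := by
    have : energy M r v L ≤ 2 * aU M r v L := by unfold aU; linarith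
    calc energy M r v L ≤ 2 / c * (c * aU M r v L) := by field_simp; linarith
      _ ≤ _ := by gcongr
  have h4 : (farIn hM q z δ).j' r = 2 * (z * q + 2) * (r ^ (2 * (z * q + 2)) / r) := by
    change 2 * (z * q + 2) * r ^ (2 * (z * q + 2) - 1) = _
    rw [Real.rpow_sub_one h0.ne']
  have hj : 0 < r ^ (2 * (z * q + 2)) := by positivity
  rw [h4, abs_of_nonneg (by positivity)]
  change _ ≤ _ * (r ^ (2 * (z * q + 2)) * _)
  calc v ^ 2 * (2 * (z * q + 2) * (r ^ (2 * (z * q + 2)) / r))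
      ≤ energy M r v L ^ 2 * (2 * (z * q + 2) * (r ^ (2 * (z * q + 2)) / (2 * M))) := by
        rw [← sq_abs v]; gcongr
    _ = (z * q + 2) / M * r ^ (2 * (z * q + 2)) * energy M r v L * energy M r v L := by field_simp
    _ ≤ (z * q + 2) / M * r ^ (2 * (z * q + 2)) * energy M r v L * (2 / c * Φ) := by gcongr
    _ = _ := by field_simp

/-! ### The comparison needed for the Hölder inequality -/

/-- The weight which the Hölder inequality requires to be controlled. -/
def holderWeight (M q z δ r v L : ℝ) : ℝ :=
  redEnergy M r v L ^ (2 * z) * (r ^ 2 * (aU M r v L / energy M r v L)) ^ (z * q) *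
    energy M r v L ^ (-z) * (energy M r v L + L) ^ 4 * bracketWeight z δ (energy M r v L) L

theorem add_pow_four_le (E L : ℝ) : (E + L) ^ 4 ≤ 4 * (E ^ 2 + L ^ 2) ^ 2 := by
  have h : (E + L) ^ 2 ≤ 2 * (E ^ 2 + L ^ 2) := by nlinarith [sq_nonneg (E - L)]
  calc (E + L) ^ 4 = ((E + L) ^ 2) ^ 2 := by ring
    _ ≤ (2 * (E ^ 2 + L ^ 2)) ^ 2 := by gcongr
    _ = _ := by ring

theorem holderWeight_le (hM : 0 < M) (hr : 2 * M < r) (hz : 3 < z) (hq : 0 ≤ q)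
    (hE : 0 < energy M r v L) {N X S : ℝ} (hN : redEnergy M r v L ≤ N)
    (hX : r ^ 2 * (aU M r v L / energy M r v L) ≤ X) (hS : energy M r v L ^ 2 + L ^ 2 ≤ S) :
    holderWeight M q z δ r v L ≤ N ^ (2 * z) * X ^ (z * q) * energy M r v L ^ (-z) * (4 * S ^ 2) *
      bracketWeight z δ (energy M r v L) L := by
  have hB := (bracketWeight_pos z δ (energy M r v L) L).le
  have ha := aU_nonneg (v := v) (L := L) hM hr
  have hX0 : 0 ≤ r ^ 2 * (aU M r v L / energy M r v L) := by positivity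
  have hN0 : 0 ≤ redEnergy M r v L := hE.le.trans (le_redEnergy hM hr)
  have h4 : (energy M r v L + L) ^ 4 ≤ 4 * S ^ 2 := (add_pow_four_le _ _).trans (by gcongr)
  have hzq : 0 ≤ z * q := mul_nonneg (by linarith) hq
  have hX1 := hX0.trans hX
  have hN1 := hN0.trans hN
  unfold holderWeight
  gcongr

/-- The red-shift energy is at most `2 |v_t| / lapse`, and `|v_t|² + |v̸|²` is bounded by a multiple
of `|v_t|² / lapse`. These cost `2z` and `2` powers of the lapse, which is why `nearOut` carries the
exponent `-2(z+1)`. -/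
theorem holderWeight_le_nearOut (hM : 0 < M) (hr : 2 * M < r) (hz : 3 < z) (hq : 0 ≤ q) (hv : 0 < v)
    {R : ℝ} (hR : r ≤ R) :
    holderWeight M q z δ r v L ≤
      2 ^ (2 * z) * (R ^ 2) ^ (z * q) * (4 * (1 + 4 * R ^ 2) ^ 2) *
        ((nearOut hM z δ).j r * (nearOut hM z δ).μ (energy M r v L) L) := by
  have hl := lapse_pos hM hr
  have hl1 := (lapse_lt_one hM hr).le
  have h0 : 0 < r := by linarith
  have hE : 0 < energy M r v L := (energy_pos_iff hM hr _ _).mpr (Or.inl hv.ne')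
  have ha := aU_le (v := v) (L := L) hM hr
  have ha0 := aU_nonneg (v := v) (L := L) hM hr
  have hb := bU_le (v := v) (L := L) hM hr
  have hEl : energy M r v L ≤ energy M r v L / lapse M r := by
    rw [le_div_iff₀ hl]; nlinarith
  have hN : redEnergy M r v L ≤ 2 * (energy M r v L / lapse M r) := by
    have : bU M r v L / lapse M r ≤ energy M r v L / lapse M r := by gcongr
    unfold redEnergy; linarith
  have hX : r ^ 2 * (aU M r v L / energy M r v L) ≤ R ^ 2 := by
    have : aU M r v L / energy M r v L ≤ 1 := by rw [div_le_one hE]; exact ha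
    have h1 : r ^ 2 ≤ R ^ 2 := by gcongr
    nlinarith [sq_nonneg r]
  have hS : energy M r v L ^ 2 + L ^ 2 ≤ (1 + 4 * R ^ 2) * (energy M r v L ^ 2 / lapse M r) := by
    have h1 : L ^ 2 ≤ 4 * R ^ 2 * (energy M r v L ^ 2 / lapse M r) := by
      rw [sq_eq_aU_mul_bU (v := v) (L := L) hM hr]
      have hb0 : 0 ≤ bU M r v L := bU_nonneg hM hr
      calc _ ≤ 4 * R ^ 2 * energy M r v L * (energy M r v L / lapse M r) := by gcongr
        _ = _ := by ring
    have h2 : energy M r v L ^ 2 ≤ energy M r v L ^ 2 / lapse M r := by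
      rw [le_div_iff₀ hl]; nlinarith [sq_nonneg (energy M r v L)]
    linarith
  refine (holderWeight_le hM hr hz hq hE hN hX hS).trans (le_of_eq ?_)
  change _ = _ * (lapse M r ^ (-(2 * (z + 1))) *
    (bracketWeight z δ (energy M r v L) L * energy M r v L ^ (z + 4)))
  rw [Real.mul_rpow zero_le_two (by positivity), Real.div_rpow hE.le hl.le]
  have e1 : energy M r v L ^ (z + 4) = energy M r v L ^ (2 * z) * energy M r v L ^ (-z) *
      energy M r v L ^ 4 := by
    rw [← Real.rpow_add hE, ← Real.rpow_natCast, ← Real.rpow_add hE]; congr 1; push_cast; ring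
  have e2 : lapse M r ^ (-(2 * (z + 1))) = (lapse M r ^ (2 * z))⁻¹ * (lapse M r ^ 2)⁻¹ := by
    rw [← Real.rpow_natCast, ← Real.rpow_neg hl.le, ← Real.rpow_neg hl.le, ← Real.rpow_add hl]
    congr 1; push_cast; ring
  rw [e1, e2]
  ring

/-- With `|v_u̲| ≥ |v_t| / 2` and `r ≥ 2M`, the null relation bounds `|v_u| / lapse` by `|v̸|² / (8
M² |v_t|)`. The red-shift energy of ingoing particles is thus controlled by conserved quantities and
no weight in `r` is needed. -/
theorem holderWeight_le_nearIn (hM : 0 < M) (hr : 2 * M < r) (hz : 3 < z) (hq : 0 ≤ q) (hv : v < 0)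
    {R : ℝ} (hR : r ≤ R) :
    holderWeight M q z δ r v L ≤
      (1 + 1 / (8 * M ^ 2)) ^ (2 * z) * (R ^ 2) ^ (z * q) * 4 *
        ((nearIn (M := M) z δ).j r * (nearIn (M := M) z δ).μ (energy M r v L) L) := by
  have hl := lapse_pos hM hr
  have h0 : 0 < r := by linarith
  have hE : 0 < energy M r v L := (energy_pos_iff hM hr _ _).mpr (Or.inl hv.ne)
  have ha := aU_le (v := v) (L := L) hM hr
  have ha0 := aU_nonneg (v := v) (L := L) hM hr
  have hb0 : 0 ≤ bU M r v L := bU_nonneg hM hr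
  have hN : redEnergy M r v L ≤ (1 + 1 / (8 * M ^ 2)) *
      ((energy M r v L ^ 2 + L ^ 2) / energy M r v L) := by
    have h1 : 8 * M ^ 2 * energy M r v L * (bU M r v L / lapse M r) ≤ L ^ 2 := by
      rw [sq_eq_aU_mul_bU (v := v) (L := L) hM hr]
      have h2 : energy M r v L ≤ 2 * aU M r v L := by unfold aU; linarith
      have h3 : 4 * M ^ 2 ≤ r ^ 2 := by nlinarith
      have h4 : 4 * M ^ 2 * energy M r v L ≤ r ^ 2 * (2 * aU M r v L) := by gcongr
      have h5 : 0 ≤ bU M r v L / lapse M r := by positivity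
      nlinarith
    have h2 : bU M r v L / lapse M r ≤ 1 / (8 * M ^ 2) * (L ^ 2 / energy M r v L) := by
      rw [div_mul_div_comm, one_mul, le_div_iff₀ (by positivity)]; linarith
    have h3 : energy M r v L = energy M r v L ^ 2 / energy M r v L := by field_simp
    have h4 : 0 ≤ L ^ 2 / energy M r v L := by positivity
    have h5 : 0 ≤ 1 / (8 * M ^ 2) := by positivity
    rw [add_div, ← h3]
    unfold redEnergy
    nlinarith
  have hX : r ^ 2 * (aU M r v L / energy M r v L) ≤ R ^ 2 := by
    have : aU M r v L / energy M r v L ≤ 1 := by rw [div_le_one hE]; exact ha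
    have h1 : r ^ 2 ≤ R ^ 2 := by gcongr
    nlinarith [sq_nonneg r]
  refine (holderWeight_le hM hr hz hq hE hN hX le_rfl).trans (le_of_eq ?_)
  change _ = _ * (1 * (bracketWeight z δ (energy M r v L) L *
    (energy M r v L ^ (-(3 * z)) * (energy M r v L ^ 2 + L ^ 2) ^ (2 * (z + 1)))))
  have hS : 0 < energy M r v L ^ 2 + L ^ 2 := by positivity
  rw [Real.mul_rpow (by positivity) (by positivity), Real.div_rpow hS.le hE.le]
  have e1 : energy M r v L ^ (-(3 * z)) = (energy M r v L ^ (2 * z))⁻¹ * energy M r v L ^ (-z) := by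
    rw [← Real.rpow_neg hE.le, ← Real.rpow_add hE]; congr 1; ring
  have e2 : (energy M r v L ^ 2 + L ^ 2) ^ (2 * (z + 1)) =
      (energy M r v L ^ 2 + L ^ 2) ^ (2 * z) * (energy M r v L ^ 2 + L ^ 2) ^ 2 := by
    rw [← Real.rpow_natCast (energy M r v L ^ 2 + L ^ 2) 2, ← Real.rpow_add hS]
    congr 1; push_cast; ring
  rw [e1, e2]
  ring

theorem redEnergy_le_far (hM : 0 < M) (hr : 3 * M ≤ r) :
    redEnergy M r v L ≤ 4 * energy M r v L := by
  have := bU_div_le (v := v) (L := L) hM hr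
  unfold redEnergy; linarith

/-- Since `|v_u| ≥ |v_t| / 2`, the null relation bounds `r² |v_u̲| / |v_t|` by `1 + (|v̸| /
|v_t|)²`. The exponent `z q + 2` collects `z q` from this factor and `2` from `(|v_t| + |v̸|)⁴`. -/
theorem holderWeight_le_farOut (hM : 0 < M) (hr : 3 * M ≤ r) (hz : 3 < z) (hq : 0 ≤ q) (hv : 0 < v) :
    holderWeight M q z δ r v L ≤
      4 ^ (2 * z) * 4 *
        ((farOut (M := M) q z δ).j r * (farOut (M := M) q z δ).μ (energy M r v L) L) := by
  have hr2 : 2 * M < r := by linarith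
  have hl := lapse_pos hM hr2
  have hE : 0 < energy M r v L := (energy_pos_iff hM hr2 _ _).mpr (Or.inl hv.ne')
  have ha0 := aU_nonneg (v := v) (L := L) hM hr2
  have hX : r ^ 2 * (aU M r v L / energy M r v L) ≤ 1 + (L / energy M r v L) ^ 2 := by
    have h1 : energy M r v L / 2 ≤ bU M r v L / lapse M r := by
      rw [le_div_iff₀ hl]
      have : energy M r v L / 2 ≤ bU M r v L := by unfold bU; linarith
      nlinarith [lapse_lt_one hM hr2]
    have h2 : 2 * (r ^ 2 * (aU M r v L / energy M r v L)) ≤ (L / energy M r v L) ^ 2 := by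
      rw [div_pow, sq_eq_aU_mul_bU (v := v) (L := L) hM hr2]
      calc _ = 4 * r ^ 2 * aU M r v L * (energy M r v L / 2) / energy M r v L ^ 2 := by
            field_simp; ring
        _ ≤ _ := by gcongr
    nlinarith [sq_nonneg (L / energy M r v L)]
  have hS : energy M r v L ^ 2 + L ^ 2 =
      energy M r v L ^ 2 * (1 + (L / energy M r v L) ^ 2) := by field_simp
  refine (holderWeight_le hM hr2 hz hq hE (redEnergy_le_far hM hr) hX hS.le).trans (le_of_eq ?_)
  change _ = _ * (1 * (bracketWeight z δ (energy M r v L) L *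
    (energy M r v L ^ (z + 4) * (1 + (L / energy M r v L) ^ 2) ^ (z * q + 2))))
  set u := 1 + (L / energy M r v L) ^ 2 with hu
  have hu0 : 0 < u := by positivity
  rw [Real.mul_rpow (by norm_num) hE.le]
  have e1 : energy M r v L ^ (z + 4) = energy M r v L ^ (2 * z) * energy M r v L ^ (-z) *
      energy M r v L ^ 4 := by
    rw [← Real.rpow_add hE, ← Real.rpow_natCast, ← Real.rpow_add hE]; congr 1; push_cast; ring
  have e2 : u ^ (z * q + 2) = u ^ (z * q) * u ^ 2 := by
    rw [← Real.rpow_natCast u 2, ← Real.rpow_add hu0]; congr 1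
  rw [e1, e2]
  ring

/-- Here `r² |v_u̲| / |v_t| ≤ r²`, and `|v_t|² + |v̸|²` is at most a multiple of `r² |v_t|²`. The
two bounds consume the powers `2 z q` and `4` of `r` in `j`. -/
theorem holderWeight_le_farIn (hM : 0 < M) (hr : 3 * M ≤ r) (hz : 3 < z) (hq : 0 ≤ q) (hv : v < 0) :
    holderWeight M q z δ r v L ≤
      4 ^ (2 * z) * (4 * (1 / (9 * M ^ 2) + 12) ^ 2) *
        ((farIn hM q z δ).j r * (farIn hM q z δ).μ (energy M r v L) L) := by
  have hr2 : 2 * M < r := by linarith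
  have h0 : 0 < r := by linarith
  have hE : 0 < energy M r v L := (energy_pos_iff hM hr2 _ _).mpr (Or.inl hv.ne)
  have ha := aU_le (v := v) (L := L) hM hr2
  have ha0 := aU_nonneg (v := v) (L := L) hM hr2
  have hX : r ^ 2 * (aU M r v L / energy M r v L) ≤ r ^ 2 := by
    have : aU M r v L / energy M r v L ≤ 1 := by rw [div_le_one hE]; exact ha
    nlinarith [sq_nonneg r]
  have hS : energy M r v L ^ 2 + L ^ 2 ≤
      (1 / (9 * M ^ 2) + 12) * (r ^ 2 * energy M r v L ^ 2) := by
    have h1 : L ^ 2 ≤ 12 * (r ^ 2 * energy M r v L ^ 2) := by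
      rw [sq_eq_aU_mul_bU (v := v) (L := L) hM hr2]
      have hb := bU_div_le (v := v) (L := L) hM hr
      have hb0 : 0 ≤ bU M r v L / lapse M r :=
        div_nonneg (bU_nonneg hM hr2) (lapse_pos hM hr2).le
      calc _ ≤ 4 * r ^ 2 * energy M r v L * (3 * energy M r v L) := by gcongr
        _ = _ := by ring
    have h2 : 1 ≤ 1 / (9 * M ^ 2) * r ^ 2 := by
      rw [div_mul_eq_mul_div, one_mul, le_div_iff₀ (by positivity)]; nlinarith
    nlinarith [sq_nonneg (energy M r v L)]
  refine (holderWeight_le hM hr2 hz hq hE (redEnergy_le_far hM hr) hX hS).trans (le_of_eq ?_)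
  change _ = _ * (r ^ (2 * (z * q + 2)) *
    (bracketWeight z δ (energy M r v L) L * energy M r v L ^ (z + 4)))
  rw [Real.mul_rpow (by norm_num) hE.le]
  have e1 : energy M r v L ^ (z + 4) = energy M r v L ^ (2 * z) * energy M r v L ^ (-z) *
      energy M r v L ^ 4 := by
    rw [← Real.rpow_add hE, ← Real.rpow_natCast, ← Real.rpow_add hE]; congr 1; push_cast; ring
  have e2 : r ^ (2 * (z * q + 2)) = (r ^ 2) ^ (z * q) * r ^ 4 := by
    rw [← Real.rpow_natCast, ← Real.rpow_natCast, ← Real.rpow_mul h0.le, ← Real.rpow_add h0]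
    congr 1; push_cast; ring
  rw [e1, e2]
  ring

end Cases

/-! ### The bound of the transported quantities by the flux through the leaves -/

/-- A weight is admissible over `I` if it is controlled by the weight of the flux and if the source
term of the transport inequality is controlled by the flux. -/
def Weight.Admissible {M : ℝ} (W : Weight M) (q z δ ε : ℝ) (I : Set ℝ) (Φ : ℝ → ℝ → ℝ → ℝ)
    (C : ℝ) : Prop :=
  ∀ r ∈ I, ∀ v L, 0 ≤ L → 0 < ε * v →
    energy M r v L * (W.j r * W.μ (energy M r v L) L) ≤ C * fluxWeight M q z δ r v L ∧
    W.μ (energy M r v L) L * (v ^ 2 * |W.j' r| + 1 / 2 * L ^ 2 * |potDeriv M r| * W.j r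
      + z * |v| * W.j r * |Φ r v L|) ≤ C * (fluxWeight M q z δ r v L * Φ r v L)

theorem fluxWeight_nonneg {M q z δ r v L : ℝ} (hM : 0 < M) (hr : 2 * M < r) :
    0 ≤ fluxWeight M q z δ r v L := by
  have hB := (bracketWeight_pos z δ (energy M r v L) L).le
  have hE := energy_nonneg M r v L
  have h1 := one_le_factor (q := q) (z := z) (v := v) (L := L) hM hr
  have hN := hE.trans (le_redEnergy hM hr)
  unfold fluxWeight
  change 0 ≤ _ * bracketWeight z δ (energy M r v L) L * _ * _
  have := zero_le_one.trans h1
  positivity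

theorem Weight.Admissible.mono {M : ℝ} {W : Weight M} {q z δ ε : ℝ} {I J : Set ℝ}
    {Φ : ℝ → ℝ → ℝ → ℝ} {C : ℝ} (h : W.Admissible q z δ ε I Φ C) (hJ : J ⊆ I) :
    W.Admissible q z δ ε J Φ C := fun r hr => h r (hJ hr)

theorem Weight.Admissible.of_bounds {M : ℝ} (hM : 0 < M) {W : Weight M} {q z δ ε : ℝ} {I : Set ℝ}
    (hI : ∀ r ∈ I, 2 * M < r) {Φ : ℝ → ℝ → ℝ → ℝ} (hz : 3 < z) {c₁ c₂ c₃ : ℝ} (hc₁ : 0 ≤ c₁)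
    (hc₂ : 0 ≤ c₂) (hc₃ : 0 ≤ c₃)
    (hΦ : ∀ r ∈ I, ∀ v L, 0 ≤ Φ r v L)
    (h : ∀ r ∈ I, ∀ v L, 0 ≤ L → 0 < ε * v →
      energy M r v L * (W.j r * W.μ (energy M r v L) L) ≤ c₁ * fluxWeight M q z δ r v L ∧
      L ^ 2 * |potDeriv M r| ≤ c₂ * (energy M r v L * Φ r v L) ∧
      v ^ 2 * |W.j' r| ≤ c₃ * (W.j r * (energy M r v L * Φ r v L))) :
    W.Admissible q z δ ε I Φ (c₁ + (c₃ + c₂ / 2 + z) * c₁) := by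
  intro r hr v L hL hv
  obtain ⟨h1, h2, h3⟩ := h r hr v L hL hv
  have hr2 := hI r hr
  have hv0 : v ≠ 0 := fun h => by simp [h] at hv
  have hE : 0 < energy M r v L := (energy_pos_iff hM hr2 _ _).mpr (Or.inl hv0)
  have hw := fluxWeight_nonneg (q := q) (z := z) (δ := δ) (v := v) (L := L) hM hr2
  have hz0 : 0 ≤ z := by linarith
  have hk : 0 ≤ (c₃ + c₂ / 2 + z) * c₁ := by positivity
  have hwΦ := mul_nonneg hw (hΦ r hr v L)
  constructor
  · nlinarith
  · have := source_bound (W.j_nonneg r hr2) (W.μ_nonneg _ L hE hL) hz0 (hΦ r hr v L) hc₂ hc₃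
      (abs_le_energy hM hr2 v L) h1 h2 h3
    nlinarith

namespace Foliation

variable {M : ℝ} (𝓕 : Foliation M)

/-- `|v · n|` times the density of the volume form of the leaves. -/
def leafFlux (r v L : ℝ) : ℝ := if r < 𝓕.R₀ then 𝓕.innerFlux r v L else outerFlux M r v L

/-- The point of the phase space above `Σ_τ` with coordinates `(r, e, y)`. -/
def leafPoint (τ r : ℝ) (x : S2 × E3) : Phase := graphPoint M (fun r => 𝓕.height r + τ) r x

/-- The flux through `Σ_τ` of a function and of its time derivative. -/
def flux (q z δ τ : ℝ) (g : Phase → ℝ) : ℝ≥0∞ :=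
  ∫⁻ r in Set.Ioi (2 * M), ∫⁻ x, ENNReal.ofReal ((|g (𝓕.leafPoint τ r x)| ^ z
    + |dT 𝓕.phaseRegion g (𝓕.leafPoint τ r x)| ^ z)
      * (fluxWeight M q z δ r (vr x) (va x) * 𝓕.leafFlux r (vr x) (va x))) ∂sphereBundle

/-- The weighted integral above the sphere of radius `r` of `Σ_τ`. -/
def sphereFlux (W : Weight M) (ε z τ : ℝ) (g : Phase → ℝ) (r : ℝ) : ℝ≥0∞ :=
  ∫⁻ x, ENNReal.ofReal (W.density ε r (vr x) (va x) * |g (𝓕.leafPoint τ r x)| ^ z) ∂sphereBundle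

variable {𝓕}

theorem innerFlux_nonneg (hM : 0 < M) {r : ℝ} (hr : 2 * M < r) (hr' : r ≤ 𝓕.R₀) (v L : ℝ) :
    0 ≤ 𝓕.innerFlux r v L := by
  obtain ⟨c, hc, h⟩ := 𝓕.exists_innerFlux_ge hM
  have hb : 0 ≤ bU M r v L / lapse M r := div_nonneg (bU_nonneg hM hr) (lapse_pos hM hr).le
  exact le_trans (mul_nonneg hc.le (add_nonneg (aU_nonneg hM hr) hb)) (h r hr hr' v L)

theorem outerFlux_nonneg (hM : 0 < M) {r : ℝ} (hr : 2 * M < r) (v L : ℝ) :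
    0 ≤ outerFlux M r v L := by
  have h := outerFlux_ge hM hr v L
  linarith [aU_nonneg (v := v) (L := L) hM hr]

theorem lintegral_le_flux {q z δ τ C a b : ℝ} (hC : 0 ≤ C) {g : Phase → ℝ} {H : ℝ → ℝ}
    {Φ : ℝ → ℝ → ℝ → ℝ} (ha : 2 * M < a)
    (hH : ∀ r ∈ Set.Ioo a b, H r = 𝓕.height r + τ)
    (hΦ : ∀ r ∈ Set.Ioo a b, ∀ v L, Φ r v L = 𝓕.leafFlux r v L) :
    ∫⁻ r in Set.Icc a b, ∫⁻ x, ENNReal.ofReal ((|g (graphPoint M H r x)| ^ z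
      + |dT 𝓕.phaseRegion g (graphPoint M H r x)| ^ z)
        * (C * (fluxWeight M q z δ r (vr x) (va x) * Φ r (vr x) (va x)))) ∂sphereBundle ≤
      ENNReal.ofReal C * 𝓕.flux q z δ τ g := by
  -- The right endpoint may be `R₀`, where the flux density of the leaf already belongs to the null
  -- branch; endpoints are negligible.
  rw [← restrict_Ioo_eq_restrict_Icc]
  have h1 : ∫⁻ r in Set.Ioo a b, ∫⁻ x, ENNReal.ofReal ((|g (graphPoint M H r x)| ^ z
      + |dT 𝓕.phaseRegion g (graphPoint M H r x)| ^ z)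
        * (C * (fluxWeight M q z δ r (vr x) (va x) * Φ r (vr x) (va x)))) ∂sphereBundle =
      ∫⁻ r in Set.Ioo a b, ENNReal.ofReal C * ∫⁻ x, ENNReal.ofReal
        ((|g (𝓕.leafPoint τ r x)| ^ z + |dT 𝓕.phaseRegion g (𝓕.leafPoint τ r x)| ^ z)
        * (fluxWeight M q z δ r (vr x) (va x) * 𝓕.leafFlux r (vr x) (va x))) ∂sphereBundle := by
    refine setLIntegral_congr_fun measurableSet_Ioo fun r hr => ?_
    rw [← lintegral_const_mul' _ _ ENNReal.ofReal_ne_top]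
    refine lintegral_congr fun x => ?_
    have h2 : graphPoint M H r x = 𝓕.leafPoint τ r x := by
      simp only [leafPoint, graphPoint, hH r hr]
    rw [h2, hΦ r hr, ← ENNReal.ofReal_mul hC]
    congr 1; ring
  rw [h1, lintegral_const_mul' _ _ ENNReal.ofReal_ne_top, flux]
  gcongr
  exact fun r hr => ha.trans hr.1

section Transport

variable {W : Weight M} {q z δ ε C τ : ℝ} {g : Phase → ℝ}

theorem sphereFlux_le_inner (hM : 0 < M) (hz : 3 < z) (hε : ε ^ 2 = 1) (hC : 0 ≤ C) (hτ : 0 ≤ τ)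
    (hg : ContDiffOn ℝ 1 g 𝓕.phaseRegion)
    (hg' : ∀ y ∈ 𝓕.phaseRegion, liouville M 𝓕.phaseRegion g y = 0) {a b : ℝ} (ha : 2 * M < a)
    (hab : a ≤ b) (hb : b ≤ 𝓕.R₀) (hW : W.Admissible q z δ ε (Set.Icc a b) 𝓕.innerFlux C) :
    𝓕.sphereFlux W ε z τ g b ≤ 𝓕.sphereFlux W ε z τ g a + ENNReal.ofReal C * 𝓕.flux q z δ τ g ∧
    𝓕.sphereFlux W ε z τ g a ≤ 𝓕.sphereFlux W ε z τ g b + ENNReal.ofReal C * 𝓕.flux q z δ τ g := by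
  have hlt : ∀ r ∈ Set.Icc a b, 2 * M < r := fun r hr => ha.trans_le hr.1
  let T : TransportSetup 𝓕 a b z :=
    { g := g
      H := fun r => 𝓕.innerHeight r + τ
      H' := fun r => 𝓕.U' r - 1 / lapse M r
      W := W
      ε := ε
      S := fun r v L => C * (fluxWeight M q z δ r v L * 𝓕.innerFlux r v L)
      hM := hM
      lt_a := ha
      a_le_b := hab
      hz := hz
      sign := hε
      g_smooth := hg
      g_liouville := hg'
      height_le := fun r hr => by
        rw [𝓕.height_of_le (hr.2.trans hb)]; linarith
      H_deriv := fun r hr => (𝓕.hasDerivAt_innerHeight hM (hlt r hr)).add_const τ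
      H'_cont := by
        have h1 : ContinuousOn 𝓕.U' (Set.Icc a b) :=
          𝓕.continuousOn_U'.mono fun r hr => (hlt r hr).le
        have h2 : ContinuousOn (lapse M) (Set.Icc a b) := fun r hr =>
          (hasDerivAt_lapse M (by linarith [hlt r hr])).continuousAt.continuousWithinAt
        have h3 : ∀ r ∈ Set.Icc a b, lapse M r ≠ 0 := fun r hr => (lapse_pos hM (hlt r hr)).ne'
        fun_prop (disch := assumption)
      S_nonneg := fun r hr v L _ => mul_nonneg hC (mul_nonneg (fluxWeight_nonneg hM (hlt r hr))
        (innerFlux_nonneg hM (hlt r hr) (hr.2.trans hb) v L))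
      source_le := fun r hr v L hL hv => (hW r hr v L hL hv).2 }
  have hK : ∀ r ∈ Set.Icc a b, 𝓕.sphereFlux W ε z τ g r = T.K r := fun r hr => by
    refine lintegral_congr fun x => ?_
    simp only [T, leafPoint, graphPoint, 𝓕.height_of_le (hr.2.trans hb)]
  have hR : T.R ≤ ENNReal.ofReal C * 𝓕.flux q z δ τ g := by
    refine lintegral_le_flux (Φ := 𝓕.innerFlux) hC ha (fun r hr => ?_) fun r hr v L => ?_
    · rw [𝓕.height_of_le (hr.2.le.trans hb)]
    · rw [leafFlux, if_pos (hr.2.trans_le hb)]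
  rw [hK a ⟨le_rfl, hab⟩, hK b ⟨hab, le_rfl⟩]
  exact ⟨(T.K_le (Or.inl ⟨rfl, rfl⟩)).trans (by gcongr),
    (T.K_le (Or.inr ⟨rfl, rfl⟩)).trans (by gcongr)⟩

/-- Only outward propagation is stated, since the average over starting radii is taken inside `R₀`.
-/
theorem sphereFlux_le_outer (hM : 0 < M) (hz : 3 < z) (hε : ε ^ 2 = 1) (hC : 0 ≤ C) (hτ : 0 ≤ τ)
    (hg : ContDiffOn ℝ 1 g 𝓕.phaseRegion)
    (hg' : ∀ y ∈ 𝓕.phaseRegion, liouville M 𝓕.phaseRegion g y = 0) {a b : ℝ} (ha : 𝓕.R₀ ≤ a)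
    (hab : a ≤ b) (hW : W.Admissible q z δ ε (Set.Icc a b) (outerFlux M) C) :
    𝓕.sphereFlux W ε z τ g b ≤ 𝓕.sphereFlux W ε z τ g a + ENNReal.ofReal C * 𝓕.flux q z δ τ g := by
  have ha' : 2 * M < a := (𝓕.two_mul_lt_R₀ hM).trans_le ha
  have hlt : ∀ r ∈ Set.Icc a b, 2 * M < r := fun r hr => ha'.trans_le hr.1
  let T : TransportSetup 𝓕 a b z :=
    { g := g
      H := fun r => 𝓕.outerHeight r + τ
      H' := fun r => 1 / lapse M r
      W := W
      ε := ε
      S := fun r v L => C * (fluxWeight M q z δ r v L * outerFlux M r v L)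
      hM := hM
      lt_a := ha'
      a_le_b := hab
      hz := hz
      sign := hε
      g_smooth := hg
      g_liouville := hg'
      height_le := fun r hr => by
        rw [𝓕.height_of_ge (ha.trans hr.1)]; linarith
      H_deriv := fun r hr => (𝓕.hasDerivAt_outerHeight hM (hlt r hr)).add_const τ
      H'_cont := by
        have h2 : ContinuousOn (lapse M) (Set.Icc a b) := fun r hr =>
          (hasDerivAt_lapse M (by linarith [hlt r hr])).continuousAt.continuousWithinAt
        have h3 : ∀ r ∈ Set.Icc a b, lapse M r ≠ 0 := fun r hr => (lapse_pos hM (hlt r hr)).ne'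
        fun_prop (disch := assumption)
      S_nonneg := fun r hr v L _ => mul_nonneg hC (mul_nonneg (fluxWeight_nonneg hM (hlt r hr))
        (outerFlux_nonneg hM (hlt r hr) v L))
      source_le := fun r hr v L hL hv => (hW r hr v L hL hv).2 }
  have hK : ∀ r ∈ Set.Icc a b, 𝓕.sphereFlux W ε z τ g r = T.K r := fun r hr => by
    refine lintegral_congr fun x => ?_
    simp only [T, leafPoint, graphPoint, 𝓕.height_of_ge (ha.trans hr.1)]
  have hR : T.R ≤ ENNReal.ofReal C * 𝓕.flux q z δ τ g := by
    refine lintegral_le_flux (Φ := outerFlux M) hC ha' (fun r hr => ?_) fun r hr v L => ?_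
    · rw [𝓕.height_of_ge (ha.trans hr.1.le)]
    · rw [leafFlux, if_neg (not_lt.mpr (ha.trans hr.1.le))]
  rw [hK a ⟨le_rfl, hab⟩, hK b ⟨hab, le_rfl⟩]
  exact (T.K_le (Or.inl ⟨rfl, rfl⟩)).trans (by gcongr)

/-- Of the factors in `v_{r*}² ≤ |v_t|²`, one turns `j μ` into the flux weight and the other is
bounded by the flux density. The second step uses that on the spacelike part the flux controls both
null components. -/
theorem lintegral_sphereFlux_le (hM : 0 < M) (hC : 0 ≤ C) {c : ℝ} (hc : 0 < c)
    (hΦ : ∀ r, 2 * M < r → r ≤ 𝓕.R₀ → ∀ v L,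
      c * (aU M r v L + bU M r v L / lapse M r) ≤ 𝓕.innerFlux r v L) {a b : ℝ} (ha : 2 * M < a)
    (hb : b ≤ 𝓕.R₀) (hW : W.Admissible q z δ ε (Set.Icc a b) 𝓕.innerFlux C) :
    ∫⁻ r in Set.Icc a b, 𝓕.sphereFlux W ε z τ g r ≤
      ENNReal.ofReal (C / c) * 𝓕.flux q z δ τ g := by
  refine le_trans ?_ (lintegral_le_flux (C := C / c) (a := a) (b := b) (H := fun r => 𝓕.height r + τ)
    (Φ := 𝓕.innerFlux) (by positivity) ha (fun r _ => rfl) fun r hr v L => ?_)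
  · refine setLIntegral_mono' measurableSet_Icc fun r hr => lintegral_mono fun x =>
      ENNReal.ofReal_le_ofReal ?_
    have hr2 : 2 * M < r := ha.trans_le hr.1
    have hg0 : 0 ≤ |g (𝓕.leafPoint τ r x)| ^ z := Real.rpow_nonneg (abs_nonneg _) _
    have hg1 : 0 ≤ |dT 𝓕.phaseRegion g (𝓕.leafPoint τ r x)| ^ z := Real.rpow_nonneg (abs_nonneg _) _
    have hw := fluxWeight_nonneg (q := q) (z := z) (δ := δ) (v := vr x) (L := va x) hM hr2
    have hΦ0 := innerFlux_nonneg hM hr2 (hr.2.trans hb) (vr x) (va x)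
    have hd : W.density ε r (vr x) (va x) ≤ C / c * (fluxWeight M q z δ r (vr x) (va x) *
        𝓕.innerFlux r (vr x) (va x)) := by
      unfold Weight.density
      split_ifs with hv
      · have hL : 0 ≤ va x := norm_nonneg _
        have h1 := (hW r hr (vr x) (va x) hL hv).1
        have h2 := abs_le_energy hM hr2 (vr x) (va x)
        have hE0 := energy_nonneg M r (vr x) (va x)
        have hv0 : vr x ≠ 0 := fun h => by simp [h] at hv
        have hE : 0 < energy M r (vr x) (va x) := (energy_pos_iff hM hr2 _ _).mpr (Or.inl hv0)
        have hjμ := mul_nonneg (W.j_nonneg r hr2) (W.μ_nonneg _ (va x) hE hL)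
        have h3 : c * energy M r (vr x) (va x) ≤ 𝓕.innerFlux r (vr x) (va x) := by
          refine le_trans ?_ (hΦ r hr2 (hr.2.trans hb) (vr x) (va x))
          rw [← aU_add_bU]
          have hb0 := bU_nonneg (v := vr x) (L := va x) hM hr2
          have : bU M r (vr x) (va x) ≤ bU M r (vr x) (va x) / lapse M r := by
            rw [le_div_iff₀ (lapse_pos hM hr2)]
            nlinarith [lapse_lt_one hM hr2]
          gcongr
        have h4 : energy M r (vr x) (va x) ≤ 𝓕.innerFlux r (vr x) (va x) / c := by
          rw [le_div_iff₀ hc]; linarith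
        calc _ ≤ energy M r (vr x) (va x) ^ 2 *
              (W.j r * W.μ (energy M r (vr x) (va x)) (va x)) := by
              rw [← sq_abs (vr x)]; gcongr
          _ = energy M r (vr x) (va x) * (energy M r (vr x) (va x) *
              (W.j r * W.μ (energy M r (vr x) (va x)) (va x))) := by ring
          _ ≤ 𝓕.innerFlux r (vr x) (va x) / c * (C * fluxWeight M q z δ r (vr x) (va x)) := by
              gcongr
          _ = _ := by ring
      · positivity
    calc _ ≤ C / c * (fluxWeight M q z δ r (vr x) (va x) * 𝓕.innerFlux r (vr x) (va x)) *
          |g (𝓕.leafPoint τ r x)| ^ z := by gcongr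
      _ ≤ C / c * (fluxWeight M q z δ r (vr x) (va x) * 𝓕.innerFlux r (vr x) (va x)) *
          (|g (𝓕.leafPoint τ r x)| ^ z + |dT 𝓕.phaseRegion g (𝓕.leafPoint τ r x)| ^ z) := by
        gcongr; linarith
      _ = _ := by rw [mul_comm]; rfl
  · rw [leafFlux, if_pos (hr.2.trans_le hb)]

/-- Integrating the bound over all starting radii `s` and dividing by `b - a` replaces the unknown
value `K s` by its integral. -/
theorem le_of_average {a b : ℝ} (hab : a < b) {k Q : ℝ≥0∞} {K : ℝ → ℝ≥0∞} {C₁ C₂ : ℝ}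
    (hC₁ : 0 ≤ C₁) (hC₂ : 0 ≤ C₂)
    (h : ∀ s ∈ Set.Icc a b, k ≤ K s + ENNReal.ofReal C₁ * Q)
    (hA : ∫⁻ s in Set.Icc a b, K s ≤ ENNReal.ofReal C₂ * Q) :
    k ≤ ENNReal.ofReal (C₂ / (b - a) + C₁) * Q := by
  have hba : 0 < b - a := sub_pos.mpr hab
  have h1 : k * ENNReal.ofReal (b - a) ≤
      (ENNReal.ofReal C₂ + ENNReal.ofReal C₁ * ENNReal.ofReal (b - a)) * Q := by
    calc k * ENNReal.ofReal (b - a) = ∫⁻ s in Set.Icc a b, k := by simp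
      _ ≤ ∫⁻ s in Set.Icc a b, (K s + ENNReal.ofReal C₁ * Q) :=
        setLIntegral_mono' measurableSet_Icc h
      _ = (∫⁻ s in Set.Icc a b, K s) + ENNReal.ofReal C₁ * Q * ENNReal.ofReal (b - a) := by
        rw [lintegral_add_right _ measurable_const]; simp
      _ ≤ ENNReal.ofReal C₂ * Q + ENNReal.ofReal C₁ * Q * ENNReal.ofReal (b - a) := by gcongr
      _ = _ := by ring
  have h2 : ENNReal.ofReal (C₂ / (b - a) + C₁) * Q = (ENNReal.ofReal C₂ +
      ENNReal.ofReal C₁ * ENNReal.ofReal (b - a)) * Q / ENNReal.ofReal (b - a) := by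
    rw [← ENNReal.ofReal_mul hC₁, ← ENNReal.ofReal_add hC₂ (by positivity),
      ENNReal.mul_div_right_comm, ← ENNReal.ofReal_div_of_pos hba]
    congr 2; field_simp
  rw [h2]
  exact (ENNReal.le_div_iff_mul_le (Or.inl (by simpa using hab)) (Or.inl ENNReal.ofReal_ne_top)).mpr h1

-- Start at an arbitrary `s` in `[3M, R₀]`. Radii up to `R₀` are reached along the spacelike part,
-- inward or outward; larger ones by going to `R₀` and then along the null part, hence `C + C`. Then
-- average over `s`; this uses `3M < R₀`.
variable (𝓕) in
theorem exists_sphereFlux_le (hM : 0 < M) (hz : 3 < z) (hε : ε ^ 2 = 1) (hC : 0 ≤ C) :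
    ∃ C' : ℝ, 0 ≤ C' ∧ ∀ τ, 0 ≤ τ → ∀ g : Phase → ℝ, ContDiffOn ℝ 1 g 𝓕.phaseRegion →
      (∀ y ∈ 𝓕.phaseRegion, liouville M 𝓕.phaseRegion g y = 0) →
      (W.Admissible q z δ ε (Set.Ioc (2 * M) 𝓕.R₀) 𝓕.innerFlux C →
        ∀ r, 2 * M < r → r ≤ 𝓕.R₀ →
          𝓕.sphereFlux W ε z τ g r ≤ ENNReal.ofReal C' * 𝓕.flux q z δ τ g) ∧
      (W.Admissible q z δ ε (Set.Icc (3 * M) 𝓕.R₀) 𝓕.innerFlux C →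
        W.Admissible q z δ ε (Set.Ici 𝓕.R₀) (outerFlux M) C →
        ∀ r, 𝓕.R₀ ≤ r → 𝓕.sphereFlux W ε z τ g r ≤ ENNReal.ofReal C' * 𝓕.flux q z δ τ g) := by
  have h3 := 𝓕.three_mul_lt
  obtain ⟨c, hc, hΦ⟩ := 𝓕.exists_innerFlux_ge hM
  refine ⟨C / c / (𝓕.R₀ - 3 * M) + (C + C), by
    have : 0 < 𝓕.R₀ - 3 * M := by linarith
    positivity, fun τ hτ g hg hg' => ⟨fun hW r hr hr' => ?_, fun hW₁ hW₂ r hr => ?_⟩⟩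
  · refine le_of_average (K := 𝓕.sphereFlux W ε z τ g) h3 (by positivity) (by positivity)
      (fun s hs => ?_) (lintegral_sphereFlux_le hM hC hc hΦ (by linarith) le_rfl
        (hW.mono fun s hs => ⟨by linarith [hs.1], hs.2⟩))
    have hs2 : 2 * M < s := by linarith [hs.1]
    have hCC : ENNReal.ofReal C ≤ ENNReal.ofReal (C + C) := ENNReal.ofReal_le_ofReal (by linarith)
    rcases le_total r s with h | h
    · exact (sphereFlux_le_inner hM hz hε hC hτ hg hg' hr h hs.2
        (hW.mono fun x hx => ⟨hr.trans_le hx.1, hx.2.trans hs.2⟩)).2.trans (by gcongr)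
    · exact (sphereFlux_le_inner hM hz hε hC hτ hg hg' hs2 h hr'
        (hW.mono fun x hx => ⟨hs2.trans_le hx.1, hx.2.trans hr'⟩)).1.trans (by gcongr)
  · refine le_of_average (K := 𝓕.sphereFlux W ε z τ g) h3 (by positivity) (by positivity)
      (fun s hs => ?_) (lintegral_sphereFlux_le hM hC hc hΦ (by linarith) le_rfl hW₁)
    have hs2 : 2 * M < s := by linarith [hs.1]
    have e1 := sphereFlux_le_outer hM hz hε hC hτ hg hg' le_rfl hr
      (hW₂.mono fun x hx => hx.1)
    have e2 := (sphereFlux_le_inner hM hz hε hC hτ hg hg' hs2 hs.2 le_rfl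
      (hW₁.mono fun x hx => ⟨hs.1.trans hx.1, hx.2⟩)).1
    rw [ENNReal.ofReal_add hC hC, add_mul, ← add_assoc]
    exact e1.trans (by gcongr)

end Transport

end Foliation

/-! ### Choice of the weights near the horizon and in the far region -/

namespace Foliation

variable {M : ℝ} (𝓕 : Foliation M) {q z δ : ℝ}

theorem exists_near_weight (hM : 0 < M) (hz : 3 < z) (hq : 0 ≤ q) {ε : ℝ} (hε : ε = 1 ∨ ε = -1) :
    ∃ (W : Weight M) (C₁ C₂ : ℝ), 0 ≤ C₁ ∧ 0 ≤ C₂ ∧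
      W.Admissible q z δ ε (Set.Ioc (2 * M) 𝓕.R₀) 𝓕.innerFlux C₁ ∧
      ∀ r ∈ Set.Ioc (2 * M) 𝓕.R₀, ∀ v L, 0 < ε * v →
        holderWeight M q z δ r v L ≤ C₂ * (W.j r * W.μ (energy M r v L) L) := by
  obtain ⟨c, hc, hΦ⟩ := 𝓕.exists_innerFlux_ge hM
  have hz0 : 0 < z := by linarith
  have hpot : ∀ r ∈ Set.Ioc (2 * M) 𝓕.R₀, ∀ v L, L ^ 2 * |potDeriv M r| ≤
      8 / (M * c) * (energy M r v L * 𝓕.innerFlux r v L) := fun r hr v L =>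
    pot_le_of_flux hM hr.1 hc (hΦ r hr.1 hr.2 v L)
  have hR₀ : 0 ≤ 𝓕.R₀ := by linarith [𝓕.two_mul_lt_R₀ hM]
  have hk : ∀ c₁ c₃ : ℝ, 0 ≤ c₁ → 0 ≤ c₃ → 0 ≤ c₁ + (c₃ + 8 / (M * c) / 2 + z) * c₁ :=
    fun c₁ c₃ h₁ h₃ => by positivity
  rcases hε with rfl | rfl
  · refine ⟨nearOut hM z δ, _, _, hk (2 ^ (2 * (z + 1))) (2 * (z + 1) / M / c) (by positivity)
      (by positivity), ?_, Weight.Admissible.of_bounds hM (fun r hr => hr.1) hz (by positivity)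
      (by positivity) (by positivity) (fun r hr v L => innerFlux_nonneg hM hr.1 hr.2 v L)
      fun r hr v L _ hv => ⟨weight_le_nearOut hM hr.1 hz (by simpa using hv), hpot r hr v L,
        deriv_le_nearOut hM hr.1 hz (by simpa using hv) hc (hΦ r hr.1 hr.2 v L)⟩,
      fun r hr v L hv => holderWeight_le_nearOut hM hr.1 hz hq (by simpa using hv) hr.2⟩
    positivity
  · refine ⟨nearIn z δ, _, _, hk ((1 + 4 * 𝓕.R₀ ^ 2) ^ (2 * (z + 1))) 0 (by positivity) le_rfl, ?_,
      Weight.Admissible.of_bounds hM (fun r hr => hr.1) hz (by positivity)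
      (by positivity) le_rfl (fun r hr v L => innerFlux_nonneg hM hr.1 hr.2 v L)
      fun r hr v L _ hv => ⟨weight_le_nearIn hM hr.1 hz (fun h => by simp [h] at hv) hr.2,
        hpot r hr v L, ?_⟩,
      fun r hr v L hv => holderWeight_le_nearIn hM hr.1 hz hq (by simpa using hv) hr.2⟩
    · positivity
    · change v ^ 2 * |(0 : ℝ)| ≤ _
      simp

theorem far_admissible (hM : 0 < M) (hz : 3 < z) (hq : 0 ≤ q) {I : Set ℝ}
    (hI : ∀ r ∈ I, 3 * M ≤ r) {Φ : ℝ → ℝ → ℝ → ℝ} {c : ℝ} (hc : 0 < c)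
    (hΦ : ∀ r ∈ I, ∀ v L, c * aU M r v L ≤ Φ r v L) :
    (∃ C, 0 ≤ C ∧ (farOut (M := M) q z δ).Admissible q z δ 1 I Φ C) ∧
    ∃ C, 0 ≤ C ∧ (farIn hM q z δ).Admissible q z δ (-1) I Φ C := by
  have hz0 : 0 < z := by linarith
  have hzq : 0 ≤ z * q := mul_nonneg hz0.le hq
  have hI2 : ∀ r ∈ I, 2 * M < r := fun r hr => by linarith [hI r hr]
  have hΦ0 : ∀ r ∈ I, ∀ v L, 0 ≤ Φ r v L := fun r hr v L =>
    (mul_nonneg hc.le (aU_nonneg hM (hI2 r hr))).trans (hΦ r hr v L)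
  have hk : ∀ c₁ c₃ : ℝ, 0 ≤ c₁ → 0 ≤ c₃ → 0 ≤ c₁ + (c₃ + 24 / (M * c) / 2 + z) * c₁ :=
    fun c₁ c₃ h₁ h₃ => by positivity
  have hpot : ∀ r ∈ I, ∀ v L, L ^ 2 * |potDeriv M r| ≤
      24 / (M * c) * (energy M r v L * Φ r v L) := fun r hr v L =>
    pot_le_of_flux' hM (hI r hr) hc (hΦ r hr v L)
  refine ⟨⟨_, hk (13 ^ (z * q + 2)) 0 (by positivity) le_rfl,
      Weight.Admissible.of_bounds hM hI2 hz (by positivity) (by positivity) le_rfl hΦ0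
      fun r hr v L _ hv => ⟨weight_le_farOut hM (hI r hr) hz hq (by simpa using hv),
        hpot r hr v L, ?_⟩⟩,
    ⟨_, hk (2 ^ (z * q + 2)) (2 * (z * q + 2) / M / c) (by positivity) (by positivity),
      Weight.Admissible.of_bounds hM hI2 hz (by positivity) (by positivity) (by positivity) hΦ0
      fun r hr v L _ hv => ⟨weight_le_farIn hM (hI2 r hr) hz hq (by simpa using hv),
        hpot r hr v L, deriv_le_farIn hM (hI2 r hr) hz hq (by simpa using hv) hc (hΦ r hr v L)⟩⟩⟩
  change v ^ 2 * |(0 : ℝ)| ≤ _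
  simp

theorem _root_.SchwarzschildVlasov.Weight.Admissible.mono_const {W : Weight M} (hM : 0 < M) {ε : ℝ}
    {I : Set ℝ} (hI : ∀ r ∈ I, 2 * M < r) {Φ : ℝ → ℝ → ℝ → ℝ} {C C' : ℝ}
    (hΦ : ∀ r ∈ I, ∀ v L, 0 ≤ Φ r v L)
    (h : W.Admissible q z δ ε I Φ C) (hC : C ≤ C') : W.Admissible q z δ ε I Φ C' := by
  intro r hr v L hL hv
  have hw := fluxWeight_nonneg (q := q) (z := z) (δ := δ) (v := v) (L := L) hM (hI r hr)
  have hwΦ := mul_nonneg hw (hΦ r hr v L)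
  obtain ⟨h1, h2⟩ := h r hr v L hL hv
  exact ⟨h1.trans (by gcongr), h2.trans (by gcongr)⟩

theorem exists_far_weight (hM : 0 < M) (hz : 3 < z) (hq : 0 ≤ q) {ε : ℝ} (hε : ε = 1 ∨ ε = -1) :
    ∃ (W : Weight M) (C₁ C₂ : ℝ), 0 ≤ C₁ ∧ 0 ≤ C₂ ∧
      W.Admissible q z δ ε (Set.Icc (3 * M) 𝓕.R₀) 𝓕.innerFlux C₁ ∧
      W.Admissible q z δ ε (Set.Ici 𝓕.R₀) (outerFlux M) C₁ ∧
      ∀ r ∈ Set.Ici 𝓕.R₀, ∀ v L, 0 < ε * v →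
        holderWeight M q z δ r v L ≤ C₂ * (W.j r * W.μ (energy M r v L) L) := by
  obtain ⟨c, hc, hΦ⟩ := 𝓕.exists_innerFlux_ge hM
  have h3 := 𝓕.three_mul_lt
  have hi2 : ∀ r ∈ Set.Icc (3 * M) 𝓕.R₀, 2 * M < r := fun r hr => by linarith [hr.1]
  have ho3 : ∀ r ∈ Set.Ici 𝓕.R₀, 3 * M ≤ r := fun r hr => h3.le.trans hr
  have ho2 : ∀ r ∈ Set.Ici 𝓕.R₀, 2 * M < r := fun r hr => by linarith [ho3 r hr]
  have hi := far_admissible (δ := δ) hM hz hq (I := Set.Icc (3 * M) 𝓕.R₀) (Φ := 𝓕.innerFlux)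
    (fun r hr => hr.1) hc fun r hr v L => by
      refine le_trans ?_ (hΦ r (hi2 r hr) hr.2 v L)
      have hb : 0 ≤ bU M r v L / lapse M r :=
        div_nonneg (bU_nonneg hM (hi2 r hr)) (lapse_pos hM (hi2 r hr)).le
      gcongr; linarith
  have ho := far_admissible (δ := δ) hM hz hq (I := Set.Ici 𝓕.R₀) (Φ := outerFlux M) ho3 one_pos
    fun r hr v L => outerFlux_ge hM (ho2 r hr) v L
  have hi0 : ∀ r ∈ Set.Icc (3 * M) 𝓕.R₀, ∀ v L, 0 ≤ 𝓕.innerFlux r v L := fun r hr v L =>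
    innerFlux_nonneg hM (hi2 r hr) hr.2 v L
  have ho0 : ∀ r ∈ Set.Ici 𝓕.R₀, ∀ v L, 0 ≤ outerFlux M r v L := fun r hr v L =>
    outerFlux_nonneg hM (ho2 r hr) v L
  rcases hε with rfl | rfl
  · obtain ⟨⟨C, hC, h⟩, -⟩ := hi
    obtain ⟨⟨C', hC', h'⟩, -⟩ := ho
    refine ⟨farOut q z δ, C + C', _, by positivity, ?_, h.mono_const hM hi2 hi0 (by linarith),
      h'.mono_const hM ho2 ho0 (by linarith), fun r hr v L hv =>
        holderWeight_le_farOut hM (ho3 r hr) hz hq (by simpa using hv)⟩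
    positivity
  · obtain ⟨-, C, hC, h⟩ := hi
    obtain ⟨-, C', hC', h'⟩ := ho
    refine ⟨farIn hM q z δ, C + C', _, by positivity, ?_, h.mono_const hM hi2 hi0 (by linarith),
      h'.mono_const hM ho2 ho0 (by linarith), fun r hr v L hv =>
        holderWeight_le_farIn hM (ho3 r hr) hz hq (by simpa using hv)⟩
    positivity

/-- For each sign of `v_{r*}` and each `r`, there is a weight which dominates the one of the Hölder
inequality, and whose integral above the sphere of radius `r` is bounded by the flux. -/
theorem exists_weight (hM : 0 < M) (hz : 3 < z) (hq : 0 ≤ q) {ε : ℝ} (hε : ε = 1 ∨ ε = -1) :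
    ∃ C : ℝ, 0 ≤ C ∧ ∀ r, 2 * M < r → ∃ W : Weight M,
      (∀ v L, 0 ≤ L → 0 < ε * v →
        holderWeight M q z δ r v L ≤ C * (W.j r * W.μ (energy M r v L) L)) ∧
      ∀ τ, 0 ≤ τ → ∀ g : Phase → ℝ, ContDiffOn ℝ 1 g 𝓕.phaseRegion →
      (∀ y ∈ 𝓕.phaseRegion, liouville M 𝓕.phaseRegion g y = 0) →
        𝓕.sphereFlux W ε z τ g r ≤ ENNReal.ofReal C * 𝓕.flux q z δ τ g := by
  have hε2 : ε ^ 2 = 1 := by rcases hε with rfl | rfl <;> norm_num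
  obtain ⟨W₁, C₁, D₁, hC₁, hD₁, h₁, h₁'⟩ := 𝓕.exists_near_weight (δ := δ) hM hz hq hε
  obtain ⟨W₂, C₂, D₂, hC₂, hD₂, h₂, h₂', h₂''⟩ := 𝓕.exists_far_weight (δ := δ) hM hz hq hε
  obtain ⟨K₁, hK₁, k₁⟩ := 𝓕.exists_sphereFlux_le (W := W₁) (q := q) (δ := δ) hM hz hε2 hC₁
  obtain ⟨K₂, hK₂, k₂⟩ := 𝓕.exists_sphereFlux_le (W := W₂) (q := q) (δ := δ) hM hz hε2 hC₂
  have hjμ : ∀ (W : Weight M) r, 2 * M < r → ∀ v L, 0 ≤ L → 0 < ε * v →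
      0 ≤ W.j r * W.μ (energy M r v L) L := fun W r hr v L hL hv => by
    have hv0 : v ≠ 0 := fun h => by simp [h] at hv
    exact mul_nonneg (W.j_nonneg r hr)
      (W.μ_nonneg _ L ((energy_pos_iff hM hr _ _).mpr (Or.inl hv0)) hL)
  refine ⟨D₁ + D₂ + K₁ + K₂, by positivity, fun r hr => ?_⟩
  rcases le_total r 𝓕.R₀ with h | h
  · refine ⟨W₁, fun v L hL hv => (h₁' r ⟨hr, h⟩ v L hv).trans ?_, fun τ hτ g hg hg' =>
      ((k₁ τ hτ g hg hg').1 h₁ r hr h).trans ?_⟩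
    · have := hjμ W₁ r hr v L hL hv
      gcongr; linarith
    · gcongr; linarith
  · refine ⟨W₂, fun v L hL hv => (h₂'' r h v L hv).trans ?_, fun τ hτ g hg hg' =>
      ((k₂ τ hτ g hg hg').2 h₂ h₂' r h).trans ?_⟩
    · have := hjμ W₂ r hr v L hL hv
      gcongr; linarith
    · gcongr; linarith

end Foliation

/-! ### The integral in the dual factor of the Hölder inequality -/

/-- The factor `|x|^{-s} (1 + x²)^{-m}`. -/
def dualFactor (s m x : ℝ) : ℝ≥0∞ := ENNReal.ofReal |x| ^ (-s) * ENNReal.ofReal ((1 + x ^ 2) ^ (-m))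

theorem measurable_dualFactor (s m : ℝ) : Measurable (dualFactor s m) := by
  unfold dualFactor; fun_prop

/-- Near `0` the function is at most `|x|^{-s}`, near infinity at most `|x|^{-s-2m}`; the two strict
inequalities are the corresponding integrability conditions. -/
theorem lintegral_dualFactor_lt_top {s m : ℝ} (hs1 : s < 1) (hm : 0 ≤ m)
    (hsm : 1 < s + 2 * m) : ∫⁻ x, dualFactor s m x < ⊤ := by
  have hpos : ∫⁻ x in Set.Ioi (0 : ℝ), dualFactor s m x < ⊤ := by
    have h1 : ∫⁻ x in Set.Ioc (0 : ℝ) 1, dualFactor s m x < ⊤ := by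
      have hi : IntegrableOn (fun x : ℝ => x ^ (-s)) (Set.Ioc 0 1) := by
        rw [← intervalIntegrable_iff_integrableOn_Ioc_of_le zero_le_one]
        exact intervalIntegral.intervalIntegrable_rpow' (by linarith)
      refine lt_of_le_of_lt (setLIntegral_mono' measurableSet_Ioc fun x hx => ?_) hi.lintegral_lt_top
      rw [dualFactor, abs_of_pos hx.1, ENNReal.ofReal_rpow_of_pos hx.1]
      refine mul_le_of_le_one_right' ?_
      rw [ENNReal.ofReal_le_one]
      exact Real.rpow_le_one_of_one_le_of_nonpos (by nlinarith [sq_nonneg x]) (by linarith)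
    have h2 : ∫⁻ x in Set.Ioi (1 : ℝ), dualFactor s m x < ⊤ := by
      have hi : IntegrableOn (fun x : ℝ => x ^ (-s - 2 * m)) (Set.Ioi 1) :=
        integrableOn_Ioi_rpow_of_lt (by linarith) one_pos
      refine lt_of_le_of_lt (setLIntegral_mono' measurableSet_Ioi fun x hx => ?_) hi.lintegral_lt_top
      have hx0 : 0 < x := one_pos.trans hx
      rw [dualFactor, abs_of_pos hx0, ENNReal.ofReal_rpow_of_pos hx0,
        ← ENNReal.ofReal_mul (by positivity)]
      refine ENNReal.ofReal_le_ofReal ?_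
      rw [sub_eq_add_neg, Real.rpow_add hx0]
      gcongr
      rw [← mul_neg, Real.rpow_mul hx0.le, Real.rpow_two]
      exact Real.rpow_le_rpow_of_nonpos (by positivity) (by linarith) (by linarith)
    rw [← Set.Ioc_union_Ioi_eq_Ioi zero_le_one]
    exact (lintegral_union_le _ _ _).trans_lt (ENNReal.add_lt_top.mpr ⟨h1, h2⟩)
  have hneg : ∫⁻ x in Set.Iio (0 : ℝ), dualFactor s m x < ⊤ := by
    have h := (Measure.measurePreserving_neg (volume : Measure ℝ)).setLIntegral_comp_preimage
      (s := Set.Ioi (0 : ℝ)) measurableSet_Ioi (measurable_dualFactor s m)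
    have h2 : (Neg.neg ⁻¹' Set.Ioi (0 : ℝ)) = Set.Iio 0 := by ext; simp
    rw [h2] at h
    have h3 : ∀ x, dualFactor s m (-x) = dualFactor s m x := fun x => by simp [dualFactor]
    simp only [h3] at h
    rwa [h]
  rw [← setLIntegral_univ, ← Set.Iic_union_Ioi (a := (0 : ℝ))]
  refine (lintegral_union_le _ _ _).trans_lt (ENNReal.add_lt_top.mpr ⟨?_, hpos⟩)
  rwa [setLIntegral_congr Iio_ae_eq_Iic.symm]

/-- Coordinates of which the first axis is a given direction. -/
theorem exists_isometry {e : E3} (he : ‖e‖ = 1) : ∃ φ : E3 ≃ₗᵢ[ℝ] E3,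
    (∀ y, φ y 0 = inner ℝ e y) ∧ ∀ y i, |φ y i| ≤ max |inner ℝ e y| ‖cross e y‖ := by
  have ho : Orthonormal ℝ (({0} : Set (Fin 3)).domRestrict fun _ => e) := by
    rw [orthonormal_iff_ite]
    rintro ⟨i, hi⟩ ⟨j, hj⟩
    have h : i = j := (Set.mem_singleton_iff.mp hi).trans (Set.mem_singleton_iff.mp hj).symm
    subst h
    simp [Set.domRestrict, he]
  obtain ⟨b, hb⟩ := ho.exists_orthonormalBasis_extension_of_card_eq (by simp)
  have h0 : ∀ y, b.repr y 0 = inner ℝ e y := fun y => by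
    rw [b.repr_apply_apply, hb 0 rfl]
  refine ⟨b.repr, h0, fun y i => ?_⟩
  have h1 : (b.repr y 0) ^ 2 + (b.repr y 1) ^ 2 + (b.repr y 2) ^ 2 =
      inner ℝ e y ^ 2 + ‖cross e y‖ ^ 2 := by
    rw [← norm_sq_decomp y he, ← b.repr.norm_map y, norm_sq_eq_sum]
  rw [h0] at h1
  fin_cases i
  · exact (congrArg abs (h0 y)).le.trans (le_max_left _ _)
  · refine le_trans ?_ (le_max_right _ _)
    have h2 : b.repr y 1 ^ 2 ≤ ‖cross e y‖ ^ 2 := by nlinarith [sq_nonneg (b.repr y 2)]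
    exact abs_le_of_sq_le_sq h2 (norm_nonneg _)
  · refine le_trans ?_ (le_max_right _ _)
    have h2 : b.repr y 2 ^ 2 ≤ ‖cross e y‖ ^ 2 := by nlinarith [sq_nonneg (b.repr y 1)]
    exact abs_le_of_sq_le_sq h2 (norm_nonneg _)

theorem lintegral_prod_dualFactor {s m : ℝ} (φ : E3 ≃ₗᵢ[ℝ] E3) :
    ∫⁻ y, dualFactor s m (φ y 0) * (dualFactor s m (φ y 1) * dualFactor s m (φ y 2)) =
      (∫⁻ x, dualFactor s m x) * ((∫⁻ x, dualFactor s m x) * ∫⁻ x, dualFactor s m x) := by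
  have hm := measurable_dualFactor s m
  have h := φ.measurePreserving.lintegral_comp
    (f := fun y : E3 => dualFactor s m (y 0) * (dualFactor s m (y 1) * dualFactor s m (y 2)))
    (by fun_prop)
  rw [h, lintegral_E3 (by fun_prop), Measure.volume_eq_prod, Measure.volume_eq_prod]
  simp only [Matrix.cons_val_zero, Matrix.cons_val_one, Matrix.cons_val]
  rw [lintegral_prod_mul (f := dualFactor s m)
    (g := fun w : ℝ × ℝ => dualFactor s m w.1 * dualFactor s m w.2) (by fun_prop) (by fun_prop),
    lintegral_prod_mul (f := dualFactor s m) (g := dualFactor s m) (by fun_prop) (by fun_prop)]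

/-- The function which appears in the dual factor is dominated by a product. -/
theorem dual_le {s m v E L : ℝ} {a : Fin 3 → ℝ} (hs : 0 ≤ s) (hm : 0 ≤ m) (hL : 0 ≤ L)
    (hvE : |v| ≤ E) (hv : v ≠ 0) (h0 : a 0 = v) (ha : ∀ i, |a i| ≤ max |v| L) :
    ENNReal.ofReal (|v| ^ (-s) * (E + L) ^ (-(2 * s)) * (1 + (E + L) ^ 2) ^ (-(3 * m))) ≤
      dualFactor s m (a 0) * (dualFactor s m (a 1) * dualFactor s m (a 2)) := by
  have hv0 : 0 < |v| := abs_pos.mpr hv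
  have hE : 0 < E + L := by linarith
  have hb : ∀ i, |a i| ≤ E + L := fun i => (ha i).trans (max_le (by linarith) (by linarith))
  have e1 : (1 + (E + L) ^ 2) ^ (-(3 * m)) = (1 + (E + L) ^ 2) ^ (-m) *
      ((1 + (E + L) ^ 2) ^ (-m) * (1 + (E + L) ^ 2) ^ (-m)) := by
    rw [← Real.rpow_add (by positivity), ← Real.rpow_add (by positivity)]; congr 1; ring
  have e2 : (E + L) ^ (-(2 * s)) = (E + L) ^ (-s) * (E + L) ^ (-s) := by
    rw [← Real.rpow_add hE]; congr 1; ring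
  -- The exponents are split evenly over three coordinates. The first keeps `|v|^{-s}`; each of the
  -- other two takes one factor `(E + L)^{-s}`, to be compared with `|a i|^{-s}`.
  have e3 : |v| ^ (-s) * (E + L) ^ (-(2 * s)) * (1 + (E + L) ^ 2) ^ (-(3 * m)) =
      (|v| ^ (-s) * (1 + (E + L) ^ 2) ^ (-m)) * (((E + L) ^ (-s) * (1 + (E + L) ^ 2) ^ (-m)) *
        ((E + L) ^ (-s) * (1 + (E + L) ^ 2) ^ (-m))) := by
    rw [e1, e2]; ring
  have hm' : ∀ i, ENNReal.ofReal ((1 + (E + L) ^ 2) ^ (-m)) ≤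
      ENNReal.ofReal ((1 + a i ^ 2) ^ (-m)) := fun i => by
    refine ENNReal.ofReal_le_ofReal (Real.rpow_le_rpow_of_nonpos (by positivity) ?_ (by linarith))
    have : a i ^ 2 ≤ (E + L) ^ 2 := by
      rw [← sq_abs (a i)]; gcongr; exact hb i
    linarith
  -- Taking the power in `[0, ∞]` covers the case `a i = 0` as well.
  have hs' : ∀ i, ENNReal.ofReal ((E + L) ^ (-s)) ≤ ENNReal.ofReal |a i| ^ (-s) := fun i => by
    rw [← ENNReal.ofReal_rpow_of_pos hE, ENNReal.rpow_neg, ENNReal.rpow_neg, ENNReal.inv_le_inv]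
    gcongr
    exact hb i
  have h0' : ENNReal.ofReal (|v| ^ (-s)) = ENNReal.ofReal |a 0| ^ (-s) := by
    rw [h0, ENNReal.ofReal_rpow_of_pos hv0]
  rw [e3, ENNReal.ofReal_mul (by positivity), ENNReal.ofReal_mul (by positivity),
    ENNReal.ofReal_mul (by positivity), ENNReal.ofReal_mul (by positivity)]
  unfold dualFactor
  rw [h0']
  exact mul_le_mul' (mul_le_mul' le_rfl (hm' 0))
    (mul_le_mul' (mul_le_mul' (hs' 1) (hm' 1)) (mul_le_mul' (hs' 2) (hm' 2)))

/-- The function `μ` is continuous only for `L ≥ 0`; the absolute value extends the density to the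
whole plane. -/
theorem Weight.measurable_density {M : ℝ} (W : Weight M) (hM : 0 < M) (ε : ℝ) {r : ℝ}
    (hr : 2 * M < r) : Measurable fun p : ℝ × ℝ => W.density ε r p.1 |p.2| := by
  have hs : MeasurableSet {p : ℝ × ℝ | 0 < ε * p.1} :=
    measurableSet_lt measurable_const (by fun_prop)
  have h1 : ContinuousOn (fun p : ℝ × ℝ => p.1 ^ 2 * (W.j r * W.μ (energy M r p.1 |p.2|) |p.2|))
      {p : ℝ × ℝ | 0 < ε * p.1} := by
    have hE : Continuous fun p : ℝ × ℝ => (energy M r p.1 |p.2|, |p.2|) := by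
      unfold energy; fun_prop
    have h2 : ContinuousOn (fun p : ℝ × ℝ => W.μ (energy M r p.1 |p.2|) |p.2|)
        {p : ℝ × ℝ | 0 < ε * p.1} := by
      refine W.μ_cont.comp (f := fun p : ℝ × ℝ => (energy M r p.1 |p.2|, |p.2|)) hE.continuousOn
        fun p hp => ⟨(energy_pos_iff hM hr _ _).mpr (Or.inl fun h => ?_),
          Set.mem_Ici.mpr (abs_nonneg p.2)⟩
      have : 0 < ε * p.1 := hp
      simp [h] at this
    fun_prop
  have h3 : (fun p : ℝ × ℝ => W.density ε r p.1 |p.2|) = Set.indicator {p : ℝ × ℝ | 0 < ε * p.1}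
      fun p => p.1 ^ 2 * (W.j r * W.μ (energy M r p.1 |p.2|) |p.2|) := by
    funext p
    simp only [Weight.density, Set.indicator_apply, Set.mem_ofPred_eq]
  rw [h3]
  exact measurable_indicator_of_continuousOn hs h1

theorem Weight.density_nonneg {M : ℝ} (W : Weight M) (hM : 0 < M) (ε : ℝ) {r : ℝ}
    (hr : 2 * M < r) {v L : ℝ} (hL : 0 ≤ L) : 0 ≤ W.density ε r v L := by
  unfold Weight.density
  split_ifs with hv
  · have hv0 : v ≠ 0 := fun h => by simp [h] at hv
    exact mul_nonneg (sq_nonneg v) (mul_nonneg (W.j_nonneg r hr)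
      (W.μ_nonneg _ L ((energy_pos_iff hM hr _ _).mpr (Or.inl hv0)) hL))
  · exact le_rfl

theorem measurable_leafPoint {M : ℝ} (𝓕 : Foliation M) (τ r : ℝ) :
    Measurable (𝓕.leafPoint τ r) := by
  have h1 : Measurable fun x : S2 × E3 => mom M r (x.1 : E3) x.2 :=
    measurable_mom M measurable_const (by fun_prop) (by fun_prop)
  have h2 : Measurable fun x : S2 × E3 => r • (x.1 : E3) := by fun_prop
  exact measurable_const.prodMk (h2.prodMk h1)

namespace Foliation

variable {M : ℝ} {𝓕 : Foliation M}

/-- Nothing is known about `f` off the phase region, so measurability is available only after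
multiplication by its indicator. -/
theorem measurable_indicator_word (hM : 0 < M) {z : ℝ} (hz : 3 < z) {f : Phase → ℝ} {k : ℕ}
    (hk : k < 3) (hf : ContDiffOn ℝ 2 f 𝓕.phaseRegion) (I : Fin k → Fin 3) :
    Measurable (𝓕.phaseRegion.indicator
      fun y => ENNReal.ofReal (|omegaHatWord 𝓕.phaseRegion I f y| ^ z)) := by
  have h1 : ContinuousOn (omegaHatWord 𝓕.phaseRegion I f) 𝓕.phaseRegion :=
    (𝓕.contDiffOn_omegaHatWord (n := 0) hM
      (hf.of_le (by norm_cast; omega)) I).continuousOn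
  refine measurable_indicator_of_continuousOn (𝓕.measurableSet_phaseRegion hM) ?_
  exact ENNReal.continuous_ofReal.comp_continuousOn
    (h1.abs.rpow_const fun _ _ => Or.inr (by linarith))

theorem indicator_rotSum (D : Set Phase) (z : ℝ) (f : Phase → ℝ) (y : Phase) :
    D.indicator (fun y => ENNReal.ofReal (rotSum D z f y)) y =
      ∑ k ∈ Finset.range 3, ∑ I : Fin k → Fin 3,
        D.indicator (fun y => ENNReal.ofReal (|omegaHatWord D I f y| ^ z)) y := by
  by_cases hy : y ∈ D
  · simp only [Set.indicator_of_mem hy, rotSum]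
    rw [ENNReal.ofReal_sum_of_nonneg fun k _ => Finset.sum_nonneg fun I _ =>
      Real.rpow_nonneg (abs_nonneg _) _]
    refine Finset.sum_congr rfl fun k _ => ?_
    rw [ENNReal.ofReal_sum_of_nonneg fun I _ => Real.rpow_nonneg (abs_nonneg _) _]
  · simp [Set.indicator_of_notMem hy]

theorem lintegral_density_le (hM : 0 < M) {z : ℝ} (hz : 3 < z) {f : Phase → ℝ}
    (hf : ContDiffOn ℝ 2 f 𝓕.phaseRegion) (W : Weight M) (ε : ℝ) {r τ : ℝ} (hr : 2 * M < r)
    (hτ : 0 ≤ τ) {e : E3} (he : ‖e‖ = 1) :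
    ∫⁻ y, ENNReal.ofReal (W.density ε r (inner ℝ e y) ‖cross e y‖ *
        |f (𝓕.height r + τ, r • e, mom M r e y)| ^ z) ≤
      ENNReal.ofReal (8 * sobolevConst z) * ∑ k ∈ Finset.range 3, ∑ I : Fin k → Fin 3,
        𝓕.sphereFlux W ε z τ (omegaHatWord 𝓕.phaseRegion I f) r := by
  have hk : Measurable fun p : ℝ × ℝ => ENNReal.ofReal (W.density ε r p.1 |p.2|) :=
    (W.measurable_density hM ε hr).ennreal_ofReal
  have h := 𝓕.sobolev_sphere hM hz hf hr (t := 𝓕.height r + τ) (by linarith) he hk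
  simp only [abs_norm] at h
  have e1 : ∀ (y : E3) (x : ℝ), ENNReal.ofReal (W.density ε r (inner ℝ e y) ‖cross e y‖ * x) =
      ENNReal.ofReal (W.density ε r (inner ℝ e y) ‖cross e y‖) * ENNReal.ofReal x := fun y x =>
    ENNReal.ofReal_mul (W.density_nonneg hM ε hr (norm_nonneg _))
  simp only [e1]
  refine h.trans ?_
  gcongr
  have hkx : Measurable fun x : S2 × E3 => ENNReal.ofReal (W.density ε r (vr x) (va x)) := by
    have := hk.comp (f := fun x : S2 × E3 => (vr x, va x))
      (by fun_prop : Continuous fun x : S2 × E3 => (vr x, va x)).measurable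
    simpa only [Function.comp_def, va, abs_norm] using this
  have hmeas : ∀ k < 3, ∀ I : Fin k → Fin 3, Measurable fun x : S2 × E3 =>
      ENNReal.ofReal (W.density ε r (vr x) (va x)) * 𝓕.phaseRegion.indicator
        (fun y => ENNReal.ofReal (|omegaHatWord 𝓕.phaseRegion I f y| ^ z)) (𝓕.leafPoint τ r x) :=
    fun k hk3 I => hkx.mul ((measurable_indicator_word hM hz hk3 hf I).comp
      (measurable_leafPoint 𝓕 τ r))
  have e2 : ∫⁻ e : S2, (∫⁻ y, ENNReal.ofReal (W.density ε r (inner ℝ (e : E3) y) ‖cross (e : E3) y‖) *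
        𝓕.phaseRegion.indicator (fun y => ENNReal.ofReal (rotSum 𝓕.phaseRegion z f y))
          (𝓕.height r + τ, r • (e : E3), mom M r e y)) ∂sphMeasure =
      ∫⁻ x : S2 × E3, ENNReal.ofReal (W.density ε r (vr x) (va x)) *
        𝓕.phaseRegion.indicator (fun y => ENNReal.ofReal (rotSum 𝓕.phaseRegion z f y))
          (𝓕.leafPoint τ r x) ∂sphereBundle := by
    have hm : Measurable fun x : S2 × E3 => ENNReal.ofReal (W.density ε r (vr x) (va x)) *
        𝓕.phaseRegion.indicator (fun y => ENNReal.ofReal (rotSum 𝓕.phaseRegion z f y))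
          (𝓕.leafPoint τ r x) :=
      hkx.mul ((𝓕.measurable_indicator_rotSum hM (by linarith) hf).comp
        (measurable_leafPoint 𝓕 τ r))
    exact (lintegral_prod _ hm.aemeasurable).symm
  rw [e2]
  simp only [indicator_rotSum, Finset.mul_sum]
  rw [lintegral_finsetSum _ fun k hk3 => Finset.measurable_sum _ fun I _ =>
    hmeas k (Finset.mem_range.mp hk3) I]
  refine Finset.sum_le_sum fun k hk3 => ?_
  rw [lintegral_finsetSum _ fun I _ => hmeas k (Finset.mem_range.mp hk3) I]
  refine Finset.sum_le_sum fun I _ => lintegral_mono fun x => ?_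
  rw [ENNReal.ofReal_mul (show 0 ≤ W.density ε r (vr x) (va x) from
    W.density_nonneg hM ε hr (norm_nonneg _))]
  gcongr
  exact Set.indicator_le_self _ _ _

end Foliation

/-! ### The Hölder inequality in the light cone -/

/-- Up to `(|v_t| + |v̸|)⁴` and the bracket, `holderWeight` is the `z`-th power of the factor
multiplying `|f|` in the integrand. The factor `v²` is inserted in the density and removed in the
dual factor, where it produces the singularity at `v_{r*} = 0`. The constant `81` is the square of
the `9` in the bound of `N`. -/
theorem holder_pointwise {M q z δ r v L j μ C N F : ℝ} (hM : 0 < M) (hr : 2 * M < r) (hz : 3 < z)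
    (hL : 0 ≤ L) (hv : v ≠ 0) (hC : 0 ≤ C) (hjμ : 0 ≤ j * μ) (hF : 0 ≤ F)
    (hN : |N| ≤ 9 * redEnergy M r v L) (h : holderWeight M q z δ r v L ≤ C * (j * μ)) :
    aU M r v L ^ q / energy M r v L ^ q * F * |N| ^ 2 / (r ^ 2 * energy M r v L) ≤
      81 * C ^ (1 / z) / r ^ (2 + 2 * q) * ((v ^ 2 * (j * μ) * F ^ z) ^ (1 / z) *
        (v ^ 2 * (energy M r v L + L) ^ 4 * bracketWeight z δ (energy M r v L) L) ^ (-(1 / z))) := by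
  have hz0 : 0 < z := by linarith
  have h0 : 0 < r := by linarith
  have hE : 0 < energy M r v L := (energy_pos_iff hM hr _ _).mpr (Or.inl hv)
  have hB := bracketWeight_pos z δ (energy M r v L) L
  have ha := aU_nonneg (v := v) (L := L) hM hr
  have hR : 0 ≤ redEnergy M r v L := hE.le.trans (le_redEnergy hM hr)
  set E := energy M r v L
  set B := bracketWeight z δ E L
  set S := (E + L) ^ 4 * B with hS
  have hS0 : 0 < S := by positivity
  have hv2 : 0 < v ^ 2 := by positivity
  set X := r ^ 2 * (aU M r v L / E) with hX
  have hX0 : 0 ≤ X := by positivity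
  have e1 : (v ^ 2 * (j * μ) * F ^ z) ^ (1 / z) * (v ^ 2 * (E + L) ^ 4 * B) ^ (-(1 / z)) =
      F * (j * μ / S) ^ (1 / z) := by
    rw [mul_assoc (v ^ 2) ((E + L) ^ 4) B, ← hS, Real.rpow_neg (by positivity),
      Real.mul_rpow (by positivity) (by positivity), ← Real.rpow_mul hF, mul_one_div_cancel hz0.ne',
      Real.rpow_one, Real.mul_rpow hv2.le hjμ, Real.mul_rpow hv2.le hS0.le,
      Real.div_rpow hjμ hS0.le]
    have : 0 < (v ^ 2) ^ (1 / z) := by positivity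
    field_simp
  have e2 : redEnergy M r v L ^ 2 * X ^ q / E ≤ C ^ (1 / z) * (j * μ / S) ^ (1 / z) := by
    rw [← Real.mul_rpow hC (by positivity)]
    have h1 : redEnergy M r v L ^ (2 * z) * X ^ (z * q) * E ^ (-z) ≤ C * (j * μ / S) := by
      rw [← mul_div_assoc, le_div_iff₀ hS0, hS]
      calc _ = holderWeight M q z δ r v L := by unfold holderWeight; ring
        _ ≤ _ := h
    refine le_trans (le_of_eq ?_) (Real.rpow_le_rpow (by positivity) h1 (by positivity))
    have h2 : (redEnergy M r v L ^ (2 * z) * X ^ (z * q) * E ^ (-z)) ^ (1 / z) =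
        redEnergy M r v L ^ (2 * z * (1 / z)) * X ^ (z * q * (1 / z)) * E ^ (-z * (1 / z)) := by
      rw [Real.rpow_mul hR (2 * z) (1 / z), Real.rpow_mul hX0 (z * q) (1 / z),
        Real.rpow_mul hE.le (-z) (1 / z), Real.mul_rpow (by positivity) (by positivity), Real.mul_rpow (by positivity) (by positivity)]
    rw [h2]
    have a1 : 2 * z * (1 / z) = 2 := by field_simp
    have a2 : z * q * (1 / z) = q := by field_simp
    have a3 : -z * (1 / z) = -1 := by field_simp
    rw [a1, a2, a3, Real.rpow_two, Real.rpow_neg_one]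
    ring
  have e3 : X ^ q = r ^ (2 * q) * (aU M r v L ^ q / E ^ q) := by
    have h1 : r ^ (2 * q) = (r ^ 2) ^ q := by rw [Real.rpow_mul h0.le, Real.rpow_two]
    rw [hX, h1, ← Real.div_rpow ha hE.le, Real.mul_rpow (by positivity) (by positivity)]
  have e4 : r ^ (2 + 2 * q) = r ^ 2 * r ^ (2 * q) := by
    rw [Real.rpow_add h0, Real.rpow_two]
  have hr2q : 0 < r ^ (2 * q) := by positivity
  have hN2 : |N| ^ 2 ≤ 81 * redEnergy M r v L ^ 2 := by
    calc |N| ^ 2 ≤ (9 * redEnergy M r v L) ^ 2 := by gcongr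
      _ = _ := by ring
  have haq : 0 ≤ aU M r v L ^ q / E ^ q := by positivity
  rw [e1]
  calc _ ≤ aU M r v L ^ q / E ^ q * F * (81 * redEnergy M r v L ^ 2) / (r ^ 2 * E) := by gcongr
    _ = 81 / r ^ (2 + 2 * q) * F * (redEnergy M r v L ^ 2 * X ^ q / E) := by
      rw [e3, e4]; field_simp
    _ ≤ 81 / r ^ (2 + 2 * q) * F * (C ^ (1 / z) * (j * μ / S) ^ (1 / z)) := by gcongr
    _ = _ := by ring

/-- The total exponent is `-(1/z) · z/(z-1) = -1/(z-1)`. Applied to the square and the fourth power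
it gives `-s` and `-2s` with `s = 2/(z-1)`; applied to the bracket it fixes `m`. -/
theorem dual_rpow_eq {z δ v E L : ℝ} (hz : 3 < z) (hL : 0 ≤ L) (hE : 0 < E) (hv : v ≠ 0) :
    ((v ^ 2 * (E + L) ^ 4 * bracketWeight z δ E L) ^ (-(1 / z))) ^ (z / (z - 1)) =
      |v| ^ (-(2 / (z - 1))) * (E + L) ^ (-(2 * (2 / (z - 1)))) *
        (1 + (E + L) ^ 2) ^ (-(3 * ((z - 3 + δ) / (2 * (z - 1))))) := by
  have hv0 : 0 < |v| := abs_pos.mpr hv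
  have hEL : 0 < E + L := by linarith
  have hB := bracketWeight_pos z δ E L
  have hz1 : z - 1 ≠ 0 := by linarith
  have hz0 : z ≠ 0 := by linarith
  rw [← sq_abs v, ← Real.rpow_mul (by positivity), Real.mul_rpow (by positivity) hB.le,
    Real.mul_rpow (by positivity) (by positivity), ← Real.rpow_natCast, ← Real.rpow_natCast,
    ← Real.rpow_mul hv0.le, ← Real.rpow_mul hEL.le, bracketWeight, bracket, Real.sqrt_eq_rpow,
    ← Real.rpow_mul (by positivity), ← Real.rpow_mul (by positivity)]
  congr 2
  · congr 1; push_cast; field_simp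
  · congr 1; push_cast; field_simp; norm_num
  · field_simp

/-- Hölder with exponents `z` and `z/(z-1)` on one half of the cone. The first factor is the
transported density at one direction `e`; the second does not depend on `e`, because in an
orthonormal frame starting with `e` it is dominated by a product of one-dimensional functions. -/
theorem holder_half {M q z δ : ℝ} (hM : 0 < M) (hz : 3 < z) (hδ : 0 < δ) {r C ε : ℝ} (hr : 2 * M < r)
    (hC : 0 ≤ C) {W : Weight M}
    (hW : ∀ v L, 0 ≤ L → 0 < ε * v →
        holderWeight M q z δ r v L ≤ C * (W.j r * W.μ (energy M r v L) L))
    {e : E3} (he : ‖e‖ = 1) {F N : E3 → ℝ} (hF : ContinuousOn F {y | y ≠ 0}) (hF0 : ∀ y, 0 ≤ F y)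
    (hN : ∀ y, |N y| ≤ 9 * redEnergy M r (inner ℝ e y) ‖cross e y‖) :
    ∫⁻ y in {y | 0 < ε * inner ℝ e y},
      ENNReal.ofReal (aU M r (inner ℝ e y) ‖cross e y‖ ^ q / energy M r (inner ℝ e y) ‖cross e y‖ ^ q *
        F y * |N y| ^ 2 / (r ^ 2 * energy M r (inner ℝ e y) ‖cross e y‖)) ≤
      ENNReal.ofReal (81 * C ^ (1 / z) / r ^ (2 + 2 * q)) *
        ((∫⁻ y, ENNReal.ofReal (W.density ε r (inner ℝ e y) ‖cross e y‖ * F y ^ z)) ^ (1 / z) *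
        ((∫⁻ x, dualFactor (2 / (z - 1)) ((z - 3 + δ) / (2 * (z - 1))) x) *
          ((∫⁻ x, dualFactor (2 / (z - 1)) ((z - 3 + δ) / (2 * (z - 1))) x) *
          (∫⁻ x, dualFactor (2 / (z - 1)) ((z - 3 + δ) / (2 * (z - 1))) x))) ^ (1 / (z / (z - 1)))) := by
  have hz0 : 0 < z := by linarith
  set s := 2 / (z - 1) with hs
  set m := (z - 3 + δ) / (2 * (z - 1)) with hm
  have hz1 : 0 < z - 1 := by linarith
  have hs0 : 0 ≤ s := by positivity
  have hm0 : 0 ≤ m := by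
    have : 0 ≤ z - 3 + δ := by linarith
    positivity
  obtain ⟨φ, hφ0, hφ⟩ := exists_isometry he
  set H : Set E3 := {y | 0 < ε * inner ℝ e y} with hH
  have hHm : MeasurableSet H := measurableSet_lt measurable_const (by fun_prop)
  have hHv : ∀ y ∈ H, inner ℝ e y ≠ (0 : ℝ) := fun y hy h => by
    have : 0 < ε * inner ℝ e y := hy
    simp [h] at this
  have hHsub : H ⊆ {y | y ≠ 0} := fun y hy h => hHv y hy (by simp [h])
  have hE : ∀ y ∈ H, 0 < energy M r (inner ℝ e y) ‖cross e y‖ := fun y hy =>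
    (energy_pos_iff hM hr _ _).mpr (Or.inl (hHv y hy))
  set a : E3 → ℝ≥0∞ := fun y =>
    ENNReal.ofReal (W.density ε r (inner ℝ e y) ‖cross e y‖ * F y ^ z) ^ (1 / z)
  set b : E3 → ℝ≥0∞ := fun y => ENNReal.ofReal (((inner ℝ e y) ^ 2 *
    (energy M r (inner ℝ e y) ‖cross e y‖ + ‖cross e y‖) ^ 4 *
      bracketWeight z δ (energy M r (inner ℝ e y) ‖cross e y‖) ‖cross e y‖) ^ (-(1 / z)))
  have ha : AEMeasurable a (volume.restrict H) := by
    have h1 : Measurable fun y : E3 => W.density ε r (inner ℝ e y) ‖cross e y‖ := by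
      have := (W.measurable_density hM ε hr).comp
        (f := fun y : E3 => ((inner ℝ e y : ℝ), ‖cross e y‖))
        (by unfold cross; fun_prop : Continuous fun y : E3 =>
          ((inner ℝ e y : ℝ), ‖cross e y‖)).measurable
      simpa only [Function.comp_def, abs_norm] using this
    have h2 : AEMeasurable F (volume.restrict H) :=
      (hF.mono hHsub).aemeasurable hHm
    exact ((h1.aemeasurable.mul (h2.pow_const z)).ennreal_ofReal).pow_const _
  have hb : AEMeasurable b (volume.restrict H) := by
    have h1 : Measurable b := by
      have hv : Measurable fun y : E3 => (inner ℝ e y : ℝ) := by fun_prop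
      have hL : Measurable fun y : E3 => ‖cross e y‖ := by
        have : Continuous fun y : E3 => ‖cross e y‖ := by unfold cross; fun_prop
        exact this.measurable
      have hE : Measurable fun y : E3 => energy M r (inner ℝ e y) ‖cross e y‖ :=
        measurable_energy M measurable_const hv hL
      have hB : Measurable fun y : E3 =>
          bracketWeight z δ (energy M r (inner ℝ e y) ‖cross e y‖) ‖cross e y‖ := by
        unfold bracketWeight bracket; fun_prop
      fun_prop
    exact h1.aemeasurable
  have hpq : z.HolderConjugate (z / (z - 1)) := Real.HolderConjugate.conjExponent (by linarith)
  have hpt : ∀ y ∈ H, ENNReal.ofReal (aU M r (inner ℝ e y) ‖cross e y‖ ^ q /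
      energy M r (inner ℝ e y) ‖cross e y‖ ^ q * F y * |N y| ^ 2 /
        (r ^ 2 * energy M r (inner ℝ e y) ‖cross e y‖)) ≤
      ENNReal.ofReal (81 * C ^ (1 / z) / r ^ (2 + 2 * q)) * (a * b) y := fun y hy => by
    have hE' := hE y hy
    have hjμ : 0 ≤ W.j r * W.μ (energy M r (inner ℝ e y) ‖cross e y‖) ‖cross e y‖ :=
      mul_nonneg (W.j_nonneg r hr) (W.μ_nonneg _ _ hE' (norm_nonneg _))
    have hd : W.density ε r (inner ℝ e y) ‖cross e y‖ = (inner ℝ e y) ^ 2 *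
        (W.j r * W.μ (energy M r (inner ℝ e y) ‖cross e y‖) ‖cross e y‖) := by
      unfold Weight.density
      exact if_pos hy
    have hFy : 0 ≤ F y ^ z := Real.rpow_nonneg (hF0 y) _
    simp only [a, b, Pi.mul_apply]
    rw [ENNReal.ofReal_rpow_of_nonneg (by rw [hd]; positivity) (by positivity),
      ← ENNReal.ofReal_mul (Real.rpow_nonneg (by rw [hd]; positivity) _),
      ← ENNReal.ofReal_mul (div_nonneg (by positivity) (Real.rpow_nonneg (by linarith) _)), hd]
    exact ENNReal.ofReal_le_ofReal (holder_pointwise hM hr hz (norm_nonneg _) (hHv y hy) hC hjμ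
      (hF0 y) (hN y) (hW _ _ (norm_nonneg _) hy))
  calc _ ≤ ∫⁻ y in H, ENNReal.ofReal (81 * C ^ (1 / z) / r ^ (2 + 2 * q)) * (a * b) y :=
        setLIntegral_mono' hHm hpt
    _ = ENNReal.ofReal (81 * C ^ (1 / z) / r ^ (2 + 2 * q)) * ∫⁻ y in H, (a * b) y :=
        lintegral_const_mul' _ _ ENNReal.ofReal_ne_top
    _ ≤ ENNReal.ofReal (81 * C ^ (1 / z) / r ^ (2 + 2 * q)) *
        ((∫⁻ y in H, a y ^ z) ^ (1 / z) * (∫⁻ y in H, b y ^ (z / (z - 1))) ^ (1 / (z / (z - 1)))) := by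
        gcongr
        exact ENNReal.lintegral_mul_le_Lp_mul_Lq _ hpq ha hb
    _ ≤ _ := by
        refine mul_le_mul' le_rfl (mul_le_mul' (ENNReal.rpow_le_rpow ?_ (by positivity))
          (ENNReal.rpow_le_rpow ?_ (by positivity)))
        · refine (setLIntegral_le_lintegral _ _).trans (le_of_eq (lintegral_congr fun y => ?_))
          simp only [a]
          rw [← ENNReal.rpow_mul, one_div_mul_cancel hz0.ne', ENNReal.rpow_one]
        · rw [← lintegral_prod_dualFactor φ]
          refine le_trans (setLIntegral_mono' hHm fun y hy => ?_) (setLIntegral_le_lintegral _ _)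
          have hE' := hE y hy
          have hB := bracketWeight_pos z δ (energy M r (inner ℝ e y) ‖cross e y‖) ‖cross e y‖
          simp only [b]
          rw [ENNReal.ofReal_rpow_of_nonneg (by positivity) (by positivity),
            dual_rpow_eq hz (norm_nonneg _) hE' (hHv y hy)]
          exact dual_le (a := fun i => φ y i) hs0 hm0 (norm_nonneg _) (abs_le_energy hM hr _ _)
            (hHv y hy) (hφ0 y) (hφ y)

namespace Foliation

variable {M : ℝ} (𝓕 : Foliation M) {q z δ : ℝ}

theorem exists_half_cone_bound (hM : 0 < M) (hz : 3 < z) (hq : 0 ≤ q) (hδ : 0 < δ) {ε : ℝ}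
    (hε : ε = 1 ∨ ε = -1) :
    ∃ C : ℝ, 0 ≤ C ∧ ∀ f : Phase → ℝ, ContDiffOn ℝ 3 f 𝓕.phaseRegion →
      (∀ y ∈ 𝓕.phaseRegion, liouville M 𝓕.phaseRegion f y = 0) → ∀ τ, 0 ≤ τ → ∀ r, 2 * M < r →
      ∀ (e : E3) (N : E3 → ℝ), ‖e‖ = 1 →
        (∀ y, |N y| ≤ 9 * redEnergy M r (inner ℝ e y) ‖cross e y‖) →
      ∫⁻ y in {y | 0 < ε * inner ℝ e y}, ENNReal.ofReal (aU M r (inner ℝ e y) ‖cross e y‖ ^ q /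
          energy M r (inner ℝ e y) ‖cross e y‖ ^ q * |f (𝓕.height r + τ, r • e, mom M r e y)| *
          |N y| ^ 2 / (r ^ 2 * energy M r (inner ℝ e y) ‖cross e y‖)) ≤
        ENNReal.ofReal (C / r ^ (2 + 2 * q)) * (∑ k ∈ Finset.range 3, ∑ I : Fin k → Fin 3,
          𝓕.flux q z δ τ (omegaHatWord 𝓕.phaseRegion I f)) ^ (1 / z) := by
  obtain ⟨C, hC, hW⟩ := 𝓕.exists_weight (δ := δ) hM hz hq hε
  have hz0 : 0 < z := by linarith
  have hz1 : 0 < z - 1 := by linarith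
  set J := ∫⁻ x, dualFactor (2 / (z - 1)) ((z - 3 + δ) / (2 * (z - 1))) x with hJ
  -- The hypothesis `z > 3` gives `2/(z-1) < 1`, and `δ > 0` makes the decay exponent
  -- `(z-1+δ)/(z-1)` larger than `1`.
  have hJtop : J < ⊤ := by
    refine lintegral_dualFactor_lt_top ?_ (div_nonneg (by linarith) (by linarith)) ?_
    · rw [div_lt_one hz1]; linarith
    · have : 2 / (z - 1) + 2 * ((z - 3 + δ) / (2 * (z - 1))) = (z - 1 + δ) / (z - 1) := by
        field_simp; ring
      rw [this, lt_div_iff₀ hz1]; linarith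
  set Q := (J * (J * J)) ^ (1 / (z / (z - 1))) with hQ
  have hQtop : Q ≠ ⊤ := ENNReal.rpow_ne_top_of_nonneg (by positivity)
    (ENNReal.mul_lt_top hJtop (ENNReal.mul_lt_top hJtop hJtop)).ne
  have hS : 0 ≤ sobolevConst z := by unfold sobolevConst; positivity
  refine ⟨81 * C ^ (1 / z) * (8 * sobolevConst z * C) ^ (1 / z) * Q.toReal, by positivity,
    fun f hf hTf τ hτ r hr e N he hN => ?_⟩
  obtain ⟨W, hW₁, hW₂⟩ := hW r hr
  have h0 : 0 < r := by linarith
  have hcont : ContinuousOn (fun y => |f (𝓕.height r + τ, r • e, mom M r e y)|) {y | y ≠ 0} := by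
    refine (hf.continuousOn.comp (f := fun y => (𝓕.height r + τ, r • e, mom M r e y)) ?_
      fun y hy => ?_).abs
    · exact (continuous_const.prodMk (continuous_const.prodMk
        (by unfold mom; fun_prop))).continuousOn
    · exact 𝓕.mem_phaseRegion_mom hM hr (by linarith) he hy
  have h1 := holder_half (q := q) hM hz hδ hr hC hW₁ he hcont (fun y => abs_nonneg _) hN
  refine h1.trans ?_
  have h2 := 𝓕.lintegral_density_le hM hz (hf.of_le (by norm_cast)) W ε hr hτ he
  have h3 : ∑ k ∈ Finset.range 3, ∑ I : Fin k → Fin 3,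
        𝓕.sphereFlux W ε z τ (omegaHatWord 𝓕.phaseRegion I f) r ≤
      ENNReal.ofReal C * ∑ k ∈ Finset.range 3, ∑ I : Fin k → Fin 3,
        𝓕.flux q z δ τ (omegaHatWord 𝓕.phaseRegion I f) := by
    rw [Finset.mul_sum]
    refine Finset.sum_le_sum fun k hk => ?_
    rw [Finset.mul_sum]
    refine Finset.sum_le_sum fun I _ => hW₂ τ hτ _ ?_ ?_
    · have := Finset.mem_range.mp hk
      exact 𝓕.contDiffOn_omegaHatWord (n := 1) hM (hf.of_le (by norm_cast; omega)) I
    · have := Finset.mem_range.mp hk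
      exact 𝓕.liouville_omegaHatWord hM (hf.of_le (by norm_cast; omega)) hTf I
  set X := ∑ k ∈ Finset.range 3, ∑ I : Fin k → Fin 3,
        𝓕.flux q z δ τ (omegaHatWord 𝓕.phaseRegion I f)
  calc _ ≤ ENNReal.ofReal (81 * C ^ (1 / z) / r ^ (2 + 2 * q)) *
        ((ENNReal.ofReal (8 * sobolevConst z) * (ENNReal.ofReal C * X)) ^ (1 / z) * Q) := by
        refine mul_le_mul' le_rfl (mul_le_mul' (ENNReal.rpow_le_rpow ?_ (by positivity)) le_rfl)
        exact h2.trans (mul_le_mul' le_rfl h3)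
    _ = _ := by
        rw [← mul_assoc (ENNReal.ofReal (8 * _)), ← ENNReal.ofReal_mul (by positivity),
          ENNReal.mul_rpow_of_nonneg _ _ (by positivity),
          ENNReal.ofReal_rpow_of_nonneg (by positivity) (by positivity),
          ← ENNReal.ofReal_toReal hQtop, ENNReal.toReal_ofReal ENNReal.toReal_nonneg]
        rw [mul_assoc (ENNReal.ofReal _) (X ^ _), mul_comm (X ^ _), ← mul_assoc, ← mul_assoc,
          ← ENNReal.ofReal_mul (by positivity), ← ENNReal.ofReal_mul (by positivity)]
        congr 2
        ring

/-- The two half cones cover everything except the plane `v_{r*} = 0`, which is a null set. -/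
theorem exists_cone_bound (hM : 0 < M) (hz : 3 < z) (hq : 0 ≤ q) (hδ : 0 < δ) :
    ∃ C : ℝ, 0 ≤ C ∧ ∀ f : Phase → ℝ, ContDiffOn ℝ 3 f 𝓕.phaseRegion →
      (∀ y ∈ 𝓕.phaseRegion, liouville M 𝓕.phaseRegion f y = 0) → ∀ τ, 0 ≤ τ → ∀ r, 2 * M < r →
      ∀ (e : E3) (N : E3 → ℝ), ‖e‖ = 1 →
        (∀ y, |N y| ≤ 9 * redEnergy M r (inner ℝ e y) ‖cross e y‖) →
      ∫⁻ y, ENNReal.ofReal (aU M r (inner ℝ e y) ‖cross e y‖ ^ q /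
          energy M r (inner ℝ e y) ‖cross e y‖ ^ q * |f (𝓕.height r + τ, r • e, mom M r e y)| *
          |N y| ^ 2 / (r ^ 2 * energy M r (inner ℝ e y) ‖cross e y‖)) ≤
        ENNReal.ofReal (C / r ^ (2 + 2 * q)) * (∑ k ∈ Finset.range 3, ∑ I : Fin k → Fin 3,
          𝓕.flux q z δ τ (omegaHatWord 𝓕.phaseRegion I f)) ^ (1 / z) := by
  obtain ⟨C₁, hC₁, h₁⟩ := 𝓕.exists_half_cone_bound hM hz hq hδ (Or.inl rfl)
  obtain ⟨C₂, hC₂, h₂⟩ := 𝓕.exists_half_cone_bound hM hz hq hδ (Or.inr rfl)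
  refine ⟨C₁ + C₂, by positivity, fun f hf hTf τ hτ r hr e N he hN => ?_⟩
  have h0 : 0 < r := by linarith
  have hnull : volume ({y : E3 | inner ℝ e y = (0 : ℝ)}) = 0 := by
    have h := Measure.addHaar_submodule (volume : Measure E3) (ℝ ∙ e)ᗮ fun h => by
      have : e ∈ (ℝ ∙ e)ᗮ := h ▸ Submodule.mem_top
      rw [Submodule.mem_orthogonal_singleton_iff_inner_right, real_inner_self_eq_norm_sq, he] at this
      norm_num at this
    refine measure_mono_null (fun y hy => ?_) h
    exact Submodule.mem_orthogonal_singleton_iff_inner_right.mpr hy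
  rw [add_div, ENNReal.ofReal_add (by positivity) (by positivity), add_mul]
  refine le_trans ?_ (add_le_add (h₁ f hf hTf τ hτ r hr e N he hN) (h₂ f hf hTf τ hτ r hr e N he hN))
  refine le_trans (le_of_eq ?_) (lintegral_union_le _ _ _)
  rw [← setLIntegral_univ]
  refine setLIntegral_congr (Filter.EventuallyEq.symm (Filter.eventuallyEq_univ.mpr ?_))
  rw [mem_ae_iff]
  refine measure_mono_null (fun y hy => ?_) hnull
  simp only [Set.mem_compl_iff, Set.mem_union, Set.mem_ofPred_eq, not_or, one_mul, neg_mul] at hy ⊢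
  exact le_antisymm (not_lt.mp hy.1) (by linarith [not_lt.mp hy.2])

end Foliation

/-! ### Comparison of the red-shift weight `|v_N|` with the red-shift energy -/

theorem vUbar_mom {M r : ℝ} (hM : 0 < M) (hr : 2 * M < r) {e : E3} (he : ‖e‖ = 1) (y : E3) :
    vUbar M (r • e) (mom M r e y) = -aU M r (inner ℝ e y) ‖cross e y‖ := by
  rw [vUbar, vT_mom y hM hr he, vRStar_mom y hM hr he, aU]; ring

theorem vU_mom {M r : ℝ} (hM : 0 < M) (hr : 2 * M < r) {e : E3} (he : ‖e‖ = 1) (y : E3) :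
    vU M (r • e) (mom M r e y) = -bU M r (inner ℝ e y) ‖cross e y‖ := by
  rw [vU, vT_mom y hM hr he, vRStar_mom y hM hr he, bU]; ring

theorem abs_vN_mom {M r r₀ r₁ : ℝ} {χ : ℝ → ℝ} (hχ : IsCutoff r₀ r₁ χ) (hM : 0 < M)
    (hr : 2 * M < r) {e : E3} (he : ‖e‖ = 1) (y : E3) :
    |vN M χ (r • e) (mom M r e y)| =
      2 * χ r * bU M r (inner ℝ e y) ‖cross e y‖ / lapse M r
        + 8 * χ r * lapse M r * energy M r (inner ℝ e y) ‖cross e y‖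
        + energy M r (inner ℝ e y) ‖cross e y‖ := by
  have h0 : 0 < r := by linarith
  have hl := lapse_pos hM hr
  have hb := bU_nonneg (v := inner ℝ e y) (L := ‖cross e y‖) hM hr
  have hE := energy_nonneg M r (inner ℝ e y) ‖cross e y‖
  have hc := hχ.nonneg r
  rw [vN, vT_mom y hM hr he, vU_mom hM hr he, norm_smul_unit h0 he, ← abs_neg,
    ← abs_of_nonneg (show 0 ≤ 2 * χ r * bU M r (inner ℝ e y) ‖cross e y‖ / lapse M r
        + 8 * χ r * lapse M r * energy M r (inner ℝ e y) ‖cross e y‖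
        + energy M r (inner ℝ e y) ‖cross e y‖ by positivity)]
  congr 1
  ring

theorem abs_vN_le {M r r₀ r₁ : ℝ} {χ : ℝ → ℝ} (hχ : IsCutoff r₀ r₁ χ) (hM : 0 < M)
    (hr : 2 * M < r) {e : E3} (he : ‖e‖ = 1) (y : E3) :
    |vN M χ (r • e) (mom M r e y)| ≤ 9 * redEnergy M r (inner ℝ e y) ‖cross e y‖ := by
  rw [abs_vN_mom hχ hM hr he, redEnergy]
  have h0 : 0 < r := by linarith
  have hl := lapse_pos hM hr
  have hl1 : lapse M r ≤ 1 := by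
    unfold lapse
    have : 0 ≤ 2 * M / r := by positivity
    linarith
  have hE := energy_nonneg M r (inner ℝ e y) ‖cross e y‖
  have hb : 0 ≤ bU M r (inner ℝ e y) ‖cross e y‖ / lapse M r :=
    div_nonneg (bU_nonneg hM hr) hl.le
  have hc := hχ.nonneg r
  have hc1 := hχ.le_one r
  have h1 : χ r * (bU M r (inner ℝ e y) ‖cross e y‖ / lapse M r) ≤
      1 * (bU M r (inner ℝ e y) ‖cross e y‖ / lapse M r) := by gcongr
  have h2 : χ r * lapse M r * energy M r (inner ℝ e y) ‖cross e y‖ ≤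
      1 * 1 * energy M r (inner ℝ e y) ‖cross e y‖ := by gcongr
  rw [mul_div_assoc, mul_assoc 2]
  linarith

/-- Up to `r₀` the cutoff equals `1` and `|v_N|` contains the singular component. Beyond `r₀` the
lapse is at least its value at `r₀`, so `|v_t|` alone suffices. The constant does not involve `χ`.
-/
theorem redEnergy_le_abs_vN {M r r₀ r₁ : ℝ} {χ : ℝ → ℝ} (hχ : IsCutoff r₀ r₁ χ) (hM : 0 < M)
    (hr₀ : 2 * M < r₀) (hr : 2 * M < r) {e : E3} (he : ‖e‖ = 1) (y : E3) :
    redEnergy M r (inner ℝ e y) ‖cross e y‖ ≤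
      (1 + 1 / lapse M r₀) * |vN M χ (r • e) (mom M r e y)| := by
  rw [abs_vN_mom hχ hM hr he, redEnergy]
  have hl := lapse_pos hM hr
  have hl₀ := lapse_pos hM hr₀
  have hE := energy_nonneg M r (inner ℝ e y) ‖cross e y‖
  have hb0 := bU_nonneg (v := inner ℝ e y) (L := ‖cross e y‖) hM hr
  have hbE := bU_le (v := inner ℝ e y) (L := ‖cross e y‖) hM hr
  have hc := hχ.nonneg r
  rcases le_or_gt r r₀ with h | h
  · rw [hχ.eq_one r h, mul_one, mul_one, mul_div_assoc, one_add_mul]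
    have : 0 ≤ bU M r (inner ℝ e y) ‖cross e y‖ / lapse M r := by positivity
    have h2 : 0 ≤ 1 / lapse M r₀ * (2 * (bU M r (inner ℝ e y) ‖cross e y‖ / lapse M r)
        + 8 * lapse M r * energy M r (inner ℝ e y) ‖cross e y‖
        + energy M r (inner ℝ e y) ‖cross e y‖) := by positivity
    have h3 : 0 ≤ 8 * lapse M r * energy M r (inner ℝ e y) ‖cross e y‖ := by positivity
    linarith
  · have h1 : bU M r (inner ℝ e y) ‖cross e y‖ / lapse M r ≤
        energy M r (inner ℝ e y) ‖cross e y‖ / lapse M r₀ := by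
      have := lapse_mono hM (by linarith) h.le
      gcongr
    calc _ ≤ (1 + 1 / lapse M r₀) * energy M r (inner ℝ e y) ‖cross e y‖ := by
          rw [one_add_mul, one_div_mul_eq_div]; linarith
      _ ≤ _ := by
        gcongr
        have : 0 ≤ 2 * χ r * bU M r (inner ℝ e y) ‖cross e y‖ / lapse M r := by positivity
        have : 0 ≤ 8 * χ r * lapse M r * energy M r (inner ℝ e y) ‖cross e y‖ := by positivity
        linarith

/-- The integrand of the weighted fluxes, at a point `y` of the spacetime. -/
def weightedPower (M : ℝ) (χ : ℝ → ℝ) (q z δ : ℝ) (u : Phase → ℝ) (y : Spacetime) (p : E3) : ℝ :=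
  (1 + ‖y.2‖ ^ (2 * z * q + 4) * (|vUbar M y.2 p| ^ (z * q + 2) / |vT M y.2 p| ^ (z * q + 2)))
    * |u (y.1, y.2, p)| ^ z * bracket (|vT M y.2 p| + vAng y.2 p) ^ (3 * (z - 3 + δ))
    * |vT M y.2 p| ^ (4 - z) * |vN M χ y.2 p| ^ (2 * (z + 1))

theorem weightedPower_nonneg {M : ℝ} {χ : ℝ → ℝ} {q z δ : ℝ} {u : Phase → ℝ} (y : Spacetime)
    (p : E3) : 0 ≤ weightedPower M χ q z δ u y p := by
  have : 0 ≤ bracket (|vT M y.2 p| + vAng y.2 p) := Real.sqrt_nonneg _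
  unfold weightedPower
  positivity

theorem weightedPower_mono {M : ℝ} {χ : ℝ → ℝ} {q z δ : ℝ} (hz : 0 ≤ z) {u w : Phase → ℝ}
    (h : ∀ y, |u y| ≤ |w y|) (y : Spacetime) (p : E3) :
    weightedPower M χ q z δ u y p ≤ weightedPower M χ q z δ w y p := by
  have : 0 ≤ bracket (|vT M y.2 p| + vAng y.2 p) := Real.sqrt_nonneg _
  have := h (y.1, y.2, p)
  unfold weightedPower
  gcongr

theorem measurable_vRStar (M : ℝ) : Measurable fun w : E3 × E3 => vRStar M w.1 w.2 := by
  unfold vRStar lapse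
  fun_prop

theorem measurable_vAng : Measurable fun w : E3 × E3 => vAng w.1 w.2 := by
  have h : Continuous fun w : E3 × E3 => ‖(WithLp.toLp 2 (crossProduct w.1.ofLp w.2.ofLp) : E3)‖ := by
    simp only [cross_apply]
    fun_prop
  unfold vAng cross
  exact h.measurable

theorem measurable_vT (M : ℝ) : Measurable fun w : E3 × E3 => vT M w.1 w.2 := by
  have h1 := measurable_vRStar M
  have h2 := measurable_vAng
  unfold vT lapse
  fun_prop

theorem measurable_weightedPower (M : ℝ) {χ : ℝ → ℝ} (hχ : Continuous χ) (q z δ : ℝ)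
    {u : Phase → ℝ} (hu : Measurable u) :
    Measurable fun w : Spacetime × E3 => weightedPower M χ q z δ u w.1 w.2 := by
  have h2 : Measurable fun w : Spacetime × E3 => (w.1.2, w.2) := by fun_prop
  have hT : Measurable fun w : Spacetime × E3 => vT M w.1.2 w.2 :=
    (measurable_vT M).comp (f := fun w : Spacetime × E3 => (w.1.2, w.2)) h2
  have hR : Measurable fun w : Spacetime × E3 => vRStar M w.1.2 w.2 :=
    (measurable_vRStar M).comp (f := fun w : Spacetime × E3 => (w.1.2, w.2)) h2
  have hA : Measurable fun w : Spacetime × E3 => vAng w.1.2 w.2 :=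
    measurable_vAng.comp (f := fun w : Spacetime × E3 => (w.1.2, w.2)) h2
  have hU : Measurable fun w : Spacetime × E3 => u (w.1.1, w.1.2, w.2) :=
    hu.comp (f := fun w : Spacetime × E3 => ((w.1.1, w.1.2, w.2) : Phase)) (by fun_prop)
  have hχ' : Measurable fun w : Spacetime × E3 => χ ‖w.1.2‖ :=
    hχ.measurable.comp (f := fun w : Spacetime × E3 => ‖w.1.2‖) (by fun_prop)
  have hUbar : Measurable fun w : Spacetime × E3 => vUbar M w.1.2 w.2 := by
    unfold vUbar; fun_prop
  have hN : Measurable fun w : Spacetime × E3 => vN M χ w.1.2 w.2 := by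
    unfold vN vU lapse; fun_prop
  have hB : Measurable fun w : Spacetime × E3 => bracket (|vT M w.1.2 w.2| + vAng w.1.2 w.2) := by
    unfold bracket; fun_prop
  have h1 : Measurable fun w : Spacetime × E3 => 1 + ‖w.1.2‖ ^ (2 * z * q + 4) *
      (|vUbar M w.1.2 w.2| ^ (z * q + 2) / |vT M w.1.2 w.2| ^ (z * q + 2)) := by fun_prop
  have hT' : Measurable fun w : Spacetime × E3 => |vT M w.1.2 w.2| := by fun_prop
  have hN' : Measurable fun w : Spacetime × E3 => |vN M χ w.1.2 w.2| := by fun_prop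
  have hU' : Measurable fun w : Spacetime × E3 => |u (w.1.1, w.1.2, w.2)| := by fun_prop
  exact (((h1.mul (hU'.pow_const z)).mul (hB.pow_const _)).mul (hT'.pow_const _)).mul
    (hN'.pow_const _)

/-! ### Fluxes through the leaves, in the variables of the statement -/

namespace Foliation

variable {M : ℝ} (𝓕 : Foliation M) {q z δ : ℝ}

/-- The flux through `Σ_τ` of `ρ[weightedPower]`. -/
def weightedFlux (χ : ℝ → ℝ) (q z δ τ : ℝ) (u : Phase → ℝ) : ℝ≥0∞ :=
  𝓕.leafIntegral τ fun y => 𝓕.rho y.2 (weightedPower M χ q z δ u y)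

/-- Integration in polar coordinates asks for a measurable integrand on the whole space, while the
height and `U'` are known to be continuous only outside the horizon; hence the indicator and the
passage to the subtype. -/
theorem measurable_weightedFlux_density (hM : 0 < M) {χ : ℝ → ℝ} (hχ : Continuous χ) (τ : ℝ)
    {u : Phase → ℝ} (hu : Measurable u) :
    Measurable (Set.indicator {x : E3 | 2 * M < ‖x‖} fun x =>
      𝓕.rho x (weightedPower M χ q z δ u (𝓕.height ‖x‖ + τ, x)) *
        ENNReal.ofReal (𝓕.leafDensity ‖x‖)) := by
  have hs : MeasurableSet {x : E3 | 2 * M < ‖x‖} := measurableSet_lt measurable_const (by fun_prop)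
  refine measurable_of_restrict_of_restrict_compl hs ?_ ?_
  swap
  · convert (measurable_const : Measurable fun _ : ({x : E3 | 2 * M < ‖x‖}ᶜ : Set E3) => (0 : ℝ≥0∞))
      using 1
    funext x
    exact Set.indicator_of_notMem x.2 _
  have e1 : ({x : E3 | 2 * M < ‖x‖}.domRestrict (Set.indicator {x : E3 | 2 * M < ‖x‖} fun x =>
      𝓕.rho x (weightedPower M χ q z δ u (𝓕.height ‖x‖ + τ, x)) *
        ENNReal.ofReal (𝓕.leafDensity ‖x‖))) = fun x : {x : E3 | 2 * M < ‖x‖} =>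
      𝓕.rho x (weightedPower M χ q z δ u (𝓕.height ‖(x : E3)‖ + τ, x)) *
        ENNReal.ofReal (𝓕.leafDensity ‖(x : E3)‖) := by
    funext x
    exact Set.indicator_of_mem x.2 _
  rw [e1]
  have hn : Measurable fun x : {x : E3 | 2 * M < ‖x‖} => ‖(x : E3)‖ := by fun_prop
  have hi : Measurable fun x : {x : E3 | 2 * M < ‖x‖} =>
      (⟨‖(x : E3)‖, x.2⟩ : Set.Ioi (2 * M)) := hn.subtype_mk
  have hh : Measurable fun x : {x : E3 | 2 * M < ‖x‖} => 𝓕.height ‖(x : E3)‖ :=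
    (𝓕.continuousOn_height hM).domRestrict.measurable.comp hi
  have hU : Measurable fun x : {x : E3 | 2 * M < ‖x‖} => 𝓕.U' ‖(x : E3)‖ := by
    have h1 : ContinuousOn 𝓕.U' (Set.Ioi (2 * M)) := (𝓕.continuousOn_U').mono
      Set.Ioi_subset_Ici_self
    exact h1.domRestrict.measurable.comp hi
  have hd : Measurable fun x : {x : E3 | 2 * M < ‖x‖} => 𝓕.leafDensity ‖(x : E3)‖ := by
    unfold leafDensity lapse
    exact Measurable.ite (measurableSet_lt hn measurable_const) (by fun_prop) (by fun_prop)
  have hT : Measurable fun w : {x : E3 | 2 * M < ‖x‖} × E3 => vT M w.1 w.2 :=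
    (measurable_vT M).comp (g := fun w : E3 × E3 => vT M w.1 w.2)
      (f := fun w : {x : E3 | 2 * M < ‖x‖} × E3 => ((w.1 : E3), w.2)) (by fun_prop)
  have hR : Measurable fun w : {x : E3 | 2 * M < ‖x‖} × E3 => vRStar M w.1 w.2 :=
    (measurable_vRStar M).comp (g := fun w : E3 × E3 => vRStar M w.1 w.2)
      (f := fun w : {x : E3 | 2 * M < ‖x‖} × E3 => ((w.1 : E3), w.2)) (by fun_prop)
  have hU2 : Measurable fun w : {x : E3 | 2 * M < ‖x‖} × E3 => 𝓕.U' ‖(w.1 : E3)‖ :=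
    hU.comp measurable_fst
  have hN : Measurable fun w : {x : E3 | 2 * M < ‖x‖} × E3 => 𝓕.vNormal w.1 w.2 := by
    unfold vNormal vU vUbar lapse
    exact Measurable.ite (measurableSet_lt (hn.comp measurable_fst) measurable_const)
      (by fun_prop) (by fun_prop)
  have hw : Measurable fun w : {x : E3 | 2 * M < ‖x‖} × E3 =>
      weightedPower M χ q z δ u (𝓕.height ‖(w.1 : E3)‖ + τ, w.1) w.2 :=
    (measurable_weightedPower M hχ q z δ hu).comp
      (f := fun w : {x : E3 | 2 * M < ‖x‖} × E3 =>
        (((𝓕.height ‖(w.1 : E3)‖ + τ, (w.1 : E3)) : Spacetime), w.2))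
      ((((hh.comp measurable_fst).add_const τ).prodMk (by fun_prop)).prodMk measurable_snd)
  refine Measurable.mul ?_ hd.ennreal_ofReal
  unfold rho coneIntegral lapse
  refine Measurable.lintegral_prod_right' (f := fun w : {x : E3 | 2 * M < ‖x‖} × E3 =>
    ENNReal.ofReal (weightedPower M χ q z δ u (𝓕.height ‖(w.1 : E3)‖ + τ, w.1) w.2 *
      |𝓕.vNormal w.1 w.2| * ((1 - 2 * M / ‖(w.1 : E3)‖) / |vT M w.1 w.2|))) ?_
  fun_prop

end Foliation

namespace Foliation

variable {M : ℝ} (𝓕 : Foliation M) {q z δ : ℝ}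

/-- The square root normalising the unit normal is the volume density, so it cancels; on the null
part the factor `2 / lapse` turns `|v_u̲|` into the outer flux. -/
theorem abs_vNormal_mul_leafDensity (hM : 0 < M) {r : ℝ} (hr : 2 * M < r) {e : E3} (he : ‖e‖ = 1)
    (y : E3) : |𝓕.vNormal (r • e) (mom M r e y)| * 𝓕.leafDensity r =
      𝓕.leafFlux r (inner ℝ e y) ‖cross e y‖ := by
  have h0 : 0 < r := by linarith
  have hl := lapse_pos hM hr
  rw [vNormal, vUbar_mom hM hr he, vU_mom hM hr he, norm_smul_unit h0 he, leafDensity, leafFlux]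
  split_ifs with h
  · have hD : 0 < Real.sqrt (2 * 𝓕.U' r - lapse M r * 𝓕.U' r ^ 2) :=
      Real.sqrt_pos.mpr (𝓕.spacelike r hr.le)
    have hI := innerFlux_nonneg (𝓕 := 𝓕) hM hr h.le (inner ℝ e y) ‖cross e y‖
    rw [abs_div, abs_of_pos hD, div_mul_cancel₀ _ hD.ne', ← abs_of_nonneg hI, ← abs_neg, innerFlux_eq]
    congr 1
    ring
  · rw [abs_neg, abs_of_nonneg (aU_nonneg hM hr), outerFlux_eq]
    ring

/-- The exponent `3 - z` of `fluxWeight` becomes `4 - z` because the cone measure contributes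
`1/|v_t|`. Its factor `r⁻²` is compensated by the area element of the sphere. -/
theorem fluxWeight_mul_le {χ : ℝ → ℝ} {r₀ r₁ : ℝ} (hχ : IsCutoff r₀ r₁ χ) (hM : 0 < M)
    (hr₀ : 2 * M < r₀) (hz : 3 < z) {r : ℝ} (hr : 2 * M < r) {e : E3} (he : ‖e‖ = 1) (y : E3)
    (u : Phase → ℝ) (t : ℝ) :
    |u (t, r • e, mom M r e y)| ^ z * (fluxWeight M q z δ r (inner ℝ e y) ‖cross e y‖ *
      𝓕.leafFlux r (inner ℝ e y) ‖cross e y‖) ≤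
    (1 + 1 / lapse M r₀) ^ (2 * (z + 1)) *
      (r ^ 2 * (weightedPower M χ q z δ u (t, r • e) (mom M r e y) *
        |𝓕.vNormal (r • e) (mom M r e y)| /
          (r ^ 2 * energy M r (inner ℝ e y) ‖cross e y‖) * 𝓕.leafDensity r)) := by
  have h0 : 0 < r := by linarith
  have hl₀ := lapse_pos hM hr₀
  have hN := redEnergy_le_abs_vN hχ hM hr₀ hr he y
  have ha := aU_nonneg (v := inner ℝ e y) (L := ‖cross e y‖) hM hr
  have hflux : 0 ≤ 𝓕.leafFlux r (inner ℝ e y) ‖cross e y‖ := by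
    unfold leafFlux
    split_ifs with h
    · exact innerFlux_nonneg hM hr h.le _ _
    · exact outerFlux_nonneg hM hr _ _
  have hB : 0 ≤ bracket (energy M r (inner ℝ e y) ‖cross e y‖ + ‖cross e y‖) := Real.sqrt_nonneg _
  rw [← 𝓕.abs_vNormal_mul_leafDensity hM hr he] at hflux ⊢
  have hE0 := energy_nonneg M r (inner ℝ e y) ‖cross e y‖
  have hR : 0 ≤ redEnergy M r (inner ℝ e y) ‖cross e y‖ := hE0.trans (le_redEnergy hM hr)
  simp only [weightedPower]
  rw [norm_smul_unit h0 he, vUbar_mom hM hr he, vT_mom y hM hr he, vAng_mom y h0.ne', abs_neg, abs_neg,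
    abs_of_nonneg ha, abs_of_nonneg hE0, fluxWeight]
  set E := energy M r (inner ℝ e y) ‖cross e y‖
  set n := |vN M χ (r • e) (mom M r e y)|
  set ν := |𝓕.vNormal (r • e) (mom M r e y)|
  set a := aU M r (inner ℝ e y) ‖cross e y‖
  set R := redEnergy M r (inner ℝ e y) ‖cross e y‖
  set B := bracket (E + ‖cross e y‖) ^ (3 * (z - 3 + δ)) with hBdef
  have hB' : 0 ≤ B := by positivity
  set w := |u (t, r • e, mom M r e y)| ^ z with hw
  have hw0 : 0 ≤ w := by positivity
  -- At zero energy the left-hand side vanishes by the convention `0 ^ (3 - z) = 0`, the exponent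
  -- being nonzero.
  rcases hE0.eq_or_lt with h | h
  · rw [← h, Real.zero_rpow (by linarith : 3 - z ≠ 0)]
    simp
  have e1 : (r ^ 2 * (a / E)) ^ (z * q + 2) =
      r ^ (2 * z * q + 4) * (a ^ (z * q + 2) / E ^ (z * q + 2)) := by
    have : r ^ (2 * z * q + 4) = (r ^ 2) ^ (z * q + 2) := by
      rw [← Real.rpow_two, ← Real.rpow_mul h0.le]; ring_nf
    rw [this, ← Real.div_rpow ha h.le, Real.mul_rpow (by positivity) (by positivity)]
  have e2 : E ^ (4 - z) = E ^ (3 - z) * E := by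
    rw [show 4 - z = 3 - z + 1 by ring, Real.rpow_add_one h.ne']
  have e3 : R ^ (2 * (z + 1)) ≤ (1 + 1 / lapse M r₀) ^ (2 * (z + 1)) * n ^ (2 * (z + 1)) := by
    rw [← Real.mul_rpow (by positivity) (by positivity)]
    exact Real.rpow_le_rpow hR hN (by linarith)
  rw [e1, e2]
  set X := r ^ (2 * z * q + 4) * (a ^ (z * q + 2) / E ^ (z * q + 2)) with hX
  have hX0 : 0 ≤ X := by positivity
  calc w * ((1 + X) * B * E ^ (3 - z) * R ^ (2 * (z + 1)) * (ν * 𝓕.leafDensity r))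
      ≤ w * ((1 + X) * B * E ^ (3 - z) * ((1 + 1 / lapse M r₀) ^ (2 * (z + 1)) * n ^ (2 * (z + 1)))
        * (ν * 𝓕.leafDensity r)) := by gcongr
    _ = _ := by field_simp

theorem measurable_fluxWeight_mul_leafFlux (q z δ r : ℝ) (e : E3) :
    Measurable fun y : E3 => fluxWeight M q z δ r (inner ℝ e y) ‖cross e y‖ *
      𝓕.leafFlux r (inner ℝ e y) ‖cross e y‖ := by
  have hv : Measurable fun y : E3 => (inner ℝ e y : ℝ) := by fun_prop
  have hL : Measurable fun y : E3 => ‖cross e y‖ := by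
    have : Continuous fun y : E3 => ‖cross e y‖ := by unfold cross; fun_prop
    exact this.measurable
  have hE : Measurable fun y : E3 => energy M r (inner ℝ e y) ‖cross e y‖ :=
    measurable_energy M measurable_const hv hL
  have h1 : Measurable fun y : E3 => fluxWeight M q z δ r (inner ℝ e y) ‖cross e y‖ := by
    unfold fluxWeight redEnergy aU bU bracket
    fun_prop
  refine h1.mul ?_
  unfold leafFlux innerFlux outerFlux
  split_ifs <;> fun_prop

theorem lintegral_leaf_le {χ : ℝ → ℝ} {r₀ r₁ : ℝ} (hχ : IsCutoff r₀ r₁ χ) (hM : 0 < M)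
    (hr₀ : 2 * M < r₀) (hz : 3 < z) (τ : ℝ) {u w : Phase → ℝ} (hu : Measurable u)
    (hw : Measurable w) :
    ∫⁻ r in Set.Ioi (2 * M), ∫⁻ x, ENNReal.ofReal
      ((|u (𝓕.leafPoint τ r x)| ^ z + |w (𝓕.leafPoint τ r x)| ^ z) *
        (fluxWeight M q z δ r (vr x) (va x) * 𝓕.leafFlux r (vr x) (va x))) ∂sphereBundle ≤
    ENNReal.ofReal ((1 + 1 / lapse M r₀) ^ (2 * (z + 1))) *
      (𝓕.weightedFlux χ q z δ τ u + 𝓕.weightedFlux χ q z δ τ w) := by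
  have hl₀ := lapse_pos hM hr₀
  have hK : 0 ≤ (1 + 1 / lapse M r₀) ^ (2 * (z + 1)) := by positivity
  have hs : MeasurableSet {x : E3 | 2 * M < ‖x‖} := measurableSet_lt measurable_const (by fun_prop)
  have hmu := 𝓕.measurable_weightedFlux_density (q := q) (z := z) (δ := δ) hM
    hχ.smooth.continuous τ hu
  have hmw := 𝓕.measurable_weightedFlux_density (q := q) (z := z) (δ := δ) hM
    hχ.smooth.continuous τ hw
  have e0 := lintegral_polar (hmu.add hmw)
  simp only [Pi.add_apply] at e0
  rw [lintegral_add_left hmu, lintegral_indicator hs, lintegral_indicator hs] at e0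
  rw [weightedFlux, weightedFlux, leafIntegral, leafIntegral, e0,
    ← lintegral_const_mul' _ _ ENNReal.ofReal_ne_top]
  refine le_trans ?_ (lintegral_mono_set (Set.Ioi_subset_Ioi (by linarith : (0 : ℝ) ≤ 2 * M)))
  refine setLIntegral_mono' measurableSet_Ioi fun r hr => ?_
  have hr : 2 * M < r := hr
  have h0 : 0 < r := by linarith
  -- Only the inequality of Tonelli's theorem that needs no measurability is used here.
  refine (lintegral_prod_le _).trans ?_
  rw [← lintegral_const_mul' _ _ ENNReal.ofReal_ne_top]
  refine lintegral_mono fun e => ?_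
  have he : ‖(e : E3)‖ = 1 := norm_eq_of_mem_sphere e
  have hD : 0 ≤ 𝓕.leafDensity r := by
    have hl := lapse_pos hM hr
    unfold leafDensity
    split_ifs <;> positivity
  have hmem : r • (e : E3) ∈ {x : E3 | 2 * M < ‖x‖} := by
    rw [Set.mem_ofPred_eq, norm_smul_unit h0 he]; exact hr
  have key : ∀ v : Phase → ℝ, ∫⁻ y, ENNReal.ofReal (|v (𝓕.height r + τ, r • (e : E3), mom M r e y)| ^ z *
      (fluxWeight M q z δ r (inner ℝ (e : E3) y) ‖cross e y‖ *
        𝓕.leafFlux r (inner ℝ (e : E3) y) ‖cross e y‖)) ≤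
      ENNReal.ofReal ((1 + 1 / lapse M r₀) ^ (2 * (z + 1))) * (ENNReal.ofReal (r ^ 2) *
        (𝓕.rho (r • (e : E3)) (weightedPower M χ q z δ v (𝓕.height r + τ, r • (e : E3))) *
          ENNReal.ofReal (𝓕.leafDensity r))) := fun v => by
    rw [rho, coneIntegral_eq hM hr he,
      ← lintegral_mul_const' _ _ ENNReal.ofReal_ne_top, ← lintegral_const_mul' _ _ ENNReal.ofReal_ne_top,
      ← lintegral_const_mul' _ _ ENNReal.ofReal_ne_top]
    refine lintegral_mono fun y => ?_
    rw [← ENNReal.ofReal_mul' hD, ← ENNReal.ofReal_mul (by positivity), ← ENNReal.ofReal_mul hK]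
    exact ENNReal.ofReal_le_ofReal (𝓕.fluxWeight_mul_le hχ hM hr₀ hz hr he y v _)
  simp only [Set.indicator_of_mem hmem, norm_smul_unit h0 he]
  rw [mul_add (ENNReal.ofReal (r ^ 2)), mul_add (ENNReal.ofReal _)]
  refine le_trans ?_ (add_le_add (key u) (key w))
  rw [← lintegral_add_left]
  · refine lintegral_mono fun y => ?_
    rw [add_mul]
    exact ENNReal.ofReal_add_le
  · have hp : Measurable fun y : E3 => ((𝓕.height r + τ, r • (e : E3), mom M r e y) : Phase) :=
      measurable_const.prodMk (measurable_const.prodMk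
        (measurable_mom M measurable_const measurable_const measurable_id))
    have h1 : Measurable fun y : E3 => u (𝓕.height r + τ, r • (e : E3), mom M r e y) := hu.comp hp
    have h2 : Measurable fun y : E3 => |u (𝓕.height r + τ, r • (e : E3), mom M r e y)| := by fun_prop
    exact ((h2.pow_const z).mul
      (𝓕.measurable_fluxWeight_mul_leafFlux q z δ r (e : E3))).ennreal_ofReal

theorem weightedFlux_mono (hz : 0 ≤ z) {χ : ℝ → ℝ} (τ : ℝ) {u w : Phase → ℝ}
    (h : ∀ y, |u y| ≤ |w y|) : 𝓕.weightedFlux χ q z δ τ u ≤ 𝓕.weightedFlux χ q z δ τ w := by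
  unfold weightedFlux leafIntegral
  refine lintegral_mono fun x => mul_le_mul' ?_ le_rfl
  unfold rho coneIntegral
  refine lintegral_mono_ae (Filter.Eventually.of_forall fun p => ?_)
  simp only [mul_assoc]
  rw [ENNReal.ofReal_mul (weightedPower_nonneg _ _), ENNReal.ofReal_mul (weightedPower_nonneg _ _)]
  gcongr
  exact weightedPower_mono hz h _ _

/-- Replacing `g` and `∂_t g` by their indicators on the phase region provides the measurable
functions needed for polar coordinates. The flux does not change, and the weighted fluxes do not
increase. -/
theorem flux_le_weightedFlux {χ : ℝ → ℝ} {r₀ r₁ : ℝ} (hχ : IsCutoff r₀ r₁ χ) (hM : 0 < M)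
    (hr₀ : 2 * M < r₀) (hz : 3 < z) {τ : ℝ} (hτ : 0 ≤ τ) {g : Phase → ℝ}
    (hg : ContDiffOn ℝ 1 g 𝓕.phaseRegion) :
    𝓕.flux q z δ τ g ≤ ENNReal.ofReal ((1 + 1 / lapse M r₀) ^ (2 * (z + 1))) *
      (𝓕.weightedFlux χ q z δ τ g + 𝓕.weightedFlux χ q z δ τ (dT 𝓕.phaseRegion g)) := by
  have hD := 𝓕.measurableSet_phaseRegion hM
  have hm₁ : Measurable (𝓕.phaseRegion.indicator g) :=
    measurable_indicator_of_continuousOn hD hg.continuousOn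
  have hm₂ : Measurable (𝓕.phaseRegion.indicator (dT 𝓕.phaseRegion g)) :=
    measurable_indicator_of_continuousOn hD
      ((hg.continuousOn_fderivWithin (𝓕.uniqueDiffOn_phaseRegion hM) le_rfl).clm_apply
        continuousOn_const)
  have hle : ∀ (u : Phase → ℝ) y, |𝓕.phaseRegion.indicator u y| ≤ |u y| := fun u y => by
    simp only [← Real.norm_eq_abs]
    exact norm_indicator_le_norm_self _ _
  refine le_trans (le_of_eq ?_) ((𝓕.lintegral_leaf_le hχ hM hr₀ hz τ hm₁ hm₂).trans
    (mul_le_mul' le_rfl (add_le_add (𝓕.weightedFlux_mono (by linarith) τ (hle g))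
      (𝓕.weightedFlux_mono (by linarith) τ (hle _)))))
  unfold flux
  refine setLIntegral_congr_fun measurableSet_Ioi fun r hr => lintegral_congr fun x => ?_
  have hr : 2 * M < r := hr
  -- At the zero covector, which lies outside the region, the weight of the flux vanishes on both
  -- sides.
  by_cases hx : x.2 = 0
  · have h1 : fluxWeight M q z δ r (vr x) (va x) = 0 := by
      have hE : energy M r (vr x) (va x) = 0 := by simp [vr, va, hx, cross, energy]
      rw [fluxWeight, hE, Real.zero_rpow (by linarith : 3 - z ≠ 0)]
      ring
    rw [h1]; simp
  · have hmem : 𝓕.leafPoint τ r x ∈ 𝓕.phaseRegion :=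
      𝓕.mem_phaseRegion_mom hM hr (by linarith) (norm_eq_of_mem_sphere x.1) hx
    rw [Set.indicator_of_mem hmem, Set.indicator_of_mem hmem]

end Foliation

/-! ### Assembly of the final estimate -/

theorem rpow_finset_sum_le {ι : Type*} (s : Finset ι) (a : ι → ℝ≥0∞) {p : ℝ} (hp : 0 < p)
    (hp1 : p ≤ 1) : (∑ i ∈ s, a i) ^ p ≤ ∑ i ∈ s, a i ^ p := by
  classical
  induction s using Finset.induction_on with
  | empty => simp [hp]
  | insert i s hi ih =>
    rw [Finset.sum_insert hi, Finset.sum_insert hi]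
    exact (ENNReal.rpow_add_le_add_rpow _ _ hp.le hp1).trans (add_le_add le_rfl ih)

namespace Foliation

variable {M : ℝ} (𝓕 : Foliation M) {q z δ : ℝ}

/-- The power `1/z ≤ 1` is subadditive, so it passes through all the sums and through the splitting
into `g` and `∂_t g`. -/
theorem sum_flux_le {χ : ℝ → ℝ} {r₀ r₁ : ℝ} (hχ : IsCutoff r₀ r₁ χ) (hM : 0 < M)
    (hr₀ : 2 * M < r₀) (hz : 3 < z) {τ : ℝ} (hτ : 0 ≤ τ) {f : Phase → ℝ}
    (hf : ContDiffOn ℝ 3 f 𝓕.phaseRegion) :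
    (∑ k ∈ Finset.range 3, ∑ I : Fin k → Fin 3,
        𝓕.flux q z δ τ (omegaHatWord 𝓕.phaseRegion I f)) ^ (1 / z) ≤
      ENNReal.ofReal (((1 + 1 / lapse M r₀) ^ (2 * (z + 1))) ^ (1 / z)) *
        ∑ n ∈ Finset.range 2, ∑ k ∈ Finset.range (4 - n), ∑ I : Fin k → Fin 3,
          𝓕.weightedFlux χ q z δ τ (mixedDeriv 𝓕.phaseRegion n I f) ^ (1 / z) := by
  have hz0 : 0 < z := by linarith
  have hp : 0 < 1 / z := by positivity
  have hp1 : 1 / z ≤ 1 := by rw [div_le_one hz0]; linarith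
  have hl₀ := lapse_pos hM hr₀
  set K := (1 + 1 / lapse M r₀) ^ (2 * (z + 1)) with hK
  have hK0 : 0 ≤ K := by positivity
  have h1 : ∀ k ∈ Finset.range 3, ∀ I : Fin k → Fin 3,
      𝓕.flux q z δ τ (omegaHatWord 𝓕.phaseRegion I f) ^ (1 / z) ≤
        ENNReal.ofReal (K ^ (1 / z)) *
          (𝓕.weightedFlux χ q z δ τ (mixedDeriv 𝓕.phaseRegion 0 I f) ^ (1 / z) +
            𝓕.weightedFlux χ q z δ τ (mixedDeriv 𝓕.phaseRegion 1 I f) ^ (1 / z)) := by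
    intro k hk I
    have hk := Finset.mem_range.mp hk
    have hg : ContDiffOn ℝ 1 (omegaHatWord 𝓕.phaseRegion I f) 𝓕.phaseRegion :=
      𝓕.contDiffOn_omegaHatWord (n := 1) hM (hf.of_le (by norm_cast; omega)) I
    refine (ENNReal.rpow_le_rpow (𝓕.flux_le_weightedFlux (q := q) (δ := δ) hχ hM hr₀ hz hτ hg)
      hp.le).trans ?_
    rw [ENNReal.mul_rpow_of_nonneg _ _ hp.le, ENNReal.ofReal_rpow_of_nonneg hK0 hp.le]
    exact mul_le_mul' le_rfl (ENNReal.rpow_add_le_add_rpow _ _ hp.le hp1)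
  calc _ ≤ ∑ k ∈ Finset.range 3, ∑ I : Fin k → Fin 3,
        𝓕.flux q z δ τ (omegaHatWord 𝓕.phaseRegion I f) ^ (1 / z) :=
        (rpow_finset_sum_le _ _ hp hp1).trans
          (Finset.sum_le_sum fun k _ => rpow_finset_sum_le _ _ hp hp1)
    _ ≤ ∑ k ∈ Finset.range 3, ∑ I : Fin k → Fin 3, ENNReal.ofReal (K ^ (1 / z)) *
          (𝓕.weightedFlux χ q z δ τ (mixedDeriv 𝓕.phaseRegion 0 I f) ^ (1 / z) +
            𝓕.weightedFlux χ q z δ τ (mixedDeriv 𝓕.phaseRegion 1 I f) ^ (1 / z)) :=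
        Finset.sum_le_sum fun k hk => Finset.sum_le_sum fun I _ => h1 k hk I
    _ = ENNReal.ofReal (K ^ (1 / z)) * ((∑ k ∈ Finset.range 3, ∑ I : Fin k → Fin 3,
          𝓕.weightedFlux χ q z δ τ (mixedDeriv 𝓕.phaseRegion 0 I f) ^ (1 / z)) +
          ∑ k ∈ Finset.range 3, ∑ I : Fin k → Fin 3,
            𝓕.weightedFlux χ q z δ τ (mixedDeriv 𝓕.phaseRegion 1 I f) ^ (1 / z)) := by
        simp only [← Finset.mul_sum, Finset.sum_add_distrib]
    _ ≤ _ := by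
        refine mul_le_mul' le_rfl ?_
        -- Without `∂_t` only words of length at most two occur; the sum allows length three, so it
        -- is enlarged.
        rw [Finset.sum_range_succ _ 1, Finset.sum_range_one]
        exact add_le_add (Finset.sum_le_sum_of_subset (Finset.range_mono (by norm_num))) le_rfl

end Foliation

end SchwarzschildVlasov

end

theorem mainTheorem8 (M : ℝ) (hM : 0 < M) (𝓕 : SchwarzschildVlasov.Foliation M)
    (r₀ r₁ : ℝ) (hr₀ : 2 * M < r₀) (hr₀₁ : r₀ < r₁) (hr₁ : r₁ < 3 * M)
    (q z δ : ℝ) (hq : 0 ≤ q) (hz : 3 < z) (hz' : z ≤ 4) (hδ : 0 < δ) :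
    ∃ C : ℝ, 0 < C ∧ ∀ χ : ℝ → ℝ, SchwarzschildVlasov.IsCutoff r₀ r₁ χ →
      ∀ f : SchwarzschildVlasov.Phase → ℝ, ContDiffOn ℝ 3 f 𝓕.phaseRegion →
      (∀ y ∈ 𝓕.phaseRegion, SchwarzschildVlasov.liouville M 𝓕.phaseRegion f y = 0) →
      ∀ τ : ℝ, 0 ≤ τ → ∀ (t : ℝ) (x : SchwarzschildVlasov.E3), (t, x) ∈ 𝓕.leaf τ →
        SchwarzschildVlasov.coneIntegral M x (fun p =>
            |SchwarzschildVlasov.vUbar M x p| ^ q / |SchwarzschildVlasov.vT M x p| ^ q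
              * |f (t, x, p)| * |SchwarzschildVlasov.vN M χ x p| ^ 2)
          ≤ ENNReal.ofReal (C / ‖x‖ ^ (2 + 2 * q)) *
            ∑ n ∈ Finset.range 2, ∑ k ∈ Finset.range (4 - n), ∑ I : Fin k → Fin 3,
              (𝓕.leafIntegral τ (fun y => 𝓕.rho y.2 (fun p =>
                (1 + ‖y.2‖ ^ (2 * z * q + 4)
                    * (|SchwarzschildVlasov.vUbar M y.2 p| ^ (z * q + 2)
                        / |SchwarzschildVlasov.vT M y.2 p| ^ (z * q + 2)))
                  * |SchwarzschildVlasov.mixedDeriv 𝓕.phaseRegion n I f (y.1, y.2, p)| ^ z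
                  * SchwarzschildVlasov.bracket
                      (|SchwarzschildVlasov.vT M y.2 p| + SchwarzschildVlasov.vAng y.2 p)
                        ^ (3 * (z - 3 + δ))
                  * |SchwarzschildVlasov.vT M y.2 p| ^ (4 - z)
                  * |SchwarzschildVlasov.vN M χ y.2 p| ^ (2 * (z + 1))))) ^ (1 / z) := by
  obtain ⟨C, hC, hcone⟩ := 𝓕.exists_cone_bound (q := q) hM hz hq hδ
  have hl₀ := SchwarzschildVlasov.lapse_pos hM hr₀
  set K := ((1 + 1 / SchwarzschildVlasov.lapse M r₀) ^ (2 * (z + 1))) ^ (1 / z) with hK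
  have hK0 : 0 ≤ K := by positivity
  -- Adding `1` serves only to make the constant strictly positive.
  refine ⟨C * K + 1, by positivity, fun χ hχ f hf hTf τ hτ t x htx => ?_⟩
  obtain ⟨hx, rfl⟩ := (𝓕.mem_leaf_iff hM τ t x).mp htx
  have hx0 : 0 < ‖x‖ := by linarith
  obtain ⟨e, he, r, hr, rfl⟩ : ∃ e : SchwarzschildVlasov.E3, ‖e‖ = 1 ∧ ∃ r, 2 * M < r ∧ x = r • e :=
    ⟨‖x‖⁻¹ • x, by rw [norm_smul, norm_inv, norm_norm, inv_mul_cancel₀ hx0.ne'], ‖x‖, hx,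
      by rw [smul_smul, mul_inv_cancel₀ hx0.ne', one_smul]⟩
  have h0 : 0 < r := by linarith
  have hE := SchwarzschildVlasov.energy_nonneg M r
  have h1 := hcone f hf hTf τ hτ r hr e _ he (SchwarzschildVlasov.abs_vN_le hχ hM hr he)
  rw [SchwarzschildVlasov.norm_smul_unit h0 he, SchwarzschildVlasov.coneIntegral_eq hM hr he]
  simp only [SchwarzschildVlasov.vUbar_mom hM hr he, SchwarzschildVlasov.vT_mom _ hM hr he, abs_neg,
    abs_of_nonneg (SchwarzschildVlasov.aU_nonneg hM hr), abs_of_nonneg (hE _ _)]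
  refine h1.trans ?_
  refine (mul_le_mul' le_rfl (𝓕.sum_flux_le hχ hM hr₀ hz hτ hf)).trans ?_
  rw [← mul_assoc, ← ENNReal.ofReal_mul (by positivity)]
  refine mul_le_mul' (ENNReal.ofReal_le_ofReal ?_) le_rfl
  rw [div_mul_eq_mul_div]
  gcongr
  linarith
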